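/- Let $n \ge 1$ and $\gamma > -1$. Let $\mathbb{B}_n$ be the open unit ball of $\mathbb{C}^n$, let $dv$ be Lebesgue measure, $z\cdot w=\sum_j z_j\overline{w_j}$, and let $$dv_\gamma(z) = \frac{\Gamma(n+1+\gamma)}{\pi^n\,\Gamma(\gamma+1)}\,(1-|z|^2)^{\gamma}\,dv(z), \qquad d\tau(z) = (1-|z|^2)^{-n-1}\,dv(z)$$ on $\mathbb{B}_n$. Let $P_\gamma$ be the orthogonal projection of $L^2(\mathbb{B}_n,dv_\gamma)$ onto the Bergman space $L^2_a(\mathbb{B}_n,dv_\gamma)$ of holomorphic functions in $L^2(\mathbb{B}_n,dv_\gamma)$. For $f\in L^2(\mathbb{B}_n,dv_\gamma)$ and $z \in \mathbb{B}_n$ put $$B_\gamma(f)(z)=\int_{\mathbb{B}_n} f(w)\,\frac{(1-|z|^2)^{n+1+\gamma}}{|1-w\cdot z|^{2(n+1+\gamma)}}\,dv_\gamma(w),\qquad \mathrm{MO}_\gamma(f)(z)=\bigl(B_\gamma(|f|^2)(z)-|B_\gamma(f)(z)|^2\bigr)^{1/2},$$ and let $\mathrm{BMO}_\partial$ be the space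 of all $f\in L^2(\mathbb{B}_n,dv_\gamma)$ for which $\mathrm{MO}_\gamma(f)$ is bounded on $\mathbb{B}_n$. Let $M_f$ be multiplication by $f$, and let $[M_f,P_\gamma]=M_fP_\gamma-P_\gamma M_f$, with domain $\{g\in L^2(\mathbb{B}_n,dv_\gamma) : fg\in L^2(\mathbb{B}_n,dv_\gamma),\ f\,P_\gamma g\in L^2(\mathbb{B}_n,dv_\gamma)\}$. A bounded operator $T$ on a Hilbert space is in the Schatten class $S_p$ if $(T^*T)^{p/2}$ is of trace class; $[M_f,P_\gamma]\in S_p$ means that $[M_f,P_\gamma]$ is densely defined and extends to a bounded operator on $L^2(\mathbb{B}_n,dv_\gamma)$ that is in $S_p$. **Theorem.** Let $f\in \mathrm{BMO}_\partial$ and let $\frac{2n}{n+1+\gamma}<p<1$. Then $[M_f,P_\gamma]\in S_p$ if and only if $\mathrm{MO}_\gamma(f)\in L^p(\mathbb{B}_n,d\tau)$. -/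

import Mathlib

open MeasureTheory

noncomputable section

namespace BergmanBall

/-- `ℂⁿ` with its Euclidean norm; `inner ℂ z w = ∑ i, w i * conj (z i)`. -/
abbrev Cn (n : ℕ) : Type := EuclideanSpace ℂ (Fin n)

/-- The open unit ball of `ℂⁿ`. -/
def unitBall (n : ℕ) : Set (Cn n) := Metric.ball 0 1

/-- The probability measure `dv_γ = c_γ (1 - |z|²)^γ dv` on the unit ball, with
`c_γ = Γ(n+1+γ) / (πⁿ Γ(γ+1))`, regarded as a measure on `ℂⁿ` that vanishes off the ball. -/
def weightedMeasure (n : ℕ) (γ : ℝ) : Measure (Cn n) :=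
  (volume.restrict (unitBall n)).withDensity fun z =>
    ENNReal.ofReal (Real.Gamma (n + 1 + γ) / (Real.pi ^ n * Real.Gamma (γ + 1))
      * (1 - ‖z‖ ^ 2) ^ γ)

/-- The Möbius invariant measure `dτ = (1 - |z|²)^{-n-1} dv` on the unit ball. -/
def invariantMeasure (n : ℕ) : Measure (Cn n) :=
  (volume.restrict (unitBall n)).withDensity fun z =>
    ENNReal.ofReal (((1 - ‖z‖ ^ 2) ^ (n + 1))⁻¹)

/-- The Hilbert space `L²(𝔹ₙ, dv_γ)`. -/
abbrev L2 (n : ℕ) (γ : ℝ) : Type := Lp ℂ 2 (weightedMeasure n γ)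

/-- The weighted Bergman space `Hol(𝔹ₙ) ∩ L²(𝔹ₙ, dv_γ)`: the classes in `L²` that have a
representative which is holomorphic on the ball. -/
def bergmanSpace (n : ℕ) (γ : ℝ) : Submodule ℂ (L2 n γ) where
  carrier := {g | ∃ h : Cn n → ℂ, DifferentiableOn ℂ h (unitBall n) ∧
    (g : Cn n → ℂ) =ᵐ[weightedMeasure n γ] h}
  zero_mem' := ⟨0, differentiableOn_const 0, Lp.coeFn_zero _ _ _⟩
  add_mem' := by
    rintro a b ⟨h, hd, hh⟩ ⟨k, kd, hk⟩
    exact ⟨h + k, hd.add kd, (Lp.coeFn_add a b).trans (hh.add hk)⟩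
  smul_mem' := by
    rintro c a ⟨h, hd, hh⟩
    exact ⟨c • h, hd.const_smul c, (Lp.coeFn_smul c a).trans (hh.const_smul c)⟩

/-- The orthogonal projection `P_γ` of `L²(𝔹ₙ, dv_γ)` onto the Bergman space. The Bergman space is
a closed subspace, so the topological closure below is the Bergman space itself; it is written only
because it makes the completeness that an orthogonal projection needs available by definition. -/
def bergmanProj (n : ℕ) (γ : ℝ) : L2 n γ →L[ℂ] L2 n γ :=
  (bergmanSpace n γ).topologicalClosure.starProjection

/-- The (in general unbounded) operator `M_f` of multiplication by `f` on `L²(𝔹ₙ, dv_γ)`, with its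
maximal domain `{g ∈ L² : f g ∈ L²}`. -/
def mulOp (n : ℕ) (γ : ℝ) (f : Cn n → ℂ) : L2 n γ →ₗ.[ℂ] L2 n γ where
  domain :=
    { carrier := {g | MemLp (fun z => f z * g z) 2 (weightedMeasure n γ)}
      zero_mem' := by
        refine (MemLp.zero (p := 2) (μ := weightedMeasure n γ) (ε := ℂ)).ae_eq ?_
        filter_upwards [Lp.coeFn_zero ℂ 2 (weightedMeasure n γ)] with z hz
        rw [hz, Pi.zero_apply, mul_zero]
      add_mem' := by
        intro a b ha hb
        refine (MemLp.add ha hb).ae_eq ?_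
        filter_upwards [Lp.coeFn_add a b] with z hz
        rw [hz, Pi.add_apply, Pi.add_apply, mul_add]
      smul_mem' := by
        intro c a ha
        refine (MemLp.const_smul ha c).ae_eq ?_
        filter_upwards [Lp.coeFn_smul c a] with z hz
        simp [hz, mul_left_comm] }
  toFun :=
    { toFun := fun g => MemLp.toLp (fun z => f z * (g : L2 n γ) z) g.2
      map_add' := by
        intro a b
        rw [← MemLp.toLp_add, MemLp.toLp_eq_toLp_iff]
        filter_upwards [Lp.coeFn_add (a : L2 n γ) (b : L2 n γ)] with z hz
        rw [Submodule.coe_add, hz, Pi.add_apply, Pi.add_apply, mul_add]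
      map_smul' := by
        intro c a
        rw [RingHom.id_apply, ← MemLp.toLp_const_smul, MemLp.toLp_eq_toLp_iff]
        filter_upwards [Lp.coeFn_smul c (a : L2 n γ)] with z hz
        simp [hz, mul_left_comm] }

/-- The composition `A ∘ T` of a partially defined operator `A` with an everywhere defined operator
`T`, on its natural domain `{x : T x ∈ dom A}`. -/
def pmapComp {H : Type*} [AddCommGroup H] [Module ℂ H] (A : H →ₗ.[ℂ] H) (T : H →ₗ[ℂ] H) :
    H →ₗ.[ℂ] H where
  domain := A.domain.comap T
  toFun :=
    { toFun := fun x => A ⟨T x, x.2⟩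
      map_add' := by
        intro x y
        rw [← A.map_add]
        congr 1
        ext
        simp
      map_smul' := by
        intro c x
        rw [RingHom.id_apply, ← A.map_smul]
        congr 1
        ext
        simp }

/-- The commutator `[M_f, P_γ] = M_f P_γ - P_γ M_f` as an unbounded operator on `L²(𝔹ₙ, dv_γ)`, on
its natural domain `{g ∈ L² : f · P_γ g ∈ L² and f g ∈ L²}`. -/
def commutator (n : ℕ) (γ : ℝ) (f : Cn n → ℂ) : L2 n γ →ₗ.[ℂ] L2 n γ :=
  pmapComp (mulOp n γ f) (bergmanProj n γ).toLinearMap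
    - (bergmanProj n γ).toLinearMap.compPMap (mulOp n γ f)

/-- A bounded operator `A` on a complex Hilbert space is of trace class if
`∑ ⟨|A| e_i, e_i⟩ < ∞` for every orthonormal basis `(e_i)`, where `|A| = (A* A)^{1/2}`. -/
def IsTraceClass {H : Type*} [NormedAddCommGroup H] [InnerProductSpace ℂ H] [CompleteSpace H]
    (A : H →L[ℂ] H) : Prop :=
  ∀ (w : Set H) (e : HilbertBasis w ℂ H), Summable fun i => (inner ℂ (e i) (CFC.abs A (e i))).re

/-- A bounded operator `T` is in the Schatten class `S_p` if `(T* T)^{p/2}` (continuous functional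
calculus) is of trace class. -/
def IsSchatten {H : Type*} [NormedAddCommGroup H] [InnerProductSpace ℂ H] [CompleteSpace H]
    (p : ℝ) (T : H →L[ℂ] H) : Prop :=
  IsTraceClass ((star T * T) ^ (p / 2))

/-- A partially defined operator `A` is in `S_p` if it is densely defined and extends to a bounded
operator on the whole space (unique by density) that lies in `S_p`. -/
def PMapIsSchatten {H : Type*} [NormedAddCommGroup H] [InnerProductSpace ℂ H] [CompleteSpace H]
    (p : ℝ) (A : H →ₗ.[ℂ] H) : Prop :=
  Dense (A.domain : Set H) ∧
    ∃ T : H →L[ℂ] H, (∀ x : A.domain, T (x : H) = A x) ∧ IsSchatten p T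

/-- `|k_z^γ(w)|² = (1 - |z|²)^{n+1+γ} / |1 - w·z|^{2(n+1+γ)}`, where `k_z^γ` is the normalized
reproducing kernel of the Bergman space. -/
def kernelSq (n : ℕ) (γ : ℝ) (z w : Cn n) : ℝ :=
  (1 - ‖z‖ ^ 2) ^ ((n : ℝ) + 1 + γ) / ‖1 - inner ℂ z w‖ ^ (2 * ((n : ℝ) + 1 + γ))

/-- The Berezin transform `B_γ(f)(z) = ∫ f(w) |k_z^γ(w)|² dv_γ(w)` of a real or complex valued
function. -/
def berezin (n : ℕ) (γ : ℝ) {F : Type*} [NormedAddCommGroup F] [NormedSpace ℝ F]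
    (f : Cn n → F) (z : Cn n) : F :=
  ∫ w, kernelSq n γ z w • f w ∂(weightedMeasure n γ)

/-- The mean oscillation `MO_γ(f)(z) = (B_γ(|f|²)(z) - |B_γ(f)(z)|²)^{1/2}`. -/
def meanOsc (n : ℕ) (γ : ℝ) (f : Cn n → ℂ) (z : Cn n) : ℝ :=
  Real.sqrt (berezin n γ (fun w => ‖f w‖ ^ 2) z - ‖berezin n γ f z‖ ^ 2)

/-- `f ∈ BMO_∂`: `f ∈ L²(𝔹ₙ, dv_γ)` and `MO_γ(f)` is bounded on the ball. -/
def MemBMO (n : ℕ) (γ : ℝ) (f : Cn n → ℂ) : Prop :=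
  MemLp f 2 (weightedMeasure n γ) ∧ ∃ C : ℝ, ∀ z ∈ unitBall n, meanOsc n γ f z ≤ C

end BergmanBall

end

open MeasureTheory

noncomputable section

namespace BergmanBall

open scoped ENNReal

section Operators

variable {H : Type*} [NormedAddCommGroup H] [InnerProductSpace ℂ H] [CompleteSpace H]

/-! ### Quadratic forms of functions of a self-adjoint operator -/

/-! Write `s = n + 1 + γ`, `K_z` for the reproducing kernel at `z`, and `β = 1 - ρ²` with `ρ` the
pseudohyperbolic distance. Two facts link the operator to `MO`: up to the factor `‖K_z‖⁻¹`,
`MO(f)(z)` is the distance from `f K_z` to the line `ℂ K_z`, and `‖K_z‖² dv_γ` is a constant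
multiple of `dτ`.

Sufficiency. A commutator with a projection satisfies `T = TP + PT`. Since `T K_z = (1 - P)(f K_z)`
and `1 - P` kills `ℂ K_z`, `‖T K_z‖ ≤ ‖K_z‖ MO(f)(z)`; the adjoint obeys the same bound through the
symbol `conj f`. For `X = TP` and `p ≤ 2`, Jensen's inequality gives `⟨|X|^p k, k⟩ ≤ ‖X k‖^p` for
unit vectors `k`, and integrating this over normalized kernels against `dτ` bounds the trace of
`|X|^p` by the integral of `MO^p` (`powTrace_mul_bergmanProj_le`). Boundedness of `T` itself comes
from `MO ∈ L²(dτ)`, because `MO` is bounded and in `L^p`.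

Necessity. For `p < 2` Jensen's inequality points the wrong way, so the oscillation is discretized.
The kernel is nearly constant on a small pseudohyperbolic ball. Hence the matrix entry of `T`
between the normalized indicator of a ball and the normalized deviation of `f` from its mean there
is at least a multiple of the local oscillation `O` (`exists_diag_bound`); between balls at `a` and
`b` the entry is at most a multiple of `β(a,b)^(s/2)` times `O(a) + O(b)` plus the difference of the
two means (`exists_offdiag_bound`). For `p < 1`, `sum_diag_rpow_le` bounds the `p`-th powers of the
diagonal entries by the `S_p` quasinorm plus the `p`-th powers of the off-diagonal entries, and the
latter must be absorbed.

The difference of means is telescoped along lattice points: from `a` along its ray towards the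
origin, across to the ray of `b` at depth comparable to `|1 - a·b|`, and back out to `b`. Each point
`m` on this path satisfies `β(a,b) ≲ β(a,m) β(m,b)` (`exists_chain_bound`). Sums of `β^q` over a
separated set converge for `q > n`, and the hypothesis on `p` says exactly that `q = sp/2 > n`.
Choosing `n < q' < q`, the off-diagonal sum over points with pairwise `β ≤ δ` is at most a constant
times `δ^(q - q') ∑ O^p`. Finitely many colours split the lattice into such parts, so on a finite
truncation the off-diagonal part is absorbed with a bound that does not depend on the truncation
(`tsum_rpow_ne_top`). The same chain estimate bounds `MO(f)(z)^p` by a `β^q`-average of the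
`O(m)^p`, which is integrated in `z` (`exists_meanOsc_rpow_le_tsum`).

Traces of powers are handled through the functional calculus and Hilbert-Schmidt norms, without
singular values. The reproducing formula is proved by averaging over rotations and computing
Gaussian moments. -/

lemma re_inner_le_of_le {A B : H →L[ℂ] H} (h : A ≤ B) (x : H) :
    (inner ℂ x (A x)).re ≤ (inner ℂ x (B x)).re := by
  have := ((ContinuousLinearMap.le_def A B).1 h).re_inner_nonneg_right x
  simp only [sub_apply, inner_sub_right, map_sub] at this
  simpa using this

lemma re_inner_star_mul_self (B : H →L[ℂ] H) (x : H) :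
    (inner ℂ x ((star B * B) x)).re = ‖B x‖ ^ 2 := by
  rw [mul_apply_eq_comp, ContinuousLinearMap.star_eq_adjoint,
    ContinuousLinearMap.adjoint_inner_right]
  exact inner_self_eq_norm_sq (𝕜 := ℂ) _

lemma norm_cfc_apply_sq {g : ℝ → ℝ} (hg : Continuous g) (A : H →L[ℂ] H) (x : H) :
    ‖cfc g A x‖ ^ 2 = (inner ℂ x (cfc (fun t => g t * g t) A x)).re := by
  rw [cfc_mul g g A hg.continuousOn hg.continuousOn, ← re_inner_star_mul_self]
  have : IsSelfAdjoint (cfc g A) := cfc_predicate g A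
  rw [this.star_eq]

lemma re_inner_cfc_le {A : H →L[ℂ] H} (hA : 0 ≤ A) {f g : ℝ → ℝ} (hf : Continuous f)
    (hg : Continuous g) (h : ∀ t, 0 ≤ t → f t ≤ g t) (x : H) :
    (inner ℂ x (cfc f A x)).re ≤ (inner ℂ x (cfc g A x)).re :=
  re_inner_le_of_le (cfc_mono (fun t ht => h t (spectrum_nonneg_of_nonneg hA ht))
    hf.continuousOn hg.continuousOn) x

lemma re_inner_cfc_congr {A : H →L[ℂ] H} (hA : 0 ≤ A) {f g : ℝ → ℝ}
    (h : ∀ t, 0 ≤ t → f t = g t) (x : H) :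
    (inner ℂ x (cfc f A x)).re = (inner ℂ x (cfc g A x)).re := by
  rw [cfc_congr fun t ht => h t (spectrum_nonneg_of_nonneg hA ht)]

lemma re_inner_nonneg_of_nonneg {A : H →L[ℂ] H} (hA : 0 ≤ A) (x : H) :
    0 ≤ (inner ℂ x (A x)).re := by
  simpa using re_inner_le_of_le hA x

/-- Bernoulli's inequality at `a / t`: the concave graph lies below its tangent at `t`. The majorant
is affine in `a`, so under the functional calculus it only involves `⟨x, A x⟩` and `‖x‖²`. -/
lemma rpow_le_tangent {q t a : ℝ} (hq : 0 < q) (hq1 : q ≤ 1) (ht : 0 < t) (ha : 0 ≤ a) :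
    a ^ q ≤ q * t ^ (q - 1) * a + (1 - q) * t ^ q := by
  have h := rpow_one_add_le_one_add_mul_self (s := a / t - 1) (by
    have : 0 ≤ a / t := by positivity
    linarith) hq.le hq1
  rw [add_sub_cancel, Real.div_rpow ha ht.le] at h
  have htq : 0 < t ^ q := Real.rpow_pos_of_pos ht q
  rw [div_le_iff₀ htq] at h
  refine h.trans (le_of_eq ?_)
  rw [Real.rpow_sub_one ht.ne']
  field_simp
  ring

/-- The trace-class form of Jensen's inequality for the concave function `t ↦ t ^ q`. -/
lemma re_inner_cfc_rpow_le {A : H →L[ℂ] H} (hA : 0 ≤ A) {q : ℝ} (hq : 0 < q) (hq1 : q ≤ 1)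
    (x : H) :
    (inner ℂ x (cfc (fun t : ℝ => t ^ q) A x)).re ≤
      (inner ℂ x (A x)).re ^ q * (‖x‖ ^ 2) ^ (1 - q) := by
  have hAs : IsSelfAdjoint A := IsSelfAdjoint.of_nonneg hA
  have key : ∀ t : ℝ, 0 < t → (inner ℂ x (cfc (fun t : ℝ => t ^ q) A x)).re ≤
      q * t ^ (q - 1) * (inner ℂ x (A x)).re + (1 - q) * t ^ q * ‖x‖ ^ 2 := by
    intro t ht
    refine (re_inner_cfc_le hA (g := fun a => q * t ^ (q - 1) * a + (1 - q) * t ^ q)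
      (Real.continuous_rpow_const hq.le) (by fun_prop)
      (fun a ha => rpow_le_tangent hq hq1 ht ha) x).trans (le_of_eq ?_)
    rw [cfc_add_const _ _ A (by fun_prop) hAs, cfc_const_mul_id _ A hAs]
    rw [add_apply, inner_add_right, Complex.add_re, Algebra.algebraMap_eq_smul_one]
    simp only [smul_apply, one_apply_eq_self]
    rw [← Complex.coe_smul, ← Complex.coe_smul, inner_smul_right, inner_smul_right, Complex.re_ofReal_mul,
      Complex.re_ofReal_mul]
    congr 2
    exact inner_self_eq_norm_sq (𝕜 := ℂ) x
  have ha : 0 ≤ (inner ℂ x (A x)).re := re_inner_nonneg_of_nonneg hA x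
  set a := (inner ℂ x (A x)).re
  set N := ‖x‖ ^ 2 with hN
  rcases eq_or_ne x 0 with rfl | hx
  · simp only [map_zero, inner_zero_right, Complex.zero_re]
    positivity
  have hNpos : 0 < N := by positivity
  -- The optimal point of tangency is `t = a / N`; when `a = 0` it degenerates and is replaced by
  -- the limit `t → 0+`.
  rcases ha.eq_or_lt with h0 | hpos
  · rw [← h0, Real.zero_rpow hq.ne', zero_mul]
    have h1 : Filter.Tendsto (fun t : ℝ => q * t ^ (q - 1) * a + (1 - q) * t ^ q * N)
        (nhdsWithin 0 (Set.Ioi 0)) (nhds 0) := by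
      rw [← h0]
      have : Filter.Tendsto (fun t : ℝ => (1 - q) * t ^ q * N) (nhds 0) (nhds ((1 - q) * 0 ^ q * N)) :=
        ((Real.continuous_rpow_const hq.le).const_mul _ |>.mul_const _).tendsto 0
      rw [Real.zero_rpow hq.ne'] at this
      simpa using this.mono_left nhdsWithin_le_nhds
    refine ge_of_tendsto h1 ?_
    filter_upwards [self_mem_nhdsWithin] with t ht using key t ht
  · refine (key (a / N) (by positivity)).trans (le_of_eq ?_)
    rw [Real.rpow_sub_one (by positivity), Real.div_rpow hpos.le hNpos.le, Real.rpow_sub hNpos,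
      Real.rpow_one]
    field_simp
    ring

/-! ### Hilbert-Schmidt norms -/

lemma enorm_sq_eq_tsum_inner {ι : Type*} (b : HilbertBasis ι ℂ H) (x : H) :
    ‖x‖ₑ ^ 2 = ∑' i, ‖inner ℂ (b i) x‖ₑ ^ 2 := by
  have h := b.hasSum_inner_mul_inner x x
  have h2 : HasSum (fun i => ‖inner ℂ (b i) x‖ ^ 2) (‖x‖ ^ 2) := by
    have h3 := Complex.hasSum_re h
    rw [show (inner ℂ x x).re = ‖x‖ ^ 2 from inner_self_eq_norm_sq (𝕜 := ℂ) x] at h3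
    refine h3.congr_fun ?_
    intro i
    rw [← inner_conj_symm x (b i), Complex.conj_mul', ← Complex.ofReal_pow, Complex.ofReal_re]
  have h4 := ENNReal.ofReal_tsum_of_nonneg (fun i => by positivity) h2.summable
  rw [h2.tsum_eq, ENNReal.ofReal_pow (norm_nonneg _), ofReal_norm] at h4
  rw [h4]
  refine tsum_congr fun i => ?_
  rw [ENNReal.ofReal_pow (norm_nonneg _), ofReal_norm]

/-- Both sides are the double sum of `|⟨c j, B (b i)⟩|²`, by Parseval. As the two bases are
unrelated, using this twice also shows that the Hilbert-Schmidt norm does not depend on the basis.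
-/
lemma tsum_enorm_sq_adjoint {ι κ : Type*} (b : HilbertBasis ι ℂ H) (c : HilbertBasis κ ℂ H)
    (B : H →L[ℂ] H) : ∑' i, ‖B (b i)‖ₑ ^ 2 = ∑' j, ‖star B (c j)‖ₑ ^ 2 := by
  simp_rw [enorm_sq_eq_tsum_inner c (B _), enorm_sq_eq_tsum_inner b (star B _)]
  rw [ENNReal.tsum_comm]
  refine tsum_congr fun j => tsum_congr fun i => ?_
  rw [ContinuousLinearMap.star_eq_adjoint, ContinuousLinearMap.adjoint_inner_right,
    ← inner_conj_symm]
  congr 1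
  simp only [enorm_eq_nnnorm, RCLike.nnnorm_conj]

/-- The square of the Hilbert-Schmidt norm. -/
def hsSq (B : H →L[ℂ] H) : ℝ≥0∞ :=
  ∑' i, ‖B (Classical.choose (Classical.choose_spec (exists_hilbertBasis ℂ H)) i)‖ₑ ^ 2

lemma hsSq_star (B : H →L[ℂ] H) : hsSq (star B) = hsSq B := by
  rw [hsSq, hsSq, ← tsum_enorm_sq_adjoint]

lemma hsSq_eq_tsum {ι : Type*} (b : HilbertBasis ι ℂ H) (B : H →L[ℂ] H) :
    hsSq B = ∑' i, ‖B (b i)‖ₑ ^ 2 := by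
  rw [← hsSq_star, hsSq, ← tsum_enorm_sq_adjoint b]

lemma hsSq_mono {B C : H →L[ℂ] H} (h : ∀ x, ‖B x‖ ≤ ‖C x‖) : hsSq B ≤ hsSq C := by
  refine ENNReal.tsum_le_tsum fun i => ?_
  gcongr
  exact enorm_le_iff_norm_le.2 (h _)

lemma hsSq_congr {B C : H →L[ℂ] H} (h : ∀ x, ‖B x‖ ^ 2 = ‖C x‖ ^ 2) : hsSq B = hsSq C :=
  le_antisymm (hsSq_mono fun x => (sq_le_sq₀ (norm_nonneg _) (norm_nonneg _)).1 (h x).le)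
    (hsSq_mono fun x => (sq_le_sq₀ (norm_nonneg _) (norm_nonneg _)).1 (h x).ge)

lemma hsSq_le_add {B C D : H →L[ℂ] H} (h : ∀ x, ‖B x‖ ^ 2 ≤ ‖C x‖ ^ 2 + ‖D x‖ ^ 2) :
    hsSq B ≤ hsSq C + hsSq D := by
  rw [hsSq, hsSq, hsSq, ← ENNReal.tsum_add]
  refine ENNReal.tsum_le_tsum fun i => ?_
  simp only [← ofReal_norm, ← ENNReal.ofReal_pow (norm_nonneg _)]
  rw [← ENNReal.ofReal_add (by positivity) (by positivity)]
  exact ENNReal.ofReal_le_ofReal (h _)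

/-- The trace of `A ^ q` for a positive operator `A`. -/
def powTrace (q : ℝ) (A : H →L[ℂ] H) : ℝ≥0∞ := hsSq (cfc (fun t : ℝ => t ^ (q / 2)) A)

lemma norm_cfc_rpow_half_sq {q : ℝ} (hq : 0 < q) {A : H →L[ℂ] H} (hA : 0 ≤ A) (x : H) :
    ‖cfc (fun t : ℝ => t ^ (q / 2)) A x‖ ^ 2 = (inner ℂ x (cfc (fun t : ℝ => t ^ q) A x)).re := by
  rw [norm_cfc_apply_sq (Real.continuous_rpow_const (by positivity))]
  refine re_inner_cfc_congr hA (fun t ht => ?_) x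
  rw [← Real.rpow_add_of_nonneg ht (by positivity) (by positivity), add_halves]

/-- The power is positive, hence equal to its absolute value, and its diagonal entries are `‖(T*
T)^(p/4) e_i‖²`. Basis independence of `hsSq` reduces the quantifier over all bases to a single one.
-/
lemma isSchatten_iff_powTrace {p : ℝ} (hp : 0 < p) (T : H →L[ℂ] H) :
    IsSchatten p T ↔ powTrace (p / 2) (star T * T) < ∞ := by
  have hA : 0 ≤ star T * T := star_mul_self_nonneg T
  have hpow : (star T * T) ^ (p / 2) = cfc (fun t : ℝ => t ^ (p / 2)) (star T * T) :=
    CFC.rpow_eq_cfc_real hA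
  have hnn : 0 ≤ (star T * T) ^ (p / 2) := CFC.rpow_nonneg
  have key : ∀ x : H, (inner ℂ x (CFC.abs ((star T * T) ^ (p / 2)) x)).re =
      ‖cfc (fun t : ℝ => t ^ (p / 2 / 2)) (star T * T) x‖ ^ 2 := by
    intro x
    rw [CFC.abs_of_nonneg _ hnn, hpow, norm_cfc_rpow_half_sq (by positivity) hA]
  have key2 : ∀ x : H, ‖cfc (fun t : ℝ => t ^ (p / 2 / 2)) (star T * T) x‖ₑ ^ 2 =
      ENNReal.ofReal (‖cfc (fun t : ℝ => t ^ (p / 2 / 2)) (star T * T) x‖ ^ 2) := by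
    intro x
    rw [ENNReal.ofReal_pow (norm_nonneg _), ofReal_norm]
  unfold IsSchatten IsTraceClass
  simp_rw [key]
  constructor
  · intro h
    obtain ⟨w, b, -⟩ := exists_hilbertBasis ℂ H
    rw [powTrace, hsSq_eq_tsum b]
    simp_rw [key2]
    rw [← ENNReal.ofReal_tsum_of_nonneg (fun i => by positivity) (h w b)]
    exact ENNReal.ofReal_lt_top
  · intro h w b
    rw [powTrace, hsSq_eq_tsum b] at h
    have := ENNReal.summable_toReal h.ne
    refine this.congr fun i => ?_
    rw [key2, ENNReal.toReal_ofReal (by positivity)]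

end Operators

section Operators

variable {H : Type*} [NormedAddCommGroup H] [InnerProductSpace ℂ H] [CompleteSpace H]

/-! ### Traces of powers -/

/-- An intertwiner of two self-adjoint operators intertwines their functional calculi. -/
lemma mul_cfc_eq_cfc_mul {X A B : H →L[ℂ] H} (hA : IsSelfAdjoint A) (hB : IsSelfAdjoint B)
    (h : X * A = B * X) {g : ℝ → ℝ} (hg : Continuous g) : X * cfc g A = cfc g B * X := by
  -- The interval `[-R, R]` contains both spectra, so one Weierstrass polynomial approximates `g`
  -- for `A` and `B` simultaneously; polynomials are intertwined algebraically.
  set R := max ‖A‖ ‖B‖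
  have hspec : ∀ C : H →L[ℂ] H, ‖C‖ ≤ R → ∀ t ∈ spectrum ℝ C, t ∈ Set.Icc (-R) R := by
    intro C hC t ht
    have h1 : ‖t‖ ≤ ‖C‖ * ‖(1 : H →L[ℂ] H)‖ := spectrum.norm_le_norm_mul_of_mem ht
    have h2 : ‖(1 : H →L[ℂ] H)‖ ≤ 1 := ContinuousLinearMap.norm_id_le
    have h3 : |t| ≤ R := by
      calc |t| = ‖t‖ := rfl
        _ ≤ ‖C‖ * ‖(1 : H →L[ℂ] H)‖ := h1
        _ ≤ ‖C‖ * 1 := by gcongr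
        _ ≤ R := by simpa using hC
    exact abs_le.1 h3
  have hpoly : ∀ P : Polynomial ℝ, X * Polynomial.aeval A P = Polynomial.aeval B P * X := by
    intro P
    induction P using Polynomial.induction_on' with
    | add p q hp hq => simp only [map_add, mul_add, add_mul, hp, hq]
    | monomial k a =>
      have hk : SemiconjBy X (A ^ k) (B ^ k) := SemiconjBy.pow_right h k
      simp only [Polynomial.aeval_monomial]
      rw [← mul_assoc, ← Algebra.commutes a X, mul_assoc, hk.eq, mul_assoc]
  rw [← sub_eq_zero, ← norm_le_zero_iff]
  refine le_of_forall_pos_le_add fun ε hε => ?_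
  obtain ⟨P, hP⟩ := exists_polynomial_near_of_continuousOn (-R) R g hg.continuousOn
    (ε / (2 * (‖X‖ + 1))) (by positivity)
  have hclose : ∀ C : H →L[ℂ] H, IsSelfAdjoint C → ‖C‖ ≤ R →
      ‖cfc g C - Polynomial.aeval C P‖ ≤ ε / (2 * (‖X‖ + 1)) := by
    intro C hC hCR
    rw [← cfc_polynomial P C hC, ← cfc_sub g _ C hg.continuousOn (by fun_prop)]
    refine norm_cfc_le (by positivity) fun t ht => ?_
    have := hP t (hspec C hCR t ht)
    rw [abs_sub_comm] at this
    exact this.le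
  have h1 := hclose A hA (le_max_left _ _)
  have h2 := hclose B hB (le_max_right _ _)
  have : X * cfc g A - cfc g B * X =
      X * (cfc g A - Polynomial.aeval A P) - (cfc g B - Polynomial.aeval B P) * X := by
    rw [mul_sub, sub_mul, hpoly]; abel
  rw [this, zero_add]
  calc _ ≤ ‖X‖ * (ε / (2 * (‖X‖ + 1))) + (ε / (2 * (‖X‖ + 1))) * ‖X‖ := by
        refine (norm_sub_le _ _).trans (add_le_add ?_ ?_)
        · exact (norm_mul_le _ _).trans (by gcongr)
        · exact (norm_mul_le _ _).trans (by gcongr)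
    _ = ε * (‖X‖ / (‖X‖ + 1)) := by field_simp; ring
    _ ≤ ε * 1 := by
        gcongr
        rw [div_le_one (by positivity)]
        linarith
    _ = ε := mul_one ε

/-- A bounded multiplier regularizing `t ↦ t ^ ((q - 1) / 2)` at the origin. -/
def regWeight (q ε t : ℝ) : ℝ := (|t| + ε) ^ ((q - 1) / 2)

lemma continuous_regWeight (q : ℝ) {ε : ℝ} (hε : 0 < ε) : Continuous (regWeight q ε) := by
  unfold regWeight
  refine Continuous.rpow_const (by fun_prop) fun t => Or.inl ?_
  positivity

/-- A regularization of `t ↦ t ^ (q / 2)`. -/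
def regPow (q ε t : ℝ) : ℝ := √t * regWeight q ε t

lemma continuous_regPow (q : ℝ) {ε : ℝ} (hε : 0 < ε) : Continuous (regPow q ε) :=
  Real.continuous_sqrt.mul (continuous_regWeight q hε)

lemma regPow_nonneg {q ε : ℝ} (hε : 0 < ε) (t : ℝ) : 0 ≤ regPow q ε t := by
  unfold regPow regWeight
  positivity

lemma regPow_mul_self {q ε t : ℝ} (ht : 0 ≤ t) :
    regPow q ε t * regPow q ε t = regWeight q ε t * t * regWeight q ε t := by
  calc regPow q ε t * regPow q ε t = regWeight q ε t * (√t * √t) * regWeight q ε t := by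
        unfold regPow; ring
    _ = _ := by rw [Real.mul_self_sqrt ht]

lemma regPow_le {q ε t : ℝ} (hq1 : q < 1) (hε : 0 < ε) (ht : 0 ≤ t) :
    regPow q ε t ≤ t ^ (q / 2) := by
  unfold regPow regWeight
  rcases ht.eq_or_lt with rfl | hpos
  · simp only [Real.sqrt_zero, zero_mul]
    positivity
  rw [abs_of_pos hpos]
  calc √t * (t + ε) ^ ((q - 1) / 2) ≤ √t * t ^ ((q - 1) / 2) := by
        gcongr ?_ * ?_
        exact Real.rpow_le_rpow_of_nonpos hpos (by linarith) (by linarith)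
    _ = t ^ (q / 2) := by
        rw [Real.sqrt_eq_rpow, ← Real.rpow_add hpos]
        congr 1; ring

/-- The error is uniform on the half-line, so the regularized operators converge in norm. For `t ≥
ε` the quotient of the two functions is `(t / (t + ε)) ^ ((1 - q) / 2) ≥ t / (t + ε)`, which leaves
an error of at most `t ^ (q / 2) * (ε / t) ≤ ε ^ (q / 2)`. -/
lemma rpow_sub_regPow_le {q ε t : ℝ} (hq : 0 < q) (hq1 : q < 1) (hε : 0 < ε) (ht : 0 ≤ t) :
    t ^ (q / 2) - regPow q ε t ≤ ε ^ (q / 2) := by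
  rcases ht.eq_or_lt with rfl | hpos
  · have : regPow q ε 0 = 0 := by simp [regPow]
    rw [Real.zero_rpow (by positivity), this]
    simp only [sub_self]
    positivity
  rcases le_total t ε with hte | hte
  · have := regPow_nonneg (q := q) hε t
    have : t ^ (q / 2) ≤ ε ^ (q / 2) := Real.rpow_le_rpow ht hte (by positivity)
    linarith
  have h1 : regPow q ε t = t ^ (q / 2) * (t / (t + ε)) ^ ((1 - q) / 2) := by
    unfold regPow regWeight
    rw [abs_of_pos hpos, Real.div_rpow ht (by positivity), Real.sqrt_eq_rpow,
      show (q - 1) / 2 = -((1 - q) / 2) by ring, Real.rpow_neg (by positivity), ← mul_div_assoc,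
      ← Real.rpow_add hpos, div_eq_mul_inv (t ^ _)]
    congr 2; ring
  have h2 : t / (t + ε) ≤ (t / (t + ε)) ^ ((1 - q) / 2) := by
    refine Real.self_le_rpow_of_le_one (by positivity) ?_ (by linarith)
    rw [div_le_one (by positivity)]; linarith
  have h3 : t ^ (q / 2) - regPow q ε t ≤ t ^ (q / 2) * (ε / (t + ε)) := by
    rw [h1]
    have : ε / (t + ε) = 1 - t / (t + ε) := by field_simp; ring
    rw [this]
    have : 0 ≤ t ^ (q / 2) := by positivity
    nlinarith
  refine h3.trans ?_
  have h4 : t ^ (q / 2) * (ε / (t + ε)) ≤ t ^ (q / 2) * (ε / t) := by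
    gcongr; linarith
  refine h4.trans ?_
  have h5 : (t / ε) ^ (q / 2) ≤ t / ε := by
    refine Real.rpow_le_self_of_one_le ?_ (by linarith)
    rwa [one_le_div hε]
  rw [Real.div_rpow ht hε.le, div_le_iff₀ (by positivity)] at h5
  calc t ^ (q / 2) * (ε / t) ≤ (t / ε * ε ^ (q / 2)) * (ε / t) := by gcongr
    _ = ε ^ (q / 2) := by field_simp

lemma hsSq_regPow_le {q ε : ℝ} (hq : 0 < q) (hq1 : q < 1) (hε : 0 < ε) {A : H →L[ℂ] H}
    (hA : 0 ≤ A) : hsSq (cfc (regPow q ε) A) ≤ powTrace q A := by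
  refine hsSq_mono fun x => ?_
  have hc : Continuous fun t : ℝ => t ^ (q / 2) := Real.continuous_rpow_const (by positivity)
  rw [← sq_le_sq₀ (norm_nonneg _) (norm_nonneg _), norm_cfc_apply_sq (continuous_regPow q hε),
    norm_cfc_apply_sq hc]
  refine re_inner_cfc_le hA ((continuous_regPow q hε).mul (continuous_regPow q hε)) (hc.mul hc)
    (fun t ht => ?_) x
  have := regPow_nonneg (q := q) hε t
  have := regPow_le hq1 hε ht
  exact mul_self_le_mul_self ‹_› this

/-- Lower semicontinuity of the Hilbert-Schmidt norm: every finite partial sum passes to the norm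
limit `ε → 0+`. -/
lemma powTrace_le_of_forall_regPow {q : ℝ} (hq : 0 < q) (hq1 : q < 1) {A : H →L[ℂ] H}
    (hA : 0 ≤ A) {C : ℝ≥0∞} (h : ∀ ε : ℝ, 0 < ε → hsSq (cfc (regPow q ε) A) ≤ C) :
    powTrace q A ≤ C := by
  have hc : Continuous fun t : ℝ => t ^ (q / 2) := Real.continuous_rpow_const (by positivity)
  have hlim : Filter.Tendsto (fun ε : ℝ => cfc (regPow q ε) A) (nhdsWithin 0 (Set.Ioi 0))
      (nhds (cfc (fun t : ℝ => t ^ (q / 2)) A)) := by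
    rw [tendsto_iff_norm_sub_tendsto_zero]
    have hz : Filter.Tendsto (fun ε : ℝ => ε ^ (q / 2)) (nhdsWithin 0 (Set.Ioi 0)) (nhds 0) := by
      have := (Real.continuous_rpow_const (q := q / 2) (by positivity)).tendsto 0
      rw [Real.zero_rpow (by positivity)] at this
      exact this.mono_left nhdsWithin_le_nhds
    refine squeeze_zero' (Filter.Eventually.of_forall fun _ => norm_nonneg _) ?_ hz
    filter_upwards [self_mem_nhdsWithin] with ε hε
    have hε : 0 < ε := hε
    rw [← cfc_sub _ _ A (continuous_regPow q hε).continuousOn hc.continuousOn]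
    refine norm_cfc_le (by positivity) fun t ht => ?_
    have ht := spectrum_nonneg_of_nonneg hA ht
    have h1 := rpow_sub_regPow_le hq hq1 hε ht
    have h2 := regPow_le hq1 hε ht
    rw [Real.norm_eq_abs, abs_sub_comm, abs_of_nonneg (by linarith)]
    exact h1
  rw [powTrace, hsSq, ENNReal.tsum_eq_iSup_sum]
  refine iSup_le fun s => ?_
  refine le_of_tendsto (f := fun ε : ℝ => ∑ i ∈ s, ‖cfc (regPow q ε) A
    (Classical.choose (Classical.choose_spec (exists_hilbertBasis ℂ H)) i)‖ₑ ^ 2)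
    (x := nhdsWithin (0 : ℝ) (Set.Ioi 0)) (tendsto_finsetSum _ fun i _ => ?_) ?_
  · refine ENNReal.Tendsto.pow ?_
    have : Continuous fun B : H →L[ℂ] H => ‖B
      (Classical.choose (Classical.choose_spec (exists_hilbertBasis ℂ H)) i)‖ₑ := by fun_prop
    exact (this.tendsto _).comp hlim
  · filter_upwards [self_mem_nhdsWithin] with ε hε
    exact (ENNReal.sum_le_tsum s).trans (h ε hε)

/-- The nonzero parts of `X* X` and `X X*` have the same traces of powers. -/
lemma powTrace_star_mul_self_le {q : ℝ} (hq : 0 < q) (hq1 : q < 1) (X : H →L[ℂ] H) :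
    powTrace q (star X * X) ≤ powTrace q (X * star X) := by
  have hA : 0 ≤ star X * X := star_mul_self_nonneg X
  have hB : 0 ≤ X * star X := mul_star_self_nonneg X
  have hAs := IsSelfAdjoint.of_nonneg hA
  have hBs := IsSelfAdjoint.of_nonneg hB
  refine powTrace_le_of_forall_regPow hq hq1 hA fun ε hε => ?_
  refine le_trans (le_of_eq ?_) (hsSq_regPow_le hq hq1 hε hB)
  have hw := continuous_regWeight q hε
  have key : ∀ (Y C : H →L[ℂ] H), C = star Y * Y → ∀ x,
      ‖cfc (regPow q ε) C x‖ ^ 2 = ‖(Y * cfc (regWeight q ε) C) x‖ ^ 2 := by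
    rintro Y C rfl x
    have hC : 0 ≤ star Y * Y := star_mul_self_nonneg Y
    have hCs := IsSelfAdjoint.of_nonneg hC
    have hs : IsSelfAdjoint (cfc (regWeight q ε) (star Y * Y)) := cfc_predicate _ _
    rw [norm_cfc_apply_sq (continuous_regPow q hε), ← re_inner_star_mul_self,
      re_inner_cfc_congr hC (fun t ht => regPow_mul_self ht) x,
      cfc_mul (fun t => regWeight q ε t * t) _ _ (by fun_prop) hw.continuousOn,
      cfc_mul _ (fun t => t) _ hw.continuousOn (by fun_prop), cfc_id' ℝ _ hCs, star_mul, hs.star_eq]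
    simp only [mul_assoc]
  -- With `w = regWeight`, the two sides are the Hilbert-Schmidt norms of `X w(X* X)` and `X* w(X
  -- X*)`. The adjoint of the second is `w(X X*) X`, which equals the first because `X` intertwines
  -- `X* X` and `X X*`. The regularization keeps `w` continuous at `0`.
  rw [hsSq_congr (key X _ rfl), hsSq_congr (key (star X) (X * star X) (by rw [star_star])),
    ← hsSq_star (star X * _), star_mul, star_star]
  have hs : IsSelfAdjoint (cfc (regWeight q ε) (X * star X)) := cfc_predicate _ _
  rw [hs.star_eq, mul_cfc_eq_cfc_mul hAs hBs (by rw [mul_assoc]) hw]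

/-- Löwner-Heinz: powers with exponent in `[0, 1]` are operator monotone. -/
lemma powTrace_mono {q : ℝ} (hq : 0 < q) (hq1 : q < 1) {A B : H →L[ℂ] H} (hA : 0 ≤ A)
    (h : A ≤ B) : powTrace q A ≤ powTrace q B := by
  refine hsSq_mono fun x => ?_
  rw [← sq_le_sq₀ (norm_nonneg _) (norm_nonneg _), norm_cfc_rpow_half_sq hq hA,
    norm_cfc_rpow_half_sq hq (hA.trans h), ← CFC.rpow_eq_cfc_real hA,
    ← CFC.rpow_eq_cfc_real (hA.trans h)]
  exact re_inner_le_of_le (CFC.rpow_le_rpow ⟨hq.le, hq1.le⟩ h) x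

/-- On positive operators the square of `regWeight` is the inverse of `(t + ε) ^ (1 - q)`. Since `0
< 1 - q < 1` the latter is operator monotone, and inversion reverses the order. -/
lemma regWeight_sq_antitone {q ε : ℝ} (hq : 0 < q) (hq1 : q < 1) (hε : 0 < ε)
    {A B : H →L[ℂ] H} (hA : 0 ≤ A) (h : A ≤ B) (x : H) :
    ‖cfc (regWeight q ε) B x‖ ≤ ‖cfc (regWeight q ε) A x‖ := by
  have hw := continuous_regWeight q hε
  have hv : Continuous fun t : ℝ => (|t| + ε) ^ (1 - q) :=
    Continuous.rpow_const (by fun_prop) fun t => Or.inl (by positivity)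
  have hpos : ∀ C : H →L[ℂ] H, 0 ≤ C → 
      cfc (fun t : ℝ => (|t| + ε) ^ (1 - q)) C = (C + algebraMap ℝ _ ε) ^ (1 - q) ∧
      Ring.inverse (cfc (fun t : ℝ => (|t| + ε) ^ (1 - q)) C) =
        cfc (fun t => regWeight q ε t * regWeight q ε t) C ∧
      IsStrictlyPositive (cfc (fun t : ℝ => (|t| + ε) ^ (1 - q)) C) := by
    intro C hC
    have hCs := IsSelfAdjoint.of_nonneg hC
    have e1 : cfc (fun t : ℝ => t + ε) C = C + algebraMap ℝ _ ε := by
      rw [cfc_add_const _ _ C (by fun_prop) hCs, cfc_id' ℝ C hCs]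
    have hn : 0 ≤ C + algebraMap ℝ (H →L[ℂ] H) ε := by
      rw [← e1]
      exact cfc_nonneg fun t ht => by
        have := spectrum_nonneg_of_nonneg hC ht
        positivity
    have hmul : cfc (fun t : ℝ => (|t| + ε) ^ (1 - q)) C *
        cfc (fun t => regWeight q ε t * regWeight q ε t) C = 1 := by
      rw [← cfc_mul _ (fun t => regWeight q ε t * regWeight q ε t) C hv.continuousOn
        (hw.mul hw).continuousOn, ← cfc_one ℝ C hCs]
      refine cfc_congr fun t _ => ?_
      have : 0 < |t| + ε := by positivity
      simp only [regWeight, Pi.one_apply]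
      rw [← Real.rpow_add this, ← Real.rpow_add this]
      ring_nf
      exact Real.rpow_zero _
    have hmul' : cfc (fun t => regWeight q ε t * regWeight q ε t) C *
        cfc (fun t : ℝ => (|t| + ε) ^ (1 - q)) C = 1 := by
      rw [(cfc_commute_cfc _ _ C).eq, hmul]
    have hu : IsUnit (cfc (fun t : ℝ => (|t| + ε) ^ (1 - q)) C) :=
      ⟨⟨_, _, hmul, hmul'⟩, rfl⟩
    refine ⟨?_, ?_, ?_⟩
    · rw [CFC.rpow_eq_cfc_real hn, ← e1, ← cfc_comp' (fun t : ℝ => t ^ (1 - q)) (fun t : ℝ => t + ε) C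
        (Real.continuous_rpow_const (by linarith)).continuousOn (by fun_prop) hCs]
      refine cfc_congr fun t ht => ?_
      simp only [abs_of_nonneg (spectrum_nonneg_of_nonneg hC ht)]
    · exact (Ring.inverse_unit ⟨_, _, hmul, hmul'⟩ : _)
    · exact ⟨cfc_nonneg fun t _ => by positivity, hu⟩
  obtain ⟨a1, a2, a3⟩ := hpos A hA
  obtain ⟨b1, b2, b3⟩ := hpos B (hA.trans h)
  have hle : cfc (fun t : ℝ => (|t| + ε) ^ (1 - q)) A ≤ cfc (fun t : ℝ => (|t| + ε) ^ (1 - q)) B := by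
    rw [a1, b1]
    exact CFC.rpow_le_rpow ⟨by linarith, by linarith⟩ (by gcongr)
  have := CStarAlgebra.antitoneOn_ringInverse a3 b3 hle
  rw [a2, b2] at this
  rw [← sq_le_sq₀ (norm_nonneg _) (norm_nonneg _), norm_cfc_apply_sq hw, norm_cfc_apply_sq hw]
  exact re_inner_le_of_le this x

lemma norm_sqrt_mul_sq {A W : H →L[ℂ] H} (hA : 0 ≤ A) (x : H) :
    ‖(cfc Real.sqrt A * W) x‖ ^ 2 = (inner ℂ (W x) (A (W x))).re := by
  have hAs := IsSelfAdjoint.of_nonneg hA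
  rw [mul_apply_eq_comp, norm_cfc_apply_sq Real.continuous_sqrt,
    re_inner_cfc_congr hA (g := fun t => t) (fun t ht => Real.mul_self_sqrt ht), cfc_id' ℝ A hAs]

/-- Rotfel'd's inequality. With `W ≈ (A + B)^((q-1)/2)`, the trace of `(A + B)^q` is approximately
that of `W (A + B) W`, which splits as `‖A^(1/2) W‖² + ‖B^(1/2) W‖²` in Hilbert-Schmidt norms.
Taking adjoints and using `A ≤ A + B`, the antitone weight may be replaced by the weight of `A` in
the first term, and by that of `B` in the second. -/
lemma powTrace_add_le {q : ℝ} (hq : 0 < q) (hq1 : q < 1) {A B : H →L[ℂ] H} (hA : 0 ≤ A)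
    (hB : 0 ≤ B) : powTrace q (A + B) ≤ powTrace q A + powTrace q B := by
  have hZ : 0 ≤ A + B := add_nonneg hA hB
  refine powTrace_le_of_forall_regPow hq hq1 hZ fun ε hε => ?_
  have hw := continuous_regWeight q hε
  set W := cfc (regWeight q ε) (A + B) with hW
  have hWs : IsSelfAdjoint W := cfc_predicate _ _
  have hreg : ∀ C : H →L[ℂ] H, 0 ≤ C → cfc (regPow q ε) C =
      cfc (regWeight q ε) C * cfc Real.sqrt C := by
    intro C hC
    rw [← cfc_mul _ _ C hw.continuousOn Real.continuous_sqrt.continuousOn]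
    refine cfc_congr fun t _ => ?_
    simp only [regPow, mul_comm]
  have hpart : ∀ C : H →L[ℂ] H, 0 ≤ C → C ≤ A + B →
      hsSq (cfc Real.sqrt C * W) ≤ powTrace q C := by
    intro C hC hCle
    have hs : IsSelfAdjoint (cfc Real.sqrt C) := cfc_predicate _ _
    rw [← hsSq_star, star_mul, hs.star_eq, hWs.star_eq]
    refine le_trans (hsSq_mono fun x => ?_) (hsSq_regPow_le hq hq1 hε hC)
    rw [hreg C hC]
    exact regWeight_sq_antitone hq hq1 hε hC hCle _
  refine le_trans (hsSq_le_add (C := cfc Real.sqrt A * W) (D := cfc Real.sqrt B * W) fun x => ?_)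
    (add_le_add (hpart A hA (le_add_of_nonneg_right hB)) (hpart B hB (le_add_of_nonneg_left hA)))
  rw [hreg _ hZ, (cfc_commute_cfc _ _ _).eq, norm_sqrt_mul_sq hZ, norm_sqrt_mul_sq hA,
    norm_sqrt_mul_sq hB, add_apply, inner_add_right, Complex.add_re]

lemma powTrace_smul {q c : ℝ} (hq : 0 < q) (hc : 0 ≤ c) {A : H →L[ℂ] H} (hA : 0 ≤ A) :
    powTrace q (c • A) = ENNReal.ofReal (c ^ q) * powTrace q A := by
  have hAs := IsSelfAdjoint.of_nonneg hA
  have : cfc (fun t : ℝ => t ^ (q / 2)) (c • A) =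
      (c ^ (q / 2)) • cfc (fun t : ℝ => t ^ (q / 2)) A := by
    have hcont := Real.continuous_rpow_const (q := q / 2) (by positivity)
    rw [← cfc_comp_smul c _ A hcont.continuousOn hAs, ← cfc_smul _ _ A hcont.continuousOn]
    refine cfc_congr fun t ht => ?_
    simp only [smul_eq_mul]
    exact Real.mul_rpow hc (spectrum_nonneg_of_nonneg hA ht)
  rw [powTrace, this, powTrace, hsSq, hsSq, ← ENNReal.tsum_mul_left]
  refine tsum_congr fun i => ?_
  rw [smul_apply, enorm_smul, mul_pow, Real.enorm_of_nonneg (by positivity),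
    ← ENNReal.ofReal_pow (by positivity), ← Real.rpow_natCast, ← Real.rpow_mul hc]
  norm_num

/-- The quasi-triangle inequality for `T ↦ tr |T| ^ (2 q)`. -/
lemma powTrace_star_mul_self_add_le {q : ℝ} (hq : 0 < q) (hq1 : q < 1) (S T : H →L[ℂ] H) :
    powTrace q (star (S + T) * (S + T)) ≤
      ENNReal.ofReal (2 ^ q) * (powTrace q (star S * S) + powTrace q (star T * T)) := by
  have h : star (S + T) * (S + T) ≤ (2 : ℝ) • (star S * S + star T * T) := by
    -- Parallelogram law: the defect in the inequality is `(S - T)* (S - T)`.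
    have h0 : 0 ≤ star (S - T) * (S - T) := star_mul_self_nonneg _
    rw [← sub_nonneg]
    convert h0 using 1
    rw [two_smul, star_add, star_sub]
    noncomm_ring
  have hS := star_mul_self_nonneg S
  have hT := star_mul_self_nonneg T
  refine (powTrace_mono hq hq1 (star_mul_self_nonneg _) h).trans ?_
  rw [powTrace_smul hq (by norm_num) (add_nonneg hS hT)]
  gcongr
  exact powTrace_add_le hq hq1 hS hT

/-- The left contraction disappears from `(VTU)* (VTU)` by monotonicity. The right one disappears in
the same way after exchanging `X* X` for `X X*` with `X = T U`. -/
lemma powTrace_compress_le {q : ℝ} (hq : 0 < q) (hq1 : q < 1) (T : H →L[ℂ] H) {V U : H →L[ℂ] H}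
    (hV : star V * V ≤ 1) (hU : U * star U ≤ 1) :
    powTrace q (star (V * T * U) * (V * T * U)) ≤ powTrace q (star T * T) := by
  have h1 : star (V * T * U) * (V * T * U) ≤ star (T * U) * (T * U) := by
    have := star_left_conjugate_le_conjugate hV (T * U)
    simpa only [star_mul, mul_assoc, one_mul] using this
  have h2 : (T * U) * star (T * U) ≤ T * star T := by
    have := star_right_conjugate_le_conjugate hU T
    simpa only [star_mul, mul_assoc, one_mul] using this
  calc _ ≤ powTrace q (star (T * U) * (T * U)) :=
        powTrace_mono hq hq1 (star_mul_self_nonneg _) h1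
    _ ≤ powTrace q ((T * U) * star (T * U)) := powTrace_star_mul_self_le hq hq1 _
    _ ≤ powTrace q (T * star T) := powTrace_mono hq hq1 (mul_star_self_nonneg _) h2
    _ ≤ powTrace q (star T * T) := by
        simpa only [star_star] using powTrace_star_mul_self_le hq hq1 (star T)

end Operators

section Operators

variable {H : Type*} [NormedAddCommGroup H] [InnerProductSpace ℂ H] [CompleteSpace H]

/-! ### Schatten norms and matrix entries -/

/-- Jensen's inequality `re_inner_cfc_rpow_le` at each unit vector of the basis; concavity, that is
`q ≤ 1`, fixes the direction. -/
lemma powTrace_star_mul_self_le_tsum {q : ℝ} (hq : 0 < q) (hq1 : q < 1) (E : H →L[ℂ] H)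
    {ι : Type*} (b : HilbertBasis ι ℂ H) :
    powTrace q (star E * E) ≤ ∑' i, ‖E (b i)‖ₑ ^ (2 * q) := by
  rw [powTrace, hsSq_eq_tsum b]
  refine ENNReal.tsum_le_tsum fun i => ?_
  have h := re_inner_cfc_rpow_le (star_mul_self_nonneg E) hq hq1.le (b i)
  rw [← norm_cfc_rpow_half_sq hq (star_mul_self_nonneg E), re_inner_star_mul_self,
    b.orthonormal.1 i, one_pow, Real.one_rpow, mul_one, ← Real.rpow_natCast (‖E (b i)‖),
    ← Real.rpow_mul (norm_nonneg _)] at h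
  rw [← ofReal_norm, ← ofReal_norm, ← ENNReal.ofReal_pow (norm_nonneg _),
    ENNReal.ofReal_rpow_of_nonneg (norm_nonneg _) (by positivity)]
  exact ENNReal.ofReal_le_ofReal h

variable {κ : Type*} [Fintype κ]

lemma sum_enorm_sq_le_hsSq {u : κ → H} (hu : Orthonormal ℂ u) (B : H →L[ℂ] H) :
    ∑ j, ‖B (u j)‖ₑ ^ 2 ≤ hsSq B := by
  obtain ⟨w, b, hw, hb⟩ := hu.toSubtypeRange.exists_hilbertBasis_extension
  rw [hsSq_eq_tsum b, ← tsum_fintype (L := .unconditional _)]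
  have hinj : Function.Injective fun j : κ => (⟨u j, hw ⟨j, rfl⟩⟩ : w) := by
    intro i j hij
    exact hu.linearIndependent.injective (congrArg Subtype.val hij)
  refine le_trans (le_of_eq ?_) (ENNReal.tsum_comp_le_tsum_of_injective hinj _)
  simp [hb]

lemma powTrace_star_mul_self_le_sum {q : ℝ} (hq : 0 < q) (hq1 : q < 1) {u : κ → H}
    (hu : Orthonormal ℂ u) (E : H →L[ℂ] H) (hE : ∀ x, (∀ j, inner ℂ (u j) x = 0) → E x = 0) :
    powTrace q (star E * E) ≤ ∑ j, ‖E (u j)‖ₑ ^ (2 * q) := by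
  obtain ⟨w, b, hw, hb⟩ := hu.toSubtypeRange.exists_hilbertBasis_extension
  refine (powTrace_star_mul_self_le_tsum hq hq1 E b).trans (le_of_eq ?_)
  have hinj : Function.Injective fun j : κ => (⟨u j, hw ⟨j, rfl⟩⟩ : w) := by
    intro i j hij
    exact hu.linearIndependent.injective (congrArg Subtype.val hij)
  rw [← tsum_fintype (L := .unconditional _), ← hinj.tsum_eq]
  · simp [hb]
  · intro x hx
    by_contra hxn
    refine hx ?_
    have : E (b x) = 0 := by
      refine hE _ fun j => ?_
      have hne : (⟨u j, hw ⟨j, rfl⟩⟩ : w) ≠ x := fun h => hxn ⟨j, h⟩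
      have := b.orthonormal.2 hne
      rwa [hb] at this ⊢
    simp [this, hq]

/-- The operator `x ↦ ∑ j, c j ⟨v j, x⟩ u j`. -/
def diagOp (c : κ → ℂ) (u v : κ → H) : H →L[ℂ] H :=
  ∑ j, c j • InnerProductSpace.rankOne ℂ (u j) (v j)

lemma diagOp_apply (c : κ → ℂ) (u v : κ → H) (x : H) :
    diagOp c u v x = ∑ j, (c j * inner ℂ (v j) x) • u j := by
  simp [diagOp, mul_smul, sum_apply]

lemma diagOp_apply_self {c : κ → ℂ} {u v : κ → H} (hv : Orthonormal ℂ v) (i : κ) :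
    diagOp c u v (v i) = c i • u i := by
  classical
  rw [diagOp_apply, Finset.sum_eq_single i]
  · simp [hv.1 i]
  · intro j _ hj
    simp [orthonormal_iff_ite.1 hv, hj]
  · simp

lemma norm_diagOp_one_le {u v : κ → H} (hu : Orthonormal ℂ u) (hv : Orthonormal ℂ v) :
    ‖diagOp 1 u v‖ ≤ 1 := by
  refine ContinuousLinearMap.opNorm_le_bound _ zero_le_one fun x => ?_
  rw [one_mul, ← sq_le_sq₀ (norm_nonneg _) (norm_nonneg _), diagOp_apply]
  simp only [Pi.one_apply, one_mul]
  have h : ‖∑ j, inner ℂ (v j) x • u j‖ ^ 2 = ∑ j, ‖inner ℂ (v j) x‖ ^ 2 := by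
    have h1 := hu.inner_sum (fun j => inner ℂ (v j) x) (fun j => inner ℂ (v j) x) Finset.univ
    have h2 := congrArg Complex.re h1
    rw [show (inner ℂ _ _ : ℂ).re = _ from inner_self_eq_norm_sq (𝕜 := ℂ) _] at h2
    rw [h2, Complex.re_sum]
    refine Finset.sum_congr rfl fun j _ => ?_
    rw [Complex.conj_mul', ← Complex.ofReal_pow, Complex.ofReal_re]
  rw [h]
  exact hv.sum_inner_products_le x

lemma star_mul_self_le_one {V : H →L[ℂ] H} (hV : ‖V‖ ≤ 1) : star V * V ≤ 1 := by
  rw [← CStarAlgebra.norm_le_one_iff_of_nonneg _ (star_mul_self_nonneg V), CStarRing.norm_star_mul_self]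
  exact mul_le_one₀ hV (norm_nonneg _) hV

/-- A quadratic minorant valid for all exponents in `[0, 1]`: below `1` use `x ≤ x ^ q`, above `1`
use `(x - 2)² ≥ 0`. Its value `3/4` at `x = 1` is the constant of the next lemma. -/
lemma sub_sq_div_four_le_rpow {q x : ℝ} (hq : 0 ≤ q) (hq1 : q ≤ 1) (hx : 0 ≤ x) :
    x - x ^ 2 / 4 ≤ x ^ q := by
  rcases le_total x 1 with h | h
  · have := Real.self_le_rpow_of_le_one hx h hq1
    nlinarith [sq_nonneg x]
  · have := Real.one_le_rpow h hq
    nlinarith [sq_nonneg (x - 2)]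

/-- The exact value is `l ^ q`. A lower bound is enough here, and the quadratic minorant rescaled to
`l` is evaluated on the eigenvector by applying `A` twice. -/
lemma three_quarters_le_cfc_rpow {q : ℝ} (hq : 0 < q) (hq1 : q ≤ 1) {A : H →L[ℂ] H} (hA : 0 ≤ A)
    {u : H} (hu : ‖u‖ = 1) {l : ℝ} (hl : 0 ≤ l) (h : A u = (l : ℂ) • u) :
    3 / 4 * l ^ q ≤ (inner ℂ u (cfc (fun t : ℝ => t ^ q) A u)).re := by
  have hAs := IsSelfAdjoint.of_nonneg hA
  rcases hl.eq_or_lt with rfl | hpos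
  · rw [Real.zero_rpow hq.ne', mul_zero]
    refine re_inner_nonneg_of_nonneg (cfc_nonneg fun t ht => ?_) u
    exact Real.rpow_nonneg (spectrum_nonneg_of_nonneg hA ht) _
  have hmono := re_inner_cfc_le hA
    (f := fun t => (l ^ q * l⁻¹) * t - (l ^ q * (l⁻¹ ^ 2 / 4)) * t ^ 2) (g := fun t => t ^ q)
    (by fun_prop) (Real.continuous_rpow_const hq.le) (fun t ht => by
      have := sub_sq_div_four_le_rpow hq.le hq1 (x := t / l) (by positivity)
      rw [Real.div_rpow ht hl, le_div_iff₀ (by positivity)] at this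
      refine le_trans (le_of_eq ?_) this
      field_simp) u
  refine le_trans (le_of_eq ?_) hmono
  rw [cfc_sub _ _ A (by fun_prop) (by fun_prop), cfc_const_mul_id _ A hAs,
    cfc_const_mul _ _ A (by fun_prop), cfc_pow_id A 2 hAs, sub_apply, smul_apply, smul_apply, pow_two A,
    mul_apply_eq_comp, h, map_smul, h, smul_smul, ← Complex.coe_smul, ← Complex.coe_smul, inner_sub_right,
    inner_smul_right, inner_smul_right, inner_smul_right, inner_smul_right,
    inner_self_eq_norm_sq_to_K, hu]
  have : ∀ a b c : ℝ, ((a : ℂ) * ((l : ℂ) * ((1 : ℝ) : ℂ) ^ 2) -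
      (b : ℂ) * ((c : ℂ) * ((1 : ℝ) : ℂ) ^ 2)).re = a * l - b * c := by
    intro a b c
    rw [← Complex.ofReal_re (a * l - b * c)]
    push_cast
    congr 1
    ring
  rw [← Complex.ofReal_mul]
  refine Eq.trans ?_ (this _ _ _).symm
  field_simp
  ring

variable {p : ℝ}

lemma rpow_sum_le_sum_rpow {ι : Type*} (hp : 0 < p) (hp1 : p ≤ 1) (s : Finset ι) (a : ι → ℝ≥0∞) :
    (∑ j ∈ s, a j) ^ p ≤ ∑ j ∈ s, a j ^ p := by
  classical
  induction s using Finset.induction_on with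
  | empty => simp [hp]
  | insert i s hi ih =>
    rw [Finset.sum_insert hi, Finset.sum_insert hi]
    exact (ENNReal.rpow_add_le_add_rpow _ _ hp.le hp1).trans (by gcongr)

lemma rpow_norm_sum_le (hp : 0 < p) (hp1 : p < 1) {u : κ → H} (hu : Orthonormal ℂ u) (a : κ → ℂ) :
    ‖∑ j, a j • u j‖ₑ ^ p ≤ ∑ j, ‖a j‖ₑ ^ p := by
  calc ‖∑ j, a j • u j‖ₑ ^ p ≤ (∑ j, ‖a j‖ₑ) ^ p := by
        gcongr
        refine (enorm_sum_le _ _).trans (le_of_eq (Finset.sum_congr rfl fun j _ => ?_))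
        rw [enorm_smul, ← ofReal_norm (u j), hu.1 j, ENNReal.ofReal_one, mul_one]
    _ ≤ _ := rpow_sum_le_sum_rpow hp hp1.le _ _

/-- The diagonal of a Schatten class operator with respect to two orthonormal families is
controlled by its Schatten norm and the off-diagonal entries. -/
theorem sum_diag_rpow_le [DecidableEq κ] (hp : 0 < p) (hp1 : p < 1) (T : H →L[ℂ] H) {u v : κ → H}
    (hu : Orthonormal ℂ u) (hv : Orthonormal ℂ v) :
    ∑ j, ‖inner ℂ (v j) (T (u j))‖ₑ ^ p ≤ 4 * (powTrace (p / 2) (star T * T) +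
      ∑ i, ∑ j, if i = j then 0 else ‖inner ℂ (v j) (T (u i))‖ₑ ^ p) := by
  set q := p / 2 with hq
  have hq0 : 0 < q := by positivity
  have hq1 : q < 1 := by linarith
  set d : κ → ℂ := fun j => inner ℂ (v j) (T (u j)) with hd
  -- In the family `u`, the operator `M = V T U` has the matrix `⟨v j, T (u i)⟩`, with `V` and `U`
  -- contractions. `D` is its diagonal part and `-E` its off-diagonal part.
  set V := diagOp 1 u v
  set U := diagOp 1 u u
  set D := diagOp d u u
  set M := V * T * U
  set E := D - M with hE
  have hUu : ∀ i, U (u i) = u i := fun i => by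
    simpa using diagOp_apply_self (c := (1 : κ → ℂ)) (u := u) hu i
  have hDu : ∀ i, D (u i) = d i • u i := fun i => diagOp_apply_self hu i
  have hMu : ∀ i, M (u i) = ∑ j, inner ℂ (v j) (T (u i)) • u j := fun i => by
    simp only [M, mul_apply_eq_comp, hUu]
    simp [V, diagOp_apply]
  have hEu : ∀ i, E (u i) = ∑ j, (if i = j then 0 else -inner ℂ (v j) (T (u i))) • u j := fun i => by
    rw [hE, sub_apply, hDu, hMu, ← Finset.add_sum_erase _ _ (Finset.mem_univ i),
      ← Finset.add_sum_erase _ (fun j => (if i = j then 0 else -inner ℂ (v j) (T (u i))) • u j)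
        (Finset.mem_univ i)]
    simp only [hd, sub_add_cancel_left, if_true, zero_smul, zero_add]
    rw [← Finset.sum_neg_distrib]
    refine Finset.sum_congr rfl fun j hj => ?_
    rw [if_neg (Finset.ne_of_mem_erase hj).symm, neg_smul]
  have hE0 : ∀ x, (∀ j, inner ℂ (u j) x = 0) → E x = 0 := by
    intro x hx
    have h1 : U x = 0 := by simp [U, diagOp_apply, hx]
    have h2 : D x = 0 := by simp [D, diagOp_apply, hx]
    simp [hE, M, h1, h2]
  have hVn : star V * V ≤ 1 := star_mul_self_le_one (norm_diagOp_one_le hu hv)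
  have hUn : U * star U ≤ 1 := by
    have := star_mul_self_le_one (V := star U) (by
      rw [norm_star]; exact norm_diagOp_one_le hu hu)
    rwa [star_star] at this
  have htM : powTrace q (star M * M) ≤ powTrace q (star T * T) :=
    powTrace_compress_le hq0 hq1 T hVn hUn
  have htE : powTrace q (star E * E) ≤
      ∑ i, ∑ j, if i = j then 0 else ‖inner ℂ (v j) (T (u i))‖ₑ ^ p := by
    refine (powTrace_star_mul_self_le_sum hq0 hq1 hu E hE0).trans (Finset.sum_le_sum fun i _ => ?_)
    rw [show 2 * q = p by rw [hq]; ring, hEu]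
    refine (rpow_norm_sum_le hp hp1 hu _).trans (le_of_eq (Finset.sum_congr rfl fun j _ => ?_))
    split_ifs <;> simp [hp]
  -- The `u j` are eigenvectors of `D* D` with eigenvalues `|d j|²`; the constant `2` absorbs `4/3`
  -- from `three_quarters_le_cfc_rpow`.
  have htD : ∑ j, ‖d j‖ₑ ^ p ≤ 2 * powTrace q (star D * D) := by
    have hDD := star_mul_self_nonneg D
    have hstar : ∀ i, star D (u i) = (starRingEnd ℂ) (d i) • u i := by
      intro i
      refine ext_inner_left ℂ fun x => ?_
      rw [ContinuousLinearMap.star_eq_adjoint, ContinuousLinearMap.adjoint_inner_right]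
      simp only [D]
      rw [diagOp_apply, sum_inner, Finset.sum_eq_single i]
      · rw [inner_smul_left, inner_smul_right, inner_self_eq_norm_sq_to_K, hu.1 i, map_mul,
          inner_conj_symm]
        simp
      · intro j _ hj
        rw [inner_smul_left, hu.2 hj, mul_zero]
      · simp
    have heig : ∀ i, (star D * D) (u i) = ((‖d i‖ ^ 2 : ℝ) : ℂ) • u i := by
      intro i
      rw [mul_apply_eq_comp, hDu, map_smul, hstar, smul_smul, Complex.mul_conj, Complex.normSq_eq_norm_sq]
    have hb : ∑ j, ‖d j‖ₑ ^ p ≤ 2 * ∑ j, ‖cfc (fun t : ℝ => t ^ (q / 2)) (star D * D) (u j)‖ₑ ^ 2 := by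
      rw [Finset.mul_sum]
      refine Finset.sum_le_sum fun j _ => ?_
      have h := three_quarters_le_cfc_rpow hq0 hq1.le hDD (hu.1 j) (by positivity) (heig j)
      rw [← norm_cfc_rpow_half_sq hq0 hDD, ← Real.rpow_natCast, ← Real.rpow_mul (norm_nonneg _)] at h
      rw [← ofReal_norm, ← ofReal_norm, ← ENNReal.ofReal_pow (norm_nonneg _),
        ENNReal.ofReal_rpow_of_nonneg (norm_nonneg _) hp.le,
        show (2 : ℝ≥0∞) = ENNReal.ofReal 2 by simp, ← ENNReal.ofReal_mul (by norm_num)]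
      refine ENNReal.ofReal_le_ofReal ?_
      rw [show ((2 : ℕ) : ℝ) * q = p by rw [hq]; push_cast; ring] at h
      have : 0 ≤ ‖d j‖ ^ p := by positivity
      linarith
    exact hb.trans (by gcongr; exact sum_enorm_sq_le_hsSq hu _)
  refine htD.trans ?_
  have hsum : D = E + M := by rw [hE]; abel
  have h2q : ENNReal.ofReal (2 ^ q) ≤ 2 := by
    rw [show (2 : ℝ≥0∞) = ENNReal.ofReal 2 by simp]
    refine ENNReal.ofReal_le_ofReal ?_
    exact Real.rpow_le_self_of_one_le (by norm_num) hq1.le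
  calc 2 * powTrace q (star D * D)
      ≤ 2 * (2 * (powTrace q (star E * E) + powTrace q (star M * M))) := by
        rw [hsum]
        gcongr
        exact (powTrace_star_mul_self_add_le hq0 hq1 E M).trans (by gcongr)
    _ = 4 * (powTrace q (star M * M) + powTrace q (star E * E)) := by
        rw [← mul_assoc, add_comm]; norm_num
    _ ≤ _ := by gcongr

end Operators

section Averages

/-! ### Averaging over rotations -/

lemma MeasurePreserving.integral_comp_stronglyMeasurable {X E : Type*} [MeasurableSpace X]
    [NormedAddCommGroup E] [NormedSpace ℝ E] {ν : Measure X} {R : X → X}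
    (hR : MeasurePreserving R ν ν) {F : X → E} (hF : StronglyMeasurable F) :
    ∫ y, F (R y) ∂ν = ∫ y, F y ∂ν := by
  have h := integral_map (μ := ν) hR.measurable.aemeasurable (f := F) hF.aestronglyMeasurable
  rw [hR.map_eq] at h
  exact h.symm

section

variable {X : Type*} [MeasurableSpace X] {ν : Measure X} [SFinite ν] {R : ℝ → X → X} {F : X → ℂ}

lemma integrable_prod_rotation (hRm : Measurable (Function.uncurry R))
    (hR : ∀ θ, MeasurePreserving (R θ) ν ν) (hF : Integrable F ν) (hFm : StronglyMeasurable F) :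
    Integrable (fun x : ℝ × X => F (R x.1 x.2))
      ((volume.restrict (Set.Ioc 0 (2 * Real.pi))).prod ν) := by
  have hm : AEStronglyMeasurable (fun x : ℝ × X => F (R x.1 x.2))
      ((volume.restrict (Set.Ioc 0 (2 * Real.pi))).prod ν) :=
    (hFm.comp_measurable hRm).aestronglyMeasurable
  rw [integrable_prod_iff hm]
  refine ⟨Filter.Eventually.of_forall fun θ => (hR θ).integrable_comp_of_integrable hF, ?_⟩
  simp only [fun θ => MeasurePreserving.integral_comp_stronglyMeasurable (hR θ) hFm.norm]
  exact integrable_const _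

/-- Fubini and invariance of the measure. Replacing an integrand by its average over a circle action
isolates a single Taylor coefficient. -/
lemma integral_eq_integral_rotation_average (hRm : Measurable (Function.uncurry R))
    (hR : ∀ θ, MeasurePreserving (R θ) ν ν) (hF : Integrable F ν) (hFm : StronglyMeasurable F) :
    ∫ w, F w ∂ν = ∫ w, ((2 * Real.pi)⁻¹ • ∫ θ in (0 : ℝ)..2 * Real.pi, F (R θ w)) ∂ν := by
  have hpi : (0 : ℝ) ≤ 2 * Real.pi := by positivity
  have hswap := integral_integral_swap (f := fun θ w => F (R θ w))
    (integrable_prod_rotation hRm hR hF hFm)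
  rw [integral_smul]
  simp only [intervalIntegral.integral_of_le hpi]
  rw [← hswap]
  simp only [fun θ => MeasurePreserving.integral_comp_stronglyMeasurable (hR θ) hFm, integral_const,
    measureReal_restrict_apply_univ, Real.volume_real_Ioc_of_le hpi, sub_zero, smul_smul]
  rw [inv_mul_cancel₀ (by positivity), one_smul]

lemma integrable_rotation_average (hRm : Measurable (Function.uncurry R))
    (hR : ∀ θ, MeasurePreserving (R θ) ν ν) (hF : Integrable F ν) (hFm : StronglyMeasurable F) :
    Integrable (fun w => (2 * Real.pi)⁻¹ • ∫ θ in (0 : ℝ)..2 * Real.pi, F (R θ w)) ν := by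
  have hpi : (0 : ℝ) ≤ 2 * Real.pi := by positivity
  simp only [intervalIntegral.integral_of_le hpi]
  exact (integrable_prod_rotation hRm hR hF hFm).integral_prod_right.smul ((2 * Real.pi)⁻¹ : ℝ)

end

/-- The `k`-th Fourier coefficient of an absolutely convergent power series on the unit circle. -/
lemma circleAverage_hasSum_mul_conj_pow {G : ℂ → ℂ} {a : ℕ → ℂ} (ha : Summable fun j => ‖a j‖)
    (hG : ∀ c, ‖c‖ = 1 → HasSum (fun j => a j * c ^ j) (G c)) (k : ℕ) :
    (2 * Real.pi)⁻¹ • ∫ θ in (0 : ℝ)..2 * Real.pi,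
      G (Complex.exp (θ * Complex.I)) * (starRingEnd ℂ (Complex.exp (θ * Complex.I))) ^ k = a k := by
  have hnorm : ∀ θ : ℝ, ‖Complex.exp (θ * Complex.I)‖ = 1 := Complex.norm_exp_ofReal_mul_I
  have hsum : HasSum (fun j => ∫ θ in (0 : ℝ)..2 * Real.pi,
      a j * Complex.exp (θ * Complex.I) ^ j * (starRingEnd ℂ (Complex.exp (θ * Complex.I))) ^ k)
      (∫ θ in (0 : ℝ)..2 * Real.pi,
      G (Complex.exp (θ * Complex.I)) * (starRingEnd ℂ (Complex.exp (θ * Complex.I))) ^ k) := by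
    refine intervalIntegral.hasSum_integral_of_dominated_convergence (fun j _ => ‖a j‖) ?_ ?_ ?_ ?_ ?_
    · intro j
      refine Continuous.aestronglyMeasurable ?_
      fun_prop
    · intro j
      refine Filter.Eventually.of_forall fun θ _ => ?_
      simp [hnorm]
    · exact Filter.Eventually.of_forall fun θ _ => ha
    · exact intervalIntegrable_const
    · refine Filter.Eventually.of_forall fun θ _ => ?_
      exact (hG _ (hnorm θ)).mul_right _
  have hterm : ∀ j, ∫ θ in (0 : ℝ)..2 * Real.pi,
      a j * Complex.exp (θ * Complex.I) ^ j * (starRingEnd ℂ (Complex.exp (θ * Complex.I))) ^ k =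
      if j = k then (2 * Real.pi : ℂ) * a k else 0 := by
    intro j
    have : ∀ θ : ℝ, a j * Complex.exp (θ * Complex.I) ^ j *
        (starRingEnd ℂ (Complex.exp (θ * Complex.I))) ^ k =
        a j * Complex.exp ((((j : ℂ) - k) * Complex.I) * θ) := by
      intro θ
      rw [← Complex.exp_conj, ← Complex.exp_nat_mul, ← Complex.exp_nat_mul, mul_assoc, ← Complex.exp_add]
      congr 2
      simp only [map_mul, Complex.conj_ofReal, Complex.conj_I]
      ring
    simp only [this]
    rw [intervalIntegral.integral_const_mul]
    split_ifs with h
    · subst h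
      simp [mul_comm]
    · have hne : ((j : ℂ) - k) * Complex.I ≠ 0 := by
        refine mul_ne_zero (sub_ne_zero.2 ?_) Complex.I_ne_zero
        exact_mod_cast h
      rw [integral_exp_mul_complex hne]
      have h1 : Complex.exp (((j : ℂ) - k) * Complex.I * ((2 * Real.pi : ℝ) : ℂ)) = 1 := by
        rw [Complex.exp_eq_one_iff]
        exact ⟨(j : ℤ) - k, by push_cast; ring⟩
      rw [h1]
      simp
  simp only [hterm] at hsum
  have h2 := hsum.unique (hasSum_ite_eq k _)
  rw [h2]
  rw [Complex.real_smul]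
  push_cast
  field_simp

/-- The circle average of the restriction of a function holomorphic near the closed unit disc. -/
lemma circle_average_of_differentiableOn {G : ℂ → ℂ} {r : ℝ} (hr : 1 < r)
    (hG : DifferentiableOn ℂ G (Metric.ball 0 r)) :
    (2 * Real.pi)⁻¹ • ∫ θ in (0 : ℝ)..2 * Real.pi, G (Complex.exp (θ * Complex.I)) = G 0 := by
  have h : DiffContOnCl ℂ G (Metric.ball 0 |(1 : ℝ)|) := by
    refine DifferentiableOn.diffContOnCl (hG.mono ?_)
    rw [abs_one, closure_ball _ one_ne_zero]
    exact Metric.closedBall_subset_ball hr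
  have := h.circleAverage
  rw [Real.circleAverage_def] at this
  simpa [circleMap] using this

end Averages

/-! ### Rotations of `ℂⁿ` and invariance of the weighted measures. -/

section Rotations

variable {n : ℕ}

/-- Multiplication by a unimodular scalar. -/
def smulIsometry (c : ℂ) (hc : ‖c‖ = 1) : Cn n ≃ₗᵢ[ℝ] Cn n :=
  LinearIsometry.toLinearIsometryEquiv
    { toLinearMap := (LinearMap.lsmul ℂ (Cn n) c).restrictScalars ℝ
      norm_map' := fun w => by simp [norm_smul, hc] } rfl

/-- The part of `w` orthogonal to `e` is multiplied by `c`. -/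
def transverseScale (e : Cn n) (c : ℂ) (w : Cn n) : Cn n :=
  inner ℂ e w • e + c • (w - inner ℂ e w • e)

lemma inner_transverseScale {e : Cn n} (he : ‖e‖ = 1) (c : ℂ) (w : Cn n) :
    inner ℂ e (transverseScale e c w) = inner ℂ e w := by
  simp only [transverseScale, inner_add_right, inner_smul_right, inner_sub_right,
    inner_self_eq_norm_sq_to_K, he]
  simp

lemma norm_transverseScale_sq {e : Cn n} (he : ‖e‖ = 1) (c : ℂ) (w : Cn n) :
    ‖transverseScale e c w‖ ^ 2 = ‖inner ℂ e w‖ ^ 2 + ‖c‖ ^ 2 * (‖w‖ ^ 2 - ‖inner ℂ e w‖ ^ 2) := by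
  have horth : inner ℂ e (w - inner ℂ e w • e) = 0 := by
    rw [inner_sub_right, inner_smul_right, inner_self_eq_norm_sq_to_K, he]; simp
  have h1 : ∀ a : ℂ, ‖inner ℂ e w • e + a • (w - inner ℂ e w • e)‖ ^ 2 =
      ‖inner ℂ e w‖ ^ 2 + ‖a‖ ^ 2 * ‖w - inner ℂ e w • e‖ ^ 2 := by
    intro a
    have := norm_add_sq_eq_norm_sq_add_norm_sq_of_inner_eq_zero (𝕜 := ℂ) (inner ℂ e w • e)
      (a • (w - inner ℂ e w • e)) (by rw [inner_smul_left, inner_smul_right, horth]; simp)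
    rw [sq, this, norm_smul, norm_smul, he]
    ring
  have h2 := h1 1
  rw [one_smul, add_sub_cancel] at h2
  rw [transverseScale, h1, h2]
  simp

/-- Rotation of the orthogonal complement of a unit vector. -/
def transverseRotation (e : Cn n) (he : ‖e‖ = 1) (c : ℂ) (hc : ‖c‖ = 1) : Cn n ≃ₗᵢ[ℝ] Cn n :=
  LinearIsometry.toLinearIsometryEquiv
    { toLinearMap :=
        { toFun := transverseScale e c
          map_add' := fun x y => by
            simp only [transverseScale, inner_add_right, add_smul, smul_sub, smul_add]; abel
          map_smul' := fun a x => by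
            simp only [transverseScale, RingHom.id_apply, inner_smul_right_eq_smul, smul_add,
              smul_sub, smul_assoc, smul_comm c a] }
      norm_map' := fun w => by
        rw [← sq_eq_sq₀ (norm_nonneg _) (norm_nonneg _)]
        exact (norm_transverseScale_sq he c w).trans (by rw [hc]; ring) } rfl

lemma weightedMeasure_measurePreserving (α : ℝ) (L : Cn n ≃ₗᵢ[ℝ] Cn n) :
    MeasurePreserving L (weightedMeasure n α) (weightedMeasure n α) := by
  have hL := L.measurePreserving
  have hB : MeasurableSet (unitBall n) := Metric.isOpen_ball.measurableSet
  refine ⟨hL.measurable, ?_⟩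
  ext s hs
  rw [Measure.map_apply hL.measurable hs, weightedMeasure,
    withDensity_apply _ hs, withDensity_apply _ (hL.measurable hs),
    Measure.restrict_restrict hs, Measure.restrict_restrict (hL.measurable hs)]
  have hpre : L ⁻¹' s ∩ unitBall n = L ⁻¹' (s ∩ unitBall n) := by
    ext w
    simp [unitBall]
  rw [hpre, ← hL.setLIntegral_comp_preimage_emb L.toHomeomorph.measurableEmbedding
    (fun z => ENNReal.ofReal (Real.Gamma (n + 1 + α) / (Real.pi ^ n * Real.Gamma (α + 1))
      * (1 - ‖z‖ ^ 2) ^ α)) (s ∩ unitBall n)]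
  simp only [LinearIsometryEquiv.norm_map]

end Rotations

section Moments

variable {n : ℕ}

/-! ### Moments of the weighted measures -/

lemma measurableSet_unitBall : MeasurableSet (unitBall n) := Metric.isOpen_ball.measurableSet

lemma finrank_real_Cn : Module.finrank ℝ (Cn n) = 2 * n := by
  rw [← Module.finrank_mul_finrank ℝ ℂ (Cn n), Complex.finrank_real_complex, finrank_euclideanSpace_fin]

lemma integral_gaussian : ∫ w : Cn n, Real.exp (-‖w‖ ^ 2) = Real.pi ^ n := by
  have h := GaussianFourier.integral_rexp_neg_mul_sq_norm (V := Cn n) (b := 1) one_pos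
  rw [finrank_real_Cn] at h
  simp only [neg_mul, one_mul, div_one] at h
  rw [h]
  push_cast
  rw [mul_div_cancel_left₀ _ (two_ne_zero), Real.rpow_natCast]

lemma integrable_gaussian_half : Integrable fun w : Cn n => Real.exp (-(1 / 2) * ‖w‖ ^ 2) := by
  refine Integrable.of_integral_ne_zero ?_
  rw [GaussianFourier.integral_rexp_neg_mul_sq_norm (by norm_num)]
  positivity

lemma pow_mul_exp_le (k : ℕ) {x : ℝ} (hx : 0 ≤ x) :
    x ^ k * Real.exp x * Real.exp (-x ^ 2) ≤
      (k.factorial * Real.exp 2) * Real.exp (-(1 / 2) * x ^ 2) := by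
  have h1 : x ^ k ≤ k.factorial * Real.exp x := by
    have := Real.pow_div_factorial_le_exp x hx k
    rwa [div_le_iff₀' (by positivity)] at this
  calc x ^ k * Real.exp x * Real.exp (-x ^ 2)
      ≤ (k.factorial * Real.exp x) * Real.exp x * Real.exp (-x ^ 2) := by gcongr
    _ = k.factorial * Real.exp (x + x + -x ^ 2) := by rw [Real.exp_add, Real.exp_add]; ring
    _ ≤ k.factorial * Real.exp (2 + -(1 / 2) * x ^ 2) := by
        refine mul_le_mul_of_nonneg_left (Real.exp_le_exp.2 ?_) (by positivity)
        nlinarith [sq_nonneg (x - 2)]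
    _ = _ := by rw [Real.exp_add]; ring

lemma integrable_moment_exp {e : Cn n} (he : ‖e‖ = 1) (k : ℕ) {F : Cn n → ℂ} (hF : Continuous F)
    (hb : ∀ w, ‖F w‖ ≤ ‖inner ℂ e w‖ ^ k * Real.exp ‖inner ℂ e w‖ * Real.exp (-‖w‖ ^ 2)) :
    Integrable F := by
  refine Integrable.mono' (integrable_gaussian_half.const_mul (k.factorial * Real.exp 2))
    hF.aestronglyMeasurable (Filter.Eventually.of_forall fun w => (hb w).trans ?_)
  have hle : ‖inner ℂ e w‖ ≤ ‖w‖ := by simpa [he] using norm_inner_le_norm (𝕜 := ℂ) e w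
  refine le_trans ?_ (pow_mul_exp_le k (norm_nonneg w))
  gcongr

/-- The one-parameter group of scalar rotations. -/
lemma measurePreserving_exp_smul (ν : Measure (Cn n))
    (hν : ∀ L : Cn n ≃ₗᵢ[ℝ] Cn n, MeasurePreserving L ν ν) (θ : ℝ) :
    MeasurePreserving (fun w : Cn n => Complex.exp (θ * Complex.I) • w) ν ν :=
  hν (smulIsometry _ (Complex.norm_exp_ofReal_mul_I θ))

lemma measurable_exp_smul :
    Measurable (Function.uncurry fun (θ : ℝ) (w : Cn n) => Complex.exp (θ * Complex.I) • w) := by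
  refine Continuous.measurable ?_
  unfold Function.uncurry
  fun_prop

/-- With `l = ⟨e, w⟩`, the integral of `conj(l)^k exp(l) exp(-|w|²)` is computed twice. Scalar
rotations keep only the `k`-th Taylor term of `exp`, giving the moment divided by `k!`. The
translation `w = u + e` turns the integrand into `conj((l + 1)^k exp(-l)) exp(-|u|²)`, whose circle
averages are `exp(-|u|²)` by the mean value property. -/
lemma integral_gaussian_moment {e : Cn n} (he : ‖e‖ = 1) (k : ℕ) :
    ∫ w : Cn n, ((‖inner ℂ e w‖ ^ (2 * k) * Real.exp (-‖w‖ ^ 2) : ℝ) : ℂ) =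
      (Real.pi ^ n * k.factorial : ℂ) := by
  set F : Cn n → ℂ := fun w => starRingEnd ℂ (inner ℂ e w) ^ k * Complex.exp (inner ℂ e w) *
    (Real.exp (-‖w‖ ^ 2) : ℂ) with hFdef
  have hFc : Continuous F := by fun_prop
  have hFi : Integrable F := by
    refine integrable_moment_exp he k hFc fun w => ?_
    simp only [hFdef, norm_mul, norm_pow, RCLike.norm_conj, Complex.norm_real, Real.norm_eq_abs,
      Real.abs_exp]
    gcongr
    exact Complex.norm_exp_le_exp_norm _
  have hvol : ∀ L : Cn n ≃ₗᵢ[ℝ] Cn n, MeasurePreserving L volume volume := fun L => L.measurePreserving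
  have hrot1 : ∫ w, F w = (k.factorial : ℂ)⁻¹ *
      ∫ w : Cn n, ((‖inner ℂ e w‖ ^ (2 * k) * Real.exp (-‖w‖ ^ 2) : ℝ) : ℂ) := by
    rw [integral_eq_integral_rotation_average measurable_exp_smul (measurePreserving_exp_smul _ hvol) hFi
      hFc.stronglyMeasurable, ← integral_const_mul]
    congr 1
    ext w
    have hser := circleAverage_hasSum_mul_conj_pow (G := fun c => Complex.exp (c * inner ℂ e w))
      (a := fun j => inner ℂ e w ^ j / j.factorial) ?_ ?_ k
    · have : ∀ θ : ℝ, F (Complex.exp (θ * Complex.I) • w) =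
          (Complex.exp (Complex.exp (θ * Complex.I) * inner ℂ e w) *
            (starRingEnd ℂ (Complex.exp (θ * Complex.I))) ^ k) *
          (starRingEnd ℂ (inner ℂ e w) ^ k * (Real.exp (-‖w‖ ^ 2) : ℂ)) := by
        intro θ
        simp only [hFdef, inner_smul_right, norm_smul, Complex.norm_exp_ofReal_mul_I, one_mul, map_mul,
          mul_pow]
        ring
      simp only [this, intervalIntegral.integral_mul_const]
      rw [← smul_mul_assoc, hser]
      have h2 : inner ℂ e w ^ k * starRingEnd ℂ (inner ℂ e w) ^ k = ((‖inner ℂ e w‖ ^ (2 * k) : ℝ) : ℂ) := by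
        rw [← mul_pow, Complex.mul_conj', pow_mul]; push_cast; rfl
      rw [Complex.ofReal_mul, ← h2]
      field_simp
    · exact (NormedSpace.norm_expSeries_div_summable (inner ℂ e w)).congr fun j => rfl
    · intro c _
      have := NormedSpace.expSeries_div_hasSum_exp (c * inner ℂ e w)
      rw [← Complex.exp_eq_exp_ℂ] at this
      refine this.congr_fun ?_
      intro j
      rw [mul_pow]; ring
  have hrot2 : ∫ w, F w = (Real.pi ^ n : ℂ) := by
    set F₂ : Cn n → ℂ := fun u => starRingEnd ℂ ((inner ℂ e u + 1) ^ k * Complex.exp (-inner ℂ e u)) *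
      (Real.exp (-‖u‖ ^ 2) : ℂ) with hF₂def
    have htrans : ∀ u, F (u + e) = F₂ u := by
      intro u
      have hi : inner ℂ e (u + e) = inner ℂ e u + 1 := by
        rw [inner_add_right, inner_self_eq_norm_sq_to_K, he]; simp
      have hn : ‖u + e‖ ^ 2 = ‖u‖ ^ 2 + 2 * (inner ℂ e u).re + 1 := by
        have hre : (inner ℂ u e).re = (inner ℂ e u).re := inner_re_symm (𝕜 := ℂ) u e
        rw [@norm_add_sq ℂ, he, ← hre]
        simp
      simp only [hFdef, hF₂def, hi, hn, map_mul, map_pow]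
      rw [mul_assoc, mul_assoc, ← Complex.exp_conj, Complex.ofReal_exp, Complex.ofReal_exp,
        ← Complex.exp_add, ← Complex.exp_add]
      congr 2
      rw [map_neg]
      have := Complex.add_conj (inner ℂ e u)
      push_cast at this ⊢
      linear_combination this
    have hF₂c : Continuous F₂ := by fun_prop
    have hF₂i : Integrable F₂ := by
      have := hFi.comp_add_right e
      exact this.congr (Filter.Eventually.of_forall htrans)
    rw [← integral_add_right_eq_self F e]
    simp only [htrans]
    rw [integral_eq_integral_rotation_average measurable_exp_smul (measurePreserving_exp_smul _ hvol)
      hF₂i hF₂c.stronglyMeasurable]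
    have : ∀ u : Cn n, ((2 * Real.pi)⁻¹ • ∫ θ in (0 : ℝ)..2 * Real.pi,
        F₂ (Complex.exp (θ * Complex.I) • u)) = (Real.exp (-‖u‖ ^ 2) : ℂ) := by
      intro u
      have hav := circle_average_of_differentiableOn (r := 2) (by norm_num)
        (G := fun c => (c * inner ℂ e u + 1) ^ k * Complex.exp (-(c * inner ℂ e u)))
        (by fun_prop)
      have : ∀ θ : ℝ, F₂ (Complex.exp (θ * Complex.I) • u) =
          starRingEnd ℂ ((fun c => (c * inner ℂ e u + 1) ^ k * Complex.exp (-(c * inner ℂ e u)))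
            (Complex.exp (θ * Complex.I))) * (Real.exp (-‖u‖ ^ 2) : ℂ) := by
        intro θ
        simp only [hF₂def, inner_smul_right, norm_smul, Complex.norm_exp_ofReal_mul_I, one_mul]
      simp only [this, intervalIntegral.integral_mul_const]
      rw [← smul_mul_assoc]
      have hconj := congrArg (starRingEnd ℂ) hav
      rw [Complex.real_smul, map_mul, Complex.conj_ofReal,
        intervalIntegral.integral_of_le (by positivity), ← integral_conj,
        ← intervalIntegral.integral_of_le (by positivity), ← Complex.real_smul] at hconj
      rw [hconj]
      simp
    simp only [this]
    rw [integral_complex_ofReal, integral_gaussian]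
    push_cast; rfl
  have hk : (k.factorial : ℂ) ≠ 0 := by exact_mod_cast k.factorial_ne_zero
  rw [hrot2] at hrot1
  rw [hrot1]
  field_simp

lemma lintegral_gaussian_moment {e : Cn n} (he : ‖e‖ = 1) (k : ℕ) :
    ∫⁻ w : Cn n, ENNReal.ofReal (‖inner ℂ e w‖ ^ (2 * k) * Real.exp (-‖w‖ ^ 2)) =
      ENNReal.ofReal (Real.pi ^ n * k.factorial) := by
  have h := integral_gaussian_moment he k
  rw [integral_complex_ofReal] at h
  have h' : ∫ w : Cn n, ‖inner ℂ e w‖ ^ (2 * k) * Real.exp (-‖w‖ ^ 2) =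
      Real.pi ^ n * k.factorial := by
    have : ((∫ w : Cn n, ‖inner ℂ e w‖ ^ (2 * k) * Real.exp (-‖w‖ ^ 2) : ℝ) : ℂ) =
      ((Real.pi ^ n * k.factorial : ℝ) : ℂ) := by rw [h]; push_cast; rfl
    exact_mod_cast this
  rw [← h', ofReal_integral_eq_lintegral_ofReal]
  · exact Integrable.of_integral_ne_zero (by rw [h']; positivity)
  · exact Filter.Eventually.of_forall fun w => by positivity

lemma lintegral_Gamma {a : ℝ} (ha : 0 < a) :
    ∫⁻ t in Set.Ioi (0 : ℝ), ENNReal.ofReal (t ^ (a - 1) * Real.exp (-t)) =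
      ENNReal.ofReal (Real.Gamma a) := by
  rw [Real.Gamma_eq_integral ha, ofReal_integral_eq_lintegral_ofReal]
  · simp only [mul_comm]
  · exact Real.GammaIntegral_convergent ha
  · filter_upwards [ae_restrict_mem measurableSet_Ioi] with t ht
    have : (0 : ℝ) < t := ht
    positivity

lemma lintegral_comp_smul_Cn {f : Cn n → ℝ≥0∞} (hf : Measurable f) {r : ℝ} (hr : 0 < r) :
    ∫⁻ w, f w = ENNReal.ofReal (r ^ (2 * n)) * ∫⁻ w, f (r • w) := by
  have h1 : ∫⁻ w, f (r • w) = ∫⁻ w, f w ∂(Measure.map (r • ·) volume) :=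
    (lintegral_map hf (measurable_const_smul r)).symm
  rw [h1, Measure.map_addHaar_smul _ hr.ne', finrank_real_Cn, lintegral_smul_measure, smul_eq_mul,
    ← mul_assoc, abs_of_pos (by positivity), ← ENNReal.ofReal_mul (by positivity),
    mul_inv_cancel₀ (by positivity), ENNReal.ofReal_one, one_mul]

/-- Integrals of homogeneous functions against `(1 - |w|²)^α` on the ball and against the Gaussian
are proportional. -/
lemma lintegral_ball_homogeneous {G : Cn n → ℝ} (hG : Measurable G) {k : ℕ}
    (hhom : ∀ r : ℝ, 0 < r → ∀ w, G (r • w) = r ^ (2 * k) * G w) {α : ℝ} (hα : -1 < α) :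
    ENNReal.ofReal (Real.Gamma (n + 1 + α + k)) *
        ∫⁻ w in unitBall n, ENNReal.ofReal (G w * (1 - ‖w‖ ^ 2) ^ α) =
      ENNReal.ofReal (Real.Gamma (α + 1)) * ∫⁻ w, ENNReal.ofReal (G w * Real.exp (-‖w‖ ^ 2)) := by
  -- Tonelli for `G(w) (t - |w|²)^α e^(-t)` on `|w|² < t`. For fixed `t` the scaling `w ↦ √t w`
  -- produces the ball integral times the integrand of `Γ(n + 1 + α + k)`; for fixed `w` the shift
  -- `t ↦ t + |w|²` produces the Gaussian times `Γ(α + 1)`.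
  set Φ : ℝ → Cn n → ℝ≥0∞ := fun t w => if ‖w‖ ^ 2 < t then
    ENNReal.ofReal (G w * ((t - ‖w‖ ^ 2) ^ α * Real.exp (-t))) else 0 with hΦ
  have hΦm : Measurable (Function.uncurry Φ) := by
    refine Measurable.ite ?_ ?_ measurable_const
    · exact measurableSet_lt (by fun_prop) (by fun_prop)
    · refine ENNReal.measurable_ofReal.comp ?_
      refine (hG.comp measurable_snd).mul (Measurable.mul ?_ (by fun_prop))
      exact Measurable.pow_const (by fun_prop) α
  have hswap : ∫⁻ t in Set.Ioi (0 : ℝ), ∫⁻ w, Φ t w = ∫⁻ w, ∫⁻ t in Set.Ioi (0 : ℝ), Φ t w :=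
    lintegral_lintegral_swap hΦm.aemeasurable
  have hleft : ∀ t ∈ Set.Ioi (0 : ℝ), ∫⁻ w, Φ t w =
      ENNReal.ofReal (t ^ ((n + 1 + α + k) - 1) * Real.exp (-t)) *
        ∫⁻ w in unitBall n, ENNReal.ofReal (G w * (1 - ‖w‖ ^ 2) ^ α) := by
    intro t ht
    have ht : (0 : ℝ) < t := ht
    rw [lintegral_comp_smul_Cn (f := Φ t) hΦm.of_uncurry_left (Real.sqrt_pos.2 ht),
      ← lintegral_indicator measurableSet_unitBall,
      ← lintegral_const_mul' _ _ ENNReal.ofReal_ne_top,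
      ← lintegral_const_mul' _ _ ENNReal.ofReal_ne_top]
    · congr 1
      ext w
      have hn : ‖√t • w‖ ^ 2 = t * ‖w‖ ^ 2 := by
        rw [norm_smul, mul_pow, Real.norm_of_nonneg (Real.sqrt_nonneg t), Real.sq_sqrt ht.le]
      have hiff : ‖√t • w‖ ^ 2 < t ↔ w ∈ unitBall n := by
        rw [hn, unitBall, mem_ball_zero_iff, mul_lt_iff_lt_one_right ht, sq_lt_one_iff₀ (norm_nonneg _)]
      simp only [hΦ]
      by_cases hw : w ∈ unitBall n
      · have h1 : 0 < 1 - ‖w‖ ^ 2 := by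
          rw [unitBall, mem_ball_zero_iff, ← sq_lt_one_iff₀ (norm_nonneg _)] at hw
          linarith
        rw [if_pos (hiff.2 hw), Set.indicator_of_mem hw, hn, ← ENNReal.ofReal_mul (by positivity),
          ← ENNReal.ofReal_mul (by positivity), hhom _ (Real.sqrt_pos.2 ht)]
        congr 1
        have e1 : t - t * ‖w‖ ^ 2 = t * (1 - ‖w‖ ^ 2) := by ring
        rw [e1, Real.mul_rpow ht.le h1.le, pow_mul, pow_mul, Real.sq_sqrt ht.le,
          show (n + 1 + α + k : ℝ) - 1 = n + k + α by ring, Real.rpow_add ht, Real.rpow_add ht,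
          Real.rpow_natCast, Real.rpow_natCast]
        ring
      · rw [if_neg (fun h => hw (hiff.1 h)), Set.indicator_of_notMem hw, mul_zero, mul_zero]
  have hright : ∀ w, ∫⁻ t in Set.Ioi (0 : ℝ), Φ t w =
      ENNReal.ofReal (Real.Gamma (α + 1)) * ENNReal.ofReal (G w * Real.exp (-‖w‖ ^ 2)) := by
    intro w
    have h1 : ∫⁻ t in Set.Ioi (0 : ℝ), Φ t w = ∫⁻ t, (Set.Ioi (‖w‖ ^ 2)).indicator
        (fun t => ENNReal.ofReal (G w * ((t - ‖w‖ ^ 2) ^ α * Real.exp (-t)))) t := by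
      rw [← lintegral_indicator measurableSet_Ioi]
      congr 1
      ext t
      simp only [hΦ, Set.indicator, Set.mem_Ioi]
      split_ifs with h2 h3 h3
      · rfl
      · rfl
      · exact absurd (lt_of_le_of_lt (by positivity) h3) h2
      · rfl
    rw [h1, ← lintegral_add_right_eq_self _ (‖w‖ ^ 2), ← lintegral_Gamma (by linarith : 0 < α + 1),
      ← lintegral_indicator measurableSet_Ioi, ← lintegral_mul_const']
    · congr 1
      ext t
      simp only [Set.indicator, Set.mem_Ioi, lt_add_iff_pos_left]
      split_ifs with h2
      · rw [← ENNReal.ofReal_mul (by positivity)]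
        congr 1
        rw [add_sub_cancel_right, add_sub_cancel_right, neg_add, Real.exp_add]
        ring
      · simp
    · exact ENNReal.ofReal_ne_top
  rw [setLIntegral_congr_fun measurableSet_Ioi hleft] at hswap
  simp only [hright] at hswap
  rw [lintegral_mul_const, lintegral_const_mul, lintegral_Gamma] at hswap
  · exact hswap
  · have : (0 : ℝ) ≤ n := by positivity
    have : (0 : ℝ) ≤ k := by positivity
    linarith
  · refine ENNReal.measurable_ofReal.comp (hG.mul ?_)
    fun_prop
  · refine ENNReal.measurable_ofReal.comp (Measurable.mul ?_ (by fun_prop))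
    exact measurable_id.pow_const _

end Moments

section Reproducing

variable {n : ℕ}

/-! ### The reproducing formula -/

lemma mem_unitBall {w : Cn n} : w ∈ unitBall n ↔ ‖w‖ < 1 := by
  rw [unitBall, mem_ball_zero_iff]

lemma one_sub_norm_sq_pos {w : Cn n} (hw : w ∈ unitBall n) : 0 < 1 - ‖w‖ ^ 2 := by
  have := (sq_lt_one_iff₀ (norm_nonneg _)).2 (mem_unitBall.1 hw)
  linarith

/-- The normalizing constant of `dv_α`. -/
def weightConst (n : ℕ) (α : ℝ) : ℝ := Real.Gamma (n + 1 + α) / (Real.pi ^ n * Real.Gamma (α + 1))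

lemma weightConst_pos {α : ℝ} (hα : -1 < α) : 0 < weightConst n α := by
  have h1 : 0 < Real.Gamma (α + 1) := Real.Gamma_pos_of_pos (by linarith)
  have h2 : 0 < Real.Gamma (n + 1 + α) := Real.Gamma_pos_of_pos (by
    have : (0 : ℝ) ≤ n := by positivity
    linarith)
  unfold weightConst
  positivity

lemma measurable_weight (α c : ℝ) :
    Measurable fun z : Cn n => ENNReal.ofReal (c * (1 - ‖z‖ ^ 2) ^ α) := by
  refine ENNReal.measurable_ofReal.comp (measurable_const.mul ?_)
  exact Measurable.pow_const (by fun_prop) α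

lemma lintegral_weightedMeasure (α : ℝ) {F : Cn n → ℝ≥0∞} (hF : Measurable F) :
    ∫⁻ w, F w ∂(weightedMeasure n α) =
      ∫⁻ w in unitBall n, ENNReal.ofReal (weightConst n α * (1 - ‖w‖ ^ 2) ^ α) * F w := by
  rw [weightedMeasure, lintegral_withDensity_eq_lintegral_mul _ (measurable_weight α _) hF]
  rfl

lemma ae_mem_unitBall (α : ℝ) : ∀ᵐ w ∂(weightedMeasure n α), w ∈ unitBall n :=
  (withDensity_absolutelyContinuous _ _).ae_le (ae_restrict_mem measurableSet_unitBall)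

lemma lintegral_weightedMeasure_homogeneous {G : Cn n → ℝ} (hG : Measurable G)
    {k : ℕ} (hhom : ∀ r : ℝ, 0 < r → ∀ w, G (r • w) = r ^ (2 * k) * G w) {α : ℝ} (hα : -1 < α) :
    ∫⁻ w, ENNReal.ofReal (G w) ∂(weightedMeasure n α) =
      ENNReal.ofReal (Real.Gamma (n + 1 + α) / (Real.pi ^ n * Real.Gamma (n + 1 + α + k))) *
        ∫⁻ w, ENNReal.ofReal (G w * Real.exp (-‖w‖ ^ 2)) := by
  have hn : (0 : ℝ) ≤ n := by positivity
  have hk : (0 : ℝ) ≤ k := by positivity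
  have h1 : 0 < Real.Gamma (α + 1) := Real.Gamma_pos_of_pos (by linarith)
  have h2 : 0 < Real.Gamma (n + 1 + α) := Real.Gamma_pos_of_pos (by linarith)
  have h3 : 0 < Real.Gamma (n + 1 + α + k) := Real.Gamma_pos_of_pos (by linarith)
  have h := lintegral_ball_homogeneous hG hhom hα
  have hc := weightConst_pos (n := n) hα
  rw [lintegral_weightedMeasure α (F := fun w => ENNReal.ofReal (G w))
    (ENNReal.measurable_ofReal.comp hG)]
  have hrew : ∫⁻ w in unitBall n, ENNReal.ofReal (weightConst n α * (1 - ‖w‖ ^ 2) ^ α) *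
      ENNReal.ofReal (G w) = ENNReal.ofReal (weightConst n α) *
        ∫⁻ w in unitBall n, ENNReal.ofReal (G w * (1 - ‖w‖ ^ 2) ^ α) := by
    rw [← lintegral_const_mul' _ _ ENNReal.ofReal_ne_top]
    refine setLIntegral_congr_fun measurableSet_unitBall fun w hw => ?_
    have := one_sub_norm_sq_pos hw
    rw [← ENNReal.ofReal_mul (by positivity), ← ENNReal.ofReal_mul (by positivity)]
    congr 1; ring
  rw [hrew]
  have e1 : weightConst n α = weightConst n α / Real.Gamma (n + 1 + α + k) *
      Real.Gamma (n + 1 + α + k) := by field_simp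
  have e2 : Real.Gamma (n + 1 + α) / (Real.pi ^ n * Real.Gamma (n + 1 + α + k)) =
      weightConst n α / Real.Gamma (n + 1 + α + k) * Real.Gamma (α + 1) := by
    unfold weightConst; field_simp
  rw [e2, ENNReal.ofReal_mul (by positivity), mul_assoc, ← h, ← mul_assoc,
    ← ENNReal.ofReal_mul (by positivity), ← e1]

lemma isProbabilityMeasure_weightedMeasure {α : ℝ} (hα : -1 < α) :
    IsProbabilityMeasure (weightedMeasure n α) := by
  have hn : (0 : ℝ) ≤ n := by positivity
  have h2 : 0 < Real.Gamma (n + 1 + α) := Real.Gamma_pos_of_pos (by linarith)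
  refine ⟨?_⟩
  have h := lintegral_weightedMeasure_homogeneous (n := n) (G := fun _ => 1) measurable_const (k := 0) (by simp) hα
  have hg : ∫⁻ w : Cn n, ENNReal.ofReal (Real.exp (-‖w‖ ^ 2)) = ENNReal.ofReal (Real.pi ^ n) := by
    rw [← integral_gaussian, ofReal_integral_eq_lintegral_ofReal]
    · exact Integrable.of_integral_ne_zero (by rw [integral_gaussian]; positivity)
    · exact Filter.Eventually.of_forall fun w => by positivity
  simp only [ENNReal.ofReal_one, lintegral_one, Nat.cast_zero, add_zero, one_mul, hg] at h
  rw [h, ← ENNReal.ofReal_mul (by positivity), ← ENNReal.ofReal_one]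
  congr 1
  field_simp

lemma integral_weightedMeasure_moment {e : Cn n} (he : ‖e‖ = 1) {α : ℝ} (hα : -1 < α) (k : ℕ) :
    ∫ w, ‖inner ℂ e w‖ ^ (2 * k) ∂(weightedMeasure n α) =
      k.factorial * Real.Gamma (n + 1 + α) / Real.Gamma (n + 1 + α + k) := by
  have hn : (0 : ℝ) ≤ n := by positivity
  have hk : (0 : ℝ) ≤ k := by positivity
  have h2 : 0 < Real.Gamma (n + 1 + α) := Real.Gamma_pos_of_pos (by linarith)
  have h3 : 0 < Real.Gamma (n + 1 + α + k) := Real.Gamma_pos_of_pos (by linarith)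
  rw [integral_eq_lintegral_of_nonneg_ae (Filter.Eventually.of_forall fun w => by positivity)
    (Continuous.aestronglyMeasurable (by fun_prop)),
    lintegral_weightedMeasure_homogeneous (k := k) (Continuous.measurable (by fun_prop))
      ?_ hα, lintegral_gaussian_moment he,
    ← ENNReal.ofReal_mul (by positivity), ENNReal.toReal_ofReal (by positivity)]
  · field_simp
  · intro r hr w
    rw [← Complex.coe_smul, inner_smul_right, norm_mul, Complex.norm_real, Real.norm_of_nonneg hr.le, mul_pow]

/-- The reproducing kernel `(1 - z·w)^{-s}`. -/
def bergmanKernel (s : ℝ) (z w : Cn n) : ℂ := (1 - inner ℂ w z) ^ (-s : ℂ)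

lemma ringChoose_eq_Gamma {s : ℝ} (hs : 0 < s) (k : ℕ) :
    Ring.choose ((s : ℂ) + k - 1) k =
      ((Real.Gamma (s + k) / (k.factorial * Real.Gamma s) : ℝ) : ℂ) := by
  have hasc : ∀ k : ℕ, (ascPochhammer ℂ k).eval (s : ℂ) * (Real.Gamma s : ℂ) =
      (Real.Gamma (s + k) : ℂ) := by
    intro k
    induction k with
    | zero => simp
    | succ k ih =>
      rw [ascPochhammer_succ_eval, mul_right_comm, ih]
      have : Real.Gamma (s + (k + 1 : ℕ)) = (s + k) * Real.Gamma (s + k) := by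
        rw [← Real.Gamma_add_one (by positivity)]
        push_cast
        ring_nf
      rw [this]
      push_cast
      ring
  have hΓ : (Real.Gamma s : ℂ) ≠ 0 := by exact_mod_cast (Real.Gamma_pos_of_pos hs).ne'
  have hf : (k.factorial : ℂ) ≠ 0 := by exact_mod_cast k.factorial_ne_zero
  rw [Ring.choose_eq_smul, Polynomial.descPochhammer_smeval_eq_ascPochhammer]
  have : (s : ℂ) + k - 1 - k + 1 = s := by ring
  rw [this, Polynomial.ascPochhammer_smeval_eq_eval]
  push_cast
  rw [← hasc k, smul_eq_mul]
  field_simp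

lemma hasSum_one_sub_cpow {s : ℝ} (hs : 0 < s) {x : ℂ} (hx : ‖x‖ < 1) :
    HasSum (fun k : ℕ => ((Real.Gamma (s + k) / (k.factorial * Real.Gamma s) : ℝ) : ℂ) * x ^ k)
      ((1 - x) ^ (-s : ℂ)) := by
  have h := (Complex.one_div_one_sub_cpow_hasFPowerSeriesOnBall_zero (s : ℂ)).hasSum
    (y := x) (by
      rw [Metric.mem_eball, edist_zero_right, ← ofReal_norm, ENNReal.ofReal_lt_one]
      exact hx)
  rw [zero_add, one_div, ← Complex.cpow_neg] at h
  refine h.congr_fun ?_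
  intro k
  rw [FormalMultilinearSeries.ofScalars_apply_eq, ringChoose_eq_Gamma hs, smul_eq_mul]

lemma norm_inner_lt_one {z w : Cn n} (hz : z ∈ unitBall n) (hw : ‖w‖ ≤ 1) : ‖inner ℂ w z‖ < 1 := by
  refine (norm_inner_le_norm w z).trans_lt ?_
  have h1 := mem_unitBall.1 hz
  calc ‖w‖ * ‖z‖ ≤ 1 * ‖z‖ := by gcongr
    _ < 1 := by linarith

/-- The binomial series of the kernel integrated term by term: since `|m| ≤ 1` almost everywhere, it
is dominated by the convergent series at `t < 1`. -/
lemma hasSum_mul_integral {ν : Measure (Cn n)} {s : ℝ} (hs : 0 < s) {t : ℝ} (ht0 : 0 ≤ t)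
    (ht : t < 1) {g m : Cn n → ℂ} (hg : Integrable g ν) (hm : Measurable m)
    (hm1 : ∀ᵐ w ∂ν, ‖m w‖ ≤ 1) :
    HasSum (fun k : ℕ => ((Real.Gamma (s + k) / (k.factorial * Real.Gamma s) : ℝ) : ℂ) * t ^ k *
        ∫ w, g w * m w ^ k ∂ν)
      (∫ w, g w * (1 - t * m w) ^ (-s : ℂ) ∂ν) := by
  have hsum := hasSum_one_sub_cpow hs (x := (t : ℂ)) (by
    rw [Complex.norm_real, Real.norm_of_nonneg ht0]; exact ht)
  have hnorm := hsum.summable.norm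
  have hmk : ∀ k : ℕ, Integrable (fun w => g w * m w ^ k) ν := fun k =>
    hg.mul_bdd (c := 1) (hm.pow_const k).aestronglyMeasurable (by
      filter_upwards [hm1] with w hw
      rw [norm_pow]; exact pow_le_one₀ (norm_nonneg _) hw)
  have h := hasSum_integral_of_summable_integral_norm (μ := ν)
    (F := fun (k : ℕ) w => ((Real.Gamma (s + k) / (k.factorial * Real.Gamma s) : ℝ) : ℂ) * t ^ k *
      (g w * m w ^ k)) (fun k => (hmk k).const_mul _) ?_
  · simp only [integral_const_mul] at h
    rwa [integral_congr_ae (g := fun w => g w * (1 - t * m w) ^ (-s : ℂ))] at h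
    filter_upwards [hm1] with w hw
    have hx : ‖(t : ℂ) * m w‖ < 1 := by
      rw [norm_mul, Complex.norm_real, Real.norm_of_nonneg ht0]
      nlinarith [norm_nonneg (m w)]
    have := (hasSum_one_sub_cpow hs hx).mul_left (g w)
    rw [← this.tsum_eq]
    refine tsum_congr fun k => ?_
    rw [mul_pow]; ring
  · refine Summable.of_nonneg_of_le (fun k => integral_nonneg fun w => norm_nonneg _) (fun k => ?_)
      (hnorm.mul_right (∫ w, ‖g w‖ ∂ν))
    rw [← integral_const_mul]
    refine integral_mono_ae ((hmk k).const_mul _).norm (hg.norm.const_mul _) ?_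
    filter_upwards [hm1] with w hw
    rw [norm_mul]
    gcongr
    rw [norm_mul, norm_pow]
    exact mul_le_of_le_one_right (norm_nonneg _) (pow_le_one₀ (norm_nonneg _) hw)

lemma exists_unit_smul_eq (hn : 1 ≤ n) (z : Cn n) :
    ∃ e : Cn n, ‖e‖ = 1 ∧ z = (‖z‖ : ℂ) • e := by
  rcases eq_or_ne z 0 with rfl | hz
  · refine ⟨EuclideanSpace.single ⟨0, hn⟩ 1, by simp, by simp⟩
  · have : (‖z‖ : ℂ) ≠ 0 := by exact_mod_cast (norm_ne_zero_iff.2 hz)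
    refine ⟨(‖z‖ : ℂ)⁻¹ • z, ?_, ?_⟩
    · rw [norm_smul, norm_inv, Complex.norm_real, norm_norm, inv_mul_cancel₀ (norm_ne_zero_iff.2 hz)]
    · rw [smul_smul, mul_inv_cancel₀ this, one_smul]

/-- The reproducing formula for integrable holomorphic functions on the ball. -/
theorem integral_mul_bergmanKernel (hn : 1 ≤ n) {α : ℝ} (hα : -1 < α) {h : Cn n → ℂ}
    (hd : DifferentiableOn ℂ h (unitBall n)) (hi : Integrable h (weightedMeasure n α))
    {z : Cn n} (hz : z ∈ unitBall n) :
    ∫ w, h w * bergmanKernel (n + 1 + α) z w ∂(weightedMeasure n α) = h z := by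
  have hprob := isProbabilityMeasure_weightedMeasure (n := n) hα
  set ν := weightedMeasure n α with hν
  set s : ℝ := n + 1 + α with hsdef
  have hn0 : (0 : ℝ) ≤ n := by positivity
  have hs : 0 < s := by rw [hsdef]; linarith
  obtain ⟨e, he, hze⟩ := exists_unit_smul_eq hn z
  set t := ‖z‖ with htdef
  have ht0 : 0 ≤ t := norm_nonneg z
  have ht1 : t < 1 := mem_unitBall.1 hz
  set l : Cn n → ℂ := fun w => inner ℂ e w with hl
  have hlc : Continuous l := by fun_prop
  have hl_le : ∀ w, ‖l w‖ ≤ ‖w‖ := fun w => by simpa [he] using norm_inner_le_norm (𝕜 := ℂ) e w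
  have hm1 : ∀ᵐ w ∂ν, ‖starRingEnd ℂ (l w)‖ ≤ 1 := by
    filter_upwards [ae_mem_unitBall α] with w hw
    rw [RCLike.norm_conj]
    exact (hl_le w).trans (mem_unitBall.1 hw).le
  have hker : ∀ w, bergmanKernel s z w = (1 - t * starRingEnd ℂ (l w)) ^ (-s : ℂ) := by
    intro w
    rw [bergmanKernel]
    nth_rw 1 [hze]
    rw [inner_smul_right, hl, inner_conj_symm]
  -- The slice of `h` along the complex line through `z`. Only its Taylor coefficients survive in
  -- the integral.
  set g : ℂ → ℂ := fun c => h (c • e) with hg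
  have hgd : DifferentiableOn ℂ g (Metric.ball 0 1) := by
    refine hd.comp (by fun_prop) fun c hc => ?_
    rw [mem_unitBall, norm_smul, he, mul_one]
    simpa using hc
  -- Rotating the complement of `e` replaces `h(w)` by `h(l(w) e)`, and scalar rotations then select
  -- the `k`-th Taylor coefficient of `g`. The remaining moment of `|l|` is the reciprocal of the
  -- `k`-th binomial coefficient of the kernel.
  have hcoef : ∀ k : ℕ, ∫ w, h w * starRingEnd ℂ (l w) ^ k ∂ν =
      ((k.factorial : ℂ)⁻¹ * iteratedDeriv k g 0) *
        ((k.factorial * Real.Gamma s / Real.Gamma (s + k) : ℝ) : ℂ) := by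
    intro k
    set h₀ : Cn n → ℂ := (unitBall n).indicator h with hh₀
    have hh₀m : Measurable h₀ := by
      classical
      have := hd.continuousOn.measurable_piecewise (g := fun _ => (0 : ℂ)) continuousOn_const
        (measurableSet_unitBall (n := n))
      rwa [show (fun _ : Cn n => (0 : ℂ)) = 0 from rfl, Set.piecewise_eq_indicator] at this
    have hh₀i : Integrable h₀ ν := hi.indicator measurableSet_unitBall
    have hh₀e : ∀ w ∈ unitBall n, h₀ w = h w := fun w hw => Set.indicator_of_mem hw h
    have hconjm : Measurable fun w => starRingEnd ℂ (l w) ^ k := Continuous.measurable (by fun_prop)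
    have hconjb : ∀ᵐ w ∂ν, ‖starRingEnd ℂ (l w) ^ k‖ ≤ 1 := by
      filter_upwards [hm1] with w hw
      rw [norm_pow]; exact pow_le_one₀ (norm_nonneg _) hw
    set F : Cn n → ℂ := fun w => h₀ w * starRingEnd ℂ (l w) ^ k with hF
    have hFm : StronglyMeasurable F := (hh₀m.mul hconjm).stronglyMeasurable
    have hFi : Integrable F ν := hh₀i.mul_bdd (c := 1) hconjm.aestronglyMeasurable hconjb
    set F₂ : Cn n → ℂ := fun w => h₀ (l w • e) * starRingEnd ℂ (l w) ^ k with hF₂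
    have hF₂m : StronglyMeasurable F₂ := by
      refine ((hh₀m.comp (Continuous.measurable (by fun_prop))).mul hconjm).stronglyMeasurable
    set R : ℝ → Cn n → Cn n := fun θ w => transverseScale e (Complex.exp (θ * Complex.I)) w with hR
    have hRm : Measurable (Function.uncurry R) := by
      refine Continuous.measurable ?_
      simp only [hR, transverseScale]
      unfold Function.uncurry
      fun_prop
    have hRp : ∀ θ, MeasurePreserving (R θ) ν ν := fun θ =>
      weightedMeasure_measurePreserving α
        (transverseRotation e he _ (Complex.norm_exp_ofReal_mul_I θ))
    -- Mean value property of `c ↦ h(transverseScale e c w)` at `c = 0`, where the argument is `l(w)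
    -- e`. A radius `r > 1` with `r |w| < 1` makes this function holomorphic beyond the closed disc.
    have hav1 : ∀ w ∈ unitBall n, ((2 * Real.pi)⁻¹ • ∫ θ in (0 : ℝ)..2 * Real.pi, F (R θ w)) =
        F₂ w := by
      intro w hw
      have hw1 := mem_unitBall.1 hw
      have hlw := hl_le w
      obtain ⟨r, hr1, hr⟩ : ∃ r : ℝ, 1 < r ∧ r * ‖w‖ < 1 := by
        rcases eq_or_ne w 0 with rfl | hw0
        · exact ⟨2, by norm_num, by simp⟩
        · have hwp : 0 < ‖w‖ := norm_pos_iff.2 hw0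
          obtain ⟨r, h1, h2⟩ := exists_between (one_lt_inv_iff₀.2 ⟨hwp, hw1⟩)
          exact ⟨r, h1, (lt_div_iff₀ hwp).1 (by rwa [one_div])⟩
      have hmem : ∀ c ∈ Metric.ball (0 : ℂ) r, transverseScale e c w ∈ unitBall n := by
        intro c hc
        have hc : ‖c‖ < r := by simpa using hc
        rw [mem_unitBall, ← sq_lt_one_iff₀ (norm_nonneg _), norm_transverseScale_sq he]
        have h1 : ‖inner ℂ e w‖ ^ 2 ≤ ‖w‖ ^ 2 := by gcongr
        have h2 : ‖c‖ ^ 2 ≤ r ^ 2 := by gcongr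
        have h3 : (r * ‖w‖) ^ 2 < 1 := by
          rw [sq_lt_one_iff₀ (by positivity)]; exact hr
        have h4 : 1 ≤ r ^ 2 := by nlinarith
        have h5 : 0 ≤ ‖inner ℂ e w‖ ^ 2 := by positivity
        nlinarith [mul_le_mul_of_nonneg_right h2 (sub_nonneg.2 h1)]
      have hdiff : DifferentiableOn ℂ (fun c => h (transverseScale e c w)) (Metric.ball 0 r) := by
        refine hd.comp ?_ hmem
        unfold transverseScale
        fun_prop
      have hcirc := circle_average_of_differentiableOn hr1 hdiff
      have hval : ∀ θ : ℝ, F (R θ w) = h (transverseScale e (Complex.exp (θ * Complex.I)) w) *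
          starRingEnd ℂ (l w) ^ k := by
        intro θ
        have : R θ w ∈ unitBall n := hmem _ (by simpa [Complex.norm_exp_ofReal_mul_I] using hr1)
        simp only [hF]
        rw [hh₀e _ this]
        simp only [hR, hl, inner_transverseScale he]
      simp only [hval, intervalIntegral.integral_mul_const]
      rw [← smul_mul_assoc, hcirc]
      simp only [hF₂]
      rw [hh₀e]
      · simp [transverseScale, hl]
      · rw [mem_unitBall, norm_smul, he, mul_one]
        exact hlw.trans_lt hw1
    have hF₂i : Integrable F₂ ν := by
      refine (integrable_rotation_average hRm hRp hFi hFm).congr ?_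
      filter_upwards [ae_mem_unitBall α] with w hw using hav1 w hw
    have hstep1 : ∫ w, h w * starRingEnd ℂ (l w) ^ k ∂ν = ∫ w, F₂ w ∂ν := by
      calc _ = ∫ w, F w ∂ν := by
            refine integral_congr_ae ?_
            filter_upwards [ae_mem_unitBall α] with w hw
            simp only [hF]
            rw [hh₀e w hw]
        _ = _ := by
            rw [integral_eq_integral_rotation_average hRm hRp hFi hFm]
            refine integral_congr_ae ?_
            filter_upwards [ae_mem_unitBall α] with w hw using hav1 w hw
    have hav2 : ∀ w ∈ unitBall n, ((2 * Real.pi)⁻¹ • ∫ θ in (0 : ℝ)..2 * Real.pi,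
        F₂ (Complex.exp (θ * Complex.I) • w)) =
        ((k.factorial : ℂ)⁻¹ * iteratedDeriv k g 0) * ((‖inner ℂ e w‖ ^ (2 * k) : ℝ) : ℂ) := by
      intro w hw
      have hlw1 : ‖l w‖ < 1 := (hl_le w).trans_lt (mem_unitBall.1 hw)
      have htay : ∀ c : ℂ, ‖c‖ = 1 →
          HasSum (fun j : ℕ => ((j.factorial : ℂ)⁻¹ * iteratedDeriv j g 0 * l w ^ j) * c ^ j)
            (g (c * l w)) := by
        intro c hc
        have := Complex.hasSum_taylorSeries_on_ball hgd (z := c * l w)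
          (by simpa [hc] using hlw1)
        refine this.congr_fun ?_
        intro j
        simp only [sub_zero, smul_eq_mul, mul_pow]
        ring
      have hsummable : Summable fun j : ℕ =>
          ‖(j.factorial : ℂ)⁻¹ * iteratedDeriv j g 0 * l w ^ j‖ := by
        have := (htay 1 (by simp)).summable.norm
        simpa using this
      have hcirc := circleAverage_hasSum_mul_conj_pow hsummable htay k
      have hval : ∀ θ : ℝ, F₂ (Complex.exp (θ * Complex.I) • w) =
          (g (Complex.exp (θ * Complex.I) * l w) * starRingEnd ℂ (Complex.exp (θ * Complex.I)) ^ k) *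
          starRingEnd ℂ (l w) ^ k := by
        intro θ
        have hle : l (Complex.exp (θ * Complex.I) • w) = Complex.exp (θ * Complex.I) * l w := by
          simp only [hl, inner_smul_right]
        simp only [hF₂, hle, map_mul, mul_pow]
        rw [hh₀e]
        · simp only [hg]; ring
        · rw [mem_unitBall, norm_smul, he, mul_one, norm_mul, Complex.norm_exp_ofReal_mul_I, one_mul]
          exact hlw1
      simp only [hval, intervalIntegral.integral_mul_const]
      rw [← smul_mul_assoc, hcirc]
      have h2 : inner ℂ e w ^ k * starRingEnd ℂ (inner ℂ e w) ^ k =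
          ((‖inner ℂ e w‖ ^ (2 * k) : ℝ) : ℂ) := by
        rw [← mul_pow, Complex.mul_conj', pow_mul]; push_cast; rfl
      rw [← h2]
      simp only [hl]
      ring
    rw [hstep1, integral_eq_integral_rotation_average measurable_exp_smul
      (measurePreserving_exp_smul _ (weightedMeasure_measurePreserving α)) hF₂i hF₂m,
      ← integral_weightedMeasure_moment he hα k, ← integral_complex_ofReal, ← integral_const_mul]
    refine integral_congr_ae ?_
    filter_upwards [ae_mem_unitBall α] with w hw using hav2 w hw
  have hser := hasSum_mul_integral (ν := ν) hs ht0 ht1 hi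
    (m := fun w => starRingEnd ℂ (l w)) (Continuous.measurable (by fun_prop)) hm1
  simp only [hker]
  refine hser.unique ?_
  have htay := Complex.hasSum_taylorSeries_on_ball hgd (z := (t : ℂ)) (by
    simpa [abs_of_nonneg ht0] using ht1)
  have hgt : g t = h z := by simp only [hg]; rw [← hze]
  rw [hgt] at htay
  refine htay.congr_fun ?_
  intro k
  rw [hcoef k]
  have hk : (0 : ℝ) ≤ k := by positivity
  have h2 : (Real.Gamma s : ℂ) ≠ 0 := by exact_mod_cast (Real.Gamma_pos_of_pos hs).ne'
  have h3 : (Real.Gamma (s + k) : ℂ) ≠ 0 := by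
    exact_mod_cast (Real.Gamma_pos_of_pos (by linarith : 0 < s + k)).ne'
  have h4 : (k.factorial : ℂ) ≠ 0 := by exact_mod_cast k.factorial_ne_zero
  simp only [sub_zero, smul_eq_mul]
  push_cast
  field_simp

end Reproducing

section Kernel

variable {n : ℕ} {γ : ℝ}

/-! ### Kernel functions and the Bergman projection -/

lemma one_sub_inner_ne_zero {z w : Cn n} (hz : z ∈ unitBall n) (hw : w ∈ unitBall n) :
    1 - inner ℂ w z ≠ 0 := by
  intro h
  have h1 := norm_inner_lt_one hz (mem_unitBall.1 hw).le
  rw [← sub_eq_zero.1 h] at h1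
  simp at h1

lemma norm_one_sub_inner_pos {z w : Cn n} (hz : z ∈ unitBall n) (hw : w ∈ unitBall n) :
    0 < ‖1 - inner ℂ w z‖ := norm_pos_iff.2 (one_sub_inner_ne_zero hz hw)

lemma one_sub_norm_le_norm_one_sub_inner {z w : Cn n} (hw : ‖w‖ ≤ 1) :
    1 - ‖z‖ ≤ ‖1 - inner ℂ w z‖ := by
  have h1 : ‖inner ℂ w z‖ ≤ ‖z‖ := (norm_inner_le_norm w z).trans (mul_le_of_le_one_left (norm_nonneg _) hw)
  have h2 := norm_sub_norm_le (1 : ℂ) (inner ℂ w z)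
  rw [norm_one] at h2
  linarith

lemma norm_one_sub_inner_comm (z w : Cn n) : ‖1 - inner ℂ w z‖ = ‖1 - inner ℂ z w‖ := by
  rw [← inner_conj_symm, ← RCLike.norm_conj]
  simp

lemma one_sub_inner_mem_slitPlane {z w : Cn n} (hz : z ∈ unitBall n) (hw : ‖w‖ ≤ 1) :
    1 - inner ℂ w z ∈ Complex.slitPlane := by
  left
  have h1 := norm_inner_lt_one hz hw
  have h2 := Complex.re_le_norm (inner ℂ w z)
  simp only [Complex.sub_re, Complex.one_re]
  linarith

lemma norm_bergmanKernel (s : ℝ) (z w : Cn n) :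
    ‖bergmanKernel s z w‖ = ‖1 - inner ℂ w z‖ ^ (-s) := by
  rw [bergmanKernel, ← Complex.ofReal_neg, Complex.norm_cpow_real]

lemma conj_bergmanKernel (s : ℝ) {z w : Cn n} (hz : z ∈ unitBall n) (hw : w ∈ unitBall n) :
    starRingEnd ℂ (bergmanKernel s z w) = bergmanKernel s w z := by
  have h := Complex.slitPlane_arg_ne_pi (one_sub_inner_mem_slitPlane hz (mem_unitBall.1 hw).le)
  rw [bergmanKernel, bergmanKernel, ← Complex.ofReal_neg, ← inner_conj_symm z w,
    show 1 - starRingEnd ℂ (inner ℂ w z) = starRingEnd ℂ (1 - inner ℂ w z) by simp,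
    Complex.conj_cpow _ _ h, Complex.conj_ofReal]

lemma differentiableOn_bergmanKernel (s : ℝ) {z : Cn n} (hz : z ∈ unitBall n) :
    DifferentiableOn ℂ (fun w => bergmanKernel s w z) (unitBall n) := by
  intro w hw
  unfold bergmanKernel
  refine DifferentiableAt.differentiableWithinAt ?_
  refine DifferentiableAt.cpow_const (c := (-s : ℂ)) ?_
    (one_sub_inner_mem_slitPlane hw (mem_unitBall.1 hz).le)
  exact (differentiableAt_const _).sub ((innerSL ℂ z).differentiableAt)

lemma norm_bergmanKernel_le {s : ℝ} (hs : 0 ≤ s) {z w : Cn n} (hz : z ∈ unitBall n)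
    (hw : ‖w‖ ≤ 1) : ‖bergmanKernel s w z‖ ≤ (1 - ‖z‖) ^ (-s) := by
  rw [norm_bergmanKernel, norm_one_sub_inner_comm]
  have := mem_unitBall.1 hz
  exact Real.rpow_le_rpow_of_nonpos (by linarith) (one_sub_norm_le_norm_one_sub_inner hw) (by linarith)

lemma measurable_bergmanKernel (s : ℝ) :
    Measurable fun x : Cn n × Cn n => bergmanKernel s x.1 x.2 := by
  unfold bergmanKernel
  refine Measurable.pow_const ?_ _
  exact Continuous.measurable (by fun_prop)

lemma memLp_bergmanKernel (hγ : -1 < γ) {z : Cn n} (hz : z ∈ unitBall n) (p : ℝ≥0∞) :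
    MemLp (fun w => bergmanKernel (n + 1 + γ) w z) p (weightedMeasure n γ) := by
  have := isProbabilityMeasure_weightedMeasure (n := n) hγ
  have hn : (0 : ℝ) ≤ n := by positivity
  refine MemLp.of_bound ((measurable_bergmanKernel _).comp
    measurable_prodMk_right).aestronglyMeasurable ((1 - ‖z‖) ^ (-(n + 1 + γ) : ℝ)) ?_
  filter_upwards [ae_mem_unitBall γ] with w hw
  exact norm_bergmanKernel_le (by linarith) hz (mem_unitBall.1 hw).le

/-- The reproducing kernel at `z` as an element of `L²`. -/
def kerVec (hγ : -1 < γ) {z : Cn n} (hz : z ∈ unitBall n) : L2 n γ :=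
  (memLp_bergmanKernel hγ hz 2).toLp _

lemma coeFn_kerVec (hγ : -1 < γ) {z : Cn n} (hz : z ∈ unitBall n) :
    kerVec hγ hz =ᵐ[weightedMeasure n γ] fun w => bergmanKernel (n + 1 + γ) w z :=
  MemLp.coeFn_toLp _

lemma kerVec_mem (hγ : -1 < γ) {z : Cn n} (hz : z ∈ unitBall n) :
    kerVec hγ hz ∈ bergmanSpace n γ :=
  ⟨_, differentiableOn_bergmanKernel _ hz, coeFn_kerVec hγ hz⟩

lemma inner_kerVec (hγ : -1 < γ) {z : Cn n} (hz : z ∈ unitBall n) (g : L2 n γ) :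
    inner ℂ (kerVec hγ hz) g =
      ∫ w, g w * bergmanKernel (n + 1 + γ) z w ∂(weightedMeasure n γ) := by
  rw [L2.inner_def]
  refine integral_congr_ae ?_
  filter_upwards [coeFn_kerVec hγ hz, ae_mem_unitBall γ] with w hw hwB
  rw [hw, RCLike.inner_apply, conj_bergmanKernel _ hwB hz]

lemma integrable_of_L2 (hγ : -1 < γ) (g : L2 n γ) : Integrable g (weightedMeasure n γ) := by
  have := isProbabilityMeasure_weightedMeasure (n := n) hγ
  exact (Lp.memLp g).integrable (by norm_num)

lemma ae_eq_inner_kerVec_of_mem (hn : 1 ≤ n) (hγ : -1 < γ) {g : L2 n γ}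
    (hg : g ∈ bergmanSpace n γ) :
    ∀ᵐ z ∂(weightedMeasure n γ), ∀ hz : z ∈ unitBall n, g z = inner ℂ (kerVec hγ hz) g := by
  obtain ⟨h, hd, hh⟩ := hg
  filter_upwards [hh] with z hzh hz
  rw [hzh, inner_kerVec, ← integral_mul_bergmanKernel hn hγ hd ((integrable_of_L2 hγ g).congr hh) hz]
  refine integral_congr_ae ?_
  filter_upwards [hh] with w hw
  rw [hw]

/-- Along an approximating sequence a subsequence converges almost everywhere, while the inner
products with each kernel converge. The reproducing property thus holds on the topological closure,
so closedness of the Bergman space is not needed. -/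
lemma ae_eq_inner_kerVec (hn : 1 ≤ n) (hγ : -1 < γ) {g : L2 n γ}
    (hg : g ∈ (bergmanSpace n γ).topologicalClosure) :
    ∀ᵐ z ∂(weightedMeasure n γ), ∀ hz : z ∈ unitBall n, g z = inner ℂ (kerVec hγ hz) g := by
  obtain ⟨u, hu, hlim⟩ := mem_closure_iff_seq_limit.1 hg
  have hmeas := tendstoInMeasure_of_tendsto_Lp hlim
  obtain ⟨ns, hns, hae⟩ := hmeas.exists_seq_tendsto_ae
  have hall : ∀ᵐ z ∂(weightedMeasure n γ), ∀ k, ∀ hz : z ∈ unitBall n,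
      u k z = inner ℂ (kerVec hγ hz) (u k) :=
    ae_all_iff.2 fun k => ae_eq_inner_kerVec_of_mem hn hγ (hu k)
  filter_upwards [hae, hall] with z h1 h2 hz
  refine tendsto_nhds_unique h1 ?_
  simp only [fun k => h2 k hz]
  have h3 : Filter.Tendsto (fun k => u (ns k)) Filter.atTop (nhds g) :=
    hlim.comp hns.tendsto_atTop
  exact (Filter.Tendsto.inner tendsto_const_nhds h3)

lemma bergmanProj_kerVec (hγ : -1 < γ) {z : Cn n} (hz : z ∈ unitBall n) :
    bergmanProj n γ (kerVec hγ hz) = kerVec hγ hz :=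
  Submodule.starProjection_eq_self_iff.2 (Submodule.le_topologicalClosure _ (kerVec_mem hγ hz))

lemma bergmanProj_isSelfAdjoint : IsSelfAdjoint (bergmanProj n γ) :=
  isSelfAdjoint_starProjection _

lemma inner_bergmanProj_left (g h : L2 n γ) :
    inner ℂ (bergmanProj n γ g) h = inner ℂ g (bergmanProj n γ h) :=
  Submodule.inner_starProjection_left_eq_right _ g h

lemma bergmanProj_bergmanProj (g : L2 n γ) :
    bergmanProj n γ (bergmanProj n γ g) = bergmanProj n γ g :=
  Submodule.starProjection_eq_self_iff.2 (Submodule.starProjection_apply_mem _ g)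

/-- The Bergman projection is the integral operator with the reproducing kernel. -/
lemma bergmanProj_ae_eq (hn : 1 ≤ n) (hγ : -1 < γ) (g : L2 n γ) :
    ∀ᵐ z ∂(weightedMeasure n γ), ∀ hz : z ∈ unitBall n,
      bergmanProj n γ g z = inner ℂ (kerVec hγ hz) g := by
  filter_upwards [ae_eq_inner_kerVec hn hγ
    (Submodule.starProjection_apply_mem (bergmanSpace n γ).topologicalClosure g)] with z hz hzB
  rw [← bergmanProj_kerVec hγ hzB, inner_bergmanProj_left]
  exact hz hzB

lemma inner_kerVec_kerVec (hn : 1 ≤ n) (hγ : -1 < γ) {z w : Cn n} (hz : z ∈ unitBall n)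
    (hw : w ∈ unitBall n) :
    inner ℂ (kerVec hγ hz) (kerVec hγ hw) = bergmanKernel (n + 1 + γ) z w := by
  have hprob := isProbabilityMeasure_weightedMeasure (n := n) hγ
  rw [inner_kerVec, ← integral_mul_bergmanKernel hn hγ (differentiableOn_bergmanKernel _ hw)
    ((memLp_bergmanKernel hγ hw 1).integrable le_rfl) hz]
  refine integral_congr_ae ?_
  filter_upwards [coeFn_kerVec hγ hw] with u hu
  rw [hu]

lemma bergmanKernel_self {s : ℝ} {z : Cn n} (hz : z ∈ unitBall n) :
    bergmanKernel s z z = (((1 - ‖z‖ ^ 2) ^ (-s) : ℝ) : ℂ) := by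
  rw [bergmanKernel, inner_self_eq_norm_sq_to_K, Complex.ofReal_cpow (one_sub_norm_sq_pos hz).le]
  push_cast
  rfl

lemma norm_kerVec_sq (hn : 1 ≤ n) (hγ : -1 < γ) {z : Cn n} (hz : z ∈ unitBall n) :
    ‖kerVec hγ hz‖ ^ 2 = (1 - ‖z‖ ^ 2) ^ (-(n + 1 + γ) : ℝ) := by
  have h := inner_kerVec_kerVec hn hγ hz hz
  rw [bergmanKernel_self hz] at h
  rw [← inner_self_eq_norm_sq (𝕜 := ℂ), h]
  exact Complex.ofReal_re _

lemma integral_norm_bergmanKernel_sq (hn : 1 ≤ n) (hγ : -1 < γ) {z : Cn n} (hz : z ∈ unitBall n) :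
    ∫ w, ‖bergmanKernel (n + 1 + γ) w z‖ ^ 2 ∂(weightedMeasure n γ) =
      (1 - ‖z‖ ^ 2) ^ (-(n + 1 + γ) : ℝ) := by
  rw [← norm_kerVec_sq hn hγ hz, ← inner_self_eq_norm_sq (𝕜 := ℂ) (kerVec hγ hz), L2.inner_def,
    ← integral_re (L2.integrable_inner _ _)]
  refine integral_congr_ae ?_
  filter_upwards [coeFn_kerVec hγ hz] with w hw
  rw [inner_self_eq_norm_sq (𝕜 := ℂ), hw]

end Kernel

/-! ### The function `β = 1 - ρ²`, with `ρ` the pseudohyperbolic distance, and its invariant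
integrals. -/

section Beta

variable {n : ℕ}

/-- `β(z, w) = (1 - |z|²)(1 - |w|²) / |1 - z·w|²`. -/
def beta (z w : Cn n) : ℝ := (1 - ‖z‖ ^ 2) * (1 - ‖w‖ ^ 2) / ‖1 - inner ℂ w z‖ ^ 2

lemma beta_comm (z w : Cn n) : beta z w = beta w z := by
  rw [beta, beta, norm_one_sub_inner_comm, mul_comm (1 - ‖z‖ ^ 2)]

lemma beta_pos {z w : Cn n} (hz : z ∈ unitBall n) (hw : w ∈ unitBall n) : 0 < beta z w := by
  have h1 := one_sub_norm_sq_pos hz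
  have h2 := one_sub_norm_sq_pos hw
  have h3 := norm_one_sub_inner_pos hz hw
  unfold beta
  positivity

lemma measurable_beta : Measurable fun x : Cn n × Cn n => beta x.1 x.2 := by
  unfold beta
  refine Measurable.div ?_ ?_ <;> exact Continuous.measurable (by fun_prop)

/-- The total mass of `β(z, ·)^q dτ`. -/
def betaMass (n : ℕ) (q : ℝ) : ℝ := (weightConst n (q - n - 1))⁻¹

lemma betaMass_pos {q : ℝ} (hq : n < q) : 0 < betaMass n q :=
  inv_pos.2 (weightConst_pos (by linarith))

lemma lintegral_invariantMeasure {F : Cn n → ℝ≥0∞} (hF : Measurable F) :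
    ∫⁻ w, F w ∂(invariantMeasure n) =
      ∫⁻ w in unitBall n, ENNReal.ofReal (((1 - ‖w‖ ^ 2) ^ (n + 1))⁻¹) * F w := by
  rw [invariantMeasure, lintegral_withDensity_eq_lintegral_mul _ ?_ hF]
  · rfl
  · exact ENNReal.measurable_ofReal.comp (by fun_prop)

/-- The invariant integral of a power of `β(z, ·)` does not depend on `z`. -/
theorem lintegral_beta_rpow (hn : 1 ≤ n) {q : ℝ} (hq : n < q) {z : Cn n} (hz : z ∈ unitBall n) :
    ∫⁻ w, ENNReal.ofReal (beta z w ^ q) ∂(invariantMeasure n) = ENNReal.ofReal (betaMass n q) := by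
  -- For this weight `n + 1 + α = q`, and `(1 - |w|²)^q dτ` is `dv_α` up to its normalizing
  -- constant. The integral becomes `(1 - |z|²)^q` times the squared norm of the kernel at `z` in
  -- weight `α`.
  set α : ℝ := q - n - 1 with hα
  have hα1 : -1 < α := by rw [hα]; linarith
  have hs : (n : ℝ) + 1 + α = q := by rw [hα]; ring
  have hc := weightConst_pos (n := n) hα1
  have hh := one_sub_norm_sq_pos hz
  have hker_int := integral_norm_bergmanKernel_sq hn hα1 hz
  have hm0 : Measurable fun w : Cn n => ‖bergmanKernel q w z‖ ^ 2 :=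
    ((measurable_bergmanKernel q).comp measurable_prodMk_right).norm.pow_const 2
  rw [hs, integral_eq_lintegral_of_nonneg_ae (Filter.Eventually.of_forall fun w => by positivity)
    hm0.aestronglyMeasurable] at hker_int
  have hfin : ∫⁻ w, ENNReal.ofReal (‖bergmanKernel q w z‖ ^ 2) ∂(weightedMeasure n α) =
      ENNReal.ofReal ((1 - ‖z‖ ^ 2) ^ (-q)) := by
    rw [← hker_int, ENNReal.ofReal_toReal]
    intro htop
    rw [htop] at hker_int
    have : 0 < (1 - ‖z‖ ^ 2) ^ (-q) := Real.rpow_pos_of_pos hh _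
    simp at hker_int
    linarith
  have hm1 : Measurable fun w : Cn n => ENNReal.ofReal (‖bergmanKernel q w z‖ ^ 2) :=
    ENNReal.measurable_ofReal.comp hm0
  have hm2 : Measurable fun w : Cn n => ENNReal.ofReal (beta z w ^ q) :=
    ENNReal.measurable_ofReal.comp ((measurable_beta.comp measurable_prodMk_left).pow_const q)
  rw [lintegral_weightedMeasure α hm1] at hfin
  rw [lintegral_invariantMeasure hm2]
  have hpt : ∀ w ∈ unitBall n, ENNReal.ofReal (((1 - ‖w‖ ^ 2) ^ (n + 1))⁻¹) *
      ENNReal.ofReal (beta z w ^ q) = ENNReal.ofReal ((weightConst n α)⁻¹ * (1 - ‖z‖ ^ 2) ^ q) *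
      (ENNReal.ofReal (weightConst n α * (1 - ‖w‖ ^ 2) ^ α) *
        ENNReal.ofReal (‖bergmanKernel q w z‖ ^ 2)) := by
    intro w hw
    have hw' := one_sub_norm_sq_pos hw
    have hd := norm_one_sub_inner_pos hz hw
    have hb := beta_pos hz hw
    rw [← ENNReal.ofReal_mul (by positivity), ← ENNReal.ofReal_mul (by positivity),
      ← ENNReal.ofReal_mul (by positivity), norm_bergmanKernel, norm_one_sub_inner_comm]
    congr 1
    rw [beta, Real.div_rpow (by positivity) (by positivity), Real.mul_rpow hh.le hw'.le, hα,
      Real.rpow_sub hw', Real.rpow_sub hw', Real.rpow_one, Real.rpow_natCast, Real.rpow_neg hd.le,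
      ← Real.rpow_natCast (‖1 - inner ℂ w z‖) 2, ← Real.rpow_mul hd.le, inv_pow,
      ← Real.rpow_natCast (‖1 - inner ℂ w z‖ ^ q) 2, ← Real.rpow_mul hd.le, pow_succ,
      mul_comm ((2 : ℕ) : ℝ) q]
    rw [hα] at hc
    field_simp
  rw [setLIntegral_congr_fun measurableSet_unitBall hpt,
    lintegral_const_mul' _ _ ENNReal.ofReal_ne_top, hfin, ← ENNReal.ofReal_mul (by positivity),
    Real.rpow_neg hh.le]
  congr 1
  rw [betaMass, ← hα]
  have : (1 - ‖z‖ ^ 2) ^ q ≠ 0 := (Real.rpow_pos_of_pos hh _).ne'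
  field_simp

end Beta

section MeanOscillation

variable {n : ℕ} {γ : ℝ} {f : Cn n → ℂ}

/-! ### The mean oscillation -/

lemma norm_toLp_sq {α : Type*} [MeasurableSpace α] {μ : Measure α} {F : α → ℂ} (hF : MemLp F 2 μ) :
    ‖hF.toLp F‖ ^ 2 = ∫ w, ‖F w‖ ^ 2 ∂μ := by
  rw [← inner_self_eq_norm_sq (𝕜 := ℂ), L2.inner_def, ← integral_re (L2.integrable_inner _ _)]
  refine integral_congr_ae ?_
  filter_upwards [hF.coeFn_toLp] with w hw
  rw [inner_self_eq_norm_sq (𝕜 := ℂ), hw]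

lemma kernelSq_eq (γ : ℝ) (z w : Cn n) :
    kernelSq n γ z w = (1 - ‖z‖ ^ 2) ^ ((n : ℝ) + 1 + γ) * ‖bergmanKernel (n + 1 + γ) w z‖ ^ 2 := by
  rw [kernelSq, norm_bergmanKernel, ← Real.rpow_natCast (‖1 - inner ℂ z w‖ ^ (-((n : ℝ) + 1 + γ))),
    ← Real.rpow_mul (norm_nonneg _), div_eq_mul_inv, ← Real.rpow_neg (norm_nonneg _)]
  congr 2
  push_cast
  ring

lemma memLp_mul_bergmanKernel (hγ : -1 < γ) (hf : MemLp f 2 (weightedMeasure n γ)) {z : Cn n}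
    (hz : z ∈ unitBall n) :
    MemLp (fun w => f w * bergmanKernel (n + 1 + γ) w z) 2 (weightedMeasure n γ) := by
  have hn : (0 : ℝ) ≤ n := by positivity
  refine hf.of_le_mul (c := (1 - ‖z‖) ^ (-(n + 1 + γ) : ℝ)) (hf.1.mul ((measurable_bergmanKernel _).comp
    measurable_prodMk_right).aestronglyMeasurable) ?_
  filter_upwards [ae_mem_unitBall γ] with w hw
  rw [norm_mul, mul_comm]
  exact mul_le_mul_of_nonneg_right (norm_bergmanKernel_le (by linarith) hz (mem_unitBall.1 hw).le)
    (norm_nonneg _)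

/-- The product of `f` with the reproducing kernel at `z`, as an element of `L²`. -/
def mulKer (hγ : -1 < γ) (hf : MemLp f 2 (weightedMeasure n γ)) {z : Cn n} (hz : z ∈ unitBall n) :
    L2 n γ :=
  (memLp_mul_bergmanKernel hγ hf hz).toLp _

lemma coeFn_mulKer (hγ : -1 < γ) (hf : MemLp f 2 (weightedMeasure n γ)) {z : Cn n}
    (hz : z ∈ unitBall n) : mulKer hγ hf hz =ᵐ[weightedMeasure n γ]
      fun w => f w * bergmanKernel (n + 1 + γ) w z := MemLp.coeFn_toLp _

lemma berezin_norm_sq (hγ : -1 < γ) (hf : MemLp f 2 (weightedMeasure n γ)) {z : Cn n}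
    (hz : z ∈ unitBall n) : berezin n γ (fun w => ‖f w‖ ^ 2) z =
      (1 - ‖z‖ ^ 2) ^ ((n : ℝ) + 1 + γ) * ‖mulKer hγ hf hz‖ ^ 2 := by
  rw [mulKer, norm_toLp_sq, berezin, ← integral_const_mul]
  refine integral_congr_ae (Filter.Eventually.of_forall fun w => ?_)
  simp only [kernelSq_eq, smul_eq_mul, norm_mul]
  ring

lemma berezin_eq_inner (hγ : -1 < γ) (hf : MemLp f 2 (weightedMeasure n γ)) {z : Cn n}
    (hz : z ∈ unitBall n) : berezin n γ f z =
      (((1 - ‖z‖ ^ 2) ^ ((n : ℝ) + 1 + γ) : ℝ) : ℂ) * inner ℂ (kerVec hγ hz) (mulKer hγ hf hz) := by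
  rw [L2.inner_def, berezin, ← integral_const_mul]
  refine integral_congr_ae ?_
  filter_upwards [coeFn_kerVec hγ hz, coeFn_mulKer hγ hf hz] with w h1 h2
  rw [h1, h2, RCLike.inner_apply, kernelSq_eq, mul_assoc (f w), Complex.mul_conj', Complex.real_smul]
  push_cast
  ring

/-- Pythagoras for the projection onto `ℂ k`: the distance is minimal at `a = r ⟨k, x⟩`. With `k`
the kernel at `z` and `x = f k`, the minimizer is the Berezin transform and the minimum is `MO²`. -/
lemma norm_sub_smul_sq {H : Type*} [NormedAddCommGroup H] [InnerProductSpace ℂ H] (x k : H)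
    (a : ℂ) (r : ℝ) (hr : r * ‖k‖ ^ 2 = 1) :
    r * ‖x - a • k‖ ^ 2 = r * ‖x‖ ^ 2 - ‖(r : ℂ) * inner ℂ k x‖ ^ 2 + ‖a - r * inner ℂ k x‖ ^ 2 := by
  have h1 : ‖x - a • k‖ ^ 2 = ‖x‖ ^ 2 - 2 * (a * inner ℂ x k).re + ‖a‖ ^ 2 * ‖k‖ ^ 2 := by
    rw [norm_sub_sq (𝕜 := ℂ), inner_smul_right, norm_smul, mul_pow]
    rfl
  have h2 : ‖a - r * inner ℂ k x‖ ^ 2 =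
      ‖a‖ ^ 2 - 2 * (r * (a * inner ℂ x k).re) + ‖(r : ℂ) * inner ℂ k x‖ ^ 2 := by
    rw [norm_sub_sq (𝕜 := ℂ), ← inner_conj_symm x k]
    congr 3
    simp only [RCLike.inner_apply, Complex.mul_re, Complex.conj_re, Complex.conj_im,
      Complex.ofReal_re, Complex.ofReal_im, Complex.mul_im, RCLike.re_to_complex]
    ring
  rw [h1, h2]
  linear_combination (‖a‖ ^ 2) * hr

lemma rpow_mul_norm_kerVec_sq (hn : 1 ≤ n) (hγ : -1 < γ) {z : Cn n} (hz : z ∈ unitBall n) :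
    (1 - ‖z‖ ^ 2) ^ ((n : ℝ) + 1 + γ) * ‖kerVec hγ hz‖ ^ 2 = 1 := by
  have hh := one_sub_norm_sq_pos hz
  rw [norm_kerVec_sq hn, ← Real.rpow_add hh, add_neg_cancel, Real.rpow_zero]

lemma rpow_mul_norm_mulKer_sub_sq (hn : 1 ≤ n) (hγ : -1 < γ) (hf : MemLp f 2 (weightedMeasure n γ))
    {z : Cn n} (hz : z ∈ unitBall n) (a : ℂ) :
    (1 - ‖z‖ ^ 2) ^ ((n : ℝ) + 1 + γ) * ‖mulKer hγ hf hz - a • kerVec hγ hz‖ ^ 2 =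
      berezin n γ (fun w => ‖f w‖ ^ 2) z - ‖berezin n γ f z‖ ^ 2 + ‖a - berezin n γ f z‖ ^ 2 := by
  rw [norm_sub_smul_sq _ _ _ _ (rpow_mul_norm_kerVec_sq hn hγ hz), berezin_norm_sq hγ hf hz,
    berezin_eq_inner hγ hf hz]

/-- The radicand is nonnegative, being a squared distance to the kernel line; otherwise `Real.sqrt`
would truncate it to `0`. -/
lemma meanOsc_sq (hn : 1 ≤ n) (hγ : -1 < γ) (hf : MemLp f 2 (weightedMeasure n γ))
    {z : Cn n} (hz : z ∈ unitBall n) :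
    meanOsc n γ f z ^ 2 = berezin n γ (fun w => ‖f w‖ ^ 2) z - ‖berezin n γ f z‖ ^ 2 := by
  rw [meanOsc, Real.sq_sqrt]
  have h := rpow_mul_norm_mulKer_sub_sq hn hγ hf hz (berezin n γ f z)
  have hh := one_sub_norm_sq_pos hz
  rw [sub_self, norm_zero] at h
  have : 0 ≤ (1 - ‖z‖ ^ 2) ^ ((n : ℝ) + 1 + γ) *
      ‖mulKer hγ hf hz - berezin n γ f z • kerVec hγ hz‖ ^ 2 := by positivity
  linarith

lemma meanOsc_nonneg (γ : ℝ) (f : Cn n → ℂ) (z : Cn n) : 0 ≤ meanOsc n γ f z := Real.sqrt_nonneg _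

/-- The mean oscillation is at most the distance to any constant. -/
lemma meanOsc_sq_le (hn : 1 ≤ n) (hγ : -1 < γ) (hf : MemLp f 2 (weightedMeasure n γ))
    {z : Cn n} (hz : z ∈ unitBall n) (a : ℂ) :
    meanOsc n γ f z ^ 2 ≤
      (1 - ‖z‖ ^ 2) ^ ((n : ℝ) + 1 + γ) * ‖mulKer hγ hf hz - a • kerVec hγ hz‖ ^ 2 := by
  rw [rpow_mul_norm_mulKer_sub_sq hn, meanOsc_sq hn hγ hf hz]
  have : 0 ≤ ‖a - berezin n γ f z‖ ^ 2 := by positivity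
  linarith

lemma norm_sub_bergmanProj_le (g : L2 n γ) : ‖g - bergmanProj n γ g‖ ≤ ‖g‖ := by
  have h := Submodule.norm_sq_eq_add_norm_sq_starProjection g (bergmanSpace n γ).topologicalClosure
  rw [Submodule.starProjection_orthogonal'] at h
  have h2 : ‖g - bergmanProj n γ g‖ ^ 2 ≤ ‖g‖ ^ 2 := by
    rw [h]
    simp [bergmanProj]
  exact (sq_le_sq₀ (norm_nonneg _) (norm_nonneg _)).1 h2

/-- The Hankel operator with symbol `f` on a reproducing kernel is controlled by the mean
oscillation. -/
lemma norm_mulKer_sub_bergmanProj_sq_le (hn : 1 ≤ n) (hγ : -1 < γ)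
    (hf : MemLp f 2 (weightedMeasure n γ)) {z : Cn n} (hz : z ∈ unitBall n) :
    ‖mulKer hγ hf hz - bergmanProj n γ (mulKer hγ hf hz)‖ ^ 2 ≤
      (1 - ‖z‖ ^ 2) ^ (-((n : ℝ) + 1 + γ)) * meanOsc n γ f z ^ 2 := by
  have hh := one_sub_norm_sq_pos hz
  have h := rpow_mul_norm_mulKer_sub_sq hn hγ hf hz (berezin n γ f z)
  rw [sub_self, norm_zero, zero_pow two_ne_zero, add_zero, ← meanOsc_sq hn hγ hf hz] at h
  rw [← h, ← mul_assoc, ← Real.rpow_add hh, neg_add_cancel, Real.rpow_zero, one_mul]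
  -- The projection fixes the kernel, so any multiple of it may be subtracted before applying `1 -
  -- P`; the Berezin transform is the best multiple.
  have h2 : mulKer hγ hf hz - bergmanProj n γ (mulKer hγ hf hz) =
      (mulKer hγ hf hz - berezin n γ f z • kerVec hγ hz) -
        bergmanProj n γ (mulKer hγ hf hz - berezin n γ f z • kerVec hγ hz) := by
    rw [map_sub, map_smul, bergmanProj_kerVec]
    abel
  rw [h2]
  gcongr
  exact norm_sub_bergmanProj_le _

lemma meanOsc_conj (γ : ℝ) (f : Cn n → ℂ) (z : Cn n) :
    meanOsc n γ (fun w => starRingEnd ℂ (f w)) z = meanOsc n γ f z := by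
  have h : berezin n γ (fun w => starRingEnd ℂ (f w)) z = starRingEnd ℂ (berezin n γ f z) := by
    rw [berezin, berezin, ← integral_conj]
    congr 1
    ext w
    simp
  rw [meanOsc, meanOsc, h]
  simp

lemma berezin_congr {F : Type*} [NormedAddCommGroup F] [NormedSpace ℝ F] {f g : Cn n → F}
    (h : f =ᵐ[weightedMeasure n γ] g) : berezin n γ f = berezin n γ g := by
  ext z
  refine integral_congr_ae ?_
  filter_upwards [h] with w hw
  rw [hw]

lemma measurable_kernelSq (γ : ℝ) : Measurable fun x : Cn n × Cn n => kernelSq n γ x.1 x.2 := by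
  unfold kernelSq
  refine Measurable.div ?_ ?_ <;> refine Measurable.pow_const ?_ _ <;>
    exact Continuous.measurable (by fun_prop)

lemma measurable_berezin (hγ : -1 < γ) {F : Type*} [NormedAddCommGroup F] [NormedSpace ℝ F]
    [MeasurableSpace F] [BorelSpace F] {f : Cn n → F}
    (hf : AEStronglyMeasurable f (weightedMeasure n γ)) : Measurable (berezin n γ f) := by
  have := isProbabilityMeasure_weightedMeasure (n := n) hγ
  rw [berezin_congr hf.ae_eq_mk]
  have h : StronglyMeasurable fun x : Cn n × Cn n => kernelSq n γ x.1 x.2 • hf.mk f x.2 :=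
    (measurable_kernelSq γ).stronglyMeasurable.smul
      (hf.stronglyMeasurable_mk.comp_measurable measurable_snd)
  exact (h.integral_prod_right (ν := weightedMeasure n γ)).measurable

lemma measurable_meanOsc (hγ : -1 < γ) (hf : MemLp f 2 (weightedMeasure n γ)) :
    Measurable (meanOsc n γ f) := by
  unfold meanOsc
  exact ((measurable_berezin hγ (hf.1.norm.pow 2)).sub
    ((measurable_berezin hγ hf.1).norm.pow_const 2)).sqrt

end MeanOscillation

section Commutator

variable {n : ℕ} {γ : ℝ} {f : Cn n → ℂ}

/-! ### The commutator -/

lemma mem_commutator_domain {g : L2 n γ} : g ∈ (commutator n γ f).domain ↔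
    MemLp (fun z => f z * bergmanProj n γ g z) 2 (weightedMeasure n γ) ∧
      MemLp (fun z => f z * g z) 2 (weightedMeasure n γ) := Iff.rfl

lemma commutator_apply {g : L2 n γ} (hg : g ∈ (commutator n γ f).domain) :
    commutator n γ f ⟨g, hg⟩ = (mem_commutator_domain.1 hg).1.toLp _ -
      bergmanProj n γ ((mem_commutator_domain.1 hg).2.toLp _) := rfl

lemma inner_toLp_mul (a b : L2 n γ)
    (ha : MemLp (fun z => starRingEnd ℂ (f z) * a z) 2 (weightedMeasure n γ))
    (hb : MemLp (fun z => f z * b z) 2 (weightedMeasure n γ)) :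
    inner ℂ a (hb.toLp _) = inner ℂ (ha.toLp _) b := by
  rw [L2.inner_def, L2.inner_def]
  refine integral_congr_ae ?_
  filter_upwards [ha.coeFn_toLp, hb.coeFn_toLp] with w h1 h2
  rw [h1, h2]
  simp only [RCLike.inner_apply, map_mul, Complex.conj_conj]
  ring

lemma memLp_conj_mul_iff (hf : MemLp f 2 (weightedMeasure n γ)) {g : L2 n γ} :
    MemLp (fun z => starRingEnd ℂ (f z) * g z) 2 (weightedMeasure n γ) ↔
      MemLp (fun z => f z * g z) 2 (weightedMeasure n γ) := by
  refine memLp_congr_norm ?_ ?_ ?_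
  · exact (RCLike.continuous_conj.comp_aestronglyMeasurable hf.1).mul (Lp.aestronglyMeasurable g)
  · exact hf.1.mul (Lp.aestronglyMeasurable g)
  · exact Filter.Eventually.of_forall fun z => by simp

lemma memLp_conj (hf : MemLp f 2 (weightedMeasure n γ)) :
    MemLp (fun z => starRingEnd ℂ (f z)) 2 (weightedMeasure n γ) :=
  (memLp_congr_norm (RCLike.continuous_conj.comp_aestronglyMeasurable hf.1) hf.1
    (Filter.Eventually.of_forall fun z => by simp)).2 hf

lemma memLp_mul_kerVec (hγ : -1 < γ) (hf : MemLp f 2 (weightedMeasure n γ)) {z : Cn n}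
    (hz : z ∈ unitBall n) : MemLp (fun w => f w * kerVec hγ hz w) 2 (weightedMeasure n γ) := by
  refine (memLp_mul_bergmanKernel hγ hf hz).ae_eq ?_
  filter_upwards [coeFn_kerVec hγ hz] with w hw
  rw [hw]

lemma toLp_mul_kerVec (hγ : -1 < γ) (hf : MemLp f 2 (weightedMeasure n γ)) {z : Cn n}
    (hz : z ∈ unitBall n) : (memLp_mul_kerVec hγ hf hz).toLp _ = mulKer hγ hf hz := by
  rw [mulKer, MemLp.toLp_eq_toLp_iff]
  filter_upwards [coeFn_kerVec hγ hz] with w hw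
  rw [hw]

lemma kerVec_mem_domain (hγ : -1 < γ) (hf : MemLp f 2 (weightedMeasure n γ)) {z : Cn n}
    (hz : z ∈ unitBall n) : kerVec hγ hz ∈ (commutator n γ f).domain := by
  rw [mem_commutator_domain, bergmanProj_kerVec]
  exact ⟨memLp_mul_kerVec hγ hf hz, memLp_mul_kerVec hγ hf hz⟩

lemma commutator_kerVec (hγ : -1 < γ) (hf : MemLp f 2 (weightedMeasure n γ)) {z : Cn n}
    (hz : z ∈ unitBall n) : commutator n γ f ⟨kerVec hγ hz, kerVec_mem_domain hγ hf hz⟩ =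
      mulKer hγ hf hz - bergmanProj n γ (mulKer hγ hf hz) := by
  rw [commutator_apply, ← toLp_mul_kerVec]
  congr 1
  rw [MemLp.toLp_eq_toLp_iff, bergmanProj_kerVec]

/-- A function that is bounded and supported in a smaller ball is in the domain of the
commutator. -/
lemma mem_domain_of_bounded (hn : 1 ≤ n) (hγ : -1 < γ) (hf : MemLp f 2 (weightedMeasure n γ))
    {g : L2 n γ} {C r : ℝ} (hC : 0 ≤ C) (hr : r < 1)
    (hg : ∀ᵐ w ∂(weightedMeasure n γ), ‖g w‖ ≤ C ∧ (r < ‖w‖ → g w = 0)) :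
    g ∈ (commutator n γ f).domain := by
  have hprob := isProbabilityMeasure_weightedMeasure (n := n) hγ
  have hn0 : (0 : ℝ) ≤ n := by positivity
  rw [mem_commutator_domain]
  constructor
  · refine hf.of_le_mul (c := C * (1 - r) ^ (-(n + 1 + γ) : ℝ))
      (hf.1.mul (Lp.aestronglyMeasurable _)) ?_
    filter_upwards [bergmanProj_ae_eq hn hγ g, ae_mem_unitBall γ] with z hz hzB
    rw [norm_mul, mul_comm, hz hzB, inner_kerVec]
    refine mul_le_mul_of_nonneg_right ?_ (norm_nonneg _)
    -- On the support `|w| ≤ r` the kernel is bounded by `(1 - r)^(-(n + 1 + γ))` uniformly in `z`,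
    -- so `P g` is bounded and `f P g` stays in `L²`.
    refine (norm_integral_le_of_norm_le_const (C := C * (1 - r) ^ (-(n + 1 + γ) : ℝ)) ?_).trans ?_
    · filter_upwards [hg, ae_mem_unitBall γ] with w hw hwB
      rw [norm_mul]
      by_cases hwr : r < ‖w‖
      · rw [hw.2 hwr, norm_zero, zero_mul]
        have : 0 < 1 - r := by linarith
        positivity
      · refine mul_le_mul hw.1 ?_ (norm_nonneg _) hC
        refine (norm_bergmanKernel_le (by linarith) hwB (mem_unitBall.1 hzB).le).trans ?_
        exact Real.rpow_le_rpow_of_nonpos (by linarith) (by linarith) (by linarith)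
    · simp
  · refine hf.of_le_mul (c := C) (hf.1.mul (Lp.aestronglyMeasurable _)) ?_
    filter_upwards [hg] with w hw
    rw [norm_mul, mul_comm]
    exact mul_le_mul_of_nonneg_right hw.1 (norm_nonneg _)

/-- A vector `x` orthogonal to the domain is tested against its own truncations to `{|x| ≤ k, |w| ≤
1 - 1/(k+1)}`. These lie in the domain and pair with `x` to their own squared norms, so they vanish,
and the truncation sets exhaust the ball. -/
lemma dense_commutator_domain (hn : 1 ≤ n) (hγ : -1 < γ) (hf : MemLp f 2 (weightedMeasure n γ)) :
    Dense ((commutator n γ f).domain : Set (L2 n γ)) := by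
  rw [Submodule.dense_iff_topologicalClosure_eq_top, Submodule.topologicalClosure_eq_top_iff,
    Submodule.eq_bot_iff]
  intro x hx
  obtain ⟨x', hx'm, hxx'⟩ := (Lp.aestronglyMeasurable x)
  let E : ℕ → Set (Cn n) := fun k => {w | ‖x' w‖ ≤ k ∧ ‖w‖ ≤ 1 - 1 / (k + 1 : ℝ)}
  have hE : ∀ k, MeasurableSet (E k) := fun k =>
    (measurableSet_le hx'm.measurable.norm measurable_const).inter
      (measurableSet_le measurable_norm measurable_const)
  have hzero : ∀ k, ∀ᵐ w ∂(weightedMeasure n γ), w ∈ E k → x w = 0 := by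
    intro k
    have hmem : MemLp ((E k).indicator x) 2 (weightedMeasure n γ) := (Lp.memLp x).indicator (hE k)
    have hdom : hmem.toLp _ ∈ (commutator n γ f).domain := by
      refine mem_domain_of_bounded hn hγ hf (C := k) (r := 1 - 1 / (k + 1 : ℝ)) (by positivity)
        (by have : 0 < 1 / (k + 1 : ℝ) := by positivity
            linarith) ?_
      filter_upwards [hmem.coeFn_toLp, hxx'] with w h1 h2
      rw [h1]
      refine ⟨?_, fun hw => Set.indicator_of_notMem (fun hwE => not_le.2 hw hwE.2) _⟩
      by_cases hw : w ∈ E k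
      · rw [Set.indicator_of_mem hw, h2]
        exact hw.1
      · rw [Set.indicator_of_notMem hw, norm_zero]
        positivity
    have h0 := hx _ hdom
    have h1 : inner ℂ (hmem.toLp _) (hmem.toLp _) = (0 : ℂ) := by
      rw [← h0, L2.inner_def, L2.inner_def]
      refine integral_congr_ae ?_
      filter_upwards [hmem.coeFn_toLp] with w h1
      rw [h1]
      by_cases hw : w ∈ E k
      · rw [Set.indicator_of_mem hw]
      · rw [Set.indicator_of_notMem hw, inner_zero_left, inner_zero_left]
    rw [inner_self_eq_zero] at h1
    have h2 := hmem.coeFn_toLp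
    rw [h1] at h2
    filter_upwards [h2, Lp.coeFn_zero ℂ 2 (weightedMeasure n γ)] with w h3 h4 hw
    rw [h4, Set.indicator_of_mem hw] at h3
    exact h3.symm
  rw [Lp.eq_zero_iff_ae_eq_zero]
  filter_upwards [ae_all_iff.2 hzero, ae_mem_unitBall γ] with w hw hwB
  have hw1 : 0 < 1 - ‖w‖ := by have := mem_unitBall.1 hwB; linarith
  obtain ⟨k, hk⟩ := exists_nat_ge (max ‖x' w‖ (1 / (1 - ‖w‖)))
  refine hw k ⟨(le_max_left _ _).trans hk, ?_⟩
  have h2 : 1 / (1 - ‖w‖) ≤ k + 1 := by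
    have := (le_max_right ‖x' w‖ (1 / (1 - ‖w‖))).trans hk
    linarith
  have h3 : 1 / (k + 1 : ℝ) ≤ 1 - ‖w‖ := by
    rw [div_le_comm₀ (by positivity) hw1]
    exact h2
  linarith

end Commutator

section Sufficiency

variable {n : ℕ} {γ : ℝ} {f : Cn n → ℂ}

/-! ### Sufficiency -/

lemma enorm_sq_eq_ofReal {E : Type*} [NormedAddCommGroup E] (x : E) :
    ‖x‖ₑ ^ 2 = ENNReal.ofReal (‖x‖ ^ 2) := by
  rw [← ofReal_norm, ENNReal.ofReal_pow (norm_nonneg _)]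

lemma enorm_sq_eq_lintegral (g : L2 n γ) : ‖g‖ₑ ^ 2 = ∫⁻ z, ‖g z‖ₑ ^ 2 ∂(weightedMeasure n γ) := by
  have h := eLpNorm_nnreal_pow_eq_lintegral (f := g) (μ := weightedMeasure n γ) (p := 2) two_ne_zero
  simp only [NNReal.coe_ofNat, ENNReal.coe_ofNat, ENNReal.rpow_ofNat] at h
  rw [← h, Lp.enorm_def]

/-- The identity `‖K_z‖² dv_γ = c dτ`, through which the invariant measure enters. -/
lemma lintegral_rpow_neg_mul (hγ : -1 < γ) {F : Cn n → ℝ≥0∞} (hF : Measurable F) :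
    ∫⁻ z, ENNReal.ofReal ((1 - ‖z‖ ^ 2) ^ (-((n : ℝ) + 1 + γ))) * F z ∂(weightedMeasure n γ) =
      ENNReal.ofReal (weightConst n γ) * ∫⁻ z, F z ∂(invariantMeasure n) := by
  rw [lintegral_weightedMeasure γ, lintegral_invariantMeasure hF,
    ← lintegral_const_mul' _ _ ENNReal.ofReal_ne_top]
  · refine setLIntegral_congr_fun measurableSet_unitBall fun z hz => ?_
    have hh := one_sub_norm_sq_pos hz
    have hc := weightConst_pos (n := n) hγ
    rw [← mul_assoc, ← mul_assoc, ← ENNReal.ofReal_mul (by positivity),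
      ← ENNReal.ofReal_mul (by positivity), mul_assoc (weightConst n γ), ← Real.rpow_add hh,
      show γ + -((n : ℝ) + 1 + γ) = -((n + 1 : ℕ) : ℝ) by push_cast; ring, Real.rpow_neg hh.le,
      Real.rpow_natCast]
  · refine Measurable.mul (ENNReal.measurable_ofReal.comp (Measurable.pow_const ?_ _)) hF
    fun_prop

/-- Boundedness of the adjoint Hankel operator. -/
lemma enorm_bergmanProj_mul_sub_sq_le (hn : 1 ≤ n) (hγ : -1 < γ)
    (hf : MemLp f 2 (weightedMeasure n γ)) {g : L2 n γ}
    (h1 : MemLp (fun z => f z * bergmanProj n γ g z) 2 (weightedMeasure n γ))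
    (h2 : MemLp (fun z => f z * g z) 2 (weightedMeasure n γ)) :
    ‖bergmanProj n γ (h2.toLp _ - h1.toLp _)‖ₑ ^ 2 ≤ ENNReal.ofReal (weightConst n γ) *
      (∫⁻ z, ENNReal.ofReal (meanOsc n γ f z ^ 2) ∂(invariantMeasure n)) * ‖g‖ₑ ^ 2 := by
  have hm : Measurable fun z => ENNReal.ofReal (meanOsc n γ f z ^ 2) :=
    ENNReal.measurable_ofReal.comp ((measurable_meanOsc hγ hf).pow_const 2)
  rw [enorm_sq_eq_lintegral, ← lintegral_rpow_neg_mul hγ hm,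
    ← lintegral_mul_const' _ _ (by simp)]
  refine lintegral_mono_ae ?_
  filter_upwards [bergmanProj_ae_eq hn hγ (h2.toLp _ - h1.toLp _), ae_mem_unitBall γ] with z hz hzB
  have hh := one_sub_norm_sq_pos hzB
  have hk := memLp_mul_kerVec hγ (memLp_conj hf) hzB
  -- The value at `z` is `⟨K_z, f (g - P g)⟩ = ⟨(1 - P)(conj(f) K_z), g⟩`, and the Hankel bound for
  -- `conj f` applies to the left vector.
  rw [hz hzB, inner_sub_right, inner_toLp_mul _ _ hk h2, inner_toLp_mul _ _ hk h1,
    ← inner_bergmanProj_left, ← inner_sub_left, toLp_mul_kerVec hγ (memLp_conj hf) hzB,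
    ← ENNReal.ofReal_mul (by positivity), enorm_sq_eq_ofReal, enorm_sq_eq_ofReal,
    ← ENNReal.ofReal_mul (by positivity)]
  refine ENNReal.ofReal_le_ofReal ?_
  have h3 := norm_mulKer_sub_bergmanProj_sq_le hn hγ (memLp_conj hf) hzB
  rw [meanOsc_conj] at h3
  refine le_trans ?_ (mul_le_mul_of_nonneg_right h3 (by positivity))
  rw [← mul_pow]
  gcongr
  exact norm_inner_le_norm _ _

lemma norm_le_of_inner_le_of_dense {H : Type*} [NormedAddCommGroup H] [InnerProductSpace ℂ H]
    {D : Set H} (hD : Dense D) {x : H} {C : ℝ} (hC : 0 ≤ C)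
    (h : ∀ u ∈ D, ‖inner ℂ u x‖ ≤ C * ‖u‖) : ‖x‖ ≤ C := by
  have hcl : IsClosed {u : H | ‖inner ℂ u x‖ ≤ C * ‖u‖} :=
    isClosed_le (by fun_prop) (by fun_prop)
  have hx : ‖inner ℂ x x‖ ≤ C * ‖x‖ := closure_minimal h hcl (hD x)
  rw [inner_self_eq_norm_sq_to_K, norm_pow, RCLike.norm_ofReal, abs_norm, pow_two] at hx
  rcases eq_or_ne x 0 with rfl | hx0
  · rwa [norm_zero]
  · exact le_of_mul_le_mul_right hx (norm_pos_iff.2 hx0)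

lemma norm_bergmanProj_mul_sub_le (hn : 1 ≤ n) (hγ : -1 < γ)
    (hf : MemLp f 2 (weightedMeasure n γ))
    (hM : ∫⁻ z, ENNReal.ofReal (meanOsc n γ f z ^ 2) ∂(invariantMeasure n) ≠ ∞) {g : L2 n γ}
    (h1 : MemLp (fun z => f z * bergmanProj n γ g z) 2 (weightedMeasure n γ))
    (h2 : MemLp (fun z => f z * g z) 2 (weightedMeasure n γ)) :
    ‖bergmanProj n γ (h2.toLp _ - h1.toLp _)‖ ≤ √(ENNReal.ofReal (weightConst n γ) *
      (∫⁻ z, ENNReal.ofReal (meanOsc n γ f z ^ 2) ∂(invariantMeasure n))).toReal * ‖g‖ := by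
  have h := enorm_bergmanProj_mul_sub_sq_le hn hγ hf h1 h2
  set K := ENNReal.ofReal (weightConst n γ) *
      (∫⁻ z, ENNReal.ofReal (meanOsc n γ f z ^ 2) ∂(invariantMeasure n)) with hK
  have hKt : K ≠ ∞ := ENNReal.mul_ne_top ENNReal.ofReal_ne_top hM
  rw [enorm_sq_eq_ofReal, enorm_sq_eq_ofReal, ← ENNReal.ofReal_toReal hKt,
    ← ENNReal.ofReal_mul ENNReal.toReal_nonneg, ENNReal.ofReal_le_ofReal_iff (by positivity)] at h
  rw [← sq_le_sq₀ (norm_nonneg _) (by positivity), mul_pow, Real.sq_sqrt ENNReal.toReal_nonneg]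
  exact h

/-- `[M_f, P] = (1 - P) M_f P - P M_f (1 - P)`: a Hankel operator minus the formal adjoint of the
Hankel operator with symbol `conj f`. -/
lemma commutator_eq_sub {g : L2 n γ} (hg : g ∈ (commutator n γ f).domain) :
    commutator n γ f ⟨g, hg⟩ = ((mem_commutator_domain.1 hg).1.toLp _ -
      bergmanProj n γ ((mem_commutator_domain.1 hg).1.toLp _)) -
      bergmanProj n γ ((mem_commutator_domain.1 hg).2.toLp _ -
        (mem_commutator_domain.1 hg).1.toLp _) := by
  rw [commutator_apply, map_sub]
  abel

/-- The summand with values in the Bergman space is estimated pointwise through kernels. The other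
one is its dual for the symbol `conj f`, so it is tested against the dense domain; `MO` is the same
for both symbols. -/
lemma norm_commutator_le (hn : 1 ≤ n) (hγ : -1 < γ) (hf : MemLp f 2 (weightedMeasure n γ))
    (hM : ∫⁻ z, ENNReal.ofReal (meanOsc n γ f z ^ 2) ∂(invariantMeasure n) ≠ ∞) {g : L2 n γ}
    (hg : g ∈ (commutator n γ f).domain) :
    ‖commutator n γ f ⟨g, hg⟩‖ ≤ 2 * √(ENNReal.ofReal (weightConst n γ) *
      (∫⁻ z, ENNReal.ofReal (meanOsc n γ f z ^ 2) ∂(invariantMeasure n))).toReal * ‖g‖ := by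
  rw [commutator_eq_sub]
  have hb := norm_bergmanProj_mul_sub_le hn hγ hf hM (mem_commutator_domain.1 hg).1
    (mem_commutator_domain.1 hg).2
  set C := √(ENNReal.ofReal (weightConst n γ) *
      (∫⁻ z, ENNReal.ofReal (meanOsc n γ f z ^ 2) ∂(invariantMeasure n))).toReal with hC
  have hC0 : 0 ≤ C := Real.sqrt_nonneg _
  refine (norm_sub_le _ _).trans ?_
  suffices h : ‖(mem_commutator_domain.1 hg).1.toLp _ -
      bergmanProj n γ ((mem_commutator_domain.1 hg).1.toLp _)‖ ≤ C * ‖g‖ by linarith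
  refine norm_le_of_inner_le_of_dense (dense_commutator_domain hn hγ hf) (by positivity) ?_
  intro u hu
  obtain ⟨hu1, hu2⟩ := mem_commutator_domain.1 hu
  have hu1' := (memLp_conj_mul_iff hf).2 hu1
  have hu2' := (memLp_conj_mul_iff hf).2 hu2
  have hbu := norm_bergmanProj_mul_sub_le hn hγ (memLp_conj hf) (by simpa only [meanOsc_conj] using hM)
    hu1' hu2'
  simp only [meanOsc_conj] at hbu
  rw [← hC] at hbu
  have hid : inner ℂ u ((mem_commutator_domain.1 hg).1.toLp _ -
      bergmanProj n γ ((mem_commutator_domain.1 hg).1.toLp _)) =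
      inner ℂ (bergmanProj n γ (hu2'.toLp _ - hu1'.toLp _)) g := by
    rw [inner_bergmanProj_left, inner_sub_right, ← inner_bergmanProj_left u, inner_sub_left,
      inner_toLp_mul _ _ hu1', inner_toLp_mul _ _ hu2']
  rw [hid]
  calc _ ≤ _ := norm_inner_le_norm _ _
    _ ≤ C * ‖u‖ * ‖g‖ := by gcongr
    _ = C * ‖g‖ * ‖u‖ := by ring

lemma _root_.LinearPMap.exists_continuousLinearMap_extension {H : Type*} [NormedAddCommGroup H]
    [InnerProductSpace ℂ H] [CompleteSpace H] (A : H →ₗ.[ℂ] H) (hD : Dense (A.domain : Set H)) {C : ℝ}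
    (hC : ∀ x : A.domain, ‖A x‖ ≤ C * ‖(x : H)‖) :
    ∃ T : H →L[ℂ] H, ∀ x : A.domain, T (x : H) = A x := by
  refine ⟨A.toFun.extendOfNorm A.domain.subtype, fun x => ?_⟩
  refine LinearMap.extendOfNorm_eq (e := A.domain.subtype) ?_ ⟨C, hC⟩ x
  rw [DenseRange]
  convert hD
  simp

/-- A fractional power of `X* X` is the square of a self-adjoint operator that is controlled
by `X`. -/
lemma exists_isSelfAdjoint_powTrace_eq {H : Type*} [NormedAddCommGroup H]
    [InnerProductSpace ℂ H] [CompleteSpace H] (X : H →L[ℂ] H) {q : ℝ} (hq : 0 < q) (hq1 : q ≤ 1) :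
    ∃ B : H →L[ℂ] H, IsSelfAdjoint B ∧ powTrace q (star X * X) = hsSq B ∧
      ∀ x, ‖B x‖ ^ 2 ≤ (‖X x‖ ^ 2) ^ q * (‖x‖ ^ 2) ^ (1 - q) := by
  have hA0 : 0 ≤ star X * X := star_mul_self_nonneg X
  refine ⟨cfc (fun t : ℝ => t ^ (q / 2)) (star X * X), cfc_predicate _ _, rfl, fun x => ?_⟩
  rw [norm_cfc_rpow_half_sq hq hA0, ← re_inner_star_mul_self X x]
  exact re_inner_cfc_rpow_le hA0 hq hq1 x

lemma exists_bounded_extension (hn : 1 ≤ n) (hγ : -1 < γ) (hf : MemLp f 2 (weightedMeasure n γ))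
    (hM : ∫⁻ z, ENNReal.ofReal (meanOsc n γ f z ^ 2) ∂(invariantMeasure n) ≠ ∞) :
    ∃ T : L2 n γ →L[ℂ] L2 n γ, ∀ x : (commutator n γ f).domain, T (x : L2 n γ) = commutator n γ f x := by
  exact (commutator n γ f).exists_continuousLinearMap_extension (dense_commutator_domain hn hγ hf)
    fun x => norm_commutator_le hn hγ hf hM x.2

variable {T : L2 n γ →L[ℂ] L2 n γ}

lemma extension_kerVec (hγ : -1 < γ) (hf : MemLp f 2 (weightedMeasure n γ))
    (hT : ∀ x : (commutator n γ f).domain, T (x : L2 n γ) = commutator n γ f x) {z : Cn n}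
    (hz : z ∈ unitBall n) :
    T (kerVec hγ hz) = mulKer hγ hf hz - bergmanProj n γ (mulKer hγ hf hz) := by
  rw [← commutator_kerVec, ← hT]

/-- The formal adjoint of `[M_f, P]` is `-[M_(conj f), P]`. Equality of the vectors is tested on the
dense domain of the commutator. -/
lemma star_extension_kerVec (hn : 1 ≤ n) (hγ : -1 < γ) (hf : MemLp f 2 (weightedMeasure n γ))
    (hT : ∀ x : (commutator n γ f).domain, T (x : L2 n γ) = commutator n γ f x) {z : Cn n}
    (hz : z ∈ unitBall n) :
    star T (kerVec hγ hz) =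
      -(mulKer hγ (memLp_conj hf) hz - bergmanProj n γ (mulKer hγ (memLp_conj hf) hz)) := by
  refine (dense_commutator_domain hn hγ hf).eq_of_inner_left (𝕜 := ℂ) fun g hg => ?_
  have hk := memLp_mul_kerVec hγ (memLp_conj hf) hz
  rw [ContinuousLinearMap.star_eq_adjoint, ContinuousLinearMap.adjoint_inner_left, hT ⟨g, hg⟩,
    commutator_apply, inner_sub_right, ← inner_bergmanProj_left, bergmanProj_kerVec,
    inner_toLp_mul _ _ hk, inner_toLp_mul _ _ hk, toLp_mul_kerVec hγ (memLp_conj hf),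
    inner_neg_left, inner_sub_left, inner_bergmanProj_left]
  ring

/-- A commutator with a projection is off-diagonal for the splitting into its range and kernel. Both
sides are continuous, so the identity is checked on the domain, which `P` preserves. -/
lemma extension_eq_add (hn : 1 ≤ n) (hγ : -1 < γ) (hf : MemLp f 2 (weightedMeasure n γ))
    (hT : ∀ x : (commutator n γ f).domain, T (x : L2 n γ) = commutator n γ f x) :
    T = T * bergmanProj n γ + bergmanProj n γ * T := by
  refine DFunLike.coe_injective (Continuous.ext_on (dense_commutator_domain hn hγ hf) T.continuous
    (T * bergmanProj n γ + bergmanProj n γ * T).continuous fun g hg => ?_)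
  obtain ⟨h1, h2⟩ := mem_commutator_domain.1 hg
  have hP : bergmanProj n γ g ∈ (commutator n γ f).domain := by
    rw [mem_commutator_domain, bergmanProj_bergmanProj]
    exact ⟨h1, h1⟩
  have e1 : T g = h1.toLp _ - bergmanProj n γ (h2.toLp _) := hT ⟨g, hg⟩
  have e2 : T (bergmanProj n γ g) = h1.toLp _ - bergmanProj n γ (h1.toLp _) := by
    rw [hT ⟨_, hP⟩, commutator_apply]
    congr 1
    rw [MemLp.toLp_eq_toLp_iff, bergmanProj_bergmanProj]
  simp only [add_apply, mul_apply_eq_comp]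
  rw [e1, e2, map_sub, bergmanProj_bergmanProj]
  abel

/-- The Schatten quasinorm of an operator on the Bergman space is controlled by its values on the
reproducing kernels. -/
lemma powTrace_mul_bergmanProj_le (hn : 1 ≤ n) (hγ : -1 < γ) {p : ℝ} (hp : 0 < p) (hp2 : p ≤ 2)
    (R : L2 n γ →L[ℂ] L2 n γ) {M : Cn n → ℝ} (hM0 : ∀ z, 0 ≤ M z) (hMm : Measurable M)
    (hR : ∀ z (hz : z ∈ unitBall n), ‖R (kerVec hγ hz)‖ ^ 2 ≤
      (1 - ‖z‖ ^ 2) ^ (-((n : ℝ) + 1 + γ)) * M z ^ 2) :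
    powTrace (p / 2) (star (R * bergmanProj n γ) * (R * bergmanProj n γ)) ≤
      ENNReal.ofReal (weightConst n γ) * ∫⁻ z, ENNReal.ofReal (M z ^ p) ∂(invariantMeasure n) := by
  set X := R * bergmanProj n γ with hX
  have hq : 0 < p / 2 := by positivity
  -- `B` plays the role of `|X|^(p/2)`. By Jensen it vanishes wherever `X` does, in particular on
  -- the range of `1 - P`. Taking adjoints gives `P B = B`, so every `B (b i)` is reproduced by the
  -- kernels.
  obtain ⟨B, hBs, hBX, hBx⟩ := exists_isSelfAdjoint_powTrace_eq X hq (by linarith)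
  have hBP : ∀ x, B (bergmanProj n γ x) = B x := by
    intro x
    have h1 := hBx (x - bergmanProj n γ x)
    have h2 : X (x - bergmanProj n γ x) = 0 := by
      rw [hX, mul_apply_eq_comp, map_sub, bergmanProj_bergmanProj, sub_self, map_zero]
    rw [h2, norm_zero, zero_pow two_ne_zero, Real.zero_rpow hq.ne', zero_mul] at h1
    have h3 : B (x - bergmanProj n γ x) = 0 := by
      rw [← norm_eq_zero]
      exact pow_eq_zero_iff two_ne_zero |>.1 (le_antisymm h1 (by positivity))
    rw [map_sub, sub_eq_zero] at h3
    exact h3.symm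
  have hBin : ∀ x y, inner ℂ (B x) y = inner ℂ x (B y) := fun x y => by
    conv_rhs => rw [← hBs.star_eq, ContinuousLinearMap.star_eq_adjoint,
      ContinuousLinearMap.adjoint_inner_right]
  have hPB : ∀ x, bergmanProj n γ (B x) = B x := by
    intro x
    refine ext_inner_left ℂ fun v => ?_
    rw [← inner_bergmanProj_left, ← hBin, hBP, hBin]
  obtain ⟨w, b, -⟩ := exists_hilbertBasis ℂ (L2 n γ)
  rw [hBX, hsSq_eq_tsum b, ENNReal.tsum_eq_iSup_sum]
  refine iSup_le fun F => ?_
  have hMm' : Measurable fun z => ENNReal.ofReal (M z ^ p) :=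
    ENNReal.measurable_ofReal.comp (hMm.pow_const p)
  rw [← lintegral_rpow_neg_mul hγ hMm']
  have hsum : ∑ i ∈ F, ‖B (b i)‖ₑ ^ 2 =
      ∫⁻ z, ∑ i ∈ F, ‖(B (b i) : L2 n γ) z‖ₑ ^ 2 ∂(weightedMeasure n γ) := by
    rw [lintegral_finsetSum' _ fun i _ => (Lp.aestronglyMeasurable _).enorm.pow_const 2]
    exact Finset.sum_congr rfl fun i _ => enorm_sq_eq_lintegral _
  rw [hsum]
  refine lintegral_mono_ae ?_
  have hall : ∀ᵐ z ∂(weightedMeasure n γ), ∀ i ∈ F, ∀ hz : z ∈ unitBall n,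
      (B (b i) : L2 n γ) z = inner ℂ (kerVec hγ hz) (B (b i)) := by
    refine (Filter.eventually_all_finset F).2 fun i _ => ?_
    have := bergmanProj_ae_eq hn hγ (B (b i))
    rwa [hPB] at this
  filter_upwards [hall, ae_mem_unitBall γ] with z hz hzB
  have hh := one_sub_norm_sq_pos hzB
  -- The values at `z` are coefficients of `B K_z` in the basis, so Bessel bounds the sum by `‖B
  -- K_z‖²`, and Jensen bounds that by a power of `‖R K_z‖`.
  have h1 : ∑ i ∈ F, ‖(B (b i) : L2 n γ) z‖ₑ ^ 2 =
      ENNReal.ofReal (∑ i ∈ F, ‖inner ℂ (b i) (B (kerVec hγ hzB))‖ ^ 2) := by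
    rw [ENNReal.ofReal_sum_of_nonneg fun i _ => by positivity]
    refine Finset.sum_congr rfl fun i hi => ?_
    rw [hz i hi hzB, ← hBin, enorm_sq_eq_ofReal, norm_inner_symm]
  rw [h1, ← ENNReal.ofReal_mul (by positivity)]
  refine ENNReal.ofReal_le_ofReal ((b.orthonormal.sum_inner_products_le (B (kerVec hγ hzB))).trans ?_)
  refine (hBx _).trans ?_
  have h2 : X (kerVec hγ hzB) = R (kerVec hγ hzB) := by
    rw [hX, mul_apply_eq_comp, bergmanProj_kerVec]
  rw [h2, norm_kerVec_sq hn]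
  set d := (1 - ‖z‖ ^ 2) ^ (-((n : ℝ) + 1 + γ)) with hd
  have hd0 : 0 < d := Real.rpow_pos_of_pos hh _
  calc (‖R (kerVec hγ hzB)‖ ^ 2) ^ (p / 2) * d ^ (1 - p / 2)
      ≤ (d * M z ^ 2) ^ (p / 2) * d ^ (1 - p / 2) := by
        gcongr
        exact hR z hzB
    _ = d ^ (p / 2) * d ^ (1 - p / 2) * (M z ^ 2) ^ (p / 2) := by
        rw [Real.mul_rpow hd0.le (by positivity)]
        ring
    _ = d * M z ^ p := by
        rw [← Real.rpow_add hd0, ← Real.rpow_natCast, ← Real.rpow_mul (hM0 z)]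
        norm_num
        left
        congr 1
        ring

/-- If the mean oscillation is bounded and `p`-integrable, the commutator is in `S_p`. -/
theorem pMapIsSchatten_of_memLp (hn : 1 ≤ n) (hγ : -1 < γ) {p : ℝ} (hp : 0 < p) (hp1 : p < 1)
    (hf : MemBMO n γ f)
    (hM : MemLp (meanOsc n γ f) (ENNReal.ofReal p) (invariantMeasure n)) :
    PMapIsSchatten p (commutator n γ f) := by
  obtain ⟨hf2, C, hC⟩ := hf
  have hMp : ∫⁻ z, ENNReal.ofReal (meanOsc n γ f z ^ p) ∂(invariantMeasure n) ≠ ∞ := by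
    have h := lintegral_rpow_enorm_lt_top_of_eLpNorm_lt_top (by simpa using hp) ENNReal.ofReal_ne_top hM.2
    rw [ENNReal.toReal_ofReal hp.le] at h
    refine (lt_of_eq_of_lt (lintegral_congr fun z => ?_) h).ne
    rw [← ENNReal.ofReal_rpow_of_nonneg (meanOsc_nonneg _ _ _) hp.le,
      Real.enorm_eq_ofReal (meanOsc_nonneg _ _ _)]
  -- Here the boundedness of `MO` enters: `MO² ≤ C^(2-p) MO^p`. The square integral bounds the
  -- operator norm.
  have hM2 : ∫⁻ z, ENNReal.ofReal (meanOsc n γ f z ^ 2) ∂(invariantMeasure n) ≠ ∞ := by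
    have hae : ∀ᵐ z ∂(invariantMeasure n), z ∈ unitBall n :=
      (withDensity_absolutelyContinuous _ _).ae_le (ae_restrict_mem measurableSet_unitBall)
    refine ne_top_of_le_ne_top (b := ENNReal.ofReal (C ^ (2 - p)) *
      ∫⁻ z, ENNReal.ofReal (meanOsc n γ f z ^ p) ∂(invariantMeasure n))
      (ENNReal.mul_ne_top ENNReal.ofReal_ne_top hMp) ?_
    rw [← lintegral_const_mul' _ _ ENNReal.ofReal_ne_top]
    refine lintegral_mono_ae ?_
    filter_upwards [hae] with z hz
    have h0 := meanOsc_nonneg γ f z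
    have hC0 : 0 ≤ C := h0.trans (hC z hz)
    rw [← ENNReal.ofReal_mul (by positivity)]
    refine ENNReal.ofReal_le_ofReal ?_
    calc meanOsc n γ f z ^ 2 = meanOsc n γ f z ^ (2 - p) * meanOsc n γ f z ^ p := by
          rw [← Real.rpow_add_of_nonneg h0 (by linarith) hp.le, ← Real.rpow_natCast]
          congr 1
          push_cast
          ring
      _ ≤ _ := by
          gcongr
          · linarith
          · exact hC z hz
  obtain ⟨T, hT⟩ := exists_bounded_extension hn hγ hf2 hM2
  refine ⟨dense_commutator_domain hn hγ hf2, T, hT, ?_⟩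
  rw [isSchatten_iff_powTrace hp]
  have hb : ∀ R : L2 n γ →L[ℂ] L2 n γ, (∀ z (hz : z ∈ unitBall n), ‖R (kerVec hγ hz)‖ ^ 2 ≤
      (1 - ‖z‖ ^ 2) ^ (-((n : ℝ) + 1 + γ)) * meanOsc n γ f z ^ 2) →
      powTrace (p / 2) (star (R * bergmanProj n γ) * (R * bergmanProj n γ)) < ∞ := fun R hR =>
    (powTrace_mul_bergmanProj_le hn hγ hp (by linarith) R (meanOsc_nonneg _ _)
      (measurable_meanOsc hγ hf2) hR).trans_lt
      (ENNReal.mul_lt_top ENNReal.ofReal_lt_top hMp.lt_top)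
  have h1 := hb T fun z hz => by
    rw [extension_kerVec hγ hf2 hT hz]
    exact norm_mulKer_sub_bergmanProj_sq_le hn hγ hf2 hz
  have h2 := hb (star T) fun z hz => by
    rw [star_extension_kerVec hn hγ hf2 hT hz, norm_neg, ← meanOsc_conj]
    exact norm_mulKer_sub_bergmanProj_sq_le hn hγ (memLp_conj hf2) hz
  -- For `X = P T` one has `X X* = (T* P)* (T* P)`, so the left piece reduces to the estimate of `T*
  -- P`.
  have h3 : powTrace (p / 2) (star (bergmanProj n γ * T) * (bergmanProj n γ * T)) < ∞ := by
    refine (powTrace_star_mul_self_le (by positivity) (by linarith) _).trans_lt ?_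
    rw [star_mul, bergmanProj_isSelfAdjoint.star_eq]
    rw [star_mul, star_star, bergmanProj_isSelfAdjoint.star_eq] at h2
    exact h2
  rw [extension_eq_add hn hγ hf2 hT]
  refine (powTrace_star_mul_self_add_le (by positivity) (by linarith) _ _).trans_lt ?_
  exact ENNReal.mul_lt_top ENNReal.ofReal_lt_top (ENNReal.add_lt_top.2 ⟨h1, h3⟩)

end Sufficiency

section Geometry

variable {n : ℕ}

/-! ### The pseudohyperbolic geometry of the ball -/

/-- The left side is `(1 - β)|1 - z·a|²`. The right side is a sum of squares, so `β ≤ 1`, and `β`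
near `1` forces nonisotropic closeness: `z - a` is small of order `1 - |a|²` along `a` and of order
`(1 - |a|²)^(1/2)` across it. -/
lemma norm_one_sub_inner_sq_sub (a z : Cn n) :
    ‖1 - inner ℂ a z‖ ^ 2 - (1 - ‖a‖ ^ 2) * (1 - ‖z‖ ^ 2) =
      (1 - ‖a‖ ^ 2) * ‖z - a‖ ^ 2 + ‖inner ℂ a (z - a)‖ ^ 2 := by
  obtain ⟨x, rfl⟩ : ∃ x, z = a + x := ⟨z - a, by abel⟩
  rw [add_sub_cancel_left, inner_add_right, inner_self_eq_norm_sq_to_K, norm_add_sq (𝕜 := ℂ)]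
  generalize inner ℂ a x = t
  rw [← Complex.normSq_eq_norm_sq, ← Complex.normSq_eq_norm_sq, Complex.normSq_apply,
    Complex.normSq_apply]
  simp only [← Complex.ofReal_pow, Complex.sub_re, Complex.add_re, Complex.one_re, Complex.sub_im,
    Complex.add_im, Complex.one_im, Complex.coe_algebraMap, Complex.ofReal_re, Complex.ofReal_im,
    RCLike.re_to_complex]
  ring

lemma beta_le_one {a z : Cn n} (ha : a ∈ unitBall n) (hz : z ∈ unitBall n) : beta a z ≤ 1 := by
  have h := norm_one_sub_inner_sq_sub a z
  have h1 := one_sub_norm_sq_pos ha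
  have h2 := norm_one_sub_inner_pos hz ha
  rw [beta, norm_one_sub_inner_comm, div_le_one (by positivity)]
  have : 0 ≤ (1 - ‖a‖ ^ 2) * ‖z - a‖ ^ 2 + ‖inner ℂ a (z - a)‖ ^ 2 := by positivity
  linarith

lemma beta_self {a : Cn n} (ha : a ∈ unitBall n) : beta a a = 1 := by
  have h1 := one_sub_norm_sq_pos ha
  have h : ‖(1 : ℂ) - inner ℂ a a‖ = 1 - ‖a‖ ^ 2 := by
    rw [inner_self_eq_norm_sq_to_K]
    simp only [Complex.coe_algebraMap, ← Complex.ofReal_pow, ← Complex.ofReal_one,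
      ← Complex.ofReal_sub, Complex.norm_real, Real.norm_of_nonneg h1.le]
  rw [beta, h, ← pow_two]
  exact div_self (by positivity)

lemma one_sub_norm_sq_le {a w : Cn n} (ha : a ∈ unitBall n) (hw : ‖w‖ ≤ 1) :
    1 - ‖a‖ ^ 2 ≤ 2 * ‖1 - inner ℂ a w‖ := by
  rw [norm_one_sub_inner_comm]
  have h1 := one_sub_norm_le_norm_one_sub_inner (z := a) hw
  have h2 := mem_unitBall.1 ha
  have h3 := norm_nonneg a
  nlinarith

/-- If `β(a, z) ≥ 1 - r²`, then `z` lies in a small nonisotropic ball around `a`. -/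
lemma near_bounds {a z : Cn n} (ha : a ∈ unitBall n) (hz : z ∈ unitBall n) {r : ℝ} (hr : 0 ≤ r)
    (hr2 : r ≤ 1 / 2) (h : 1 - r ^ 2 ≤ beta a z) :
    ‖inner ℂ a (z - a)‖ ≤ 2 * r * (1 - ‖a‖ ^ 2) ∧ ‖z - a‖ ^ 2 ≤ (2 * r) ^ 2 * (1 - ‖a‖ ^ 2) ∧
      ‖1 - inner ℂ a z‖ ≤ 2 * (1 - ‖a‖ ^ 2) ∧
      (1 - 2 * r) * (1 - ‖a‖ ^ 2) ≤ ‖1 - inner ℂ a z‖ := by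
  have hid := norm_one_sub_inner_sq_sub a z
  have h1 := one_sub_norm_sq_pos ha
  have h2 := norm_one_sub_inner_pos hz ha
  rw [beta, norm_one_sub_inner_comm, le_div_iff₀ (by positivity)] at h
  set D := ‖1 - inner ℂ a z‖ with hD
  set t := ‖inner ℂ a (z - a)‖ with ht
  set e := 1 - ‖a‖ ^ 2 with he
  have ht0 : 0 ≤ t := norm_nonneg _
  have hsplit : (1 : ℂ) - inner ℂ a z = (e : ℂ) - inner ℂ a (z - a) := by
    rw [inner_sub_right, inner_self_eq_norm_sq_to_K, he]
    push_cast
    simp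
  have hne : ‖(e : ℂ)‖ = e := by rw [Complex.norm_real, Real.norm_of_nonneg h1.le]
  have hDle : D ≤ e + t := by
    rw [hD, hsplit, ht]
    calc _ ≤ _ := norm_sub_le _ _
      _ = _ := by rw [hne]
  have hDge : e - t ≤ D := by
    rw [hD, hsplit, ht]
    calc _ = _ := by rw [hne]
      _ ≤ _ := norm_sub_norm_le _ _
  -- The identity together with `1 - β ≤ r²`. It yields `t ≤ r D`, and then `D ≤ e + t ≤ e + D/2`
  -- gives `D ≤ 2 e`.
  have hN : e * ‖z - a‖ ^ 2 + t ^ 2 ≤ (r * D) ^ 2 := by nlinarith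
  have htr : t ≤ r * D := by
    refine abs_le_of_sq_le_sq' ?_ (by positivity) |>.2
    have : 0 ≤ e * ‖z - a‖ ^ 2 := by positivity
    linarith
  have ht2 : t ≤ 2 * r * e := by nlinarith
  have hD2 : D ≤ 2 * e := by nlinarith
  refine ⟨ht2, ?_, hD2, by linarith⟩
  have h3 : (r * D) ^ 2 ≤ (r * (2 * e)) ^ 2 := by gcongr
  have h4 : e * ‖z - a‖ ^ 2 ≤ e * ((2 * r) ^ 2 * e) := by nlinarith
  exact le_of_mul_le_mul_left h4 h1

/-- Subtract from `w` its component `⟨a, w⟩ a`. Across `a` both factors are of square-root size,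
`(2d)^(1/2)` and `2 r (1 - |a|²)^(1/2)` with `1 - |a|² ≤ 2d`; along `a` the first bound of
`near_bounds` suffices. Each part contributes `4 r d`. -/
lemma norm_inner_sub_le {a z w : Cn n} (ha : a ∈ unitBall n) (hz : z ∈ unitBall n) (hw : ‖w‖ ≤ 1)
    {r : ℝ} (hr : 0 ≤ r) (hr2 : r ≤ 1 / 2) (h : 1 - r ^ 2 ≤ beta a z) :
    ‖inner ℂ w (z - a)‖ ≤ 8 * r * ‖1 - inner ℂ a w‖ := by
  obtain ⟨h1, h2, -, -⟩ := near_bounds ha hz hr hr2 h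
  have he := one_sub_norm_sq_pos ha
  have he2 := one_sub_norm_sq_le ha hw
  set lam : ℂ := inner ℂ a w with hlam
  set d := ‖1 - lam‖ with hd
  have hd0 : 0 ≤ d := norm_nonneg _
  have hlam1 : ‖lam‖ ≤ 1 := by
    refine (norm_inner_le_norm a w).trans ?_
    have := (mem_unitBall.1 ha).le
    exact mul_le_one₀ this (norm_nonneg _) hw
  have hd1 : 1 - ‖lam‖ ≤ d := by
    have := norm_sub_norm_le (1 : ℂ) lam
    rwa [norm_one] at this
  have hsplit : inner ℂ w (z - a) =
      inner ℂ (w - lam • a) (z - a) + starRingEnd ℂ lam * inner ℂ a (z - a) := by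
    rw [inner_sub_left w, inner_smul_left]
    ring
  have hnorm : ‖w - lam • a‖ ^ 2 ≤ 2 * d := by
    rw [norm_sub_sq (𝕜 := ℂ), inner_smul_right, ← inner_conj_symm w a, ← hlam, Complex.mul_conj',
      norm_smul, mul_pow]
    have h3 : RCLike.re ((‖lam‖ : ℂ) ^ 2) = ‖lam‖ ^ 2 := by
      rw [← Complex.ofReal_pow]
      exact Complex.ofReal_re _
    rw [h3]
    have h4 : ‖lam‖ ^ 2 * ‖a‖ ^ 2 ≤ ‖lam‖ ^ 2 := by nlinarith [sq_nonneg ‖lam‖]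
    have h5 : ‖w‖ ^ 2 ≤ 1 := pow_le_one₀ (norm_nonneg _) hw
    nlinarith [norm_nonneg lam]
  have hA : ‖inner ℂ (w - lam • a) (z - a)‖ ≤ 4 * r * d := by
    refine (norm_inner_le_norm _ _).trans ?_
    refine abs_le_of_sq_le_sq' ?_ (by positivity) |>.2
    calc (‖w - lam • a‖ * ‖z - a‖) ^ 2 = ‖w - lam • a‖ ^ 2 * ‖z - a‖ ^ 2 := by ring
      _ ≤ (2 * d) * ((2 * r) ^ 2 * (1 - ‖a‖ ^ 2)) := by gcongr
      _ ≤ (2 * d) * ((2 * r) ^ 2 * (2 * d)) := by gcongr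
      _ = (4 * r * d) ^ 2 := by ring
  have hB : ‖starRingEnd ℂ lam * inner ℂ a (z - a)‖ ≤ 4 * r * d := by
    rw [norm_mul, RCLike.norm_conj]
    calc ‖lam‖ * ‖inner ℂ a (z - a)‖ ≤ 1 * (2 * r * (1 - ‖a‖ ^ 2)) := by gcongr
      _ ≤ 1 * (2 * r * (2 * d)) := by gcongr
      _ = 4 * r * d := by ring
  rw [hsplit]
  refine (norm_add_le _ _).trans ?_
  linarith

lemma norm_one_sub_inner_le_mul {a z w : Cn n} (ha : a ∈ unitBall n) (hz : z ∈ unitBall n)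
    (hw : ‖w‖ ≤ 1) {r : ℝ} (hr : 0 ≤ r) (hr2 : r ≤ 1 / 2) (h : 1 - r ^ 2 ≤ beta a z) :
    ‖1 - inner ℂ w z‖ ≤ (1 + 8 * r) * ‖1 - inner ℂ w a‖ := by
  have h1 := norm_inner_sub_le ha hz hw hr hr2 h
  rw [norm_one_sub_inner_comm] at h1
  have h2 : (1 : ℂ) - inner ℂ w z = (1 - inner ℂ w a) - inner ℂ w (z - a) := by
    rw [inner_sub_right]
    ring
  rw [h2]
  refine (norm_sub_le _ _).trans ?_
  linarith

lemma mul_one_sub_norm_sq_le {a z : Cn n} (ha : a ∈ unitBall n) (hz : z ∈ unitBall n)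
    {r : ℝ} (hr : 0 ≤ r) (hr2 : r ≤ 1 / 2) (h : 1 - r ^ 2 ≤ beta a z) :
    (1 - r ^ 2) * (1 - 2 * r) ^ 2 * (1 - ‖a‖ ^ 2) ≤ 1 - ‖z‖ ^ 2 := by
  obtain ⟨-, -, -, h4⟩ := near_bounds ha hz hr hr2 h
  have he := one_sub_norm_sq_pos ha
  have hD := norm_one_sub_inner_pos hz ha
  rw [beta, norm_one_sub_inner_comm, le_div_iff₀ (by positivity)] at h
  have h5 : ((1 - 2 * r) * (1 - ‖a‖ ^ 2)) ^ 2 ≤ ‖1 - inner ℂ a z‖ ^ 2 := by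
    gcongr
    exact mul_nonneg (by linarith) he.le
  have h6 : 0 ≤ 1 - r ^ 2 := by nlinarith
  have h7 : (1 - r ^ 2) * ((1 - 2 * r) * (1 - ‖a‖ ^ 2)) ^ 2 ≤ (1 - ‖a‖ ^ 2) * (1 - ‖z‖ ^ 2) :=
    (mul_le_mul_of_nonneg_left h5 h6).trans h
  refine le_of_mul_le_mul_left (le_trans (le_of_eq ?_) h7) he
  ring

/-- The comparison constant tends to `1` as `r → 0`. This gives the weak triangle inequality for
arbitrarily small radii; at `r = 1/16` the constant exceeds `1/4`. -/
lemma mul_beta_le_beta {a z w : Cn n} (ha : a ∈ unitBall n) (hz : z ∈ unitBall n)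
    (hw : w ∈ unitBall n) {r : ℝ} (hr : 0 ≤ r) (hr2 : r ≤ 1 / 2) (h : 1 - r ^ 2 ≤ beta a z) :
    (1 - r ^ 2) * (1 - 2 * r) ^ 2 / (1 + 8 * r) ^ 2 * beta a w ≤ beta z w := by
  have h1 := mul_one_sub_norm_sq_le ha hz hr hr2 h
  have h2 := norm_one_sub_inner_le_mul ha hz (mem_unitBall.1 hw).le hr hr2 h
  have hea := one_sub_norm_sq_pos ha
  have hez := one_sub_norm_sq_pos hz
  have hew := one_sub_norm_sq_pos hw
  have hDa := norm_one_sub_inner_pos ha hw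
  have hDz := norm_one_sub_inner_pos hz hw
  rw [beta, beta, div_mul_div_comm, div_le_div_iff₀ (by positivity) (by positivity)]
  have h3 : ‖1 - inner ℂ w z‖ ^ 2 ≤ ((1 + 8 * r) * ‖1 - inner ℂ w a‖) ^ 2 := by gcongr
  calc (1 - r ^ 2) * (1 - 2 * r) ^ 2 * ((1 - ‖a‖ ^ 2) * (1 - ‖w‖ ^ 2)) * ‖1 - inner ℂ w z‖ ^ 2
      = ((1 - r ^ 2) * (1 - 2 * r) ^ 2 * (1 - ‖a‖ ^ 2)) * (1 - ‖w‖ ^ 2) *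
          ‖1 - inner ℂ w z‖ ^ 2 := by ring
    _ ≤ (1 - ‖z‖ ^ 2) * (1 - ‖w‖ ^ 2) * ((1 + 8 * r) * ‖1 - inner ℂ w a‖) ^ 2 := by gcongr
    _ = _ := by ring

/-- The radius `r = 1/16`, that is `β ≥ 1 - 1/256`, is the scale of all later comparisons; here `1 +
8 r = 3/2`. -/
lemma norm_one_sub_inner_le_two_mul {a z : Cn n} (ha : a ∈ unitBall n) (hz : z ∈ unitBall n)
    (h : 1 - 1 / 256 ≤ beta a z) {w : Cn n} (hw : ‖w‖ ≤ 1) :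
    ‖1 - inner ℂ w z‖ ≤ 2 * ‖1 - inner ℂ w a‖ := by
  have := norm_one_sub_inner_le_mul ha hz hw (r := 1 / 16) (by norm_num) (by norm_num)
    (by norm_num at h ⊢; exact h)
  have h0 := norm_nonneg (1 - inner ℂ w a)
  linarith

lemma one_sub_norm_sq_le_four_mul {a z : Cn n} (ha : a ∈ unitBall n) (hz : z ∈ unitBall n)
    (h : 1 - 1 / 256 ≤ beta a z) : 1 - ‖a‖ ^ 2 ≤ 4 * (1 - ‖z‖ ^ 2) := by
  have h1 := mul_one_sub_norm_sq_le ha hz (r := 1 / 16) (by norm_num) (by norm_num)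
    (by norm_num at h ⊢; exact h)
  have h0 := one_sub_norm_sq_pos ha
  norm_num at h1
  linarith

lemma beta_le_four_mul {a z : Cn n} (ha : a ∈ unitBall n) (hz : z ∈ unitBall n)
    (h : 1 - 1 / 256 ≤ beta a z) {w : Cn n} (hw : w ∈ unitBall n) : beta a w ≤ 4 * beta z w := by
  have h1 := mul_beta_le_beta ha hz hw (r := 1 / 16) (by norm_num) (by norm_num)
    (by norm_num at h ⊢; exact h)
  have h0 := beta_pos ha hw
  norm_num at h1
  linarith

/-- A weak triangle inequality for the pseudohyperbolic distance. -/
lemma exists_beta_triangle (n : ℕ) {ε : ℝ} (hε : 0 < ε) :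
    ∃ σ, 0 < σ ∧ σ < 1 ∧ ∀ x y w : Cn n, x ∈ unitBall n → y ∈ unitBall n → w ∈ unitBall n →
      1 - σ < beta x y → 1 - σ < beta y w → 1 - ε < beta x w := by
  have hcont : ContinuousAt (fun r : ℝ =>
      (1 - r ^ 2) * (1 - 2 * r) ^ 2 / (1 + 8 * r) ^ 2 * (1 - r ^ 2)) 0 := by
    refine ContinuousAt.mul (ContinuousAt.div (by fun_prop) (by fun_prop) (by norm_num))
      (by fun_prop)
  have hev : ∀ᶠ r in nhdsWithin (0 : ℝ) (Set.Ioi 0),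
      1 - ε < (1 - r ^ 2) * (1 - 2 * r) ^ 2 / (1 + 8 * r) ^ 2 * (1 - r ^ 2) := by
    refine (hcont.tendsto.mono_left nhdsWithin_le_nhds).eventually_const_lt ?_
    norm_num
    exact hε
  have hev2 : ∀ᶠ r in nhdsWithin (0 : ℝ) (Set.Ioi 0), r < 1 / 2 :=
    eventually_nhdsWithin_of_eventually_nhds (eventually_lt_nhds (by norm_num))
  obtain ⟨r, hr, hr2, hr0⟩ := (hev.and (hev2.and self_mem_nhdsWithin)).exists
  have hr0' : (0 : ℝ) < r := hr0
  refine ⟨r ^ 2, by positivity, by nlinarith, fun x y w hx hy hw hxy hyw => ?_⟩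
  rw [beta_comm] at hxy
  have h1 := mul_beta_le_beta hy hx hw hr0'.le hr2.le hxy.le
  refine hr.trans_le (le_trans ?_ h1)
  have h6 : 0 ≤ 1 - r ^ 2 := by nlinarith
  exact mul_le_mul_of_nonneg_left hyw.le (by positivity)

lemma ofReal_mul_cpow {r : ℝ} (hr : 0 < r) {x : ℂ} (hx : x ≠ 0) (c : ℂ) :
    ((r : ℂ) * x) ^ c = (r : ℂ) ^ c * x ^ c := by
  have hr' : (r : ℂ) ≠ 0 := Complex.ofReal_ne_zero.2 hr.ne'
  rw [Complex.cpow_def_of_ne_zero (mul_ne_zero hr' hx), Complex.cpow_def_of_ne_zero hr',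
    Complex.cpow_def_of_ne_zero hx, Complex.log_ofReal_mul hr hx, add_mul, Complex.exp_add,
    Complex.ofReal_log hr.le]

/-- The reproducing kernel is almost constant on small balls. -/
lemma exists_kernel_variation (n : ℕ) (s : ℝ) {κ : ℝ} (hκ : 0 < κ) :
    ∃ ε, 0 < ε ∧ ε ≤ 1 / 256 ∧ ∀ a w z : Cn n, a ∈ unitBall n → w ∈ unitBall n → z ∈ unitBall n →
      1 - ε < beta a w → 1 - ε < beta a z →
      ‖bergmanKernel s w z - (((1 - ‖a‖ ^ 2) ^ (-s) : ℝ) : ℂ)‖ ≤ κ * (1 - ‖a‖ ^ 2) ^ (-s) := by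
  have hcont : ContinuousAt (fun t : ℂ => t ^ (-s : ℂ)) 1 :=
    continuousAt_cpow_const (by simp)
  obtain ⟨d, hd, hdt⟩ := Metric.continuousAt_iff.1 hcont κ hκ
  -- The relative deviation of `1 - w·z` from `1 - |a|²` is at most `8r·2 + 8r = 24 r`; dividing by
  -- `25` makes it strictly less than `d`.
  set r : ℝ := min (1 / 16) (d / 25) with hr
  have hr0 : 0 < r := lt_min (by norm_num) (by positivity)
  have hr16 : r ≤ 1 / 16 := min_le_left _ _
  have hrd : r ≤ d / 25 := min_le_right _ _
  refine ⟨r ^ 2, by positivity, ?_, fun a w z ha hw hz haw haz => ?_⟩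
  · calc r ^ 2 ≤ (1 / 16) ^ 2 := by gcongr
      _ = 1 / 256 := by norm_num
  have he := one_sub_norm_sq_pos ha
  set e := 1 - ‖a‖ ^ 2 with hee
  have h1 := norm_inner_sub_le ha hw (mem_unitBall.1 hz).le hr0.le (by linarith) haw.le
  have h2 := norm_inner_sub_le ha hz (mem_unitBall.1 ha).le hr0.le (by linarith) haz.le
  obtain ⟨-, -, h3, -⟩ := near_bounds ha hz hr0.le (by linarith) haz.le
  have hself : (1 : ℂ) - inner ℂ a a = (e : ℂ) := by
    rw [inner_self_eq_norm_sq_to_K, hee]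
    push_cast
    rfl
  have hne : ‖(e : ℂ)‖ = e := by rw [Complex.norm_real, Real.norm_of_nonneg he.le]
  rw [hself, hne] at h2
  have hdiff : ‖(1 - inner ℂ z w) - (e : ℂ)‖ ≤ 24 * r * e := by
    have h4 : (1 - inner ℂ z w) - (e : ℂ) =
        -inner ℂ z (w - a) - starRingEnd ℂ (inner ℂ a (z - a)) := by
      rw [← hself, inner_conj_symm, inner_sub_right, inner_sub_left]
      ring
    rw [h4]
    refine (norm_sub_le _ _).trans ?_
    rw [norm_neg, RCLike.norm_conj]
    nlinarith
  have hec : (e : ℂ) ≠ 0 := Complex.ofReal_ne_zero.2 he.ne'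
  set t : ℂ := (1 - inner ℂ z w) / e with ht
  have ht1 : dist t 1 < d := by
    rw [dist_eq_norm, ht, div_sub_one hec, norm_div, hne, div_lt_iff₀ he]
    refine hdiff.trans_lt ?_
    have : 24 * r < d := by linarith
    exact mul_lt_mul_of_pos_right this he
  have h5 := (hdt ht1).le
  rw [Complex.one_cpow, dist_eq_norm] at h5
  have hK : bergmanKernel s w z = ((e ^ (-s) : ℝ) : ℂ) * t ^ (-s : ℂ) := by
    have h6 : (1 : ℂ) - inner ℂ z w = e * t := by rw [ht]; field_simp
    rw [bergmanKernel, h6, Complex.ofReal_cpow he.le]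
    push_cast
    exact ofReal_mul_cpow he (div_ne_zero (one_sub_inner_ne_zero hw hz) hec) _
  have hpos : 0 < e ^ (-s) := Real.rpow_pos_of_pos he _
  have h7 : ((e ^ (-s) : ℝ) : ℂ) * t ^ (-s : ℂ) - ((e ^ (-s) : ℝ) : ℂ) =
      ((e ^ (-s) : ℝ) : ℂ) * (t ^ (-s : ℂ) - 1) := by ring
  rw [hK, h7, norm_mul, Complex.norm_real, Real.norm_of_nonneg hpos.le, mul_comm]
  exact mul_le_mul_of_nonneg_right h5 hpos.le

end Geometry

section NearSet

variable {n : ℕ} {γ : ℝ}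

/-! ### Pseudohyperbolic balls -/

/-- The pseudohyperbolic ball `{w : β(a, w) > 1 - ε}`. -/
def nearSet (a : Cn n) (ε : ℝ) : Set (Cn n) := {w | w ∈ unitBall n ∧ 1 - ε < beta a w}

lemma measurable_beta_left (a : Cn n) : Measurable fun w => beta a w := by
  unfold beta
  refine Measurable.div ?_ ?_ <;> exact Continuous.measurable (by fun_prop)

lemma measurableSet_nearSet (a : Cn n) (ε : ℝ) : MeasurableSet (nearSet a ε) :=
  measurableSet_unitBall.inter (measurableSet_lt measurable_const (measurable_beta_left a))

lemma self_mem_nearSet {a : Cn n} (ha : a ∈ unitBall n) {ε : ℝ} (hε : 0 < ε) : a ∈ nearSet a ε :=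
  ⟨ha, by rw [beta_self ha]; linarith⟩

lemma ae_invariantMeasure_mem_unitBall : ∀ᵐ z ∂(invariantMeasure n), z ∈ unitBall n :=
  (withDensity_absolutelyContinuous _ _).ae_le (ae_restrict_mem measurableSet_unitBall)

/-- Markov's inequality for `β(a, ·)^(n+1)`, whose invariant integral does not depend on `a`. -/
lemma invariantMeasure_nearSet_le (hn : 1 ≤ n) {ε : ℝ} (hε1 : ε < 1) {a : Cn n}
    (ha : a ∈ unitBall n) :
    invariantMeasure n (nearSet a ε) ≤
      ENNReal.ofReal ((1 - ε) ^ (-((n : ℝ) + 1)) * betaMass n (n + 1)) := by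
  have h1 : (0 : ℝ) < 1 - ε := by linarith
  have hmass := lintegral_beta_rpow hn (q := n + 1) (by linarith) ha
  have h2 : ENNReal.ofReal ((1 - ε) ^ ((n : ℝ) + 1)) * invariantMeasure n (nearSet a ε) ≤
      ENNReal.ofReal (betaMass n (n + 1)) := by
    rw [← hmass, ← setLIntegral_const]
    refine (setLIntegral_mono' (measurableSet_nearSet a ε) fun w hw => ?_).trans
      (setLIntegral_le_lintegral _ _)
    refine ENNReal.ofReal_le_ofReal ?_
    have := hw.2
    gcongr
  rw [ENNReal.ofReal_mul (by positivity), Real.rpow_neg h1.le,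
    ENNReal.ofReal_inv_of_pos (by positivity)]
  rw [mul_comm, ← ENNReal.le_div_iff_mul_le (Or.inl (by simpa using Real.rpow_pos_of_pos h1 _))
    (Or.inl ENNReal.ofReal_ne_top)] at h2
  rwa [mul_comm, ← div_eq_mul_inv]

/-- The normalizing constant grows at most polynomially in the weight, so the mass of `β^(n+1+k)`
decays at most polynomially in `k`. -/
lemma weightConst_natCast_le (n k : ℕ) : weightConst n k ≤ ((k : ℝ) + n) ^ n / Real.pi ^ n := by
  have h1 : Real.Gamma (n + 1 + k) = ((n + k).factorial : ℝ) := by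
    rw [← Real.Gamma_nat_eq_factorial]
    push_cast
    ring_nf
  have h2 : ((n + k).factorial : ℝ) ≤ ((k : ℝ) + n) ^ n * k.factorial := by
    have h3 := Nat.factorial_mul_descFactorial (n := n + k) (k := n) (by omega)
    have h4 := Nat.descFactorial_le_pow (n + k) n
    rw [Nat.add_sub_cancel_left] at h3
    have h5 : (n + k).factorial ≤ (k + n) ^ n * k.factorial := by
      rw [← h3, add_comm k n, mul_comm]
      exact Nat.mul_le_mul_right _ h4
    exact_mod_cast h5
  rw [weightConst, h1, Real.Gamma_nat_eq_factorial]
  have h6 : (0 : ℝ) < k.factorial := by exact_mod_cast Nat.factorial_pos k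
  rw [div_le_div_iff₀ (by positivity) (by positivity)]
  nlinarith [pow_pos Real.pi_pos n]

/-- Pseudohyperbolic balls of a fixed radius have invariant measure bounded from below. -/
lemma exists_le_invariantMeasure_nearSet (hn : 1 ≤ n) {ε : ℝ} (hε : 0 < ε) (hε1 : ε < 1) :
    ∃ c, 0 < c ∧ ∀ a ∈ unitBall n, ENNReal.ofReal c ≤ invariantMeasure n (nearSet a ε) := by
  have hm0 : 0 < betaMass n (n + 1) := betaMass_pos (by linarith)
  -- Off the ball `β^(n+1+k) ≤ (1 - ε)^k β^(n+1)`, which decays exponentially, while the total mass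
  -- decays only polynomially. For such a `k` the ball carries at least the positive difference, and
  -- `β ≤ 1` turns this into measure.
  obtain ⟨k, hk⟩ : ∃ k : ℕ, (1 - ε) ^ k * betaMass n (n + 1) < betaMass n (n + 1 + k) := by
    have hlim := tendsto_pow_const_mul_const_pow_of_abs_lt_one n (r := 1 - ε)
      (by rw [abs_lt]; constructor <;> linarith)
    have hlim2 := (hlim.comp (Filter.tendsto_add_atTop_nat n)).mul_const
      ((1 - ε)⁻¹ ^ n * betaMass n (n + 1) / Real.pi ^ n)
    rw [zero_mul] at hlim2
    obtain ⟨k, hk⟩ := (hlim2.eventually (gt_mem_nhds one_pos)).exists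
    refine ⟨k, ?_⟩
    have hw := weightConst_natCast_le n k
    have hwp : 0 < weightConst n (k : ℝ) :=
      weightConst_pos (by have : (0 : ℝ) ≤ k := by positivity
                          linarith)
    rw [show betaMass n (n + 1 + k) = (weightConst n k)⁻¹ by rw [betaMass]; congr 2; ring]
    rw [lt_inv_comm₀ (by have : (0 : ℝ) < 1 - ε := by linarith
                         positivity) hwp]
    refine hw.trans_lt ?_
    have h1 : (0 : ℝ) < 1 - ε := by linarith
    rw [lt_inv_comm₀ (by positivity) (by positivity)]
    simp only [Function.comp_apply, Nat.cast_add] at hk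
    rw [inv_div, lt_div_iff₀ (by positivity)]
    have hpi : (0 : ℝ) < Real.pi ^ n := by positivity
    have h2 : ((k : ℝ) + n) ^ n * (1 - ε) ^ (k + n) *
        ((1 - ε)⁻¹ ^ n * betaMass n (n + 1) / Real.pi ^ n) =
        (1 - ε) ^ k * betaMass n (n + 1) * ((k : ℝ) + n) ^ n / Real.pi ^ n := by
      rw [pow_add, inv_pow]
      field_simp
    rw [h2, div_lt_one hpi] at hk
    exact hk
  refine ⟨betaMass n (n + 1 + k) - (1 - ε) ^ k * betaMass n (n + 1), by linarith, fun a ha => ?_⟩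
  have hk0 : (0 : ℝ) ≤ k := by positivity
  have h1 := lintegral_beta_rpow hn (q := n + 1 + k) (by linarith) ha
  have h2 := lintegral_beta_rpow hn (q := n + 1) (by linarith) ha
  have h3 : ENNReal.ofReal (betaMass n (n + 1 + k)) ≤ invariantMeasure n (nearSet a ε) +
      ENNReal.ofReal ((1 - ε) ^ k * betaMass n (n + 1)) := by
    have hε' : (0 : ℝ) < 1 - ε := by linarith
    rw [← h1, ENNReal.ofReal_mul (by positivity), ← h2, ← lintegral_const_mul' _ _ ENNReal.ofReal_ne_top,
      ← lintegral_indicator_one (measurableSet_nearSet a ε),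
      ← lintegral_add_left (measurable_one.indicator (measurableSet_nearSet a ε))]
    refine lintegral_mono_ae ?_
    filter_upwards [ae_invariantMeasure_mem_unitBall] with w hw
    have hb0 := beta_pos ha hw
    have hb1 := beta_le_one ha hw
    by_cases hwn : w ∈ nearSet a ε
    · rw [Set.indicator_of_mem hwn]
      refine le_add_right ?_
      rw [Pi.one_apply, ← ENNReal.ofReal_one]
      refine ENNReal.ofReal_le_ofReal ?_
      exact Real.rpow_le_one hb0.le hb1 (by positivity)
    · rw [Set.indicator_of_notMem hwn, zero_add, ← ENNReal.ofReal_mul (by positivity)]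
      refine ENNReal.ofReal_le_ofReal ?_
      have hb2 : beta a w ≤ 1 - ε := by
        by_contra hcon
        exact hwn ⟨hw, not_le.1 hcon⟩
      rw [Real.rpow_add hb0, Real.rpow_natCast, mul_comm]
      gcongr
  rw [ENNReal.ofReal_sub _ (by have : (0 : ℝ) < 1 - ε := by linarith
                               positivity)]
  exact tsub_le_iff_right.2 h3

lemma weightedMeasure_eq_lintegral (hγ : -1 < γ) {Q : Set (Cn n)} (hQ : MeasurableSet Q) :
    weightedMeasure n γ Q = ENNReal.ofReal (weightConst n γ) *
      ∫⁻ w in Q, ENNReal.ofReal ((1 - ‖w‖ ^ 2) ^ ((n : ℝ) + 1 + γ)) ∂(invariantMeasure n) := by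
  rw [← lintegral_indicator hQ, ← lintegral_rpow_neg_mul hγ, ← lintegral_indicator_one hQ]
  · refine lintegral_congr_ae ?_
    filter_upwards [ae_mem_unitBall γ] with w hw
    have hh := one_sub_norm_sq_pos hw
    by_cases hwQ : w ∈ Q
    · rw [Set.indicator_of_mem hwQ, Set.indicator_of_mem hwQ, ← ENNReal.ofReal_mul (by positivity),
        ← Real.rpow_add hh, neg_add_cancel, Real.rpow_zero, ENNReal.ofReal_one, Pi.one_apply]
    · rw [Set.indicator_of_notMem hwQ, Set.indicator_of_notMem hwQ, mul_zero]
  · refine Measurable.indicator (ENNReal.measurable_ofReal.comp (Measurable.pow_const ?_ _)) hQ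
    fun_prop

/-- The `v_γ`-measure of a pseudohyperbolic ball is comparable to `(1 - |a|²)^{n+1+γ}`. -/
lemma exists_weightedMeasure_nearSet_bounds (hn : 1 ≤ n) (hγ : -1 < γ) {ε : ℝ} (hε : 0 < ε)
    (hε1 : ε ≤ 1 / 256) :
    ∃ c C, 0 < c ∧ 0 < C ∧ ∀ a ∈ unitBall n,
      c * (1 - ‖a‖ ^ 2) ^ ((n : ℝ) + 1 + γ) ≤ (weightedMeasure n γ).real (nearSet a ε) ∧
      (weightedMeasure n γ).real (nearSet a ε) ≤ C * (1 - ‖a‖ ^ 2) ^ ((n : ℝ) + 1 + γ) := by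
  have hprob := isProbabilityMeasure_weightedMeasure (n := n) hγ
  obtain ⟨c, hc, hcQ⟩ := exists_le_invariantMeasure_nearSet hn hε (by linarith)
  have hw := weightConst_pos (n := n) hγ
  have hn0 : (0 : ℝ) ≤ n := by positivity
  set s : ℝ := (n : ℝ) + 1 + γ with hs
  have hs0 : 0 < s := by linarith
  set C := (1 - ε) ^ (-((n : ℝ) + 1)) * betaMass n (n + 1) with hC
  have hC0 : 0 < C := mul_pos (Real.rpow_pos_of_pos (by linarith) _) (betaMass_pos (by linarith))
  refine ⟨weightConst n γ * (c * (4 ^ s)⁻¹), weightConst n γ * (C * 4 ^ s), by positivity,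
    by positivity, fun a ha => ?_⟩
  have hea := one_sub_norm_sq_pos ha
  have hlow : ∀ w ∈ nearSet a ε, (4 ^ s)⁻¹ * (1 - ‖a‖ ^ 2) ^ s ≤ (1 - ‖w‖ ^ 2) ^ s := by
    intro w hw
    have h1 := one_sub_norm_sq_le_four_mul ha hw.1 (by linarith [hw.2])
    have h2 := one_sub_norm_sq_pos hw.1
    rw [inv_mul_le_iff₀ (by positivity), ← Real.mul_rpow (by norm_num) h2.le]
    gcongr
  have hupp : ∀ w ∈ nearSet a ε, (1 - ‖w‖ ^ 2) ^ s ≤ 4 ^ s * (1 - ‖a‖ ^ 2) ^ s := by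
    intro w hw
    have h1 := one_sub_norm_sq_le_four_mul hw.1 ha (by rw [beta_comm]; linarith [hw.2])
    have h2 := one_sub_norm_sq_pos hw.1
    rw [← Real.mul_rpow (by norm_num) hea.le]
    gcongr
  have hm := measurableSet_nearSet a ε
  constructor
  · rw [measureReal_def, ← ENNReal.ofReal_le_iff_le_toReal (measure_ne_top _ _),
      weightedMeasure_eq_lintegral hγ hm, mul_assoc, ENNReal.ofReal_mul hw.le]
    gcongr
    calc ENNReal.ofReal (c * (4 ^ s)⁻¹ * (1 - ‖a‖ ^ 2) ^ s)
        = ENNReal.ofReal ((4 ^ s)⁻¹ * (1 - ‖a‖ ^ 2) ^ s) * ENNReal.ofReal c := by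
          rw [← ENNReal.ofReal_mul (by positivity)]
          congr 1
          ring
      _ ≤ ENNReal.ofReal ((4 ^ s)⁻¹ * (1 - ‖a‖ ^ 2) ^ s) * invariantMeasure n (nearSet a ε) := by
          gcongr
          exact hcQ a ha
      _ ≤ _ := by
          rw [← setLIntegral_const]
          exact setLIntegral_mono' hm fun w hw => ENNReal.ofReal_le_ofReal (hlow w hw)
  · rw [measureReal_def]
    refine ENNReal.toReal_le_of_le_ofReal (by positivity) ?_
    rw [weightedMeasure_eq_lintegral hγ hm, mul_assoc, ENNReal.ofReal_mul hw.le]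
    gcongr
    calc _ ≤ ∫⁻ _ in nearSet a ε, ENNReal.ofReal (4 ^ s * (1 - ‖a‖ ^ 2) ^ s) ∂(invariantMeasure n) :=
          setLIntegral_mono' hm fun w hw => ENNReal.ofReal_le_ofReal (hupp w hw)
      _ = ENNReal.ofReal (4 ^ s * (1 - ‖a‖ ^ 2) ^ s) * invariantMeasure n (nearSet a ε) :=
          setLIntegral_const _ _
      _ ≤ ENNReal.ofReal (4 ^ s * (1 - ‖a‖ ^ 2) ^ s) * ENNReal.ofReal C := by
          gcongr
          exact invariantMeasure_nearSet_le hn (by linarith) ha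
      _ = _ := by
          rw [← ENNReal.ofReal_mul (by positivity)]
          congr 1
          ring

end NearSet

section Lattice

variable {n : ℕ}

/-! ### Lattices adapted to concentric spheres -/

/-- The power `β(z, w)^q` as an extended nonnegative real. -/
def betaPow (q : ℝ) (z w : Cn n) : ℝ≥0∞ := ENNReal.ofReal (beta z w ^ q)

lemma betaPow_comm (q : ℝ) (z w : Cn n) : betaPow q z w = betaPow q w z := by
  rw [betaPow, betaPow, beta_comm]

lemma betaPow_self (q : ℝ) {a : Cn n} (ha : a ∈ unitBall n) : betaPow q a a = 1 := by
  rw [betaPow, beta_self ha, Real.one_rpow, ENNReal.ofReal_one]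

/-- Separated sets have uniformly summable powers of `β`. -/
lemma exists_tsum_betaPow_le (hn : 1 ≤ n) {q ε : ℝ} (hq : n < q) (hε : 0 < ε) :
    ∃ C : ℝ, 0 < C ∧ ∀ Λ : Set (Cn n), Λ ⊆ unitBall n → Λ.Pairwise (fun x y => beta x y ≤ 1 - ε) →
      ∀ z ∈ unitBall n, ∑' m : Λ, betaPow q z m ≤ ENNReal.ofReal C := by
  obtain ⟨σ, hσ, hσ1, htri⟩ := exists_beta_triangle n hε
  set η := min σ (1 / 256) with hη
  have hη0 : 0 < η := lt_min hσ (by norm_num)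
  have hησ : η ≤ σ := min_le_left _ _
  have hη2 : η ≤ 1 / 256 := min_le_right _ _
  obtain ⟨c, hc, hcQ⟩ := exists_le_invariantMeasure_nearSet hn hη0 (by linarith)
  have hmass := betaMass_pos (n := n) hq
  have hq0 : 0 < q := lt_of_le_of_lt (by positivity) hq
  refine ⟨c⁻¹ * (4 ^ q * betaMass n q), by positivity, fun Λ hΛ hsep z hz => ?_⟩
  rw [ENNReal.tsum_eq_iSup_sum]
  refine iSup_le fun F => ?_
  -- Separation and the weak triangle inequality make the balls of radius parameter `η` disjoint. On
  -- each of them `β(z, ·)` is comparable to its value at the centre, so the sum is dominated by an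
  -- integral.
  have hdisj : (F : Set Λ).PairwiseDisjoint fun m : Λ => nearSet (m : Cn n) η := by
    intro m _ m' _ hne
    refine Set.disjoint_left.2 fun w hw hw' => ?_
    have h1 := hsep m.2 m'.2 (fun h => hne (Subtype.ext h))
    have h2 := htri m w m' (hΛ m.2) hw.1 (hΛ m'.2) (by linarith [hw.2])
      (by rw [beta_comm]; linarith [hw'.2])
    linarith
  have hkey : ENNReal.ofReal c * ∑ m ∈ F, betaPow q z m ≤
      ENNReal.ofReal (4 ^ q * betaMass n q) := by
    calc ENNReal.ofReal c * ∑ m ∈ F, betaPow q z m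
        ≤ ∑ m ∈ F, ∫⁻ w in nearSet (m : Cn n) η, ENNReal.ofReal (4 ^ q) *
            ENNReal.ofReal (beta z w ^ q) ∂(invariantMeasure n) := by
          rw [Finset.mul_sum]
          refine Finset.sum_le_sum fun m _ => ?_
          calc ENNReal.ofReal c * betaPow q z m
              ≤ betaPow q z m * invariantMeasure n (nearSet (m : Cn n) η) := by
                rw [mul_comm]
                gcongr
                exact hcQ m (hΛ m.2)
            _ ≤ _ := by
                rw [← setLIntegral_const]
                refine setLIntegral_mono' (measurableSet_nearSet _ _) fun w hw => ?_
                rw [← ENNReal.ofReal_mul (by positivity)]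
                refine ENNReal.ofReal_le_ofReal ?_
                have hb := beta_le_four_mul (hΛ m.2) hw.1 (by linarith [hw.2]) hz
                have h0 := beta_pos hz hw.1
                have h1 := beta_pos hz (hΛ m.2)
                rw [beta_comm, beta_comm w] at hb
                rw [← Real.mul_rpow (by norm_num) h0.le]
                gcongr
      _ ≤ ∫⁻ w, ENNReal.ofReal (4 ^ q) * ENNReal.ofReal (beta z w ^ q) ∂(invariantMeasure n) := by
          rw [← lintegral_biUnion_finset hdisj fun m _ => measurableSet_nearSet _ _]
          exact setLIntegral_le_lintegral _ _
      _ = _ := by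
          rw [lintegral_const_mul' _ _ ENNReal.ofReal_ne_top, lintegral_beta_rpow hn hq hz,
            ← ENNReal.ofReal_mul (by positivity)]
  rw [ENNReal.ofReal_mul (by positivity), ENNReal.ofReal_inv_of_pos hc]
  rwa [mul_comm _ (ENNReal.ofReal (4 ^ q * _)), ← div_eq_mul_inv, ENNReal.le_div_iff_mul_le
    (Or.inl (by simpa using hc)) (Or.inl ENNReal.ofReal_ne_top), mul_comm]

/-- A maximal separated subset of the union of the spheres `1 - |x|² = (1 - σ)^k`. -/
structure IsLattice (σ : ℝ) (Λ : Set (Cn n)) : Prop where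
  level : ∀ x ∈ Λ, ∃ k : ℕ, ‖x‖ ^ 2 = 1 - (1 - σ) ^ k
  separated : Λ.Pairwise fun x y => beta x y ≤ 1 - σ ^ 2 / 4
  cover : ∀ (x : Cn n) (k : ℕ), ‖x‖ ^ 2 = 1 - (1 - σ) ^ k →
    ∃ m ∈ Λ, ‖m‖ ^ 2 = 1 - (1 - σ) ^ k ∧ 1 - σ ^ 2 / 4 < beta x m

lemma mem_unitBall_of_level {σ : ℝ} (hσ1 : σ < 1) {x : Cn n} {k : ℕ}
    (hx : ‖x‖ ^ 2 = 1 - (1 - σ) ^ k) : x ∈ unitBall n := by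
  rw [mem_unitBall, ← sq_lt_one_iff₀ (norm_nonneg _), hx]
  have : 0 < (1 - σ) ^ k := pow_pos (by linarith) k
  linarith

lemma IsLattice.subset {σ : ℝ} (hσ1 : σ < 1) {Λ : Set (Cn n)} (hΛ : IsLattice σ Λ) :
    Λ ⊆ unitBall n := fun x hx => by
  obtain ⟨k, hk⟩ := hΛ.level x hx
  exact mem_unitBall_of_level hσ1 hk

/-- With `R = |x|`, `R' = |y|`: `(1 - R²)(1 - R'²) = (1 - R R')² - (R' - R)²`, and `R' - R ≥ σ (1 -
R²)/2`. Points on different spheres are thus automatically separated by `σ²/4`, which explains this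
threshold in `IsLattice`. -/
lemma beta_le_of_level_lt {σ : ℝ} (hσ : 0 < σ) (hσ1 : σ < 1) {x y : Cn n} {k l : ℕ} (hkl : k < l)
    (hx : ‖x‖ ^ 2 = 1 - (1 - σ) ^ k) (hy : ‖y‖ ^ 2 = 1 - (1 - σ) ^ l) :
    beta x y ≤ 1 - σ ^ 2 / 4 := by
  have hxB := mem_unitBall_of_level hσ1 hx
  have hyB := mem_unitBall_of_level hσ1 hy
  have hD := norm_one_sub_inner_pos hxB hyB
  have hR1 := mem_unitBall.1 hxB
  have hR1' := mem_unitBall.1 hyB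
  have hE : 1 - ‖x‖ * ‖y‖ ≤ ‖1 - inner ℂ y x‖ := by
    have h1 := norm_sub_norm_le (1 : ℂ) (inner ℂ y x)
    rw [norm_one] at h1
    have h2 := norm_inner_le_norm (𝕜 := ℂ) y x
    linarith
  set R := ‖x‖ with hR
  set R' := ‖y‖ with hR'
  have hR0 : 0 ≤ R := norm_nonneg _
  have hR0' : 0 ≤ R' := norm_nonneg _
  have hpow : (1 - σ) ^ l ≤ (1 - σ) * (1 - σ) ^ k := by
    rw [← pow_succ']
    exact pow_le_pow_of_le_one (by linarith) (by linarith) hkl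
  have hh : 1 - R' ^ 2 ≤ (1 - σ) * (1 - R ^ 2) := by rw [hx, hy]; linarith
  have hh0 : 0 < 1 - R ^ 2 := one_sub_norm_sq_pos hxB
  have hlt : R < R' := by
    by_contra hcon
    have : R' ^ 2 ≤ R ^ 2 := by gcongr; exact not_lt.1 hcon
    nlinarith
  have hdiff : σ * (1 - R ^ 2) / 2 ≤ R' - R := by nlinarith
  have hE1 : 1 - R * R' ≤ 1 - R ^ 2 := by nlinarith
  have hE0 : 0 < 1 - R * R' := by nlinarith
  rw [beta, div_le_iff₀ (by positivity)]
  have h1 : (σ * (1 - R * R') / 2) ^ 2 ≤ (R' - R) ^ 2 := by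
    have : σ * (1 - R * R') / 2 ≤ R' - R := le_trans (by gcongr) hdiff
    gcongr
  have h2 : (1 - R * R') ^ 2 ≤ ‖1 - inner ℂ y x‖ ^ 2 := by gcongr
  have h3 : 0 ≤ 1 - σ ^ 2 / 4 := by nlinarith
  calc (1 - R ^ 2) * (1 - R' ^ 2) = (1 - R * R') ^ 2 - (R' - R) ^ 2 := by ring
    _ ≤ (1 - σ ^ 2 / 4) * (1 - R * R') ^ 2 := by linarith
    _ ≤ _ := mul_le_mul_of_nonneg_left h2 h3

/-- Zorn's lemma. The lattice point covering `x` must lie on the sphere of `x`, since points of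
other spheres are too far away. -/
lemma exists_isLattice (n : ℕ) {σ : ℝ} (hσ : 0 < σ) (hσ1 : σ < 1) :
    ∃ Λ : Set (Cn n), IsLattice σ Λ := by
  obtain ⟨Λ, hmax⟩ := zorn_subset {Λ : Set (Cn n) | (∀ x ∈ Λ, ∃ k : ℕ, ‖x‖ ^ 2 = 1 - (1 - σ) ^ k) ∧
      Λ.Pairwise fun x y => beta x y ≤ 1 - σ ^ 2 / 4} (by
    intro c hc hchain
    refine ⟨⋃₀ c, ⟨?_, ?_⟩, fun s hs => Set.subset_sUnion_of_mem hs⟩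
    · rintro x ⟨s, hs, hx⟩
      exact (hc hs).1 x hx
    · rw [Set.pairwise_sUnion hchain.directedOn]
      exact fun s hs => (hc hs).2)
  have hlev : ∀ x ∈ Λ, ∃ k : ℕ, ‖x‖ ^ 2 = 1 - (1 - σ) ^ k := hmax.prop.1
  have hsep : Λ.Pairwise fun x y => beta x y ≤ 1 - σ ^ 2 / 4 := hmax.prop.2
  refine ⟨Λ, hlev, hsep, fun x k hx => ?_⟩
  have hxB := mem_unitBall_of_level hσ1 hx
  by_cases hxΛ : x ∈ Λ
  · refine ⟨x, hxΛ, hx, ?_⟩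
    rw [beta_self hxB]
    have : 0 < σ ^ 2 / 4 := by positivity
    linarith
  · obtain ⟨m, hm, hmb⟩ : ∃ m ∈ Λ, 1 - σ ^ 2 / 4 < beta x m := by
      by_contra hcon
      push Not at hcon
      have hins : insert x Λ ⊆ Λ := by
        refine hmax.le_of_ge ⟨?_, ?_⟩ (Set.subset_insert x Λ)
        · rintro y (rfl | hy)
          · exact ⟨k, hx⟩
          · exact hlev y hy
        · refine hsep.insert fun y hy _ => ⟨hcon y hy, ?_⟩
          rw [beta_comm]
          exact hcon y hy
      exact hxΛ (hins (Set.mem_insert x Λ))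
    obtain ⟨l, hl⟩ := hlev m hm
    refine ⟨m, hm, ?_, hmb⟩
    rcases lt_trichotomy k l with h | h | h
    · exact absurd (beta_le_of_level_lt hσ hσ1 h hx hl) (not_le.2 hmb)
    · rw [h]
      exact hl
    · rw [beta_comm] at hmb
      exact absurd (beta_le_of_level_lt hσ hσ1 h hl hx) (not_le.2 hmb)

lemma inner_ofReal_smul (r R : ℝ) (e e' : Cn n) :
    inner ℂ ((r : ℂ) • e) ((R : ℂ) • e') = ((r * R : ℝ) : ℂ) * inner ℂ e e' := by
  rw [inner_smul_left, inner_smul_right, Complex.conj_ofReal]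
  push_cast
  ring

lemma norm_ofReal_smul_unit {e : Cn n} (he : ‖e‖ = 1) {r : ℝ} (hr : 0 ≤ r) : ‖(r : ℂ) • e‖ = r := by
  rw [norm_smul, he, mul_one, Complex.norm_real, Real.norm_of_nonneg hr]

lemma ofReal_smul_mem_unitBall {e : Cn n} (he : ‖e‖ = 1) {r : ℝ} (hr : 0 ≤ r) (hr1 : r < 1) :
    (r : ℂ) • e ∈ unitBall n := by
  rwa [mem_unitBall, norm_ofReal_smul_unit he hr]

lemma le_beta_ray {e : Cn n} (he : ‖e‖ = 1) {r R : ℝ} (hr : 0 ≤ r) (hrR : r ≤ R) (hR : R < 1) :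
    (1 - R ^ 2) / (1 - r ^ 2) ≤ beta ((R : ℂ) • e) ((r : ℂ) • e) := by
  have h1 : 0 < 1 - r ^ 2 := by nlinarith
  have h2 : 0 < 1 - R ^ 2 := by nlinarith
  have h3 : 0 < 1 - r * R := by nlinarith
  have hself : inner ℂ e e = (1 : ℂ) := by
    rw [inner_self_eq_norm_sq_to_K, he]
    simp
  rw [beta, inner_ofReal_smul, hself, mul_one, norm_ofReal_smul_unit he hr,
    norm_ofReal_smul_unit he (hr.trans hrR), ← Complex.ofReal_one, ← Complex.ofReal_sub,
    Complex.norm_real, Real.norm_of_nonneg h3.le, div_le_div_iff₀ h1 (by positivity)]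
  have h4 : (1 - r * R) ^ 2 ≤ (1 - r ^ 2) ^ 2 := by
    gcongr
    nlinarith
  nlinarith

/-- Points on the ray from the origin to `i` whose distance to the sphere is not larger than
`|1 - i·j|` lie between `i` and `j`. -/
lemma beta_le_mul_beta_ray {e j : Cn n} (he : ‖e‖ = 1) (hj : j ∈ unitBall n) {r R A : ℝ}
    (hr : 0 ≤ r) (hrR : r ≤ R) (hR : R < 1) (hA : 0 ≤ A)
    (h : 1 - r ^ 2 ≤ A * ‖1 - inner ℂ j ((R : ℂ) • e)‖) :
    beta ((R : ℂ) • e) j ≤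
      (1 + A) ^ 2 * (beta ((R : ℂ) • e) ((r : ℂ) • e) * beta ((r : ℂ) • e) j) := by
  have h1 : 0 < 1 - r ^ 2 := by nlinarith
  have h2 : 0 < 1 - R ^ 2 := by nlinarith
  have hj' := one_sub_norm_sq_pos hj
  have hiB := ofReal_smul_mem_unitBall he (hr.trans hrR) hR
  have hxB := ofReal_smul_mem_unitBall he hr (hrR.trans_lt hR)
  have hD := norm_one_sub_inner_pos hiB hj
  have hDx := norm_one_sub_inner_pos hxB hj
  set D := ‖1 - inner ℂ j ((R : ℂ) • e)‖ with hDdef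
  have hle : ‖1 - inner ℂ j ((r : ℂ) • e)‖ ≤ (1 + A) * D := by
    have h3 : 1 - inner ℂ j ((r : ℂ) • e) =
        (1 - inner ℂ j ((R : ℂ) • e)) + ((R - r : ℝ) : ℂ) * inner ℂ j e := by
      rw [inner_smul_right, inner_smul_right]
      push_cast
      ring
    have h4 : ‖inner ℂ j e‖ ≤ 1 := by
      refine (norm_inner_le_norm j e).trans ?_
      rw [he, mul_one]
      exact (mem_unitBall.1 hj).le
    rw [h3]
    refine (norm_add_le _ _).trans ?_
    rw [norm_mul, Complex.norm_real, Real.norm_of_nonneg (by linarith), ← hDdef]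
    have h5 : (R - r) * ‖inner ℂ j e‖ ≤ (R - r) * 1 := by
      gcongr
    nlinarith
  have h6 := le_beta_ray he hr hrR hR
  have h7 : (1 - r ^ 2) * (1 - ‖j‖ ^ 2) / ((1 + A) * D) ^ 2 ≤ beta ((r : ℂ) • e) j := by
    rw [beta, norm_ofReal_smul_unit he hr]
    gcongr
  calc beta ((R : ℂ) • e) j
      = (1 + A) ^ 2 * ((1 - R ^ 2) / (1 - r ^ 2) *
          ((1 - r ^ 2) * (1 - ‖j‖ ^ 2) / ((1 + A) * D) ^ 2)) := by
        rw [beta, norm_ofReal_smul_unit he (hr.trans hrR), ← hDdef]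
        field_simp
    _ ≤ _ := by
        have := beta_pos hiB hxB
        gcongr

/-- The hypothesis gives `|1 - e·e'| ≤ 2D ≤ (σ/2)(1 - r²)`, with `D = |1 - Re·R'e'|`. At this depth
the two rays are pseudohyperbolically close, because `(1 - σ)(1 + σ/2)² ≤ 1`. For `r = 0` both
points are the origin. -/
lemma le_beta_jump {e e' : Cn n} (he : ‖e‖ = 1) (he' : ‖e'‖ = 1) {r R R' σ : ℝ}
    (hr : 0 ≤ r) (hr1 : r < 1) (hR : 0 ≤ R) (hR1 : R < 1) (hR' : 0 ≤ R') (hR1' : R' < 1)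
    (hσ : 0 < σ)
    (h : r = 0 ∨ 4 / σ * ‖1 - inner ℂ ((R' : ℂ) • e') ((R : ℂ) • e)‖ ≤ 1 - r ^ 2) :
    1 - σ ≤ beta ((r : ℂ) • e) ((r : ℂ) • e') := by
  rcases h with rfl | h
  · simp only [Complex.ofReal_zero, zero_smul]
    rw [beta_self (by simp [mem_unitBall])]
    linarith
  have h1 : 0 < 1 - r ^ 2 := by nlinarith
  rw [inner_ofReal_smul] at h
  set D := ‖1 - ((R' * R : ℝ) : ℂ) * inner ℂ e' e‖ with hD
  have hin : ‖inner ℂ e' e‖ ≤ 1 := by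
    refine (norm_inner_le_norm e' e).trans ?_
    rw [he, he', mul_one]
  have hRR : R' * R < 1 := by nlinarith
  have hRR0 : 0 ≤ R' * R := by positivity
  have hDge : 1 - R' * R ≤ D := by
    have h2 := norm_sub_norm_le (1 : ℂ) (((R' * R : ℝ) : ℂ) * inner ℂ e' e)
    rw [norm_one, norm_mul, Complex.norm_real, Real.norm_of_nonneg hRR0, ← hD] at h2
    nlinarith
  have hunit : ‖1 - inner ℂ e' e‖ ≤ 2 * D := by
    have h3 : 1 - inner ℂ e' e = (1 - ((R' * R : ℝ) : ℂ) * inner ℂ e' e) -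
        ((1 - R' * R : ℝ) : ℂ) * inner ℂ e' e := by
      push_cast
      ring
    rw [h3]
    refine (norm_sub_le _ _).trans ?_
    rw [norm_mul, Complex.norm_real, Real.norm_of_nonneg (by linarith), ← hD]
    nlinarith
  have hle : ‖1 - inner ℂ ((r : ℂ) • e') ((r : ℂ) • e)‖ ≤ (1 + σ / 2) * (1 - r ^ 2) := by
    have h3 : 1 - inner ℂ ((r : ℂ) • e') ((r : ℂ) • e) =
        ((1 - r ^ 2 : ℝ) : ℂ) + ((r ^ 2 : ℝ) : ℂ) * (1 - inner ℂ e' e) := by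
      rw [inner_ofReal_smul]
      push_cast
      ring
    rw [h3]
    refine (norm_add_le _ _).trans ?_
    rw [norm_mul, Complex.norm_real, Complex.norm_real, Real.norm_of_nonneg h1.le,
      Real.norm_of_nonneg (by positivity)]
    rw [div_mul_eq_mul_div, div_le_iff₀ hσ] at h
    have h4 : r ^ 2 ≤ 1 := by nlinarith
    nlinarith [norm_nonneg (1 - inner ℂ e' e)]
  have hpos := norm_one_sub_inner_pos (ofReal_smul_mem_unitBall he hr hr1)
    (ofReal_smul_mem_unitBall he' hr hr1)
  rw [beta, norm_ofReal_smul_unit he hr, norm_ofReal_smul_unit he' hr, le_div_iff₀ (by positivity)]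
  rcases le_or_gt 1 σ with hσ1 | hσ1
  · nlinarith [mul_pos h1 h1, pow_pos hpos 2]
  have h5 : ‖1 - inner ℂ ((r : ℂ) • e') ((r : ℂ) • e)‖ ^ 2 ≤ ((1 + σ / 2) * (1 - r ^ 2)) ^ 2 := by
    gcongr
  calc _ ≤ (1 - σ) * ((1 + σ / 2) * (1 - r ^ 2)) ^ 2 := by
        refine mul_le_mul_of_nonneg_left h5 (by linarith)
    _ = ((1 - σ) * (1 + σ / 2) ^ 2) * ((1 - r ^ 2) * (1 - r ^ 2)) := by ring
    _ ≤ 1 * ((1 - r ^ 2) * (1 - r ^ 2)) := by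
        gcongr
        nlinarith [pow_pos hσ 3, pow_pos hσ 2]
    _ = _ := one_mul _

end Lattice

section Chain

variable {n : ℕ} {σ : ℝ} {Λ : Set (Cn n)}

/-! ### Chains of lattice points -/

lemma IsLattice.exists_ray (hΛ : IsLattice σ Λ) (hσ : 0 < σ) (hσ1 : σ < 1) {e : Cn n}
    (he : ‖e‖ = 1) : ∃ m : ℕ → Λ, ∀ k, ‖(m k : Cn n)‖ ^ 2 = 1 - (1 - σ) ^ k ∧
      1 - σ ^ 2 / 4 < beta ((√(1 - (1 - σ) ^ k) : ℂ) • e) (m k) := by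
  have h : ∀ k : ℕ, ∃ m : Λ, ‖(m : Cn n)‖ ^ 2 = 1 - (1 - σ) ^ k ∧
      1 - σ ^ 2 / 4 < beta ((√(1 - (1 - σ) ^ k) : ℂ) • e) m := by
    intro k
    have hk : 0 ≤ 1 - (1 - σ) ^ k := by
      have : (1 - σ) ^ k ≤ 1 := pow_le_one₀ (by linarith) (by linarith)
      linarith
    obtain ⟨m, hm, h1, h2⟩ := hΛ.cover ((√(1 - (1 - σ) ^ k) : ℂ) • e) k (by
      rw [norm_ofReal_smul_unit he (Real.sqrt_nonneg _), Real.sq_sqrt hk])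
    exact ⟨⟨m, hm⟩, h1, h2⟩
  choose m hm using h
  exact ⟨m, hm⟩

/-- The oscillation hypothesis: `F` changes by at most `O i + O j` between neighbours. -/
def IsSlow (σ : ℝ) (F : Λ → ℂ) (O : Λ → ℝ≥0∞) : Prop :=
  ∀ i j : Λ, ∀ x ∈ unitBall n, ∀ y ∈ unitBall n, 1 - σ < beta (i : Cn n) x → 1 - σ ≤ beta x y →
    1 - σ < beta y (j : Cn n) → ‖F i - F j‖ₑ ≤ O i + O j

lemma sqrt_level_lt_one (hσ1 : σ < 1) (k : ℕ) : √(1 - (1 - σ) ^ k) < 1 := by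
  have : 0 < (1 - σ) ^ k := pow_pos (by linarith) k
  rw [Real.sqrt_lt' one_pos]
  linarith

lemma one_sub_sqrt_level_sq (hσ : 0 < σ) (hσ1 : σ < 1) (k : ℕ) :
    1 - √(1 - (1 - σ) ^ k) ^ 2 = (1 - σ) ^ k := by
  have : (1 - σ) ^ k ≤ 1 := pow_le_one₀ (by linarith) (by linarith)
  rw [Real.sq_sqrt (by linarith)]
  ring

lemma sqrt_level_mono (hσ : 0 < σ) (hσ1 : σ < 1) {k l : ℕ} (hkl : k ≤ l) :
    √(1 - (1 - σ) ^ k) ≤ √(1 - (1 - σ) ^ l) := by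
  have : (1 - σ) ^ l ≤ (1 - σ) ^ k := pow_le_pow_of_le_one (by linarith) (by linarith) hkl
  gcongr

/-- Telescoping along the ray from `i` towards the origin. `le_beta_ray` gives at least `1 - σ` for
consecutive spheres, so consecutive `m k` are neighbours; each `O (m k)` is counted at most twice.
-/
lemma IsSlow.enorm_sub_ray_le {F : Λ → ℂ} {O : Λ → ℝ≥0∞} (hF : IsSlow σ F O) (hσ : 0 < σ)
    (hσ1 : σ < 1) (hΛ : IsLattice σ Λ) {e : Cn n} (he : ‖e‖ = 1) {m : ℕ → Λ}
    (hm : ∀ k, 1 - σ ^ 2 / 4 < beta ((√(1 - (1 - σ) ^ k) : ℂ) • e) (m k)) {i : Λ} {N K : ℕ}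
    (hi : (i : Cn n) = (√(1 - (1 - σ) ^ N) : ℂ) • e) (hKN : K ≤ N) :
    ‖F i - F (m K)‖ₑ ≤ O i + 2 * ∑ k ∈ Finset.Icc K N, O (m k) := by
  have hσ2 : σ ^ 2 / 4 ≤ σ := by nlinarith
  have hx : ∀ k, (√(1 - (1 - σ) ^ k) : ℂ) • e ∈ unitBall n := fun k =>
    ofReal_smul_mem_unitBall he (Real.sqrt_nonneg _) (sqrt_level_lt_one hσ1 k)
  have hstep : ∀ k, edist (F (m k)) (F (m (k + 1))) ≤ O (m k) + O (m (k + 1)) := by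
    intro k
    rw [edist_eq_enorm_sub]
    refine hF _ _ _ (hx k) _ (hx (k + 1)) ?_ ?_ (by linarith [hm (k + 1)])
    · rw [beta_comm]
      linarith [hm k]
    · rw [beta_comm]
      refine le_trans (le_of_eq ?_) (le_beta_ray he (Real.sqrt_nonneg _)
        (sqrt_level_mono hσ hσ1 (Nat.le_succ k)) (sqrt_level_lt_one hσ1 (k + 1)))
      rw [one_sub_sqrt_level_sq hσ hσ1, one_sub_sqrt_level_sq hσ hσ1, pow_succ]
      have : (1 - σ) ^ k ≠ 0 := (pow_pos (by linarith) k).ne'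
      field_simp
  have hfirst : ‖F i - F (m N)‖ₑ ≤ O i + O (m N) := by
    have hiB := hΛ.subset hσ1 i.2
    refine hF _ _ _ hiB _ hiB ?_ ?_ ?_
    · rw [beta_self hiB]; linarith
    · rw [beta_self hiB]; linarith
    · rw [hi]
      linarith [hm N]
  have hsum := edist_le_Ico_sum_edist (fun k => F (m k)) hKN
  have h1 : ∑ k ∈ Finset.Ico K N, edist (F (m k)) (F (m (k + 1))) ≤
      ∑ k ∈ Finset.Ico K N, O (m k) + ∑ k ∈ Finset.Ico (K + 1) (N + 1), O (m k) := by
    rw [← Finset.sum_Ico_add' (fun k => O (m k)) K N 1, ← Finset.sum_add_distrib]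
    exact Finset.sum_le_sum fun k _ => hstep k
  have h2 : ∑ k ∈ Finset.Ico K N, O (m k) + O (m N) = ∑ k ∈ Finset.Icc K N, O (m k) := by
    rw [← Finset.sum_Ico_succ_top hKN]
    rfl
  have h3 : ∑ k ∈ Finset.Ico (K + 1) (N + 1), O (m k) ≤ ∑ k ∈ Finset.Icc K N, O (m k) := by
    refine Finset.sum_le_sum_of_subset fun k hk => ?_
    simp only [Finset.mem_Ico, Finset.mem_Icc] at hk ⊢
    omega
  calc ‖F i - F (m K)‖ₑ = edist (F i) (F (m K)) := (edist_eq_enorm_sub _ _).symm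
    _ ≤ edist (F i) (F (m N)) + edist (F (m N)) (F (m K)) := edist_triangle _ _ _
    _ ≤ (O i + O (m N)) + (∑ k ∈ Finset.Ico K N, O (m k) +
          ∑ k ∈ Finset.Ico (K + 1) (N + 1), O (m k)) := by
        rw [edist_comm (F (m N)), edist_eq_enorm_sub]
        exact add_le_add hfirst (hsum.trans h1)
    _ = O i + ((∑ k ∈ Finset.Ico K N, O (m k) + O (m N)) +
          ∑ k ∈ Finset.Ico (K + 1) (N + 1), O (m k)) := by ring
    _ ≤ O i + (∑ k ∈ Finset.Icc K N, O (m k) + ∑ k ∈ Finset.Icc K N, O (m k)) := by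
        rw [h2]
        gcongr
    _ = _ := by rw [two_mul]

lemma betaPow_le_of_beta_le {q : ℝ} (hq : 0 < q) {i j m : Cn n} (hi : i ∈ unitBall n)
    (hj : j ∈ unitBall n) (hm : m ∈ unitBall n) {C : ℝ} (hC : 0 ≤ C)
    (h : beta i j ≤ C * (beta i m * beta m j)) :
    betaPow q i j ≤ ENNReal.ofReal (C ^ q) * (betaPow q i m * betaPow q m j) := by
  have h1 := beta_pos hi hj
  have h2 := beta_pos hi hm
  have h3 := beta_pos hm hj
  rw [betaPow, betaPow, betaPow, ← ENNReal.ofReal_mul (by positivity),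
    ← ENNReal.ofReal_mul (by positivity), ← Real.mul_rpow h2.le h3.le,
    ← Real.mul_rpow hC (by positivity)]
  exact ENNReal.ofReal_le_ofReal (by gcongr)

/-- The sum that controls the oscillation between `i` and `j`. -/
def chainSum (Λ : Set (Cn n)) (q p : ℝ) (O : Λ → ℝ≥0∞) (i j : Λ) : ℝ≥0∞ :=
  ∑' m : Λ, {m : Λ | min (1 - ‖(i : Cn n)‖ ^ 2) (1 - ‖(j : Cn n)‖ ^ 2) ≤
    1 - ‖(m : Cn n)‖ ^ 2}.indicator
      (fun m => betaPow q (i : Cn n) m * betaPow q (m : Cn n) j * O m ^ p) m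

lemma chainSum_comm (q p : ℝ) (O : Λ → ℝ≥0∞) (i j : Λ) :
    chainSum Λ q p O i j = chainSum Λ q p O j i := by
  unfold chainSum
  rw [min_comm]
  refine tsum_congr fun m => ?_
  congr 1
  ext m
  rw [betaPow_comm q (i : Cn n), betaPow_comm q (m : Cn n) j, mul_comm (betaPow q (m : Cn n) i)]

lemma betaPow_mul_le_chainSum (hσ1 : σ < 1) (hΛ : IsLattice σ Λ) (q p : ℝ) (O : Λ → ℝ≥0∞) (i j : Λ) :
    betaPow q (i : Cn n) j * O i ^ p ≤ chainSum Λ q p O i j := by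
  refine le_trans (le_of_eq ?_) (ENNReal.le_tsum i)
  have hi : i ∈ {m : Λ | min (1 - ‖(i : Cn n)‖ ^ 2) (1 - ‖(j : Cn n)‖ ^ 2) ≤
      1 - ‖(m : Cn n)‖ ^ 2} := Set.mem_ofPred.2 (min_le_left _ _)
  rw [Set.indicator_of_mem hi, betaPow_self q (hΛ.subset hσ1 i.2), one_mul]

/-- Points of the ray above the jump level lie between `i` and `j`: `β(i,j)` is at most a constant
times `β(i,m) β(m,j)`. Each of the two replacements of a ray point by its lattice point costs a
factor `4`, hence `16`. The `m k` have different norms, so they are distinct terms of `chainSum`. -/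
lemma IsLattice.betaPow_mul_sum_ray_le (hΛ : IsLattice σ Λ) (hσ : 0 < σ) (hσ1 : σ ≤ 1 / 256)
    {q p : ℝ} (hq : 0 < q) (O : Λ → ℝ≥0∞) {e : Cn n} (he : ‖e‖ = 1) {m : ℕ → Λ}
    (hm : ∀ k, ‖(m k : Cn n)‖ ^ 2 = 1 - (1 - σ) ^ k ∧
      1 - σ ^ 2 / 4 < beta ((√(1 - (1 - σ) ^ k) : ℂ) • e) (m k)) {i j : Λ} {N K : ℕ}
    (hi : (i : Cn n) = (√(1 - (1 - σ) ^ N) : ℂ) • e) {A : ℝ} (hA : 0 ≤ A)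
    (hK : (1 - σ) ^ K ≤ A * ‖1 - inner ℂ (j : Cn n) (i : Cn n)‖) :
    betaPow q (i : Cn n) j * ∑ k ∈ Finset.Icc K N, O (m k) ^ p ≤
      ENNReal.ofReal ((16 * (1 + A) ^ 2) ^ q) * chainSum Λ q p O i j := by
  have hσ1' : σ < 1 := by linarith
  have hjB := hΛ.subset hσ1' j.2
  have hiB := hΛ.subset hσ1' i.2
  have hnorm : ∀ k ∈ Finset.Icc K N, betaPow q (i : Cn n) j ≤
      ENNReal.ofReal ((16 * (1 + A) ^ 2) ^ q) *
        (betaPow q (i : Cn n) (m k) * betaPow q (m k : Cn n) j) := by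
    intro k hk
    rw [Finset.mem_Icc] at hk
    have hmB := hΛ.subset hσ1' (m k).2
    refine betaPow_le_of_beta_le hq hiB hjB hmB (by positivity) ?_
    have hxB := ofReal_smul_mem_unitBall he (Real.sqrt_nonneg _) (sqrt_level_lt_one hσ1' k)
    have hnear : 1 - 1 / 256 ≤ beta ((√(1 - (1 - σ) ^ k) : ℂ) • e) (m k) := by nlinarith [(hm k).2]
    have h1 := beta_le_four_mul hxB hmB hnear hjB
    have h2 := beta_le_four_mul hxB hmB hnear hiB
    have hpow : (1 - σ) ^ k ≤ (1 - σ) ^ K := pow_le_pow_of_le_one (by linarith) (by linarith) hk.1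
    have h3 := beta_le_mul_beta_ray he hjB (Real.sqrt_nonneg _) (sqrt_level_mono hσ hσ1' hk.2)
      (sqrt_level_lt_one hσ1' N) hA (by
        rw [one_sub_sqrt_level_sq hσ hσ1', ← hi]
        exact hpow.trans hK)
    rw [← hi] at h3
    rw [beta_comm, beta_comm (m k : Cn n)] at h2
    have h4 := beta_pos hxB hjB
    have h5 := beta_pos hiB hmB
    calc beta (i : Cn n) j ≤ _ := h3
      _ ≤ (1 + A) ^ 2 * ((4 * beta (i : Cn n) (m k)) * (4 * beta (m k : Cn n) j)) := by gcongr
      _ = _ := by ring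
  have hinj : Function.Injective m := by
    intro k l hkl
    have h1 := (hm k).1
    rw [hkl, (hm l).1] at h1
    have h2 : (1 - σ) ^ l = (1 - σ) ^ k := by linarith
    exact (pow_right_injective₀ (by linarith) (by linarith) h2).symm
  have hhi : 1 - ‖(i : Cn n)‖ ^ 2 = (1 - σ) ^ N := by
    rw [hi, norm_ofReal_smul_unit he (Real.sqrt_nonneg _), one_sub_sqrt_level_sq hσ hσ1']
  classical
  calc betaPow q (i : Cn n) j * ∑ k ∈ Finset.Icc K N, O (m k) ^ p
      ≤ ∑ k ∈ Finset.Icc K N, ENNReal.ofReal ((16 * (1 + A) ^ 2) ^ q) *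
          {m : Λ | min (1 - ‖(i : Cn n)‖ ^ 2) (1 - ‖(j : Cn n)‖ ^ 2) ≤ 1 - ‖(m : Cn n)‖ ^ 2}.indicator
            (fun m => betaPow q (i : Cn n) m * betaPow q (m : Cn n) j * O m ^ p) (m k) := by
        rw [Finset.mul_sum]
        refine Finset.sum_le_sum fun k hk => ?_
        have hkN := (Finset.mem_Icc.1 hk).2
        rw [Set.indicator_of_mem, ← mul_assoc]
        · gcongr
          exact hnorm k hk
        · refine Set.mem_ofPred.2 ((min_le_left _ _).trans ?_)
          rw [hhi, (hm k).1, sub_sub_cancel]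
          exact pow_le_pow_of_le_one (by linarith) (by linarith) hkN
    _ ≤ _ := by
        rw [← Finset.mul_sum, chainSum, ← Finset.sum_image (s := Finset.Icc K N) (g := m)
          (f := {m : Λ | min (1 - ‖(i : Cn n)‖ ^ 2) (1 - ‖(j : Cn n)‖ ^ 2) ≤
            1 - ‖(m : Cn n)‖ ^ 2}.indicator
              (fun m => betaPow q (i : Cn n) m * betaPow q (m : Cn n) j * O m ^ p)) hinj.injOn]
        gcongr
        exact ENNReal.sum_le_tsum _

/-- The oscillation between two lattice points is controlled by the oscillations at the
intermediate lattice points. -/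
theorem exists_chain_bound (hn : 1 ≤ n) (hσ : 0 < σ) (hσ1 : σ ≤ 1 / 256) {q : ℝ} (hq : 0 < q) :
    ∃ C : ℝ, 0 < C ∧ ∀ Λ : Set (Cn n), IsLattice σ Λ → ∀ (F : Λ → ℂ) (O : Λ → ℝ≥0∞) (p : ℝ),
      0 < p → p ≤ 1 → IsSlow σ F O → ∀ i j : Λ,
        betaPow q (i : Cn n) j * (O i ^ p + O j ^ p + ‖F i - F j‖ₑ ^ p) ≤
          ENNReal.ofReal C * chainSum Λ q p O i j := by
  have hσ1' : σ < 1 := by linarith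
  -- A jump is allowed at depths at least `4 D / σ`. The deepest such sphere misses this value by at
  -- most a factor `1 - σ`, so its depth is at most `A D`.
  set A : ℝ := 4 / σ / (1 - σ) with hA
  have hA0 : 0 < A := div_pos (by positivity) (by linarith)
  set C := (16 * (1 + A) ^ 2) ^ q with hC
  have hC0 : 0 < C := by positivity
  refine ⟨4 + 6 * C, by positivity, fun Λ hΛ F O p hp hp1 hF i j => ?_⟩
  have hiB := hΛ.subset hσ1' i.2
  have hjB := hΛ.subset hσ1' j.2
  obtain ⟨N, hN⟩ := hΛ.level i i.2
  obtain ⟨N', hN'⟩ := hΛ.level j j.2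
  obtain ⟨e, he, hie⟩ := exists_unit_smul_eq hn (i : Cn n)
  obtain ⟨e', he', hje⟩ := exists_unit_smul_eq hn (j : Cn n)
  rw [← Real.sqrt_sq (norm_nonneg (i : Cn n)), hN] at hie
  rw [← Real.sqrt_sq (norm_nonneg (j : Cn n)), hN'] at hje
  obtain ⟨m, hm⟩ := hΛ.exists_ray hσ hσ1' he
  obtain ⟨m', hm'⟩ := hΛ.exists_ray hσ hσ1' he'
  set D := ‖1 - inner ℂ (j : Cn n) (i : Cn n)‖ with hD
  have hD0 : 0 < D := norm_one_sub_inner_pos hiB hjB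
  have hDi : (1 - σ) ^ N ≤ 2 * D := by
    have := one_sub_norm_sq_le hiB (mem_unitBall.1 hjB).le
    rwa [norm_one_sub_inner_comm, hN, sub_sub_cancel] at this
  have hDj : (1 - σ) ^ N' ≤ 2 * D := by
    have := one_sub_norm_sq_le hjB (mem_unitBall.1 hiB).le
    rwa [hN', sub_sub_cancel] at this
  -- `K` is the jump level. When `4 D / σ > 1` no sphere is deep enough, and the path passes through
  -- the origin, `K = 0`.
  obtain ⟨K, hK1, hK2⟩ : ∃ K : ℕ, (1 - σ) ^ (K + 1) ≤ 4 / σ * D ∧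
      (K = 0 ∨ 4 / σ * D ≤ (1 - σ) ^ K) := by
    by_cases h : 4 / σ * D ≤ 1
    · obtain ⟨K, h1, h2⟩ := exists_nat_pow_near_of_lt_one (x := 4 / σ * D) (y := 1 - σ)
        (by positivity) h (by linarith) (by linarith)
      exact ⟨K, h1.le, Or.inr h2⟩
    · refine ⟨0, ?_, Or.inl rfl⟩
      rw [zero_add, pow_one]
      linarith
  have hKA : (1 - σ) ^ K ≤ A * D := by
    have h1 : 0 < 1 - σ := by linarith
    rw [hA, div_mul_eq_mul_div, le_div_iff₀ h1, ← pow_succ]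
    exact hK1
  have h4σ : 4 * D ≤ 4 / σ * D := by
    gcongr
    rw [le_div_iff₀ hσ]
    linarith
  -- The points `i` and `j` have depth at most `2 D`, less than the jump depth when `K ≠ 0`, so the
  -- jump occurs before either endpoint.
  have hKle : ∀ M : ℕ, (1 - σ) ^ M ≤ 2 * D → K ≤ M := by
    intro M hM
    rcases hK2 with rfl | hK2
    · exact Nat.zero_le _
    · by_contra hcon
      have : (1 - σ) ^ K ≤ (1 - σ) ^ M :=
        pow_le_pow_of_le_one (by linarith) (by linarith) (not_le.1 hcon).le
      linarith
  have hKN := hKle N hDi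
  have hKN' := hKle N' hDj
  have hσ2 : σ ^ 2 / 4 ≤ σ := by nlinarith
  have hjump : ‖F (m K) - F (m' K)‖ₑ ≤ O (m K) + O (m' K) := by
    refine hF _ _ _ (ofReal_smul_mem_unitBall he (Real.sqrt_nonneg _) (sqrt_level_lt_one hσ1' K))
      _ (ofReal_smul_mem_unitBall he' (Real.sqrt_nonneg _) (sqrt_level_lt_one hσ1' K)) ?_ ?_ ?_
    · rw [beta_comm]
      linarith [(hm K).2]
    · refine le_beta_jump he he' (R := √(1 - (1 - σ) ^ N)) (R' := √(1 - (1 - σ) ^ N'))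
        (Real.sqrt_nonneg _) (sqrt_level_lt_one hσ1' K) (Real.sqrt_nonneg _)
        (sqrt_level_lt_one hσ1' N) (Real.sqrt_nonneg _) (sqrt_level_lt_one hσ1' N') hσ ?_
      rcases hK2 with rfl | hK2
      · left
        simp
      · right
        rw [← hie, ← hje, one_sub_sqrt_level_sq hσ hσ1']
        exact hK2
    · linarith [(hm' K).2]
  have hleg := hF.enorm_sub_ray_le hσ hσ1' hΛ he (fun k => (hm k).2) hie hKN
  have hleg' := hF.enorm_sub_ray_le hσ hσ1' hΛ he' (fun k => (hm' k).2) hje hKN'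
  set S := ∑ k ∈ Finset.Icc K N, O (m k) with hS
  set S' := ∑ k ∈ Finset.Icc K N', O (m' k) with hS'
  have hmS : O (m K) ≤ S := Finset.single_le_sum (f := fun k => O (m k)) (fun _ _ => zero_le)
    (Finset.mem_Icc.2 ⟨le_rfl, hKN⟩)
  have hmS' : O (m' K) ≤ S' := Finset.single_le_sum (f := fun k => O (m' k)) (fun _ _ => zero_le)
    (Finset.mem_Icc.2 ⟨le_rfl, hKN'⟩)
  have htotal : ‖F i - F j‖ₑ ≤ O i + O j + 3 * S + 3 * S' := by
    calc ‖F i - F j‖ₑ = edist (F i) (F j) := (edist_eq_enorm_sub _ _).symm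
      _ ≤ edist (F i) (F (m K)) + edist (F (m K)) (F (m' K)) + edist (F (m' K)) (F j) :=
          edist_triangle4 _ _ _ _
      _ ≤ (O i + 2 * S) + (S + S') + (O j + 2 * S') := by
          rw [edist_comm (F (m' K)), edist_eq_enorm_sub, edist_eq_enorm_sub, edist_eq_enorm_sub]
          exact add_le_add (add_le_add hleg (hjump.trans (add_le_add hmS hmS'))) hleg'
      _ = _ := by ring
  have h3p : (3 : ℝ≥0∞) ^ p ≤ 3 := by
    calc (3 : ℝ≥0∞) ^ p ≤ 3 ^ (1 : ℝ) := ENNReal.rpow_le_rpow_of_exponent_le (by norm_num) hp1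
      _ = 3 := ENNReal.rpow_one _
  have hpow : ‖F i - F j‖ₑ ^ p ≤ O i ^ p + O j ^ p + 3 * ∑ k ∈ Finset.Icc K N, O (m k) ^ p +
      3 * ∑ k ∈ Finset.Icc K N', O (m' k) ^ p := by
    have hadd := fun a b : ℝ≥0∞ => ENNReal.rpow_add_le_add_rpow a b hp.le hp1
    have hmul : ∀ (s : Finset ℕ) (a : ℕ → ℝ≥0∞), (3 * ∑ k ∈ s, a k) ^ p ≤ 3 * ∑ k ∈ s, a k ^ p := by
      intro s a
      rw [ENNReal.mul_rpow_of_nonneg _ _ hp.le]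
      exact mul_le_mul' h3p (rpow_sum_le_sum_rpow hp hp1 s a)
    refine (ENNReal.rpow_le_rpow htotal hp.le).trans ?_
    refine (hadd _ _).trans (add_le_add ((hadd _ _).trans (add_le_add (hadd _ _) ?_)) ?_)
    · exact hmul _ _
    · exact hmul _ _
  have hG := hΛ.betaPow_mul_sum_ray_le hσ hσ1 (p := p) hq O he hm hie hA0.le hKA
  have hG' := hΛ.betaPow_mul_sum_ray_le hσ hσ1 (p := p) (i := j) (j := i) hq O he' hm' hje hA0.le
    (by rw [norm_one_sub_inner_comm]; exact hKA)
  have hi0 := betaPow_mul_le_chainSum hσ1' hΛ q p O i j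
  have hj0 := betaPow_mul_le_chainSum hσ1' hΛ q p O j i
  rw [betaPow_comm q (j : Cn n), chainSum_comm] at hG' hj0
  rw [← hC] at hG hG'
  set G := chainSum Λ q p O i j with hGdef
  set b := betaPow q (i : Cn n) j with hb
  calc b * (O i ^ p + O j ^ p + ‖F i - F j‖ₑ ^ p)
      ≤ b * (O i ^ p + O j ^ p + (O i ^ p + O j ^ p + 3 * ∑ k ∈ Finset.Icc K N, O (m k) ^ p +
          3 * ∑ k ∈ Finset.Icc K N', O (m' k) ^ p)) := by gcongr
    _ = 2 * (b * O i ^ p) + 2 * (b * O j ^ p) + 3 * (b * ∑ k ∈ Finset.Icc K N, O (m k) ^ p) +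
          3 * (b * ∑ k ∈ Finset.Icc K N', O (m' k) ^ p) := by ring
    _ ≤ 2 * G + 2 * G + 3 * (ENNReal.ofReal C * G) + 3 * (ENNReal.ofReal C * G) := by gcongr
    _ = (4 + 6 * ENNReal.ofReal C) * G := by ring
    _ = _ := by
        congr 1
        rw [ENNReal.ofReal_add (by norm_num) (by positivity), ENNReal.ofReal_mul (by norm_num)]
        simp

end Chain

section LocalOscillation

variable {n : ℕ} {γ : ℝ} {f : Cn n → ℂ}

/-! ### Local averages, local oscillations and matrix entries of the commutator -/

/-- The average of `f` over `Q` with respect to `v_γ`. -/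
def localAvg (γ : ℝ) (f : Cn n → ℂ) (Q : Set (Cn n)) : ℂ := ⨍ w in Q, f w ∂(weightedMeasure n γ)

lemma memLp_indicator_one (hγ : -1 < γ) {Q : Set (Cn n)} (hQ : MeasurableSet Q) :
    MemLp (Q.indicator fun _ => (1 : ℂ)) 2 (weightedMeasure n γ) := by
  have := isProbabilityMeasure_weightedMeasure (n := n) hγ
  exact memLp_indicator_const 2 hQ 1 (Or.inr (measure_ne_top _ _))

/-- The indicator function of `Q` in `L²`. -/
def indVec (hγ : -1 < γ) {Q : Set (Cn n)} (hQ : MeasurableSet Q) : L2 n γ :=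
  (memLp_indicator_one hγ hQ).toLp _

lemma memLp_indicator_sub (hγ : -1 < γ) (hf : MemLp f 2 (weightedMeasure n γ)) {Q : Set (Cn n)}
    (hQ : MeasurableSet Q) (c : ℂ) :
    MemLp (Q.indicator fun w => f w - c) 2 (weightedMeasure n γ) := by
  have := isProbabilityMeasure_weightedMeasure (n := n) hγ
  exact (hf.sub (memLp_const c)).indicator hQ

/-- The deviation of `f` from its average over `Q`, as an element of `L²` supported in `Q`. -/
def oscVec (hγ : -1 < γ) (hf : MemLp f 2 (weightedMeasure n γ)) {Q : Set (Cn n)}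
    (hQ : MeasurableSet Q) : L2 n γ :=
  (memLp_indicator_sub hγ hf hQ (localAvg γ f Q)).toLp _

variable {Q Q' : Set (Cn n)}

lemma coeFn_indVec (hγ : -1 < γ) (hQ : MeasurableSet Q) :
    indVec hγ hQ =ᵐ[weightedMeasure n γ] Q.indicator fun _ => 1 := MemLp.coeFn_toLp _

lemma coeFn_oscVec (hγ : -1 < γ) (hf : MemLp f 2 (weightedMeasure n γ)) (hQ : MeasurableSet Q) :
    oscVec hγ hf hQ =ᵐ[weightedMeasure n γ] Q.indicator fun w => f w - localAvg γ f Q :=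
  MemLp.coeFn_toLp _

lemma norm_indVec_sq (hγ : -1 < γ) (hQ : MeasurableSet Q) :
    ‖indVec hγ hQ‖ ^ 2 = (weightedMeasure n γ).real Q := by
  rw [indVec, norm_toLp_sq, ← integral_indicator_one hQ]
  refine integral_congr_ae (Filter.Eventually.of_forall fun w => ?_)
  by_cases hw : w ∈ Q <;> simp [hw]

lemma norm_indVec (hγ : -1 < γ) (hQ : MeasurableSet Q) :
    ‖indVec hγ hQ‖ = √((weightedMeasure n γ).real Q) := by
  rw [← norm_indVec_sq hγ hQ, Real.sqrt_sq (norm_nonneg _)]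

lemma inner_indVec (hγ : -1 < γ) (hQ : MeasurableSet Q) (g : L2 n γ) :
    inner ℂ (indVec hγ hQ) g = ∫ w in Q, g w ∂(weightedMeasure n γ) := by
  rw [L2.inner_def, ← integral_indicator hQ]
  refine integral_congr_ae ?_
  filter_upwards [coeFn_indVec hγ hQ] with w hw
  rw [hw]
  by_cases hwQ : w ∈ Q <;> simp [hwQ]

lemma integral_sub_localAvg (hγ : -1 < γ) (hf : MemLp f 2 (weightedMeasure n γ))
    (hQ0 : 0 < (weightedMeasure n γ).real Q) (c : ℂ) :
    ∫ w in Q, (f w - c) ∂(weightedMeasure n γ) =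
      ((weightedMeasure n γ).real Q : ℂ) * (localAvg γ f Q - c) := by
  have := isProbabilityMeasure_weightedMeasure (n := n) hγ
  have hfi : Integrable f (weightedMeasure n γ) := hf.integrable (by norm_num)
  have hne : (((weightedMeasure n γ).real Q : ℝ) : ℂ) ≠ 0 := Complex.ofReal_ne_zero.2 hQ0.ne'
  rw [integral_sub hfi.integrableOn (integrable_const c), setIntegral_const, localAvg,
    setAverage_eq, Complex.real_smul, Complex.real_smul]
  push_cast
  field_simp

lemma inner_indVec_oscVec (hγ : -1 < γ) (hf : MemLp f 2 (weightedMeasure n γ))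
    (hQ : MeasurableSet Q) (hQ0 : 0 < (weightedMeasure n γ).real Q) :
    inner ℂ (indVec hγ hQ) (oscVec hγ hf hQ) = 0 := by
  rw [inner_indVec]
  have h := integral_sub_localAvg hγ hf hQ0 (localAvg γ f Q)
  rw [sub_self, mul_zero] at h
  rw [← h]
  refine setIntegral_congr_ae hQ ?_
  filter_upwards [coeFn_oscVec hγ hf hQ] with w hw hwQ
  rw [hw, Set.indicator_of_mem hwQ]

/-- The quadratic mean oscillation of `f` over `Q`. -/
def localOsc (hγ : -1 < γ) (hf : MemLp f 2 (weightedMeasure n γ)) (hQ : MeasurableSet Q) : ℝ :=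
  ‖oscVec hγ hf hQ‖ / √((weightedMeasure n γ).real Q)

lemma localOsc_nonneg (hγ : -1 < γ) (hf : MemLp f 2 (weightedMeasure n γ)) (hQ : MeasurableSet Q) :
    0 ≤ localOsc hγ hf hQ := by
  unfold localOsc
  positivity

lemma norm_oscVec (hγ : -1 < γ) (hf : MemLp f 2 (weightedMeasure n γ)) (hQ : MeasurableSet Q)
    (hQ0 : 0 < (weightedMeasure n γ).real Q) :
    ‖oscVec hγ hf hQ‖ = √((weightedMeasure n γ).real Q) * localOsc hγ hf hQ := by
  rw [localOsc, mul_div_cancel₀ _ (Real.sqrt_pos.2 hQ0).ne']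

/-- Averages over a smaller set deviate by at most a multiple of the oscillation. -/
lemma norm_localAvg_sub_le (hγ : -1 < γ) (hf : MemLp f 2 (weightedMeasure n γ))
    (hQ : MeasurableSet Q) (hQ' : MeasurableSet Q') (hsub : Q' ⊆ Q) {c : ℝ} (hc : 0 < c)
    (hQ0 : 0 < (weightedMeasure n γ).real Q)
    (hcQ : c * (weightedMeasure n γ).real Q ≤ (weightedMeasure n γ).real Q') :
    ‖localAvg γ f Q' - localAvg γ f Q‖ ≤ (√c)⁻¹ * localOsc hγ hf hQ := by
  set μ := (weightedMeasure n γ).real Q with hμ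
  set μ' := (weightedMeasure n γ).real Q' with hμ'
  have hμ0' : 0 < μ' := lt_of_lt_of_le (by positivity) hcQ
  -- The difference of the means is the pairing of the indicator of `Q'` with the deviation on `Q`;
  -- Cauchy-Schwarz finishes.
  have h1 : inner ℂ (indVec hγ hQ') (oscVec hγ hf hQ) =
      (μ' : ℂ) * (localAvg γ f Q' - localAvg γ f Q) := by
    rw [inner_indVec, ← integral_sub_localAvg hγ hf hμ0']
    refine setIntegral_congr_ae hQ' ?_
    filter_upwards [coeFn_oscVec hγ hf hQ] with w hw hwQ
    rw [hw, Set.indicator_of_mem (hsub hwQ)]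
  have h2 := norm_inner_le_norm (𝕜 := ℂ) (indVec hγ hQ') (oscVec hγ hf hQ)
  rw [h1, norm_mul, Complex.norm_real, Real.norm_of_nonneg hμ0'.le, norm_indVec,
    norm_oscVec hγ hf hQ hQ0, ← hμ, ← hμ'] at h2
  set d := ‖localAvg γ f Q' - localAvg γ f Q‖ with hd
  have hs' : 0 < √μ' := Real.sqrt_pos.2 hμ0'
  have hsc : 0 < √c := Real.sqrt_pos.2 hc
  have h3 : √μ' * d ≤ √μ * localOsc hγ hf hQ := by
    refine le_of_mul_le_mul_left ?_ hs'
    calc √μ' * (√μ' * d) = μ' * d := by rw [← mul_assoc, Real.mul_self_sqrt hμ0'.le]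
      _ ≤ _ := h2
  have h4 : √c * √μ ≤ √μ' := by
    rw [← Real.sqrt_mul hc.le]
    exact Real.sqrt_le_sqrt hcQ
  have h5 : √μ * (√c * d) ≤ √μ * localOsc hγ hf hQ := by
    calc √μ * (√c * d) = (√c * √μ) * d := by ring
      _ ≤ √μ' * d := by gcongr
      _ ≤ _ := h3
  rw [le_inv_mul_iff₀ hsc]
  exact le_of_mul_le_mul_left h5 (Real.sqrt_pos.2 hQ0)

/-- If the kernel is within `k` of a constant on `Q`, then the projection of a function supported
in `Q` is almost its integral. -/
lemma norm_inner_kerVec_sub_le (hγ : -1 < γ) (hQ : MeasurableSet Q) {w : Cn n}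
    (hw : w ∈ unitBall n) {c k : ℝ} (hk0 : 0 ≤ k)
    (hk : ∀ z ∈ Q, ‖bergmanKernel (n + 1 + γ) z w - c‖ ≤ k) {g : L2 n γ}
    (hg : ∀ᵐ z ∂(weightedMeasure n γ), z ∉ Q → g z = 0) :
    ‖inner ℂ (kerVec hγ hw) g - c * inner ℂ (indVec hγ hQ) g‖ ≤
      k * √((weightedMeasure n γ).real Q) * ‖g‖ := by
  have hprob := isProbabilityMeasure_weightedMeasure (n := n) hγ
  have hx : MemLp (Q.indicator fun z => bergmanKernel (n + 1 + γ) z w - c) 2 (weightedMeasure n γ) :=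
    ((memLp_bergmanKernel hγ hw 2).sub (memLp_const _)).indicator hQ
  have h1 : inner ℂ (hx.toLp _) g = inner ℂ (kerVec hγ hw) g - c * inner ℂ (indVec hγ hQ) g := by
    rw [show (c : ℂ) * inner ℂ (indVec hγ hQ) g = inner ℂ ((c : ℂ) • indVec hγ hQ) g by
      rw [inner_smul_left, Complex.conj_ofReal], ← inner_sub_left, L2.inner_def, L2.inner_def]
    refine integral_congr_ae ?_
    filter_upwards [hx.coeFn_toLp, Lp.coeFn_sub (kerVec hγ hw) ((c : ℂ) • indVec hγ hQ),
      Lp.coeFn_smul (c : ℂ) (indVec hγ hQ), coeFn_kerVec hγ hw, coeFn_indVec hγ hQ, hg]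
      with z h1 h2 h3 h4 h5 h6
    rw [h1, h2, Pi.sub_apply, h3, Pi.smul_apply, h4, h5]
    by_cases hz : z ∈ Q
    · simp [hz]
    · rw [h6 hz, inner_zero_right, inner_zero_right]
  rw [← h1]
  refine (norm_inner_le_norm _ _).trans (mul_le_mul_of_nonneg_right ?_ (norm_nonneg _))
  rw [← sq_le_sq₀ (norm_nonneg _) (by positivity), norm_toLp_sq, mul_pow,
    Real.sq_sqrt measureReal_nonneg, mul_comm, ← smul_eq_mul, ← setIntegral_const,
    ← integral_indicator hQ]
  refine integral_mono_of_nonneg (Filter.Eventually.of_forall fun z => by positivity)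
    ((integrable_const _).indicator hQ) (Filter.Eventually.of_forall fun z => ?_)
  by_cases hz : z ∈ Q
  · simp only [Set.indicator_of_mem hz]
    exact pow_le_pow_left₀ (norm_nonneg _) (hk z hz) 2
  · simp [Set.indicator_of_notMem hz]

lemma integral_norm_mul_norm_le (x y : L2 n γ) :
    ∫ w, ‖x w‖ * ‖y w‖ ∂(weightedMeasure n γ) ≤ ‖x‖ * ‖y‖ := by
  have h := integral_mul_norm_le_Lp_mul_Lq (μ := weightedMeasure n γ) (f := x) (g := y)
    (p := 2) (q := 2) Real.HolderConjugate.two_two (by simpa using Lp.memLp x)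
    (by simpa using Lp.memLp y)
  have hn : ∀ u : L2 n γ, (∫ w, ‖u w‖ ^ (2 : ℝ) ∂(weightedMeasure n γ)) ^ (1 / (2 : ℝ)) = ‖u‖ := by
    intro u
    have h1 := norm_toLp_sq (Lp.memLp u)
    rw [Lp.toLp_coeFn] at h1
    simp only [Real.rpow_two]
    rw [← h1, ← Real.sqrt_eq_rpow, Real.sqrt_sq (norm_nonneg _)]
  rwa [hn, hn] at h

lemma indVec_mem_domain (hn : 1 ≤ n) (hγ : -1 < γ) (hf : MemLp f 2 (weightedMeasure n γ))
    (hQ : MeasurableSet Q) {r : ℝ} (hr : r < 1) (hQr : ∀ w ∈ Q, ‖w‖ ≤ r) :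
    indVec hγ hQ ∈ (commutator n γ f).domain := by
  refine mem_domain_of_bounded hn hγ hf (C := 1) (r := r) zero_le_one hr ?_
  filter_upwards [coeFn_indVec hγ hQ] with w hw
  rw [hw]
  constructor
  · by_cases hwQ : w ∈ Q <;> simp [hwQ]
  · intro hrw
    exact Set.indicator_of_notMem (fun hwQ => not_le.2 hrw (hQr w hwQ)) _

variable {T : L2 n γ →L[ℂ] L2 n γ}

/-- Constants commute with the projection, so `f` may be replaced by its deviation from the mean
over `Q`. -/
lemma extension_indVec_ae_eq (hn : 1 ≤ n) (hγ : -1 < γ) (hf : MemLp f 2 (weightedMeasure n γ))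
    (hT : ∀ x : (commutator n γ f).domain, T (x : L2 n γ) = commutator n γ f x)
    (hQ : MeasurableSet Q) {r : ℝ} (hr : r < 1) (hQr : ∀ w ∈ Q, ‖w‖ ≤ r) :
    ∀ᵐ w ∂(weightedMeasure n γ), ∀ hw : w ∈ unitBall n, T (indVec hγ hQ) w =
      (f w - localAvg γ f Q) * inner ℂ (kerVec hγ hw) (indVec hγ hQ) -
        inner ℂ (kerVec hγ hw) (oscVec hγ hf hQ) := by
  have hd := indVec_mem_domain hn hγ hf hQ hr hQr
  obtain ⟨h1, h2⟩ := mem_commutator_domain.1 hd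
  have hTe : T (indVec hγ hQ) = h1.toLp _ - bergmanProj n γ (h2.toLp _) := hT ⟨_, hd⟩
  have hfe : h2.toLp _ = oscVec hγ hf hQ + localAvg γ f Q • indVec hγ hQ := by
    refine Lp.ext ?_
    filter_upwards [h2.coeFn_toLp, Lp.coeFn_add (oscVec hγ hf hQ) (localAvg γ f Q • indVec hγ hQ),
      Lp.coeFn_smul (localAvg γ f Q) (indVec hγ hQ), coeFn_indVec hγ hQ, coeFn_oscVec hγ hf hQ]
      with w e1 e2 e3 e4 e5
    rw [e1, e2, Pi.add_apply, e3, Pi.smul_apply, e4, e5]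
    by_cases hw : w ∈ Q <;> simp [hw]
  rw [hTe, hfe]
  filter_upwards [Lp.coeFn_sub (h1.toLp _)
      (bergmanProj n γ (oscVec hγ hf hQ + localAvg γ f Q • indVec hγ hQ)), h1.coeFn_toLp,
    bergmanProj_ae_eq hn hγ (indVec hγ hQ),
    bergmanProj_ae_eq hn hγ (oscVec hγ hf hQ + localAvg γ f Q • indVec hγ hQ)] with w e1 e2 e3 e4 hw
  rw [e1, Pi.sub_apply, e2, e3 hw, e4 hw, inner_add_right, inner_smul_right]
  ring

/-- Matrix entries of the commutator between indicators and local deviations. -/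
theorem norm_inner_oscVec_sub_le (hn : 1 ≤ n) (hγ : -1 < γ) (hf : MemLp f 2 (weightedMeasure n γ))
    (hT : ∀ x : (commutator n γ f).domain, T (x : L2 n γ) = commutator n γ f x)
    (hQ : MeasurableSet Q) (hQ' : MeasurableSet Q') (hQB : Q' ⊆ unitBall n)
    {r : ℝ} (hr : r < 1) (hQr : ∀ w ∈ Q, ‖w‖ ≤ r)
    (hQ0 : 0 < (weightedMeasure n γ).real Q) (hQ0' : 0 < (weightedMeasure n γ).real Q')
    {c k : ℝ} (hk0 : 0 ≤ k)
    (hk : ∀ w ∈ Q', ∀ z ∈ Q, ‖bergmanKernel (n + 1 + γ) z w - c‖ ≤ k) :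
    ‖inner ℂ (oscVec hγ hf hQ') (T (indVec hγ hQ)) -
      c * ((weightedMeasure n γ).real Q * (weightedMeasure n γ).real Q' *
        localOsc hγ hf hQ' ^ 2 : ℝ)‖ ≤
      k * ((weightedMeasure n γ).real Q * (weightedMeasure n γ).real Q') * localOsc hγ hf hQ' *
        (localOsc hγ hf hQ' + localOsc hγ hf hQ + ‖localAvg γ f Q' - localAvg γ f Q‖) := by
  set μ := (weightedMeasure n γ).real Q with hμ
  set μ' := (weightedMeasure n γ).real Q' with hμ'
  set x := oscVec hγ hf hQ' with hx
  set e := indVec hγ hQ with he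
  set e' := indVec hγ hQ' with he'
  set d := localAvg γ f Q' - localAvg γ f Q with hd
  set c' : ℂ := (c : ℂ) * (μ : ℂ) with hc'
  -- Freezing the kernel at the constant `c` turns `T e` on `Q'` into `c μ (x + d)`; `Y` is the
  -- remaining error. Pairing with `x` kills the `d` term, as `x` has mean zero on `Q'`, and leaves
  -- the main term `c μ ‖x‖²`.
  set Y : L2 n γ := T e - c' • x - (c' * d) • e' with hY
  have hxn : ‖x‖ ^ 2 = μ' * localOsc hγ hf hQ' ^ 2 := by
    rw [hx, norm_oscVec hγ hf hQ' hQ0', mul_pow, Real.sq_sqrt hQ0'.le]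
  have hinner : inner ℂ x Y = inner ℂ x (T e) - c * (μ * μ' * localOsc hγ hf hQ' ^ 2 : ℝ) := by
    have h1 : inner ℂ x e' = 0 := inner_eq_zero_symm.1 (inner_indVec_oscVec hγ hf hQ' hQ0')
    have h2 : inner ℂ x x = ((μ' * localOsc hγ hf hQ' ^ 2 : ℝ) : ℂ) := by
      rw [inner_self_eq_norm_sq_to_K, ← hxn]
      push_cast
      rfl
    rw [hY, inner_sub_right, inner_sub_right, inner_smul_right, inner_smul_right, h1, h2, mul_zero,
      sub_zero, hc']
    push_cast
    ring
  have hY_ae : ∀ᵐ w ∂(weightedMeasure n γ), w ∈ Q' →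
      ‖Y w‖ ≤ k * μ * ‖x w‖ + k * μ * (localOsc hγ hf hQ + ‖d‖) := by
    filter_upwards [extension_indVec_ae_eq hn hγ hf hT hQ hr hQr,
      Lp.coeFn_sub (T e - c' • x) ((c' * d) • e'), Lp.coeFn_sub (T e) (c' • x),
      Lp.coeFn_smul c' x, Lp.coeFn_smul (c' * d) e', coeFn_oscVec hγ hf hQ', coeFn_indVec hγ hQ']
      with w h1 h2 h3 h4 h5 h6 h7 hwQ
    have hwB := hQB hwQ
    have hA : ‖inner ℂ (kerVec hγ hwB) e - c'‖ ≤ k * μ := by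
      have h := norm_inner_kerVec_sub_le hγ hQ hwB hk0 (hk w hwQ) (g := e) (by
        filter_upwards [coeFn_indVec hγ hQ] with z hz hzQ
        rw [he, hz, Set.indicator_of_notMem hzQ])
      have h8 : inner ℂ e e = (μ : ℂ) := by
        rw [inner_self_eq_norm_sq_to_K, hμ, ← norm_indVec_sq hγ hQ]
        push_cast
        rfl
      rw [h8, mul_assoc, he, norm_indVec, Real.mul_self_sqrt hQ0.le] at h
      exact h
    have hB : ‖inner ℂ (kerVec hγ hwB) (oscVec hγ hf hQ)‖ ≤ k * μ * localOsc hγ hf hQ := by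
      have h := norm_inner_kerVec_sub_le hγ hQ hwB hk0 (hk w hwQ) (g := oscVec hγ hf hQ) (by
        filter_upwards [coeFn_oscVec hγ hf hQ] with z hz hzQ
        rw [hz, Set.indicator_of_notMem hzQ])
      rw [inner_indVec_oscVec hγ hf hQ hQ0, mul_zero, sub_zero, norm_oscVec hγ hf hQ hQ0,
        ← hμ] at h
      calc _ ≤ _ := h
        _ = k * (√μ * √μ) * localOsc hγ hf hQ := by ring
        _ = _ := by rw [Real.mul_self_sqrt hQ0.le]
    have hxw : x w = f w - localAvg γ f Q' := by rw [hx, h6, Set.indicator_of_mem hwQ]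
    have hYw : Y w = (x w + d) * (inner ℂ (kerVec hγ hwB) e - c') -
        inner ℂ (kerVec hγ hwB) (oscVec hγ hf hQ) := by
      rw [hY, h2, Pi.sub_apply, h3, Pi.sub_apply, h4, h5, Pi.smul_apply, Pi.smul_apply, h7,
        Set.indicator_of_mem hwQ, h1 hwB, hxw, hd, smul_eq_mul, smul_eq_mul]
      ring
    rw [hYw]
    refine (norm_sub_le _ _).trans ?_
    rw [norm_mul]
    have h9 : ‖x w + d‖ * ‖inner ℂ (kerVec hγ hwB) e - c'‖ ≤ (‖x w‖ + ‖d‖) * (k * μ) := by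
      gcongr
      exact norm_add_le _ _
    linarith
  have hxe : Integrable (fun w => ‖x w‖ * ‖e' w‖) (weightedMeasure n γ) :=
    (Lp.memLp x).norm.integrable_mul (Lp.memLp e').norm
  have hxx : Integrable (fun w => ‖x w‖ ^ 2) (weightedMeasure n γ) :=
    (Lp.memLp x).integrable_norm_pow two_ne_zero
  have hbound : ‖inner ℂ x Y‖ ≤ ∫ w, (k * μ * ‖x w‖ ^ 2 +
      k * μ * (localOsc hγ hf hQ + ‖d‖) * (‖x w‖ * ‖e' w‖)) ∂(weightedMeasure n γ) := by
    rw [L2.inner_def]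
    refine norm_integral_le_of_norm_le ((hxx.const_mul _).add (hxe.const_mul _)) ?_
    filter_upwards [hY_ae, coeFn_oscVec hγ hf hQ', coeFn_indVec hγ hQ'] with w h1 h2 h3
    by_cases hw : w ∈ Q'
    · refine (norm_inner_le_norm _ _).trans ?_
      rw [he', h3, Set.indicator_of_mem hw, norm_one, mul_one]
      calc ‖x w‖ * ‖Y w‖ ≤ ‖x w‖ * (k * μ * ‖x w‖ + k * μ * (localOsc hγ hf hQ + ‖d‖)) := by
            gcongr
            exact h1 hw
        _ = _ := by ring
    · rw [hx, h2, Set.indicator_of_notMem hw, inner_zero_left]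
      simp
  rw [← hinner]
  refine hbound.trans ?_
  rw [integral_add (hxx.const_mul _) (hxe.const_mul _), integral_const_mul, integral_const_mul]
  have h1 : ∫ w, ‖x w‖ ^ 2 ∂(weightedMeasure n γ) = ‖x‖ ^ 2 := by
    have := norm_toLp_sq (Lp.memLp x)
    rw [Lp.toLp_coeFn] at this
    exact this.symm
  have h2 := integral_norm_mul_norm_le x e'
  have h3 : ‖x‖ * ‖e'‖ = μ' * localOsc hγ hf hQ' := by
    rw [he', norm_indVec, hx, norm_oscVec hγ hf hQ' hQ0', ← hμ', mul_right_comm,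
      Real.mul_self_sqrt hQ0'.le]
  rw [h3] at h2
  rw [h1, hxn]
  have h4 := localOsc_nonneg hγ hf hQ
  have h5 : 0 ≤ μ := hQ0.le
  calc k * μ * (μ' * localOsc hγ hf hQ' ^ 2) + k * μ * (localOsc hγ hf hQ + ‖d‖) *
        ∫ w, ‖x w‖ * ‖e' w‖ ∂(weightedMeasure n γ)
      ≤ k * μ * (μ' * localOsc hγ hf hQ' ^ 2) + k * μ * (localOsc hγ hf hQ + ‖d‖) *
        (μ' * localOsc hγ hf hQ') := by gcongr
    _ = _ := by ring

end LocalOscillation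

section Absorption

variable {n : ℕ} {σ : ℝ} {Λ : Set (Cn n)}

/-! ### Absorption of the off-diagonal part -/

/-- Greedy colouring of a finite graph of bounded degree. -/
lemma exists_coloring {ι : Type*} (r : ι → ι → Prop) (hr : ∀ i j, r i j → r j i) (D : ℕ)
    (F : Finset ι) (hdeg : ∀ i ∈ F, {j ∈ (F : Set ι) | r i j}.ncard ≤ D) :
    ∃ col : ι → Fin (D + 1), ∀ i ∈ F, ∀ j ∈ F, i ≠ j → r i j → col i ≠ col j := by
  classical
  induction F using Finset.induction_on with
  | empty => exact ⟨fun _ => 0, by simp⟩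
  | insert a F ha ih =>
    obtain ⟨col, hcol⟩ := ih fun i hi => by
      refine (Set.ncard_le_ncard ?_ ?_).trans (hdeg i (Finset.mem_insert_of_mem hi))
      · exact fun j hj => ⟨by simpa using Or.inr hj.1, hj.2⟩
      · exact (Finset.finite_toSet _).subset fun j hj => hj.1
    have hcard : (Finset.image col (F.filter (r a))).card < Fintype.card (Fin (D + 1)) := by
      rw [Fintype.card_fin]
      refine Nat.lt_succ_of_le (Finset.card_image_le.trans ?_)
      rw [← Set.ncard_coe_finset]
      refine (Set.ncard_le_ncard ?_ ?_).trans (hdeg a (Finset.mem_insert_self a F))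
      · intro j hj
        rw [Finset.mem_coe, Finset.mem_filter] at hj
        exact ⟨by simpa using Or.inr hj.1, hj.2⟩
      · exact (Finset.finite_toSet _).subset fun j hj => hj.1
    obtain ⟨c, -, hc⟩ := Finset.exists_mem_notMem_of_card_lt_card
      (s := Finset.image col (F.filter (r a))) (t := Finset.univ) (by simpa using hcard)
    have hc' : ∀ j ∈ F, r a j → col j ≠ c := fun j hj hrj h =>
      hc (Finset.mem_image.2 ⟨j, Finset.mem_filter.2 ⟨hj, hrj⟩, h⟩)
    refine ⟨Function.update col a c, fun i hi j hj hij hrij => ?_⟩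
    rcases Finset.mem_insert.1 hi with rfl | hi' <;> rcases Finset.mem_insert.1 hj with rfl | hj'
    · exact absurd rfl hij
    · rw [Function.update_self, Function.update_of_ne hij.symm]
      exact (hc' j hj' hrij).symm
    · rw [Function.update_self, Function.update_of_ne hij]
      exact hc' i hi' (hr _ _ hrij)
    · rw [Function.update_of_ne (by rintro rfl; exact ha hi'),
        Function.update_of_ne (by rintro rfl; exact ha hj')]
      exact hcol i hi' j hj' hij hrij

/-- Lowering the exponent gains a small factor for well separated points; this factor makes the
absorption possible. -/
lemma betaPow_le_mul_betaPow {q q' δ : ℝ} (hq : q' ≤ q) {i j : Cn n} (hi : i ∈ unitBall n)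
    (hj : j ∈ unitBall n) (h : beta i j ≤ δ) :
    betaPow q i j ≤ ENNReal.ofReal (δ ^ (q - q')) * betaPow q' i j := by
  have h0 := beta_pos hi hj
  have hδ : 0 < δ := h0.trans_le h
  rw [betaPow, betaPow, ← ENNReal.ofReal_mul (by positivity)]
  refine ENNReal.ofReal_le_ofReal ?_
  calc beta i j ^ q = beta i j ^ (q - q') * beta i j ^ q' := by
        rw [← Real.rpow_add h0, sub_add_cancel]
    _ ≤ _ := by gcongr

/-- The lattice points in a smaller ball. -/
lemma IsLattice.finite_le (hn : 1 ≤ n) (hσ : 0 < σ) (hσ1 : σ < 1) (hΛ : IsLattice σ Λ) {η : ℝ}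
    (hη : 0 < η) : {m : Λ | η ≤ 1 - ‖(m : Cn n)‖ ^ 2}.Finite := by
  obtain ⟨C, -, hC⟩ := exists_tsum_betaPow_le hn (q := n + 1) (ε := σ ^ 2 / 4) (by linarith)
    (by positivity)
  have h0 : (0 : Cn n) ∈ unitBall n := by simp [mem_unitBall]
  have h1 := hC Λ (hΛ.subset hσ1) hΛ.separated 0 h0
  refine (ENNReal.finite_const_le_of_tsum_ne_top (ne_top_of_le_ne_top ENNReal.ofReal_ne_top h1)
    (ε := ENNReal.ofReal (η ^ ((n : ℝ) + 1))) (by simpa using Real.rpow_pos_of_pos hη _)).subset ?_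
  intro m hm
  have hm' : η ≤ 1 - ‖(m : Cn n)‖ ^ 2 := hm
  refine Set.mem_ofPred.2 (ENNReal.ofReal_le_ofReal ?_)
  have hb : beta 0 (m : Cn n) = 1 - ‖(m : Cn n)‖ ^ 2 := by simp [beta]
  rw [hb]
  gcongr

lemma IsLattice.ncard_le (hσ1 : σ < 1) (hΛ : IsLattice σ Λ) {q C δ : ℝ} (hC0 : 0 < C)
    (hδ : 0 < δ) (hq : 0 < q)
    (hC : ∀ z ∈ unitBall n, ∑' m : Λ, betaPow q z m ≤ ENNReal.ofReal C) (F : Finset Λ) (i : Λ) :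
    {j ∈ (F : Set Λ) | δ < beta (i : Cn n) j}.ncard ≤ ⌈C / δ ^ q⌉₊ := by
  classical
  have hδq : 0 < δ ^ q := Real.rpow_pos_of_pos hδ _
  have hset : {j ∈ (F : Set Λ) | δ < beta (i : Cn n) j} =
      ((F.filter fun j : Λ => δ < beta (i : Cn n) j : Finset Λ) : Set Λ) := by
    ext j
    simp
  rw [hset, Set.ncard_coe_finset]
  set G := F.filter fun j : Λ => δ < beta (i : Cn n) j with hG
  have h1 : (G.card : ℝ≥0∞) * ENNReal.ofReal (δ ^ q) ≤ ENNReal.ofReal C := by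
    calc (G.card : ℝ≥0∞) * ENNReal.ofReal (δ ^ q) = ∑ _j ∈ G, ENNReal.ofReal (δ ^ q) := by
          rw [Finset.sum_const, nsmul_eq_mul]
      _ ≤ ∑ j ∈ G, betaPow q (i : Cn n) j := by
          refine Finset.sum_le_sum fun j hj => ENNReal.ofReal_le_ofReal ?_
          have := (Finset.mem_filter.1 hj).2
          gcongr
      _ ≤ _ := (ENNReal.sum_le_tsum _).trans (hC i (hΛ.subset hσ1 i.2))
  rw [← ENNReal.ofReal_natCast, ← ENNReal.ofReal_mul (by positivity),
    ENNReal.ofReal_le_ofReal_iff hC0.le] at h1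
  have h2 : (G.card : ℝ) ≤ C / δ ^ q := by rwa [le_div_iff₀ hδq]
  exact_mod_cast h2.trans (Nat.le_ceil _)

/-- The indicator in `chainSum` admits only points no closer to the sphere than the closer of `i`
and `j`, so a truncation by depth contains all intermediate points. Summing over `i` and `j` then
leaves one sum over `m`. -/
lemma sum_sum_chainSum_le {q p : ℝ} {C : ℝ≥0∞} (hΛB : Λ ⊆ unitBall n)
    (hC : ∀ z ∈ unitBall n, ∑' m : Λ, betaPow q z m ≤ C) (O : Λ → ℝ≥0∞) {η : ℝ} (F : Finset Λ)
    (hF : ∀ m : Λ, m ∈ F ↔ η ≤ 1 - ‖(m : Cn n)‖ ^ 2) :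
    ∑ i ∈ F, ∑ j ∈ F, chainSum Λ q p O i j ≤ C * C * ∑ m ∈ F, O m ^ p := by
  have h1 : ∀ i ∈ F, ∀ j ∈ F, chainSum Λ q p O i j ≤
      ∑ m ∈ F, betaPow q (i : Cn n) m * betaPow q (m : Cn n) j * O m ^ p := by
    intro i hi j hj
    unfold chainSum
    rw [tsum_eq_sum (s := F)]
    · refine Finset.sum_le_sum fun m _ => ?_
      exact Set.indicator_le_self' (fun _ _ => zero_le) m
    · intro m hm
      refine Set.indicator_of_notMem (fun hmem => hm ((hF m).2 ?_)) _
      exact (le_min ((hF i).1 hi) ((hF j).1 hj)).trans (Set.mem_ofPred.1 hmem)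
  calc ∑ i ∈ F, ∑ j ∈ F, chainSum Λ q p O i j
      ≤ ∑ i ∈ F, ∑ j ∈ F, ∑ m ∈ F, betaPow q (i : Cn n) m * betaPow q (m : Cn n) j * O m ^ p :=
        Finset.sum_le_sum fun i hi => Finset.sum_le_sum fun j hj => h1 i hi j hj
    _ = ∑ m ∈ F, (∑ i ∈ F, betaPow q (m : Cn n) i) * (∑ j ∈ F, betaPow q (m : Cn n) j) * O m ^ p := by
        have : ∀ i ∈ F, ∑ j ∈ F, ∑ m ∈ F,
            betaPow q (i : Cn n) m * betaPow q (m : Cn n) j * O m ^ p =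
            ∑ m ∈ F, ∑ j ∈ F, betaPow q (i : Cn n) m * betaPow q (m : Cn n) j * O m ^ p :=
          fun i _ => Finset.sum_comm
        rw [Finset.sum_congr rfl this, Finset.sum_comm]
        refine Finset.sum_congr rfl fun m _ => ?_
        rw [Finset.sum_mul_sum, Finset.sum_mul]
        refine Finset.sum_congr rfl fun i _ => ?_
        rw [Finset.sum_mul]
        exact Finset.sum_congr rfl fun j _ => by rw [betaPow_comm q (i : Cn n)]
    _ ≤ ∑ m ∈ F, C * C * O m ^ p := by
        refine Finset.sum_le_sum fun m _ => ?_
        have h2 : ∑ i ∈ F, betaPow q (m : Cn n) i ≤ C :=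
          (ENNReal.sum_le_tsum _).trans (hC m (hΛB m.2))
        gcongr
    _ = _ := by rw [← Finset.mul_sum]

/-- If the local oscillations of a slowly varying function on separated parts of the lattice are
controlled up to an off-diagonal term, then they are summable. -/
theorem tsum_rpow_ne_top (hn : 1 ≤ n) (hσ : 0 < σ) (hσ1 : σ ≤ 1 / 256) (hΛ : IsLattice σ Λ)
    {F : Λ → ℂ} {O : Λ → ℝ≥0∞} (hO : ∀ i, O i ≠ ∞) (hF : IsSlow σ F O) {p q : ℝ} (hp : 0 < p)
    (hp1 : p ≤ 1) (hq : n < q) {δ₀ : ℝ} (hδ₀ : 0 < δ₀) {B C₁ : ℝ≥0∞} (hB : B ≠ ∞) (hC₁ : C₁ ≠ ∞)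
    (hmain : ∀ J : Finset Λ, (∀ i ∈ J, ∀ j ∈ J, i ≠ j → beta (i : Cn n) j ≤ δ₀) →
      ∑ j ∈ J, O j ^ p ≤ B + C₁ * ∑ i ∈ J, ∑ j ∈ J, {j : Λ | i ≠ j}.indicator
        (fun j : Λ => betaPow q (i : Cn n) j * (O i ^ p + O j ^ p + ‖F i - F j‖ₑ ^ p)) j) :
    ∑' j, O j ^ p ≠ ∞ := by
  classical
  have hσ1' : σ < 1 := by linarith
  have hn0 : (0 : ℝ) ≤ n := by positivity
  -- The condition `q' > n` keeps the chain sums summable, and the gap `q - q'` supplies the small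
  -- factor `δ^(q - q')`.
  obtain ⟨q', hnq', hq'q⟩ := exists_between hq
  obtain ⟨C₂, hC₂, hchain⟩ := exists_chain_bound hn hσ hσ1 (q := q') (by linarith)
  obtain ⟨C₃, hC₃, hsum⟩ := exists_tsum_betaPow_le hn (ε := σ ^ 2 / 4) hnq' (by positivity)
  have hsum := hsum Λ (hΛ.subset hσ1') hΛ.separated
  obtain ⟨δ, hδ0, hδδ₀, hδ⟩ : ∃ δ : ℝ, 0 < δ ∧ δ ≤ δ₀ ∧
      C₁ * (ENNReal.ofReal (δ ^ (q - q')) * (ENNReal.ofReal C₂ *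
        (ENNReal.ofReal C₃ * ENNReal.ofReal C₃))) ≤ 2⁻¹ := by
    set L : ℝ := C₁.toReal * (C₂ * (C₃ * C₃)) with hL
    have hL0 : 0 ≤ L := by positivity
    have hlim : Filter.Tendsto (fun δ : ℝ => δ ^ (q - q') * L) (nhdsWithin 0 (Set.Ioi 0))
        (nhds 0) := by
      have h1 : Filter.Tendsto (fun δ : ℝ => δ ^ (q - q')) (nhds 0) (nhds 0) := by
        have := (Real.continuousAt_rpow_const 0 (q - q') (Or.inr (by linarith))).tendsto
        rwa [Real.zero_rpow (by linarith)] at this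
      simpa using (h1.mono_left nhdsWithin_le_nhds).mul_const L
    have he1 := hlim.eventually (gt_mem_nhds (show (0 : ℝ) < 1 / 2 by norm_num))
    have he2 : ∀ᶠ δ in nhdsWithin (0 : ℝ) (Set.Ioi 0), δ < δ₀ :=
      eventually_nhdsWithin_of_eventually_nhds (eventually_lt_nhds hδ₀)
    obtain ⟨δ, h1, h2, h3⟩ := (he1.and (he2.and self_mem_nhdsWithin)).exists
    have h3' : (0 : ℝ) < δ := h3
    refine ⟨δ, h3', h2.le, ?_⟩
    rw [← ENNReal.ofReal_toReal hC₁, ← ENNReal.ofReal_mul hC₃.le, ← ENNReal.ofReal_mul hC₂.le,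
      ← ENNReal.ofReal_mul (by positivity), ← ENNReal.ofReal_mul (by positivity),
      show (2⁻¹ : ℝ≥0∞) = ENNReal.ofReal (1 / 2) by
        rw [ENNReal.ofReal_div_of_pos two_pos]; simp]
    refine ENNReal.ofReal_le_ofReal (le_trans (le_of_eq ?_) h1.le)
    rw [hL]
    ring
  set D := ⌈C₃ / δ ^ q'⌉₊ with hD
  -- On a truncation `G`, points with `β > δ` form a graph of degree at most `D`. Each of `D + 1`
  -- colour classes satisfies the separation required by `hmain`, and adding the classes gives `S ≤
  -- (D + 1) B + S/2`, with constants independent of `η`.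
  have hfinbound : ∀ η : ℝ, 0 < η → ∀ G : Finset Λ, (∀ m : Λ, m ∈ G ↔ η ≤ 1 - ‖(m : Cn n)‖ ^ 2) →
      ∑ m ∈ G, O m ^ p ≤ 2 * ((D + 1 : ℕ) * B) := by
    intro η hη G hG
    obtain ⟨col, hcol⟩ := exists_coloring (fun i j : Λ => δ < beta (i : Cn n) j)
      (fun i j h => by rwa [beta_comm]) D G fun i _ =>
        hΛ.ncard_le hσ1' hC₃ hδ0 (by linarith) hsum G i
    set X : Λ → Λ → ℝ≥0∞ := fun i j => {j : Λ | i ≠ j}.indicator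
      (fun j : Λ => betaPow q (i : Cn n) j * (O i ^ p + O j ^ p + ‖F i - F j‖ₑ ^ p)) j with hX
    set S := ∑ m ∈ G, O m ^ p with hS
    have hSfin : S ≠ ∞ := by
      rw [hS]
      exact ENNReal.sum_ne_top.2 fun m _ => ENNReal.rpow_ne_top_of_nonneg hp.le (hO m)
    have hstep : S ≤ (D + 1 : ℕ) * B + C₁ * ∑ i ∈ G, ∑ j ∈ G with col j = col i, X i j := by
      calc S = ∑ c : Fin (D + 1), ∑ j ∈ G with col j = c, O j ^ p :=
            (Finset.sum_fiberwise G col _).symm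
        _ ≤ ∑ c : Fin (D + 1), (B + C₁ * ∑ i ∈ G with col i = c, ∑ j ∈ G with col j = c, X i j) := by
            refine Finset.sum_le_sum fun c _ => hmain _ fun i hi j hj hij => ?_
            rw [Finset.mem_filter] at hi hj
            by_contra hcon
            refine hcol i hi.1 j hj.1 hij (by linarith) (hi.2.trans hj.2.symm)
        _ = (D + 1 : ℕ) * B + C₁ * ∑ c : Fin (D + 1), ∑ i ∈ G with col i = c,
              ∑ j ∈ G with col j = col i, X i j := by
            rw [Finset.sum_add_distrib, Finset.sum_const, Finset.card_univ, Fintype.card_fin,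
              nsmul_eq_mul, ← Finset.mul_sum]
            congr 2
            refine Finset.sum_congr rfl fun c _ => Finset.sum_congr rfl fun i hi => ?_
            rw [(Finset.mem_filter.1 hi).2]
        _ = _ := by rw [Finset.sum_fiberwise G col fun i => ∑ j ∈ G with col j = col i, X i j]
    have hoff : ∑ i ∈ G, ∑ j ∈ G with col j = col i, X i j ≤
        ENNReal.ofReal (δ ^ (q - q')) * (ENNReal.ofReal C₂ *
          ∑ i ∈ G, ∑ j ∈ G, chainSum Λ q' p O i j) := by
      rw [Finset.mul_sum, Finset.mul_sum]
      refine Finset.sum_le_sum fun i hi => ?_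
      rw [Finset.mul_sum, Finset.mul_sum, Finset.sum_filter]
      refine Finset.sum_le_sum fun j hj => ?_
      split_ifs with hc
      · by_cases hij : i = j
        · rw [hX]
          simp [hij]
        · have hle : beta (i : Cn n) j ≤ δ := by
            by_contra hcon
            exact hcol i hi j hj hij (not_le.1 hcon) hc.symm
          rw [hX]
          simp only
          rw [Set.indicator_of_mem (show j ∈ {j : Λ | i ≠ j} from hij)]
          calc _ ≤ ENNReal.ofReal (δ ^ (q - q')) * betaPow q' (i : Cn n) j *
                (O i ^ p + O j ^ p + ‖F i - F j‖ₑ ^ p) := by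
                gcongr
                exact betaPow_le_mul_betaPow hq'q.le (hΛ.subset hσ1' i.2) (hΛ.subset hσ1' j.2) hle
            _ ≤ _ := by
                rw [mul_assoc]
                exact mul_le_mul_right (hchain Λ hΛ F O p hp hp1 hF i j) _
      · exact zero_le
    have hfin := sum_sum_chainSum_le (p := p) (hΛ.subset hσ1') hsum O G hG
    have hS2 : S ≤ (D + 1 : ℕ) * B + 2⁻¹ * S := by
      refine hstep.trans (add_le_add_right ?_ _)
      calc C₁ * ∑ i ∈ G, ∑ j ∈ G with col j = col i, X i j
          ≤ C₁ * (ENNReal.ofReal (δ ^ (q - q')) * (ENNReal.ofReal C₂ *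
            (ENNReal.ofReal C₃ * ENNReal.ofReal C₃ * S))) := by
            gcongr
            refine hoff.trans ?_
            gcongr
        _ = C₁ * (ENNReal.ofReal (δ ^ (q - q')) * (ENNReal.ofReal C₂ *
            (ENNReal.ofReal C₃ * ENNReal.ofReal C₃))) * S := by ring
        _ ≤ 2⁻¹ * S := by gcongr
    -- `S` is a finite sum of finite terms, so half of it may be cancelled.
    have hhalf : S = 2⁻¹ * S + 2⁻¹ * S := by rw [← add_mul, ENNReal.inv_two_add_inv_two, one_mul]
    have h2S : 2⁻¹ * S ≠ ∞ := ENNReal.mul_ne_top (by simp) hSfin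
    have h3 : 2⁻¹ * S ≤ (D + 1 : ℕ) * B := by
      refine (ENNReal.add_le_add_iff_right h2S).1 ?_
      rwa [← hhalf]
    calc S = 2 * (2⁻¹ * S) := by
          rw [← mul_assoc, ENNReal.mul_inv_cancel two_ne_zero ENNReal.ofNat_ne_top, one_mul]
      _ ≤ _ := by gcongr
  refine ne_top_of_le_ne_top (b := 2 * ((D + 1 : ℕ) * B))
    (ENNReal.mul_ne_top (by simp) (ENNReal.mul_ne_top (by simp) hB)) ?_
  rw [ENNReal.tsum_eq_iSup_sum]
  refine iSup_le fun J => ?_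
  obtain ⟨η, hη, hJη⟩ : ∃ η : ℝ, 0 < η ∧ ∀ m ∈ J, η ≤ 1 - ‖(m : Cn n)‖ ^ 2 := by
    rcases J.eq_empty_or_nonempty with rfl | hJ
    · exact ⟨1, one_pos, by simp⟩
    · obtain ⟨m₀, hm₀, hmin⟩ := J.exists_min_image (fun m => 1 - ‖(m : Cn n)‖ ^ 2) hJ
      exact ⟨_, one_sub_norm_sq_pos (hΛ.subset hσ1' m₀.2), hmin⟩
  have hfin := hΛ.finite_le hn hσ hσ1' hη
  refine le_trans ?_ (hfinbound η hη hfin.toFinset fun m => by simp)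
  exact Finset.sum_le_sum_of_subset fun m hm => by simpa using hJη m hm

end Absorption

section TestFunctions

variable {n : ℕ} {γ : ℝ} {f : Cn n → ℂ}

/-! ### Test functions on pseudohyperbolic balls -/

/-- The average of `f` over a pseudohyperbolic ball. -/
def ballAvg (γ : ℝ) (f : Cn n → ℂ) (ε : ℝ) (a : Cn n) : ℂ := localAvg γ f (nearSet a ε)

/-- The oscillation of `f` over a pseudohyperbolic ball. -/
def ballOsc (hγ : -1 < γ) (hf : MemLp f 2 (weightedMeasure n γ)) (ε : ℝ) (a : Cn n) : ℝ :=
  localOsc hγ hf (measurableSet_nearSet a ε)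

lemma ballOsc_nonneg (hγ : -1 < γ) (hf : MemLp f 2 (weightedMeasure n γ)) (ε : ℝ) (a : Cn n) :
    0 ≤ ballOsc hγ hf ε a := localOsc_nonneg _ _ _

/-- Averages over neighbouring balls differ by at most a multiple of the oscillations. -/
lemma exists_isSlow_ballAvg (hn : 1 ≤ n) (hγ : -1 < γ) (hf : MemLp f 2 (weightedMeasure n γ))
    {ε : ℝ} (hε : 0 < ε) (hε1 : ε ≤ 1 / 256) :
    ∃ σ C, 0 < σ ∧ σ ≤ 1 / 256 ∧ 1 ≤ C ∧
      (∀ x ∈ unitBall n, ∀ y ∈ unitBall n, ∀ w ∈ unitBall n, 1 - σ < beta x y → 1 - σ ≤ beta y w →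
        1 - ε < beta x w) ∧
      ∀ Λ : Set (Cn n), Λ ⊆ unitBall n → IsSlow (Λ := Λ) σ (fun i => ballAvg γ f ε i)
        (fun i => ENNReal.ofReal (C * ballOsc hγ hf ε i)) := by
  have hn0 : (0 : ℝ) ≤ n := by positivity
  -- A point near `i` is linked to `j` through `x` and `y`, four links in all, so the triangle
  -- inequality is applied at two nested scales. The small ball around `i` then lies in the
  -- `ε`-balls of both `i` and `j`, and both means are compared with the mean over it.
  obtain ⟨τ₁, hτ₁, -, htri₁⟩ := exists_beta_triangle n hε
  obtain ⟨τ₂, hτ₂, -, htri₂⟩ := exists_beta_triangle n (lt_min hε hτ₁)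
  set ε₁ := min τ₂ ε with hε₁
  have hε₁0 : 0 < ε₁ := lt_min hτ₂ hε
  have hε₁ε : ε₁ ≤ ε := min_le_right _ _
  have hε₁τ : ε₁ ≤ τ₂ := min_le_left _ _
  -- Halving makes `σ < τ₂` strictly, since the middle link in `IsSlow` allows equality.
  set σ := min (τ₂ / 2) (1 / 256) with hσ
  have hσ0 : 0 < σ := lt_min (by positivity) (by norm_num)
  have hστ : σ < τ₂ := (min_le_left _ _).trans_lt (by linarith)
  obtain ⟨c, C₁, hc, -, hcb⟩ := exists_weightedMeasure_nearSet_bounds hn hγ hε₁0 (hε₁ε.trans hε1)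
  obtain ⟨c', C, hc', hC, hCb⟩ := exists_weightedMeasure_nearSet_bounds hn hγ hε hε1
  set s : ℝ := (n : ℝ) + 1 + γ with hs
  have hs0 : 0 < s := by linarith
  set d := c / (C * 4 ^ s) with hd
  have hd0 : 0 < d := by positivity
  refine ⟨σ, 1 + (√d)⁻¹, hσ0, min_le_right _ _, ?_, ?_, ?_⟩
  · have : 0 < (√d)⁻¹ := inv_pos.2 (Real.sqrt_pos.2 hd0)
    linarith
  · intro x hx y hy w hw h1 h2
    have := htri₂ x y w hx hy hw (by linarith) (by linarith)
    linarith [min_le_left ε τ₁]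
  intro Λ hΛ i j x hx y hy hix hxy hyj
  have hi := hΛ i.2
  have hj := hΛ j.2
  have hsubj : nearSet (i : Cn n) ε₁ ⊆ nearSet (j : Cn n) ε := by
    intro w hw
    refine ⟨hw.1, htri₁ j x w hj hx hw.1 ?_ ?_⟩
    · have := htri₂ j y x hj hy hx (by rw [beta_comm]; linarith) (by rw [beta_comm]; linarith)
      linarith [min_le_right ε τ₁]
    · have := htri₂ x i w hx hi hw.1 (by rw [beta_comm]; linarith) (by linarith [hw.2])
      linarith [min_le_right ε τ₁]
  have hsubi : nearSet (i : Cn n) ε₁ ⊆ nearSet (i : Cn n) ε := fun w hw =>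
    ⟨hw.1, by linarith [hw.2]⟩
  have hhi := one_sub_norm_sq_pos hi
  have hhj := one_sub_norm_sq_pos hj
  have hji : 1 - ‖(j : Cn n)‖ ^ 2 ≤ 4 * (1 - ‖(i : Cn n)‖ ^ 2) :=
    one_sub_norm_sq_le_four_mul hj hi (by linarith [(hsubj (self_mem_nearSet hi hε₁0)).2])
  have hmeas : ∀ k : Λ, 1 - ‖(k : Cn n)‖ ^ 2 ≤ 4 * (1 - ‖(i : Cn n)‖ ^ 2) →
      d * (weightedMeasure n γ).real (nearSet (k : Cn n) ε) ≤
        (weightedMeasure n γ).real (nearSet (i : Cn n) ε₁) := by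
    intro k hk
    have hhk := one_sub_norm_sq_pos (hΛ k.2)
    refine le_trans ?_ (hcb i hi).1
    calc d * (weightedMeasure n γ).real (nearSet (k : Cn n) ε)
        ≤ d * (C * (4 * (1 - ‖(i : Cn n)‖ ^ 2)) ^ s) := by
          gcongr
          refine (hCb k (hΛ k.2)).2.trans ?_
          gcongr
      _ = c * (1 - ‖(i : Cn n)‖ ^ 2) ^ s := by
          rw [Real.mul_rpow (by norm_num) hhi.le, hd]
          have : (4 : ℝ) ^ s ≠ 0 := by positivity
          field_simp
  have hpos : ∀ k : Λ, 0 < (weightedMeasure n γ).real (nearSet (k : Cn n) ε) := fun k => by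
    have hhk := one_sub_norm_sq_pos (hΛ k.2)
    exact lt_of_lt_of_le (by positivity) (hCb k (hΛ k.2)).1
  have h1 := norm_localAvg_sub_le hγ hf (measurableSet_nearSet _ _) (measurableSet_nearSet _ _) hsubi
    hd0 (hpos i) (hmeas i (by linarith))
  have h2 := norm_localAvg_sub_le hγ hf (measurableSet_nearSet _ _) (measurableSet_nearSet _ _) hsubj
    hd0 (hpos j) (hmeas j hji)
  have hOi := ballOsc_nonneg hγ hf ε i
  have hOj := ballOsc_nonneg hγ hf ε j
  have hC0 : 0 < (√d)⁻¹ := inv_pos.2 (Real.sqrt_pos.2 hd0)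
  rw [← ofReal_norm, ← ENNReal.ofReal_add (by positivity) (by positivity)]
  refine ENNReal.ofReal_le_ofReal ?_
  calc ‖ballAvg γ f ε i - ballAvg γ f ε j‖
      = ‖(localAvg γ f (nearSet (i : Cn n) ε₁) - ballAvg γ f ε j) -
          (localAvg γ f (nearSet (i : Cn n) ε₁) - ballAvg γ f ε i)‖ := by congr 1; ring
    _ ≤ _ := norm_sub_le _ _
    _ ≤ (√d)⁻¹ * ballOsc hγ hf ε j + (√d)⁻¹ * ballOsc hγ hf ε i := add_le_add h2 h1
    _ ≤ _ := by nlinarith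

lemma norm_le_of_mem_nearSet {ε : ℝ} (hε1 : ε ≤ 1 / 256) {a w : Cn n} (ha : a ∈ unitBall n)
    (hw : w ∈ nearSet a ε) : ‖w‖ ≤ √(1 - (1 - ‖a‖ ^ 2) / 4) := by
  refine Real.le_sqrt_of_sq_le ?_
  have := one_sub_norm_sq_le_four_mul ha hw.1 (by linarith [hw.2])
  linarith

lemma sqrt_one_sub_lt_one {a : Cn n} (ha : a ∈ unitBall n) : √(1 - (1 - ‖a‖ ^ 2) / 4) < 1 := by
  have := one_sub_norm_sq_pos ha
  rw [Real.sqrt_lt' one_pos]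
  linarith

lemma norm_bergmanKernel_le_of_near {s ε : ℝ} (hs : 0 ≤ s) (hε1 : ε ≤ 1 / 256) {a b z w : Cn n}
    (ha : a ∈ unitBall n) (hb : b ∈ unitBall n) (hz : z ∈ nearSet a ε) (hw : w ∈ nearSet b ε) :
    ‖bergmanKernel s z w‖ ≤ 4 ^ s * ‖1 - inner ℂ b a‖ ^ (-s) := by
  have h1 := norm_one_sub_inner_le_two_mul hw.1 hb (by rw [beta_comm]; linarith [hw.2])
    (mem_unitBall.1 ha).le
  have h2 := norm_one_sub_inner_le_two_mul hz.1 ha (by rw [beta_comm]; linarith [hz.2])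
    (mem_unitBall.1 hw.1).le
  have hD := norm_one_sub_inner_pos ha hb
  have hD' := norm_one_sub_inner_pos hz.1 hw.1
  rw [norm_one_sub_inner_comm b, norm_one_sub_inner_comm w a] at h1
  have h3 : ‖1 - inner ℂ b a‖ ≤ 4 * ‖1 - inner ℂ w z‖ := by linarith
  rw [norm_bergmanKernel, Real.rpow_neg hD.le, Real.rpow_neg hD'.le]
  rw [inv_le_comm₀ (by positivity) (by positivity), mul_inv, inv_inv,
    inv_mul_le_iff₀ (by positivity), ← Real.mul_rpow (by norm_num) hD'.le]
  gcongr

lemma inner_eq_zero_of_disjoint {Q Q' : Set (Cn n)} (h : Disjoint Q Q') {x y : L2 n γ}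
    (hx : ∀ᵐ z ∂(weightedMeasure n γ), z ∉ Q → x z = 0)
    (hy : ∀ᵐ z ∂(weightedMeasure n γ), z ∉ Q' → y z = 0) : inner ℂ x y = 0 := by
  rw [L2.inner_def]
  refine integral_eq_zero_of_ae ?_
  filter_upwards [hx, hy] with z h1 h2
  by_cases hz : z ∈ Q
  · rw [h2 (Set.disjoint_left.1 h hz), inner_zero_right, Pi.zero_apply]
  · rw [h1 hz, inner_zero_left, Pi.zero_apply]

/-- A common point would give `β(a,b) > (1 - 1/256)/4`, which exceeds `1/8`. -/
lemma disjoint_nearSet {ε : ℝ} (hε1 : ε ≤ 1 / 256) {a b : Cn n} (ha : a ∈ unitBall n)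
    (hb : b ∈ unitBall n) (h : beta a b ≤ 1 / 8) : Disjoint (nearSet a ε) (nearSet b ε) := by
  refine Set.disjoint_left.2 fun w hwa hwb => ?_
  have h1 := beta_le_four_mul hwb.1 hb (by rw [beta_comm]; linarith [hwb.2]) ha
  have h2 := hwa.2
  rw [beta_comm w, beta_comm b] at h1
  linarith

variable {T : L2 n γ →L[ℂ] L2 n γ}

/-- The normalized indicator of a pseudohyperbolic ball. -/
def testInd (hγ : -1 < γ) (ε : ℝ) (a : Cn n) : L2 n γ :=
  (((√((weightedMeasure n γ).real (nearSet a ε)))⁻¹ : ℝ) : ℂ) •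
    indVec hγ (measurableSet_nearSet a ε)

/-- The normalized deviation of `f` on a pseudohyperbolic ball. -/
def testOsc (hγ : -1 < γ) (hf : MemLp f 2 (weightedMeasure n γ)) (ε : ℝ) (a : Cn n) : L2 n γ :=
  ((‖oscVec hγ hf (measurableSet_nearSet a ε)‖⁻¹ : ℝ) : ℂ) •
    oscVec hγ hf (measurableSet_nearSet a ε)

lemma norm_inner_testOsc_testInd (hγ : -1 < γ) (hf : MemLp f 2 (weightedMeasure n γ)) {ε : ℝ}
    {a b : Cn n} (hb0 : 0 < (weightedMeasure n γ).real (nearSet b ε)) :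
    ‖inner ℂ (testOsc hγ hf ε b) (T (testInd hγ ε a))‖ =
      ‖inner ℂ (oscVec hγ hf (measurableSet_nearSet b ε))
        (T (indVec hγ (measurableSet_nearSet a ε)))‖ /
      (√((weightedMeasure n γ).real (nearSet a ε)) * √((weightedMeasure n γ).real (nearSet b ε)) *
        ballOsc hγ hf ε b) := by
  rw [testOsc, testInd, map_smul, inner_smul_left, inner_smul_right, norm_mul, norm_mul,
    RCLike.norm_conj, Complex.norm_real, Complex.norm_real, norm_oscVec hγ hf _ hb0,
    Real.norm_of_nonneg (by have := localOsc_nonneg hγ hf (measurableSet_nearSet b ε); positivity),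
    Real.norm_of_nonneg (by positivity), ballOsc, div_eq_mul_inv, mul_inv, mul_inv]
  ring

/-- The diagonal matrix entries control the oscillations. -/
lemma exists_diag_bound (hn : 1 ≤ n) (hγ : -1 < γ) (hf : MemLp f 2 (weightedMeasure n γ))
    (hT : ∀ x : (commutator n γ f).domain, T (x : L2 n γ) = commutator n γ f x)
    {ε : ℝ} (hε : 0 < ε) (hε1 : ε ≤ 1 / 256)
    (hker : ∀ a w z : Cn n, a ∈ unitBall n → w ∈ unitBall n → z ∈ unitBall n →
      1 - ε < beta a w → 1 - ε < beta a z →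
      ‖bergmanKernel (n + 1 + γ) w z - (((1 - ‖a‖ ^ 2) ^ (-((n : ℝ) + 1 + γ)) : ℝ) : ℂ)‖ ≤
        1 / 4 * (1 - ‖a‖ ^ 2) ^ (-((n : ℝ) + 1 + γ))) :
    ∃ c : ℝ, 0 < c ∧ ∀ a ∈ unitBall n, ballOsc hγ hf ε a ≠ 0 →
      c * ballOsc hγ hf ε a ≤ ‖inner ℂ (testOsc hγ hf ε a) (T (testInd hγ ε a))‖ := by
  obtain ⟨c, C, hc, hC, hb⟩ := exists_weightedMeasure_nearSet_bounds hn hγ hε hε1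
  refine ⟨c / 2, by positivity, fun a ha hne => ?_⟩
  have hh := one_sub_norm_sq_pos ha
  have hO := lt_of_le_of_ne (ballOsc_nonneg hγ hf ε a) hne.symm
  set s : ℝ := (n : ℝ) + 1 + γ with hs
  have hμ0 : 0 < (weightedMeasure n γ).real (nearSet a ε) :=
    lt_of_lt_of_le (by positivity) (hb a ha).1
  rw [norm_inner_testOsc_testInd hγ hf hμ0]
  -- With `Q = Q'` the main term is `e μ² O²`, where `e = (1 - |a|²)^(-s)`. The means cancel, and
  -- the kernel variation `1/4` gives an error of at most `(1/4) e μ² O · 2 O`, half the main term.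
  have hmain := norm_inner_oscVec_sub_le hn hγ hf hT (measurableSet_nearSet a ε)
    (measurableSet_nearSet a ε) (fun w hw => hw.1) (sqrt_one_sub_lt_one ha)
    (fun w hw => norm_le_of_mem_nearSet hε1 ha hw) hμ0 hμ0 (c := (1 - ‖a‖ ^ 2) ^ (-s))
    (k := 1 / 4 * (1 - ‖a‖ ^ 2) ^ (-s)) (by positivity)
    (fun w hw z hz => hker a z w ha hz.1 hw.1 hz.2 hw.2)
  set I := inner ℂ (oscVec hγ hf (measurableSet_nearSet a ε))
    (T (indVec hγ (measurableSet_nearSet a ε))) with hI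
  set μ := (weightedMeasure n γ).real (nearSet a ε) with hμ
  change ‖I - _ * (μ * μ * ballOsc hγ hf ε a ^ 2 : ℝ)‖ ≤ _ * ballOsc hγ hf ε a *
    (ballOsc hγ hf ε a + ballOsc hγ hf ε a + _) at hmain
  set O := ballOsc hγ hf ε a with hOdef
  set e := (1 - ‖a‖ ^ 2) ^ (-s) with he
  have he0 : 0 < e := Real.rpow_pos_of_pos hh _
  rw [sub_self, norm_zero, add_zero] at hmain
  have hlow : e * (μ * μ * O ^ 2) / 2 ≤ ‖I‖ := by
    have h1 := norm_sub_norm_le ((e : ℂ) * (μ * μ * O ^ 2 : ℝ)) I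
    rw [norm_sub_rev, norm_mul, Complex.norm_real, Complex.norm_real, Real.norm_of_nonneg he0.le,
      Real.norm_of_nonneg (by positivity)] at h1
    nlinarith
  have hce : c ≤ e * μ := by
    have h2 := (hb a ha).1
    calc c = e * (c * (1 - ‖a‖ ^ 2) ^ s) := by
          rw [he, mul_left_comm, ← Real.rpow_add hh, neg_add_cancel, Real.rpow_zero, mul_one]
      _ ≤ e * μ := by gcongr
  rw [Real.mul_self_sqrt hμ0.le, le_div_iff₀ (by positivity)]
  calc c / 2 * O * (μ * O) ≤ e * μ / 2 * O * (μ * O) := by gcongr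
    _ = e * (μ * μ * O ^ 2) / 2 := by ring
    _ ≤ _ := hlow

/-- Decay of the off-diagonal matrix entries. -/
lemma exists_offdiag_bound (hn : 1 ≤ n) (hγ : -1 < γ) (hf : MemLp f 2 (weightedMeasure n γ))
    (hT : ∀ x : (commutator n γ f).domain, T (x : L2 n γ) = commutator n γ f x)
    {ε : ℝ} (hε : 0 < ε) (hε1 : ε ≤ 1 / 256) :
    ∃ C : ℝ, 0 < C ∧ ∀ a ∈ unitBall n, ∀ b ∈ unitBall n, ballOsc hγ hf ε b ≠ 0 →
      ‖inner ℂ (testOsc hγ hf ε b) (T (testInd hγ ε a))‖ ≤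
        C * beta a b ^ (((n : ℝ) + 1 + γ) / 2) * (ballOsc hγ hf ε a + ballOsc hγ hf ε b +
          ‖ballAvg γ f ε a - ballAvg γ f ε b‖) := by
  have hn0 : (0 : ℝ) ≤ n := by positivity
  obtain ⟨c, C, hc, hC, hbd⟩ := exists_weightedMeasure_nearSet_bounds hn hγ hε hε1
  refine ⟨4 ^ ((n : ℝ) + 1 + γ) * C, by positivity, fun a ha b hb hne => ?_⟩
  set s : ℝ := (n : ℝ) + 1 + γ with hs
  have hs0 : 0 < s := by linarith
  have hha := one_sub_norm_sq_pos ha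
  have hhb := one_sub_norm_sq_pos hb
  have hD := norm_one_sub_inner_pos ha hb
  have hμa : 0 < (weightedMeasure n γ).real (nearSet a ε) :=
    lt_of_lt_of_le (by positivity) (hbd a ha).1
  have hμb : 0 < (weightedMeasure n γ).real (nearSet b ε) :=
    lt_of_lt_of_le (by positivity) (hbd b hb).1
  -- With `c = 0` there is no main term, and only the size of the kernel, `|1 - a·b|^(-s)` up to
  -- `4^s`, matters. After normalization one factor `√μ √μ'` remains, which completes it to
  -- `β(a,b)^(s/2)`.
  have hmain := norm_inner_oscVec_sub_le hn hγ hf hT (measurableSet_nearSet a ε)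
    (measurableSet_nearSet b ε) (fun w hw => hw.1) (sqrt_one_sub_lt_one ha)
    (fun w hw => norm_le_of_mem_nearSet hε1 ha hw) hμa hμb (c := 0)
    (k := 4 ^ s * ‖1 - inner ℂ b a‖ ^ (-s)) (by positivity)
    (fun w hw z hz => by
      rw [Complex.ofReal_zero, sub_zero]
      exact norm_bergmanKernel_le_of_near hs0.le hε1 ha hb hz hw)
  rw [Complex.ofReal_zero, zero_mul, sub_zero] at hmain
  rw [norm_inner_testOsc_testInd hγ hf hμb]
  set I := inner ℂ (oscVec hγ hf (measurableSet_nearSet b ε))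
    (T (indVec hγ (measurableSet_nearSet a ε))) with hI
  set μ := (weightedMeasure n γ).real (nearSet a ε) with hμ
  set μ' := (weightedMeasure n γ).real (nearSet b ε) with hμ'
  change ‖I‖ ≤ _ * ballOsc hγ hf ε b * (ballOsc hγ hf ε b + ballOsc hγ hf ε a +
    ‖ballAvg γ f ε b - ballAvg γ f ε a‖) at hmain
  have hOa := ballOsc_nonneg hγ hf ε a
  have hO := lt_of_le_of_ne (ballOsc_nonneg hγ hf ε b) hne.symm
  rw [norm_sub_rev (ballAvg γ f ε b), add_comm (ballOsc hγ hf ε b) (ballOsc hγ hf ε a)] at hmain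
  set X := ballOsc hγ hf ε a + ballOsc hγ hf ε b + ‖ballAvg γ f ε a - ballAvg γ f ε b‖ with hX
  have hX0 : 0 ≤ X := by positivity
  set O := ballOsc hγ hf ε b with hOdef
  set D := ‖1 - inner ℂ b a‖ with hDdef
  have hsq : √μ * √μ' ≤ C * ((1 - ‖a‖ ^ 2) * (1 - ‖b‖ ^ 2)) ^ (s / 2) := by
    rw [← Real.sqrt_mul hμa.le]
    refine Real.sqrt_le_iff.2 ⟨by positivity, ?_⟩
    calc μ * μ' ≤ (C * (1 - ‖a‖ ^ 2) ^ s) * (C * (1 - ‖b‖ ^ 2) ^ s) := by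
          gcongr
          · exact (hbd a ha).2
          · exact (hbd b hb).2
      _ = _ := by
          rw [mul_pow, ← Real.rpow_natCast (_ ^ (s / 2)) 2, ← Real.rpow_mul (by positivity),
            Real.mul_rpow hha.le hhb.le]
          push_cast
          rw [div_mul_cancel₀ _ two_ne_zero]
          ring
  have hbeta : beta a b ^ (s / 2) = ((1 - ‖a‖ ^ 2) * (1 - ‖b‖ ^ 2)) ^ (s / 2) * D ^ (-s) := by
    rw [beta, Real.div_rpow (by positivity) (by positivity), ← hDdef, ← Real.rpow_natCast D 2,
      ← Real.rpow_mul hD.le, Real.rpow_neg hD.le, div_eq_mul_inv]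
    congr 3
    push_cast
    ring
  have hsa := Real.sqrt_pos.2 hμa
  have hsb := Real.sqrt_pos.2 hμb
  have hprod : μ * μ' = √μ * √μ' * (√μ * √μ') := by
    rw [mul_mul_mul_comm, Real.mul_self_sqrt hμa.le, Real.mul_self_sqrt hμb.le]
  rw [hprod] at hmain
  rw [div_le_iff₀ (by positivity), hbeta]
  clear_value X O D μ μ' I
  calc ‖I‖ ≤ _ := hmain
    _ = 4 ^ s * D ^ (-s) * (√μ * √μ') * X * (√μ * √μ' * O) := by ring
    _ ≤ 4 ^ s * D ^ (-s) * (C * ((1 - ‖a‖ ^ 2) * (1 - ‖b‖ ^ 2)) ^ (s / 2)) * X *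
          (√μ * √μ' * O) := by gcongr
    _ = _ := by ring

end TestFunctions

section Summability

variable {n : ℕ} {γ : ℝ} {f : Cn n → ℂ} {T : L2 n γ →L[ℂ] L2 n γ}

/-! ### Summability of the local oscillations -/

lemma orthonormal_testInd (hγ : -1 < γ) {ε : ℝ} {ι : Type*} {a : ι → Cn n}
    (h0 : ∀ i, 0 < (weightedMeasure n γ).real (nearSet (a i) ε))
    (hd : Pairwise fun i j => Disjoint (nearSet (a i) ε) (nearSet (a j) ε)) :
    Orthonormal ℂ fun i => testInd (n := n) hγ ε (a i) := by
  constructor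
  · intro i
    have h1 := Real.sqrt_pos.2 (h0 i)
    change ‖testInd hγ ε (a i)‖ = 1
    rw [testInd, norm_smul, norm_indVec, Complex.norm_real, Real.norm_of_nonneg (by positivity),
      inv_mul_cancel₀ h1.ne']
  · intro i j hij
    change inner ℂ (testInd hγ ε (a i)) (testInd hγ ε (a j)) = 0
    have h1 : inner ℂ (indVec hγ (measurableSet_nearSet (a i) ε))
        (indVec hγ (measurableSet_nearSet (a j) ε)) = 0 := by
      refine inner_eq_zero_of_disjoint (hd hij) ?_ ?_
      · filter_upwards [coeFn_indVec hγ (measurableSet_nearSet (a i) ε)] with z hz hzQ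
        rw [hz, Set.indicator_of_notMem hzQ]
      · filter_upwards [coeFn_indVec hγ (measurableSet_nearSet (a j) ε)] with z hz hzQ
        rw [hz, Set.indicator_of_notMem hzQ]
    rw [testInd, testInd, inner_smul_left, inner_smul_right, h1, mul_zero, mul_zero]

lemma orthonormal_testOsc (hγ : -1 < γ) (hf : MemLp f 2 (weightedMeasure n γ)) {ε : ℝ} {ι : Type*}
    {a : ι → Cn n} (h0 : ∀ i, 0 < (weightedMeasure n γ).real (nearSet (a i) ε))
    (hO : ∀ i, ballOsc hγ hf ε (a i) ≠ 0)
    (hd : Pairwise fun i j => Disjoint (nearSet (a i) ε) (nearSet (a j) ε)) :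
    Orthonormal ℂ fun i => testOsc hγ hf ε (a i) := by
  constructor
  · intro i
    have h1 : ‖oscVec hγ hf (measurableSet_nearSet (a i) ε)‖ ≠ 0 := by
      rw [norm_oscVec hγ hf _ (h0 i)]
      exact mul_ne_zero (Real.sqrt_pos.2 (h0 i)).ne' (hO i)
    change ‖testOsc hγ hf ε (a i)‖ = 1
    rw [testOsc, norm_smul, Complex.norm_real, Real.norm_of_nonneg (by positivity),
      inv_mul_cancel₀ h1]
  · intro i j hij
    change inner ℂ (testOsc hγ hf ε (a i)) (testOsc hγ hf ε (a j)) = 0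
    have h1 : inner ℂ (oscVec hγ hf (measurableSet_nearSet (a i) ε))
        (oscVec hγ hf (measurableSet_nearSet (a j) ε)) = 0 := by
      refine inner_eq_zero_of_disjoint (hd hij) ?_ ?_
      · filter_upwards [coeFn_oscVec hγ hf (measurableSet_nearSet (a i) ε)] with z hz hzQ
        rw [hz, Set.indicator_of_notMem hzQ]
      · filter_upwards [coeFn_oscVec hγ hf (measurableSet_nearSet (a j) ε)] with z hz hzQ
        rw [hz, Set.indicator_of_notMem hzQ]
    rw [testOsc, testOsc, inner_smul_left, inner_smul_right, h1, mul_zero, mul_zero]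

lemma ofReal_mul_rpow_le_enorm_rpow {c C x p : ℝ} (hc : 0 < c) (hC : 0 < C) (hp : 0 < p) {z : ℂ}
    (h : c * x ≤ ‖z‖) : ENNReal.ofReal (C * x) ^ p ≤ ENNReal.ofReal ((C / c) ^ p) * ‖z‖ₑ ^ p := by
  rw [← ENNReal.ofReal_rpow_of_nonneg (by positivity) hp.le, ← ENNReal.mul_rpow_of_nonneg _ _ hp.le,
    ← ofReal_norm, ← ENNReal.ofReal_mul (by positivity)]
  refine ENNReal.rpow_le_rpow (ENNReal.ofReal_le_ofReal ?_) hp.le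
  rw [div_mul_eq_mul_div, le_div_iff₀ hc]
  nlinarith

lemma enorm_rpow_le_of_offdiag {C C₀ x y d b s p : ℝ} (hC : 0 < C) (hC₀ : 1 ≤ C₀) (hx : 0 ≤ x)
    (hy : 0 ≤ y) (hb : 0 < b) (hp : 0 < p) (hp1 : p ≤ 1) {z u : ℂ} (hu : ‖u‖ = d)
    (h : ‖z‖ ≤ C * b ^ (s / 2) * (x + y + d)) :
    ‖z‖ₑ ^ p ≤ ENNReal.ofReal (C ^ p) * (ENNReal.ofReal (b ^ (s * p / 2)) *
      (ENNReal.ofReal (C₀ * x) ^ p + ENNReal.ofReal (C₀ * y) ^ p + ‖u‖ₑ ^ p)) := by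
  have hd : 0 ≤ d := hu ▸ norm_nonneg u
  have h1 : ‖z‖ₑ ≤ ENNReal.ofReal (C * b ^ (s / 2)) *
      (ENNReal.ofReal (C₀ * x) + ENNReal.ofReal (C₀ * y) + ‖u‖ₑ) := by
    rw [← ofReal_norm, ← ofReal_norm u, hu, ← ENNReal.ofReal_add (by positivity) (by positivity),
      ← ENNReal.ofReal_add (by positivity) hd, ← ENNReal.ofReal_mul (by positivity)]
    refine ENNReal.ofReal_le_ofReal (h.trans ?_)
    gcongr
    · exact le_mul_of_one_le_left hx hC₀
    · exact le_mul_of_one_le_left hy hC₀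
  have hadd := fun a b : ℝ≥0∞ => ENNReal.rpow_add_le_add_rpow a b hp.le hp1
  calc ‖z‖ₑ ^ p ≤ (ENNReal.ofReal (C * b ^ (s / 2)) *
        (ENNReal.ofReal (C₀ * x) + ENNReal.ofReal (C₀ * y) + ‖u‖ₑ)) ^ p :=
        ENNReal.rpow_le_rpow h1 hp.le
    _ = ENNReal.ofReal (C ^ p * b ^ (s * p / 2)) *
        (ENNReal.ofReal (C₀ * x) + ENNReal.ofReal (C₀ * y) + ‖u‖ₑ) ^ p := by
        rw [ENNReal.mul_rpow_of_nonneg _ _ hp.le, ENNReal.ofReal_rpow_of_nonneg (by positivity) hp.le,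
          Real.mul_rpow hC.le (by positivity), ← Real.rpow_mul hb.le,
          show s / 2 * p = s * p / 2 by ring]
    _ ≤ ENNReal.ofReal (C ^ p * b ^ (s * p / 2)) *
        (ENNReal.ofReal (C₀ * x) ^ p + ENNReal.ofReal (C₀ * y) ^ p + ‖u‖ₑ ^ p) := by
        gcongr
        exact (hadd _ _).trans (add_le_add (hadd _ _) le_rfl)
    _ = _ := by rw [ENNReal.ofReal_mul (by positivity), mul_assoc]

/-- If the commutator is in `S_p`, the local oscillations are `p`-summable over a lattice. -/
theorem exists_lattice_tsum_ne_top (hn : 1 ≤ n) (hγ : -1 < γ) {p : ℝ} (hp : 0 < p) (hp1 : p < 1)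
    (hq : n < ((n : ℝ) + 1 + γ) * p / 2) (hf : MemLp f 2 (weightedMeasure n γ))
    (hT : ∀ x : (commutator n γ f).domain, T (x : L2 n γ) = commutator n γ f x)
    (hS : powTrace (p / 2) (star T * T) < ∞) :
    ∃ (ε σ C : ℝ) (Λ : Set (Cn n)), 0 < ε ∧ ε ≤ 1 / 256 ∧ 0 < σ ∧ σ ≤ 1 / 256 ∧ 1 ≤ C ∧
      IsLattice σ Λ ∧
      (∀ x ∈ unitBall n, ∀ y ∈ unitBall n, ∀ w ∈ unitBall n, 1 - σ < beta x y → 1 - σ ≤ beta y w →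
        1 - ε < beta x w) ∧
      IsSlow (Λ := Λ) σ (fun i => ballAvg γ f ε i)
        (fun i => ENNReal.ofReal (C * ballOsc hγ hf ε i)) ∧
      ∑' i : Λ, ENNReal.ofReal (C * ballOsc hγ hf ε i) ^ p ≠ ∞ := by
  obtain ⟨ε, hε, hε1, hker⟩ := exists_kernel_variation n ((n : ℝ) + 1 + γ) (κ := 1 / 4) (by norm_num)
  obtain ⟨σ, C, hσ, hσ1, hC, htri, hslow⟩ := exists_isSlow_ballAvg hn hγ hf hε hε1
  obtain ⟨Λ, hΛ⟩ := exists_isLattice n hσ (by linarith)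
  have hΛB := hΛ.subset (by linarith)
  have hslow := hslow Λ hΛB
  refine ⟨ε, σ, C, Λ, hε, hε1, hσ, hσ1, hC, hΛ, htri, hslow, ?_⟩
  obtain ⟨c, hc, hdiag⟩ := exists_diag_bound hn hγ hf hT hε hε1 hker
  obtain ⟨C', hC', hoff⟩ := exists_offdiag_bound hn hγ hf hT hε hε1
  obtain ⟨c₁, C₁, hc₁, -, hμ⟩ := exists_weightedMeasure_nearSet_bounds hn hγ hε hε1
  have hpos : ∀ i : Λ, 0 < (weightedMeasure n γ).real (nearSet (i : Cn n) ε) := fun i => by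
    have hh := one_sub_norm_sq_pos (hΛB i.2)
    exact lt_of_lt_of_le (by positivity) (hμ i (hΛB i.2)).1
  set A := ENNReal.ofReal ((C / c) ^ p) with hA
  set P := powTrace (p / 2) (star T * T) with hP
  refine tsum_rpow_ne_top hn hσ hσ1 hΛ (fun i => ENNReal.ofReal_ne_top) hslow hp hp1.le hq
    (δ₀ := 1 / 8) (by norm_num) (B := A * (4 * P)) (C₁ := A * (4 * ENNReal.ofReal (C' ^ p)))
    (ENNReal.mul_ne_top ENNReal.ofReal_ne_top (ENNReal.mul_ne_top (by simp) hS.ne))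
    (ENNReal.mul_ne_top ENNReal.ofReal_ne_top (ENNReal.mul_ne_top (by simp) ENNReal.ofReal_ne_top)) ?_
  intro J hJ
  classical
  -- Where the oscillation vanishes the normalized deviation is not a unit vector; such points
  -- contribute nothing to the left side and are dropped.
  set J' := J.filter fun i : Λ => ballOsc hγ hf ε (i : Cn n) ≠ 0 with hJ'
  have hJ'mem : ∀ i : J', (i : Λ) ∈ J ∧ ballOsc hγ hf ε ((i : Λ) : Cn n) ≠ 0 := fun i =>
    Finset.mem_filter.1 i.2
  have hdisj : Pairwise fun i j : J' => Disjoint (nearSet ((i : Λ) : Cn n) ε)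
      (nearSet ((j : Λ) : Cn n) ε) := fun i j hij =>
    disjoint_nearSet hε1 (hΛB i.1.2) (hΛB j.1.2)
      (hJ _ (hJ'mem i).1 _ (hJ'mem j).1 fun h => hij (Subtype.ext h))
  have hu := orthonormal_testInd hγ (fun i : J' => hpos i) hdisj
  have hv := orthonormal_testOsc hγ hf (fun i : J' => hpos i) (fun i => (hJ'mem i).2) hdisj
  have hmain := sum_diag_rpow_le hp hp1 T hu hv
  rw [← hP] at hmain
  set X : Λ → Λ → ℝ≥0∞ := fun i j => {j : Λ | i ≠ j}.indicator (fun j : Λ =>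
    betaPow (((n : ℝ) + 1 + γ) * p / 2) (i : Cn n) j *
      (ENNReal.ofReal (C * ballOsc hγ hf ε i) ^ p + ENNReal.ofReal (C * ballOsc hγ hf ε j) ^ p +
        ‖ballAvg γ f ε i - ballAvg γ f ε j‖ₑ ^ p)) j with hX
  have hoffsum : ∑ i : J', ∑ j : J', (if i = j then 0 else
      ‖inner ℂ (testOsc hγ hf ε ((j : Λ) : Cn n)) (T (testInd hγ ε ((i : Λ) : Cn n)))‖ₑ ^ p) ≤
      ENNReal.ofReal (C' ^ p) * ∑ i ∈ J, ∑ j ∈ J, X i j := by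
    calc _ ≤ ∑ i : J', ∑ j : J', ENNReal.ofReal (C' ^ p) * X i j := by
          refine Finset.sum_le_sum fun i _ => Finset.sum_le_sum fun j _ => ?_
          split_ifs with hij
          · exact zero_le
          · have hne : (i : Λ) ≠ (j : Λ) := fun h => hij (Subtype.ext h)
            rw [hX]
            simp only
            rw [Set.indicator_of_mem (show (j : Λ) ∈ {j : Λ | (i : Λ) ≠ j} from hne)]
            exact enorm_rpow_le_of_offdiag hC' hC (ballOsc_nonneg _ _ _ _) (ballOsc_nonneg _ _ _ _)
              (beta_pos (hΛB i.1.2) (hΛB j.1.2)) hp hp1.le rfl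
              (hoff i (hΛB i.1.2) j (hΛB j.1.2) (hJ'mem j).2)
      _ = ENNReal.ofReal (C' ^ p) * ∑ i ∈ J', ∑ j ∈ J', X i j := by
          rw [Finset.mul_sum, ← Finset.sum_coe_sort J']
          refine Finset.sum_congr rfl fun i _ => ?_
          rw [Finset.mul_sum, ← Finset.sum_coe_sort J']
      _ ≤ _ := by
          gcongr
          calc _ ≤ ∑ i ∈ J', ∑ j ∈ J, X i j := Finset.sum_le_sum fun i _ =>
                Finset.sum_le_sum_of_subset (Finset.filter_subset _ _)
            _ ≤ _ := Finset.sum_le_sum_of_subset (Finset.filter_subset _ _)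
  have hleft : ∑ j ∈ J, ENNReal.ofReal (C * ballOsc hγ hf ε j) ^ p ≤
      A * ∑ j : J', ‖inner ℂ (testOsc hγ hf ε ((j : Λ) : Cn n))
        (T (testInd hγ ε ((j : Λ) : Cn n)))‖ₑ ^ p := by
    calc ∑ j ∈ J, ENNReal.ofReal (C * ballOsc hγ hf ε j) ^ p
        = ∑ j ∈ J', ENNReal.ofReal (C * ballOsc hγ hf ε j) ^ p := by
          symm
          refine Finset.sum_subset (Finset.filter_subset _ _) fun j hj hj' => ?_
          have h0 : ballOsc hγ hf ε (j : Cn n) = 0 := by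
            by_contra hne
            exact hj' (Finset.mem_filter.2 ⟨hj, hne⟩)
          rw [h0, mul_zero, ENNReal.ofReal_zero, ENNReal.zero_rpow_of_pos hp]
      _ = ∑ j : J', ENNReal.ofReal (C * ballOsc hγ hf ε (j : Λ)) ^ p :=
          (Finset.sum_coe_sort J' fun j : Λ => ENNReal.ofReal (C * ballOsc hγ hf ε j) ^ p).symm
      _ ≤ _ := by
          rw [Finset.mul_sum]
          refine Finset.sum_le_sum fun j _ => ?_
          exact ofReal_mul_rpow_le_enorm_rpow hc (by linarith) hp
            (hdiag j (hΛB j.1.2) (hJ'mem j).2)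
  calc ∑ j ∈ J, ENNReal.ofReal (C * ballOsc hγ hf ε j) ^ p
      ≤ _ := hleft
    _ ≤ A * (4 * (P + ENNReal.ofReal (C' ^ p) * ∑ i ∈ J, ∑ j ∈ J, X i j)) := by
        gcongr
        refine hmain.trans ?_
        gcongr
    _ = _ := by ring

end Summability

section Integrability

variable {n : ℕ} {γ σ : ℝ} {f : Cn n → ℂ} {Λ : Set (Cn n)}

/-! ### Integrability of the mean oscillation -/

lemma rpow_tsum_le_tsum_rpow {ι : Type*} {r : ℝ} (hr : 0 < r) (hr1 : r ≤ 1) (a : ι → ℝ≥0∞) :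
    (∑' i, a i) ^ r ≤ ∑' i, a i ^ r := by
  rw [← ENNReal.le_rpow_inv_iff hr, ENNReal.tsum_eq_iSup_sum]
  refine iSup_le fun s => ?_
  rw [ENNReal.le_rpow_inv_iff hr]
  exact (rpow_sum_le_sum_rpow hr hr1 s a).trans (ENNReal.sum_le_tsum s)

lemma enorm_add_sq_le (x y : ℂ) : ‖x + y‖ₑ ^ 2 ≤ 2 * (‖x‖ₑ ^ 2 + ‖y‖ₑ ^ 2) := by
  rw [enorm_sq_eq_ofReal, enorm_sq_eq_ofReal, enorm_sq_eq_ofReal,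
    ← ENNReal.ofReal_add (by positivity) (by positivity), ← ENNReal.ofReal_ofNat 2,
    ← ENNReal.ofReal_mul (by norm_num)]
  refine ENNReal.ofReal_le_ofReal ?_
  have h := norm_add_le x y
  nlinarith [norm_nonneg (x + y), sq_nonneg (‖x‖ - ‖y‖)]

lemma lintegral_oscillation_eq (hγ : -1 < γ) (hf : MemLp f 2 (weightedMeasure n γ))
    {Q : Set (Cn n)} (hQ : MeasurableSet Q) :
    ∫⁻ w in Q, ‖f w - localAvg γ f Q‖ₑ ^ 2 ∂(weightedMeasure n γ) = ‖oscVec hγ hf hQ‖ₑ ^ 2 := by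
  rw [enorm_sq_eq_lintegral, ← lintegral_indicator hQ]
  refine lintegral_congr_ae ?_
  filter_upwards [coeFn_oscVec hγ hf hQ] with w hw
  rw [hw]
  by_cases h : w ∈ Q <;> simp [h]

lemma lintegral_sub_const_le (hγ : -1 < γ) (hf : MemLp f 2 (weightedMeasure n γ))
    {Q : Set (Cn n)} (hQ : MeasurableSet Q) (hQ0 : 0 < (weightedMeasure n γ).real Q) (a : ℂ) :
    ∫⁻ w in Q, ‖f w - a‖ₑ ^ 2 ∂(weightedMeasure n γ) ≤
      2 * (ENNReal.ofReal ((weightedMeasure n γ).real Q) *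
        (ENNReal.ofReal (localOsc hγ hf hQ) ^ 2 + ‖localAvg γ f Q - a‖ₑ ^ 2)) := by
  have hprob := isProbabilityMeasure_weightedMeasure (n := n) hγ
  calc ∫⁻ w in Q, ‖f w - a‖ₑ ^ 2 ∂(weightedMeasure n γ)
      ≤ ∫⁻ w in Q, 2 * (‖f w - localAvg γ f Q‖ₑ ^ 2 + ‖localAvg γ f Q - a‖ₑ ^ 2)
          ∂(weightedMeasure n γ) := by
        refine lintegral_mono fun w => ?_
        refine le_trans (le_of_eq ?_) (enorm_add_sq_le _ _)
        rw [sub_add_sub_cancel]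
    _ = 2 * (‖oscVec hγ hf hQ‖ₑ ^ 2 +
          ‖localAvg γ f Q - a‖ₑ ^ 2 * weightedMeasure n γ Q) := by
        rw [lintegral_const_mul' _ _ (by simp), lintegral_add_right _ measurable_const,
          lintegral_oscillation_eq hγ hf hQ, setLIntegral_const]
    _ = _ := by
        have h1 : ‖oscVec hγ hf hQ‖ₑ ^ 2 = ENNReal.ofReal ((weightedMeasure n γ).real Q) *
            ENNReal.ofReal (localOsc hγ hf hQ) ^ 2 := by
          rw [enorm_sq_eq_ofReal, norm_oscVec hγ hf hQ hQ0, mul_pow, Real.sq_sqrt hQ0.le,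
            ENNReal.ofReal_mul hQ0.le, ENNReal.ofReal_pow (localOsc_nonneg hγ hf hQ)]
        rw [h1, Measure.real, ENNReal.ofReal_toReal (measure_ne_top _ _)]
        ring

lemma IsLattice.countable (hn : 1 ≤ n) (hσ : 0 < σ) (hσ1 : σ < 1) (hΛ : IsLattice σ Λ) :
    Countable Λ := by
  have h : (Set.univ : Set Λ) ⊆ ⋃ k : ℕ, {m : Λ | 1 / ((k : ℝ) + 1) ≤ 1 - ‖(m : Cn n)‖ ^ 2} := by
    intro m _
    obtain ⟨k, hk⟩ := exists_nat_one_div_lt (one_sub_norm_sq_pos (hΛ.subset hσ1 m.2))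
    exact Set.mem_iUnion.2 ⟨k, hk.le⟩
  rw [← Set.countable_univ_iff]
  exact (Set.countable_iUnion fun k =>
    (hΛ.finite_le hn hσ hσ1 (by positivity)).countable).mono h

/-- The neighbourhoods of the lattice points cover the ball. -/
lemma IsLattice.exists_mem_nearSet (hn : 1 ≤ n) (hσ : 0 < σ) (hσ1 : σ < 1) (hΛ : IsLattice σ Λ)
    {ε : ℝ} (htri : ∀ x ∈ unitBall n, ∀ y ∈ unitBall n, ∀ w ∈ unitBall n, 1 - σ < beta x y →
      1 - σ ≤ beta y w → 1 - ε < beta x w) {z : Cn n} (hz : z ∈ unitBall n) :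
    ∃ m : Λ, z ∈ nearSet (m : Cn n) ε := by
  have hh := one_sub_norm_sq_pos hz
  obtain ⟨k, hk1, hk2⟩ := exists_nat_pow_near_of_lt_one hh
    (by nlinarith [norm_nonneg z] : 1 - ‖z‖ ^ 2 ≤ 1) (by linarith : 0 < 1 - σ) (by linarith)
  obtain ⟨e, he, hze⟩ := exists_unit_smul_eq hn z
  obtain ⟨m, hm⟩ := hΛ.exists_ray hσ hσ1 he
  have hz1 : ‖z‖ < 1 := mem_unitBall.1 hz
  have hpos : 0 < (1 - σ) ^ k := pow_pos (by linarith) k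
  have hle : √(1 - (1 - σ) ^ k) ≤ ‖z‖ := Real.sqrt_le_left (norm_nonneg _) |>.2 (by linarith)
  have h1 := le_beta_ray he (Real.sqrt_nonneg _) hle hz1
  rw [← hze, one_sub_sqrt_level_sq hσ hσ1] at h1
  have h2 : 1 - σ ≤ (1 - ‖z‖ ^ 2) / (1 - σ) ^ k := by
    rw [le_div_iff₀ hpos, mul_comm, ← pow_succ]
    exact hk1.le
  refine ⟨m k, hz, ?_⟩
  refine htri _ (hΛ.subset hσ1 (m k).2) _
    (ofReal_smul_mem_unitBall he (Real.sqrt_nonneg _) (sqrt_level_lt_one hσ1 k)) _ hz ?_ ?_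
  · rw [beta_comm]
    have := (hm k).2
    nlinarith
  · rw [beta_comm]
    exact h2.trans h1

lemma enorm_mulKer_sub_sq (hγ : -1 < γ) (hf : MemLp f 2 (weightedMeasure n γ)) {z : Cn n}
    (hz : z ∈ unitBall n) (a : ℂ) : ‖mulKer hγ hf hz - a • kerVec hγ hz‖ₑ ^ 2 =
      ∫⁻ w, ‖f w - a‖ₑ ^ 2 * ‖bergmanKernel (n + 1 + γ) w z‖ₑ ^ 2 ∂(weightedMeasure n γ) := by
  rw [enorm_sq_eq_lintegral]
  refine lintegral_congr_ae ?_
  filter_upwards [Lp.coeFn_sub (mulKer hγ hf hz) (a • kerVec hγ hz),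
    Lp.coeFn_smul a (kerVec hγ hz), coeFn_mulKer hγ hf hz, coeFn_kerVec hγ hz] with w h1 h2 h3 h4
  rw [h1, Pi.sub_apply, h2, Pi.smul_apply, h3, h4, smul_eq_mul, ← sub_mul, enorm_mul, mul_pow]

lemma rpow_mul_rpow_mul_norm_rpow {s : ℝ} {z m : Cn n} (hz : z ∈ unitBall n)
    (hm : m ∈ unitBall n) :
    (1 - ‖z‖ ^ 2) ^ s * (1 - ‖m‖ ^ 2) ^ s * (‖1 - inner ℂ z m‖ ^ (-s)) ^ 2 = beta z m ^ s := by
  have h1 := one_sub_norm_sq_pos hz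
  have h2 := one_sub_norm_sq_pos hm
  have h3 := norm_one_sub_inner_pos hm hz
  rw [beta_comm, beta, Real.div_rpow (by positivity) (by positivity), Real.mul_rpow h2.le h1.le,
    ← Real.rpow_natCast (‖1 - inner ℂ z m‖ ^ (-s)), ← Real.rpow_mul h3.le,
    ← Real.rpow_natCast ‖1 - inner ℂ z m‖, ← Real.rpow_mul h3.le, div_eq_mul_inv,
    ← Real.rpow_neg h3.le]
  push_cast
  rw [show -s * 2 = -(2 * s) by ring]
  ring

/-- The mean oscillation in terms of local oscillations and averages. -/
lemma exists_meanOsc_sq_le_tsum (hn : 1 ≤ n) (hγ : -1 < γ) (hf : MemLp f 2 (weightedMeasure n γ))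
    {ε : ℝ} (hε : 0 < ε) (hε1 : ε ≤ 1 / 256) : ∃ K : ℝ, 0 < K ∧ ∀ Λ : Set (Cn n), Countable Λ →
      Λ ⊆ unitBall n → (∀ z ∈ unitBall n, ∃ m : Λ, z ∈ nearSet (m : Cn n) ε) →
      ∀ z ∈ unitBall n, ∀ a : ℂ, ENNReal.ofReal (meanOsc n γ f z) ^ 2 ≤
        ∑' m : Λ, ENNReal.ofReal (K * beta z m ^ ((n : ℝ) + 1 + γ)) *
          (ENNReal.ofReal (ballOsc hγ hf ε m) ^ 2 + ‖ballAvg γ f ε m - a‖ₑ ^ 2) := by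
  obtain ⟨c, C, hc, hC, hμ⟩ := exists_weightedMeasure_nearSet_bounds hn hγ hε hε1
  set s : ℝ := (n : ℝ) + 1 + γ with hs
  have hs0 : 0 ≤ s := by
    have : (0 : ℝ) ≤ n := by positivity
    rw [hs]; linarith
  refine ⟨2 * (C * (4 ^ s) ^ 2), by positivity, fun Λ hΛc hΛB hcov z hz a => ?_⟩
  have hhz := one_sub_norm_sq_pos hz
  have hterm : ∀ m : Λ, ∫⁻ w in nearSet (m : Cn n) ε,
      ‖f w - a‖ₑ ^ 2 * ‖bergmanKernel (n + 1 + γ) w z‖ₑ ^ 2 ∂(weightedMeasure n γ) ≤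
      ENNReal.ofReal ((4 ^ s * ‖1 - inner ℂ z (m : Cn n)‖ ^ (-s)) ^ 2) *
        (2 * (ENNReal.ofReal (C * (1 - ‖(m : Cn n)‖ ^ 2) ^ s) *
          (ENNReal.ofReal (ballOsc hγ hf ε m) ^ 2 + ‖ballAvg γ f ε m - a‖ₑ ^ 2))) := by
    intro m
    have hm := hΛB m.2
    have hhm := one_sub_norm_sq_pos hm
    have hμ0 : 0 < (weightedMeasure n γ).real (nearSet (m : Cn n) ε) :=
      lt_of_lt_of_le (by positivity) (hμ m hm).1
    calc _ ≤ ∫⁻ w in nearSet (m : Cn n) ε, ‖f w - a‖ₑ ^ 2 *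
          ENNReal.ofReal ((4 ^ s * ‖1 - inner ℂ z (m : Cn n)‖ ^ (-s)) ^ 2)
            ∂(weightedMeasure n γ) := by
          refine setLIntegral_mono' (measurableSet_nearSet _ _) fun w hw => ?_
          gcongr
          rw [enorm_sq_eq_ofReal]
          refine ENNReal.ofReal_le_ofReal ?_
          gcongr
          exact norm_bergmanKernel_le_of_near hs0 hε1 hm hz hw (self_mem_nearSet hz hε)
      _ ≤ _ := by
          rw [lintegral_mul_const' _ _ ENNReal.ofReal_ne_top, mul_comm]
          gcongr
          refine (lintegral_sub_const_le hγ hf (measurableSet_nearSet _ _) hμ0 a).trans ?_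
          gcongr
          · exact (hμ m hm).2
          · exact le_rfl
          · exact le_rfl
  have h1 : ENNReal.ofReal (meanOsc n γ f z) ^ 2 ≤ ENNReal.ofReal ((1 - ‖z‖ ^ 2) ^ s) *
      ‖mulKer hγ hf hz - a • kerVec hγ hz‖ₑ ^ 2 := by
    rw [← ENNReal.ofReal_pow (meanOsc_nonneg γ f z), enorm_sq_eq_ofReal,
      ← ENNReal.ofReal_mul (by positivity)]
    exact ENNReal.ofReal_le_ofReal (meanOsc_sq_le hn hγ hf hz a)
  refine h1.trans ?_
  rw [enorm_mulKer_sub_sq]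
  have h2 : ∫⁻ w, ‖f w - a‖ₑ ^ 2 * ‖bergmanKernel (n + 1 + γ) w z‖ₑ ^ 2 ∂(weightedMeasure n γ) ≤
      ∑' m : Λ, ∫⁻ w in nearSet (m : Cn n) ε,
        ‖f w - a‖ₑ ^ 2 * ‖bergmanKernel (n + 1 + γ) w z‖ₑ ^ 2 ∂(weightedMeasure n γ) := by
    refine le_trans (le_of_eq ?_) (lintegral_iUnion_le _ _)
    rw [Measure.restrict_eq_self_of_ae_mem]
    filter_upwards [ae_mem_unitBall γ] with w hw
    obtain ⟨m, hm⟩ := hcov w hw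
    exact Set.mem_iUnion.2 ⟨m, hm⟩
  refine (mul_le_mul_right (h2.trans (ENNReal.tsum_le_tsum hterm)) _).trans ?_
  rw [← ENNReal.tsum_mul_left]
  refine ENNReal.tsum_le_tsum fun m => le_of_eq ?_
  have hhm := one_sub_norm_sq_pos (hΛB m.2)
  rw [← rpow_mul_rpow_mul_norm_rpow hz (hΛB m.2)]
  have e1 : 2 * (C * (4 ^ s) ^ 2) * ((1 - ‖z‖ ^ 2) ^ s * (1 - ‖(m : Cn n)‖ ^ 2) ^ s *
      (‖1 - inner ℂ z (m : Cn n)‖ ^ (-s)) ^ 2) = (1 - ‖z‖ ^ 2) ^ s *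
      ((4 ^ s * ‖1 - inner ℂ z (m : Cn n)‖ ^ (-s)) ^ 2 * (2 * (C * (1 - ‖(m : Cn n)‖ ^ 2) ^ s))) := by
    ring
  have e2 : ENNReal.ofReal (2 * (C * (1 - ‖(m : Cn n)‖ ^ 2) ^ s)) =
      2 * ENNReal.ofReal (C * (1 - ‖(m : Cn n)‖ ^ 2) ^ s) := by
    rw [ENNReal.ofReal_mul (by norm_num), ENNReal.ofReal_ofNat]
  rw [e1, ENNReal.ofReal_mul (p := (1 - ‖z‖ ^ 2) ^ s) (by positivity),
    ENNReal.ofReal_mul (p := (4 ^ s * ‖1 - inner ℂ z (m : Cn n)‖ ^ (-s)) ^ 2) (by positivity), e2]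
  ring

lemma rpow_half_mul_add_sq_le {K b s p : ℝ} (hK : 0 < K) (hb : 0 < b) (hp : 0 < p) (hp1 : p ≤ 1)
    (x y : ℝ≥0∞) : (ENNReal.ofReal (K * b ^ s) * (x ^ 2 + y ^ 2)) ^ (p / 2) ≤
      ENNReal.ofReal (K ^ (p / 2)) * (ENNReal.ofReal (b ^ (s * p / 2)) * (x ^ p + y ^ p)) := by
  have hsq : ∀ t : ℝ≥0∞, (t ^ 2) ^ (p / 2) = t ^ p := fun t => by
    rw [← ENNReal.rpow_natCast, ← ENNReal.rpow_mul]
    congr 1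
    push_cast
    ring
  rw [ENNReal.mul_rpow_of_nonneg _ _ (by positivity),
    ENNReal.ofReal_rpow_of_nonneg (by positivity) (by positivity),
    Real.mul_rpow hK.le (by positivity), ← Real.rpow_mul hb.le, ENNReal.ofReal_mul (by positivity),
    show s * (p / 2) = s * p / 2 by ring, mul_assoc, ← hsq x, ← hsq y]
  gcongr
  exact ENNReal.rpow_add_le_add_rpow _ _ (by positivity) (by linarith)

lemma betaPow_le_of_near {q : ℝ} (hq : 0 < q) {a z w : Cn n} (ha : a ∈ unitBall n)
    (hz : z ∈ unitBall n) (h : 1 - 1 / 256 ≤ beta a z) (hw : w ∈ unitBall n) :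
    betaPow q a w ≤ ENNReal.ofReal (4 ^ q) * betaPow q z w := by
  have h1 := beta_pos ha hw
  have h2 := beta_pos hz hw
  rw [betaPow, betaPow, ← ENNReal.ofReal_mul (by positivity), ← Real.mul_rpow (by norm_num) h2.le]
  refine ENNReal.ofReal_le_ofReal ?_
  gcongr
  exact beta_le_four_mul ha hz h hw

lemma tsum_chainSum_le {q p : ℝ} {C : ℝ≥0∞} (hΛB : Λ ⊆ unitBall n)
    (hC : ∀ z ∈ unitBall n, ∑' m : Λ, betaPow q z m ≤ C) (O : Λ → ℝ≥0∞) (j : Λ) :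
    ∑' i : Λ, chainSum Λ q p O i j ≤ C * ∑' m : Λ, betaPow q (m : Cn n) j * O m ^ p := by
  calc ∑' i : Λ, chainSum Λ q p O i j
      ≤ ∑' i : Λ, ∑' m : Λ, betaPow q (i : Cn n) m * betaPow q (m : Cn n) j * O m ^ p :=
        ENNReal.tsum_le_tsum fun i => ENNReal.tsum_le_tsum fun m =>
          Set.indicator_le_self' (fun _ _ => zero_le) m
    _ = ∑' m : Λ, (∑' i : Λ, betaPow q (m : Cn n) i) * (betaPow q (m : Cn n) j * O m ^ p) := by
        rw [ENNReal.tsum_comm]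
        refine tsum_congr fun m => ?_
        rw [← ENNReal.tsum_mul_right]
        exact tsum_congr fun i => by rw [betaPow_comm q (i : Cn n), mul_assoc]
    _ ≤ ∑' m : Λ, C * (betaPow q (m : Cn n) j * O m ^ p) := by
        refine ENNReal.tsum_le_tsum fun m => ?_
        gcongr
        exact hC m (hΛB m.2)
    _ = _ := ENNReal.tsum_mul_left

/-- The mean oscillation is controlled by an average of the local oscillations at lattice points. -/
lemma exists_meanOsc_rpow_le_tsum (hn : 1 ≤ n) (hγ : -1 < γ)
    (hf : MemLp f 2 (weightedMeasure n γ)) {p : ℝ} (hp : 0 < p) (hp1 : p < 1)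
    (hq : n < ((n : ℝ) + 1 + γ) * p / 2) {ε : ℝ} (hε : 0 < ε) (hε1 : ε ≤ 1 / 256) (hσ : 0 < σ)
    (hσ1 : σ ≤ 1 / 256) {C : ℝ} (hC : 1 ≤ C) (hΛ : IsLattice σ Λ)
    (htri : ∀ x ∈ unitBall n, ∀ y ∈ unitBall n, ∀ w ∈ unitBall n, 1 - σ < beta x y →
      1 - σ ≤ beta y w → 1 - ε < beta x w)
    (hslow : IsSlow (Λ := Λ) σ (fun i => ballAvg γ f ε i)
      (fun i => ENNReal.ofReal (C * ballOsc hγ hf ε i))) :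
    ∃ K : ℝ≥0∞, K ≠ ∞ ∧ ∀ z ∈ unitBall n, ENNReal.ofReal (meanOsc n γ f z) ^ p ≤
      K * ∑' m : Λ, betaPow (((n : ℝ) + 1 + γ) * p / 2) (m : Cn n) z *
        ENNReal.ofReal (C * ballOsc hγ hf ε m) ^ p := by
  have hσ1' : σ < 1 := by linarith
  have hΛB := hΛ.subset hσ1'
  have hcov := fun z hz => hΛ.exists_mem_nearSet hn hσ hσ1' htri (z := z) hz
  set s : ℝ := (n : ℝ) + 1 + γ with hs
  set q := s * p / 2 with hq'
  have hq0 : 0 < q := lt_of_le_of_lt (by positivity) hq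
  obtain ⟨K₁, hK₁, h1⟩ := exists_meanOsc_sq_le_tsum hn hγ hf hε hε1
  obtain ⟨K₂, hK₂, h2⟩ := exists_chain_bound hn hσ hσ1 hq0
  obtain ⟨K₃, hK₃, h3⟩ := exists_tsum_betaPow_le hn hq (ε := σ ^ 2 / 4) (by positivity)
  set O : Λ → ℝ≥0∞ := fun i => ENNReal.ofReal (C * ballOsc hγ hf ε i) with hO
  refine ⟨ENNReal.ofReal (K₁ ^ (p / 2)) * (ENNReal.ofReal (4 ^ q) * (ENNReal.ofReal K₂ *
    (ENNReal.ofReal K₃ * ENNReal.ofReal (4 ^ q)))), by simp [ENNReal.mul_eq_top], fun z hz => ?_⟩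
  -- The constant subtracted from `f` is its mean over the ball of a lattice point near `z`. The
  -- chain bound then applies to each pair `(m, m₀)`, and `m₀` is finally exchanged for `z`.
  obtain ⟨m₀, hm₀⟩ := hcov z hz
  have hm₀B := hΛB m₀.2
  have hnear : 1 - 1 / 256 ≤ beta (m₀ : Cn n) z := by linarith [hm₀.2]
  have hterm : ∀ m : Λ, (ENNReal.ofReal (K₁ * beta z m ^ s) *
      (ENNReal.ofReal (ballOsc hγ hf ε m) ^ 2 + ‖ballAvg γ f ε m - ballAvg γ f ε m₀‖ₑ ^ 2)) ^
        (p / 2) ≤ ENNReal.ofReal (K₁ ^ (p / 2)) * (ENNReal.ofReal (4 ^ q) * (ENNReal.ofReal K₂ *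
          chainSum Λ q p O m m₀)) := by
    intro m
    refine (rpow_half_mul_add_sq_le hK₁ (beta_pos hz (hΛB m.2)) hp hp1.le _ _).trans ?_
    gcongr ENNReal.ofReal (K₁ ^ (p / 2)) * ?_
    change betaPow q z m * _ ≤ _
    calc _ ≤ ENNReal.ofReal (4 ^ q) * betaPow q (m₀ : Cn n) m *
          (O m ^ p + O m₀ ^ p + ‖ballAvg γ f ε m - ballAvg γ f ε m₀‖ₑ ^ p) := by
          gcongr ?_ * (?_ + _)
          · exact betaPow_le_of_near hq0 hz hm₀B (by rwa [beta_comm]) (hΛB m.2)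
          · refine le_trans ?_ le_self_add
            gcongr
            exact ENNReal.ofReal_le_ofReal (le_mul_of_one_le_left (ballOsc_nonneg _ _ _ _) hC)
      _ ≤ _ := by
          rw [betaPow_comm, mul_assoc]
          gcongr ENNReal.ofReal (4 ^ q) * ?_
          exact h2 Λ hΛ _ O p hp hp1.le hslow m m₀
  calc ENNReal.ofReal (meanOsc n γ f z) ^ p = (ENNReal.ofReal (meanOsc n γ f z) ^ 2) ^ (p / 2) := by
        rw [← ENNReal.rpow_natCast, ← ENNReal.rpow_mul]
        congr 1
        push_cast
        ring
    _ ≤ _ := ENNReal.rpow_le_rpow (h1 Λ (hΛ.countable hn hσ hσ1') hΛB hcov z hz (ballAvg γ f ε m₀))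
        (by positivity)
    -- Subadditivity of the power `p / 2 ≤ 1` moves it inside the sum and turns `β^s` into
    -- `β^(sp/2)`.
    _ ≤ _ := rpow_tsum_le_tsum_rpow (by positivity) (by linarith) _
    _ ≤ _ := ENNReal.tsum_le_tsum hterm
    _ = ENNReal.ofReal (K₁ ^ (p / 2)) * (ENNReal.ofReal (4 ^ q) * (ENNReal.ofReal K₂ *
          ∑' m : Λ, chainSum Λ q p O m m₀)) := by
        rw [ENNReal.tsum_mul_left, ENNReal.tsum_mul_left, ENNReal.tsum_mul_left]
    _ ≤ ENNReal.ofReal (K₁ ^ (p / 2)) * (ENNReal.ofReal (4 ^ q) * (ENNReal.ofReal K₂ *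
          (ENNReal.ofReal K₃ * ∑' m : Λ, ENNReal.ofReal (4 ^ q) *
            (betaPow q (m : Cn n) z * O m ^ p)))) := by
        gcongr
        refine (tsum_chainSum_le hΛB (h3 Λ hΛB hΛ.separated) O m₀).trans ?_
        refine mul_le_mul_right (ENNReal.tsum_le_tsum fun m => ?_) _
        rw [← mul_assoc]
        gcongr ?_ * _
        rw [betaPow_comm, betaPow_comm q (m : Cn n) z]
        exact betaPow_le_of_near hq0 hm₀B hz hnear (hΛB m.2)
    _ = _ := by
        rw [ENNReal.tsum_mul_left]
        ring

/-- If the commutator is in `S_p`, the mean oscillation is in `L^p` of the invariant measure. -/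
theorem memLp_meanOsc_of_pMapIsSchatten (hn : 1 ≤ n) (hγ : -1 < γ) {p : ℝ} (hp : 0 < p)
    (hp1 : p < 1) (hq : n < ((n : ℝ) + 1 + γ) * p / 2) (hf : MemLp f 2 (weightedMeasure n γ))
    (hS : PMapIsSchatten p (commutator n γ f)) :
    MemLp (meanOsc n γ f) (ENNReal.ofReal p) (invariantMeasure n) := by
  obtain ⟨-, T, hT, hS⟩ := hS
  obtain ⟨ε, σ, C, Λ, hε, hε1, hσ, hσ1, hC, hΛ, htri, hslow, hsum⟩ :=
    exists_lattice_tsum_ne_top hn hγ hp hp1 hq hf hT ((isSchatten_iff_powTrace hp T).1 hS)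
  obtain ⟨K, hK, hbound⟩ :=
    exists_meanOsc_rpow_le_tsum hn hγ hf hp hp1 hq hε hε1 hσ hσ1 hC hΛ htri hslow
  have hcount := hΛ.countable hn hσ (by linarith)
  have hΛB := hΛ.subset (by linarith)
  refine ⟨(measurable_meanOsc hγ hf).aestronglyMeasurable, ?_⟩
  rw [eLpNorm_lt_top_iff_lintegral_rpow_enorm_lt_top (by simpa using hp) ENNReal.ofReal_ne_top,
    ENNReal.toReal_ofReal hp.le]
  calc ∫⁻ z, ‖meanOsc n γ f z‖ₑ ^ p ∂(invariantMeasure n)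
      ≤ ∫⁻ z, K * ∑' m : Λ, betaPow (((n : ℝ) + 1 + γ) * p / 2) (m : Cn n) z *
        ENNReal.ofReal (C * ballOsc hγ hf ε m) ^ p ∂(invariantMeasure n) := by
        refine lintegral_mono_ae ?_
        filter_upwards [ae_invariantMeasure_mem_unitBall] with z hz
        rw [Real.enorm_of_nonneg (meanOsc_nonneg γ f z)]
        exact hbound z hz
    -- Each `β(m, ·)^(sp/2)` has the same finite invariant mass because `sp/2 > n`, so the integral
    -- reduces to the sum of the `p`-th powers of the oscillations.
    _ = K * ∑' m : Λ, ENNReal.ofReal (betaMass n (((n : ℝ) + 1 + γ) * p / 2)) *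
        ENNReal.ofReal (C * ballOsc hγ hf ε m) ^ p := by
        have hmeas : ∀ m : Λ, Measurable fun z =>
            betaPow (((n : ℝ) + 1 + γ) * p / 2) (m : Cn n) z := fun m =>
          ((measurable_beta_left (m : Cn n)).pow_const _).ennreal_ofReal
        rw [lintegral_const_mul' _ _ hK, lintegral_tsum fun m => ((hmeas m).mul_const _).aemeasurable]
        congr 1
        refine tsum_congr fun m => ?_
        rw [lintegral_mul_const _ (hmeas m), ← lintegral_beta_rpow hn hq (hΛB m.2)]
        rfl
    _ < ∞ := by
        rw [ENNReal.tsum_mul_left]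
        exact ENNReal.mul_lt_top hK.lt_top (ENNReal.mul_lt_top ENNReal.ofReal_lt_top hsum.lt_top)

end Integrability

end BergmanBall

end

theorem theorem1p1 (n : ℕ) (hn : 1 ≤ n) (γ : ℝ) (hγ : -1 < γ) (p : ℝ)
    (hp : 2 * (n : ℝ) / ((n : ℝ) + 1 + γ) < p) (hp1 : p < 1)
    (f : BergmanBall.Cn n → ℂ) (hf : BergmanBall.MemBMO n γ f) :
    BergmanBall.PMapIsSchatten p (BergmanBall.commutator n γ f) ↔
      MemLp (BergmanBall.meanOsc n γ f) (ENNReal.ofReal p) (BergmanBall.invariantMeasure n) := by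
  have hn' : (1 : ℝ) ≤ n := by exact_mod_cast hn
  have hs : 0 < (n : ℝ) + 1 + γ := by linarith
  have hp0 : 0 < p := lt_of_le_of_lt (by positivity) hp
  -- The lower bound on `p` says that `β^(sp/2)`, with `s = n + 1 + γ`, has exponent greater than
  -- `n`, the range in which `lintegral_beta_rpow` gives finite mass.
  have hq : (n : ℝ) < ((n : ℝ) + 1 + γ) * p / 2 := by
    rw [div_lt_iff₀ hs] at hp
    linarith
  exact ⟨BergmanBall.memLp_meanOsc_of_pMapIsSchatten hn hγ hp0 hp1 hq hf.1,
    BergmanBall.pMapIsSchatten_of_memLp hn hγ hp0 hp1 hf⟩
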